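/- Let $\alpha$ be the positive root of $x^3+x^2+x-1$. Let $X$ be the genus three Arnoux–Yoccoz translation surface, glued by translations from the polygon $\mathcal P$ with vertices $(0,0),(0,1),(\alpha,1),(\alpha,\alpha+\alpha^2),(\alpha+\alpha^2,\alpha+\alpha^2),(\alpha+\alpha^2,\alpha),(1,\alpha),(1,0)$ slit vertically from its bottom side at $x=\frac{\alpha^2+\alpha^4}2,\ \frac{\alpha+\alpha^2}2,\ \frac{1+\alpha}2$ up to the heights $s+\alpha^3,\ s+\alpha^3+\alpha^2,\ s$, where $s=\frac{\alpha^2+\alpha^4}{2}$. The horizontal sides are paired as follows: from left to right the top sides $1,\dots,7$ have lengths $\frac{\alpha-\alpha^4}2,\frac{\alpha^4}2,\frac\alpha2,\frac{\alpha^2}2,\frac{\alpha^2}2,\frac{\alpha^3}2,\frac{\alpha^3}2$, and the bottom sides occur from left to right in the order $2,5,4,7,6,3,1$. The vertical sides and the sides of the slits are paired in the standard way: $\{1\}\times[0,\alpha]$ with $\{0\}\times[0,\alpha]$; $\{\alpha+\alpha^2\}\times[\alpha,\alpha+\alpha^2]$ with the bottom part of the right side of the second slit; $\{\alpha\}\times[\alpha+\alpha^2,1]$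 with the bottom part of the right side of the first slit; $\{0\}\times[\alpha,1]$ with the bottom part of the left side of the second slit; the left side of the first slit with the upper part of the right side of the second; the right side of the third slit with the upper part of the left side of the second; the left side of the third slit with the upper part of the right side of the first. $X$ has two singularities, one represented by the upper ends of the slits, the other by the common end points of the pairs of top sides $2,3$; $4,5$; $6,7$ and of bottom sides $2,5$; $4,7$; $6,3$. Let $h:X\to X$ be the Arnoux–Yoccoz map, which on $\mathcal P$ is $(x,y)\mapsto(\alpha x,\alpha^{-1}y)+w$ with $w=(-\frac{\alpha-\alpha^4}2,0)$ if $x>\frac{\alpha+\alpha^2}2,\ y\le\alpha$; $w=(\alpha,-1)$ if $y>\alpha$; $w=(\frac{\alpha+\alpha^4}2,0)$ if $x\le\frac{\alpha+\alpha^2}2,\ y\le\alpha$. Let $\hat X$ be the (real oriented) blow-up of $X$ at the two singularities and $\hat h:\hat X\to\hat X$ the homeomorphism covering $h$. Let $x_0=\big(\frac{\alpha-\alpha^2}{2(1+\alpha^2)},\frac1{\alpha^{-1}-\alpha}\big)$ and let $\hat x_0\in\hat X$ lie over it. Let $a,b,c,d,e,f,g$ be the closed curves through $x_0$ that run in $\mathcal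 P$, passing above the slits where needed, down through the bottom side $2$; $5$; $4$; $7$ and then $1$; $6$ and then $1$; $3$; $1$, respectively, and from the paired top side back to $x_0$; let $\epsilon$ be the path from $x_0$ to $h(x_0)$ in $\mathcal P$ that is first horizontal, then vertical. Let $\hat a,\dots,\hat g,\hat\epsilon$ be their lifts to $\hat X$. Paths are composed from left to right. Write $H_1(\hat X;\mathbb Z)=\pi_1(\hat X,\hat x_0)^{\mathrm{ab}}$ and $A=[\hat a],\dots,G=[\hat g]$. Then the following hold. (1) $\pi_1(\hat X,\hat x_0)$ is freely generated by the classes of $\hat a,\dots,\hat g$. (2) Up to base-point-fixing homotopy, $\hat h$ sends $\hat a\mapsto\hat\epsilon^{-1}\hat f\hat c\,\hat\epsilon$, $\hat b\mapsto\hat\epsilon^{-1}\hat f\hat d\hat g^{-1}\hat\epsilon$, $\hat c\mapsto\hat\epsilon^{-1}\hat f\hat e\hat g^{-1}\hat\epsilon$, $\hat d\mapsto\hat\epsilon^{-1}\hat f^2\hat c\,\hat\epsilon$, $\hat e\mapsto\hat\epsilon^{-1}\hat g\hat a\hat c\,\hat\epsilon$, $\hat f\mapsto\hat\epsilon^{-1}\hat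 g\hat b\,\hat\epsilon$, $\hat g\mapsto\hat\epsilon^{-1}\hat g\hat c\,\hat\epsilon$; and $\hat h(\hat h(\hat x_0))=\hat x_0$ and $\hat\epsilon\,\hat h(\hat\epsilon)$ is homotopic to $\hat g$. (3) $(A,\dots,G)$ is a $\mathbb Z$-basis of $H_1(\hat X;\mathbb Z)$, with respect to which $\hat h_*-\mathrm{Id}$ has the matrix (images of basis elements in columns) $$\begin{pmatrix}-1&0&0&0&1&0&0\\0&-1&0&0&0&1&0\\1&0&-1&1&1&0&1\\0&1&0&-1&0&0&0\\0&0&1&0&-1&0&0\\1&1&1&2&0&-1&0\\0&-1&-1&0&1&1&0\end{pmatrix}.$$ (4) $(-A+C+F,\,-B+D+F-G,\,-C+E+F-G,\,C-D+2F,\,A+C-E+G,\,F,\,G)$ is a $\mathbb Z$-basis of $H_1(\hat X;\mathbb Z)$, its first five elements vanish in $\mathrm{Coker}(\hat h_*-\mathrm{Id})$, and there is an isomorphism $\mathrm{Coker}(\hat h_*-\mathrm{Id})\cong\mathbb Z/2\mathbb Z\oplus\mathbb Z$ sending the class of $F$ to $(1,0)$ and the class of $G$ to $(0,1)$. Hence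 $Q=\mathrm{Coker}(\hat h_*-\mathrm{Id})/\mathrm{Torsion}$ is infinite cyclic, generated by the class $\nu$ of $G$. (5) The map $W\to\hat X$ from the wedge $W$ of seven circles given by $\hat a,\dots,\hat g$ is a homotopy equivalence. Let $W_Q\to W$ be the cover with deck group $Q$ belonging to $\pi_1(W)\to H_1(\hat X;\mathbb Z)\to Q$. There is a cellular map $h':W\to W$ corresponding to $\hat h$ up to a homotopy that moves the base point along $\hat\epsilon$ (up to homotopy), with an elevation $h_Q$ to $W_Q$ fixing the base vertex. For every such $h'$ and $h_Q$, $h_Q$ fixes all vertices, so that it acts on the $\mathbb Z[Q]$-module of $0$-cells by $\mathcal F_0=1$, and on the $\mathbb Z[Q]$-module of $1$-cells, with respect to the basis $(a_Q,\dots,g_Q)$ given by the lifts of the circles starting at the base vertex, it acts by $$\mathcal F_1=\begin{pmatrix}0&0&0&0&\nu&0&0\\0&0&0&0&0&\nu&0\\1&0&0&1&\nu&0&\nu\\0&1&0&0&0&0&0\\0&0&1&0&0&0&0\\1&1&1&2&0&0&0\\0&-\nu^{-1}&-1&0&1&1&1\end{pmatrix}.$$ (6) Fried's multivariable Lefschetz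 zeta function $\zeta_{Q,\hat h}(\tau)=\prod_{i\ge0}\det(\mathrm{Id}-\tau\mathcal F_i)^{(-1)^{i+1}}$ is $$\zeta_{Q,\hat h}(\tau)=\frac{\det(\tau\mathcal F_1-\mathrm{Id})}{\tau-1}=\frac{1-\tau-\nu\tau^2-3\nu\tau^3+3\nu\tau^4+\nu\tau^5+\nu^2\tau^6-\nu^2\tau^7}{1-\tau}=1-\nu\tau^2-4\nu\tau^3-\nu\tau^4+\nu^2\tau^6 .$$ -/

import Mathlib

noncomputable section

open scoped unitInterval Polynomial

namespace AY

/-! ### The slitted polygon and the Arnoux–Yoccoz surface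

`α` is the positive root of `x ^ 3 + x ^ 2 + x - 1`; it enters as a parameter. The plane is `ℂ`. The
polygon has vertices `(0,0), (0,1), (α,1), (α,α+α²), (α+α²,α+α²), (α+α²,α), (1,α), (1,0)` and three
vertical slits rising from its bottom side at `x = slit1, slit2, slit3`. It is cut along the vertical
lines through the slits and through the two upper steps into six closed rectangles (the cells), so
that each slit lies on the boundary of cells and its two sides belong to different cells. -/

/-- The abscissa of the first slit. -/
def slit1 (α : ℝ) : ℝ := (α ^ 2 + α ^ 4) / 2

/-- The abscissa of the second slit. -/
def slit2 (α : ℝ) : ℝ := (α + α ^ 2) / 2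

/-- The abscissa of the third slit. -/
def slit3 (α : ℝ) : ℝ := (1 + α) / 2

/-- The height of the third slit. -/
def tip3 (α : ℝ) : ℝ := (α ^ 2 + α ^ 4) / 2

/-- The height of the first slit. -/
def tip1 (α : ℝ) : ℝ := α ^ 3 + tip3 α

/-- The height of the second slit. -/
def tip2 (α : ℝ) : ℝ := α ^ 2 + tip1 α

/-- Left sides of the six cells. -/
def cellLeft (α : ℝ) : Fin 6 → ℝ := ![0, slit1 α, slit2 α, α, slit3 α, α + α ^ 2]

/-- Right sides of the six cells. -/
def cellRight (α : ℝ) : Fin 6 → ℝ := ![slit1 α, slit2 α, α, slit3 α, α + α ^ 2, 1]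

/-- Heights of the six cells. -/
def cellTop (α : ℝ) : Fin 6 → ℝ := ![1, 1, 1, α + α ^ 2, α + α ^ 2, α]

/-- The six closed rectangles whose union is the polygon, from left to right. -/
def cell (α : ℝ) (i : Fin 6) : Set ℂ :=
  {z | cellLeft α i ≤ z.re ∧ z.re ≤ cellRight α i ∧ 0 ≤ z.im ∧ z.im ≤ cellTop α i}

/-- The points of the polygon that represent the two singularities: six boundary points
representing one of them, then the three upper ends of the slits, representing the other. -/
def sing (α : ℝ) : Fin 9 → ℂ :=
  ![⟨α ^ 4 / 2, 0⟩, ⟨slit1 α + α ^ 2 / 2, 0⟩, ⟨slit2 α + α ^ 3 / 2, 0⟩,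
    ⟨α / 2, 1⟩, ⟨α + α ^ 2 / 2, α + α ^ 2⟩, ⟨α + α ^ 2 + α ^ 3 / 2, α⟩,
    ⟨slit1 α, tip1 α⟩, ⟨slit2 α, tip2 α⟩, ⟨slit3 α, tip3 α⟩]

/-- A gluing by the translation `t` of the part of the segment `[p, q]` in the cell `src` to the
part of `[p + t, q + t]` in the cell `tgt`. -/
structure Gluing where
  /-- The cell containing the first side. -/
  src : Fin 6
  /-- The cell containing the second side. -/
  tgt : Fin 6
  /-- One end of the first side. -/
  p : ℂ
  /-- The other end of the first side. -/
  q : ℂ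
  /-- The translation. -/
  t : ℂ

/-- All the gluings. The first five put the slitted polygon together; the next seven are the
vertical side pairings `A, …, G` of the polygon; the others are its horizontal pairings
`1, …, 7`, top side to bottom side (a pairing whose sides meet several cells is listed once for
each relevant pair of cells). -/
def gluings (α : ℝ) : List Gluing :=
  [⟨0, 1, ⟨slit1 α, tip1 α⟩, ⟨slit1 α, 1⟩, 0⟩,
   ⟨1, 2, ⟨slit2 α, tip2 α⟩, ⟨slit2 α, 1⟩, 0⟩,
   ⟨2, 3, ⟨α, 0⟩, ⟨α, α + α ^ 2⟩, 0⟩,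
   ⟨3, 4, ⟨slit3 α, tip3 α⟩, ⟨slit3 α, α + α ^ 2⟩, 0⟩,
   ⟨4, 5, ⟨α + α ^ 2, 0⟩, ⟨α + α ^ 2, α⟩, 0⟩,
   -- the vertical pairings A, B, C, D, E, F, G
   ⟨5, 0, ⟨1, 0⟩, ⟨1, α⟩, ⟨-1, 0⟩⟩,
   ⟨4, 2, ⟨α + α ^ 2, α⟩, ⟨α + α ^ 2, α + α ^ 2⟩, ⟨slit2 α - (α + α ^ 2), -α⟩⟩,
   ⟨2, 1, ⟨α, α + α ^ 2⟩, ⟨α, 1⟩, ⟨slit1 α - α, -(α + α ^ 2)⟩⟩,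
   ⟨1, 0, ⟨slit2 α, 0⟩, ⟨slit2 α, α ^ 2 + α ^ 3⟩, ⟨-slit2 α, α⟩⟩,
   ⟨0, 2, ⟨slit1 α, 0⟩, ⟨slit1 α, tip1 α⟩, ⟨slit2 α - slit1 α, α ^ 2⟩⟩,
   ⟨1, 4, ⟨slit2 α, α ^ 2 + α ^ 3⟩, ⟨slit2 α, tip2 α⟩,
     ⟨slit3 α - slit2 α, -(α ^ 2 + α ^ 3)⟩⟩,
   ⟨3, 1, ⟨slit3 α, 0⟩, ⟨slit3 α, tip3 α⟩, ⟨slit1 α - slit3 α, α ^ 3⟩⟩,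
   -- the horizontal pairing 1
   ⟨0, 4, ⟨0, 1⟩, ⟨(α - α ^ 4) / 2, 1⟩, ⟨slit3 α, -1⟩⟩,
   ⟨0, 5, ⟨0, 1⟩, ⟨(α - α ^ 4) / 2, 1⟩, ⟨slit3 α, -1⟩⟩,
   ⟨1, 5, ⟨0, 1⟩, ⟨(α - α ^ 4) / 2, 1⟩, ⟨slit3 α, -1⟩⟩,
   -- the horizontal pairing 2
   ⟨1, 0, ⟨(α - α ^ 4) / 2, 1⟩, ⟨α / 2, 1⟩, ⟨-((α - α ^ 4) / 2), -1⟩⟩,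
   -- the horizontal pairing 3
   ⟨1, 2, ⟨α / 2, 1⟩, ⟨α, 1⟩, ⟨(1 - α) / 2, -1⟩⟩,
   ⟨1, 3, ⟨α / 2, 1⟩, ⟨α, 1⟩, ⟨(1 - α) / 2, -1⟩⟩,
   ⟨2, 3, ⟨α / 2, 1⟩, ⟨α, 1⟩, ⟨(1 - α) / 2, -1⟩⟩,
   -- the horizontal pairing 4
   ⟨3, 1, ⟨α, α + α ^ 2⟩, ⟨α + α ^ 2 / 2, α + α ^ 2⟩, ⟨slit1 α - α, -(α + α ^ 2)⟩⟩,
   -- the horizontal pairing 5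
   ⟨3, 0, ⟨α + α ^ 2 / 2, α + α ^ 2⟩, ⟨α + α ^ 2, α + α ^ 2⟩,
     ⟨α ^ 4 / 2 - (α + α ^ 2 / 2), -(α + α ^ 2)⟩⟩,
   ⟨4, 0, ⟨α + α ^ 2 / 2, α + α ^ 2⟩, ⟨α + α ^ 2, α + α ^ 2⟩,
     ⟨α ^ 4 / 2 - (α + α ^ 2 / 2), -(α + α ^ 2)⟩⟩,
   -- the horizontal pairing 6
   ⟨5, 2, ⟨α + α ^ 2, α⟩, ⟨α + α ^ 2 + α ^ 3 / 2, α⟩, ⟨slit2 α - (α + α ^ 2), -α⟩⟩,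
   -- the horizontal pairing 7
   ⟨5, 1, ⟨α + α ^ 2 + α ^ 3 / 2, α⟩, ⟨1, α⟩, ⟨slit2 α - 1, -α⟩⟩]

/-- Disjoint union of the cells. -/
abbrev Pieces (α : ℝ) : Type := Σ i : Fin 6, cell α i

/-- The relation on the disjoint union of the cells given by the gluings. -/
def Glued (α : ℝ) (x y : Pieces α) : Prop :=
  ∃ g ∈ gluings α, x.1 = g.src ∧ y.1 = g.tgt ∧
    (x.2 : ℂ) ∈ segment ℝ g.p g.q ∧ (y.2 : ℂ) = (x.2 : ℂ) + g.t

/-- The Arnoux–Yoccoz surface of genus three, with the quotient topology. -/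
def X (α : ℝ) : Type := Quot (Glued α)

instance (α : ℝ) : TopologicalSpace (X α) := inferInstanceAs (TopologicalSpace (Quot (Glued α)))

/-- `x` is the point of the surface represented by the point `z` of the `i`-th cell. -/
def At (α : ℝ) (i : Fin 6) (z : ℂ) (x : X α) : Prop :=
  ∃ hz : z ∈ cell α i, x = Quot.mk _ ⟨i, z, hz⟩

/-! ### The blow-up -/

/-- The real oriented blow-up of a convex polygon or segment `S` at the points `v k` lying on it. A
point of it consists of a point `z` of `S` and, for each `k`, of a unit vector `u k` pointing from
`v k` into `S`, which is the direction of `z - v k` if `z ≠ v k`. So over `v k` lies the arc of all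
directions at `v k` pointing into `S`, and over every other point of `S` lies one point. -/
def blowUp {n : ℕ} (v : Fin n → ℂ) (S : Set ℂ) : Set (ℂ × (Fin n → ℂ)) :=
  {w | w.1 ∈ S ∧ ∀ k, ‖w.2 k‖ = 1 ∧ w.1 = v k + (‖w.1 - v k‖ : ℂ) * w.2 k ∧
    ∃ r : ℝ, 0 < r ∧ v k + (r : ℂ) * w.2 k ∈ S}

/-- Disjoint union of the blown-up cells. -/
abbrev HatPieces (α : ℝ) : Type := Σ i : Fin 6, blowUp (sing α) (cell α i)

/-- The gluings of the blown-up cells along their blown-up sides: over a singular end point of a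
side, the direction along the side is glued to the direction along the translated side. -/
def HatGlued (α : ℝ) (x y : HatPieces α) : Prop :=
  ∃ g ∈ gluings α, x.1 = g.src ∧ y.1 = g.tgt ∧
    (x.2 : ℂ × (Fin 9 → ℂ)) ∈ blowUp (sing α) (segment ℝ g.p g.q) ∧
    (y.2 : ℂ × (Fin 9 → ℂ)) ∈ blowUp (sing α) (segment ℝ (g.p + g.t) (g.q + g.t)) ∧
    (y.2 : ℂ × (Fin 9 → ℂ)).1 = (x.2 : ℂ × (Fin 9 → ℂ)).1 + g.t

/-- The blow-up of the Arnoux–Yoccoz surface at its two singularities. -/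
def Xhat (α : ℝ) : Type := Quot (HatGlued α)

instance (α : ℝ) : TopologicalSpace (Xhat α) :=
  inferInstanceAs (TopologicalSpace (Quot (HatGlued α)))

/-- The collapsing map from the blown-up surface to the surface, which forgets directions. -/
def collapse (α : ℝ) : Xhat α → X α :=
  Quot.map (fun x => ⟨x.1, x.2.1.1, x.2.2.1⟩)
    (fun _ _ ⟨g, hg, h1, h2, h3, _, h5⟩ => ⟨g, hg, h1, h2, h3.1, h5⟩)

/-! ### The Arnoux–Yoccoz map -/

/-- The piecewise affine formula of the Arnoux–Yoccoz map on the polygon: contraction by `α`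
horizontally and expansion by `α⁻¹` vertically, followed by a translation. -/
def ayFormula (α : ℝ) (z : ℂ) : ℂ :=
  if slit2 α < z.re then
    if z.im ≤ α then ⟨α * z.re - (α - α ^ 4) / 2, α⁻¹ * z.im⟩
    else ⟨α * z.re + α, α⁻¹ * z.im - 1⟩
  else
    if α < z.im then ⟨α * z.re + α, α⁻¹ * z.im - 1⟩
    else ⟨α * z.re + (α + α ^ 4) / 2, α⁻¹ * z.im⟩

/-- `h` is given by the formula, at the points inside cells that are sent inside cells; as these
are dense, there is at most one continuous `h` like this. -/
def IsAYMap (α : ℝ) (h : X α → X α) : Prop :=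
  ∀ (i j : Fin 6) (z : ℂ) (x : X α), z ∈ interior (cell α i) →
    ayFormula α z ∈ interior (cell α j) → At α i z x → At α j (ayFormula α z) (h x)

/-! ### The curves -/

/-- The base point, in the first cell; it belongs to the orbit of length two. -/
def base (α : ℝ) : ℂ := ⟨(α - α ^ 2) / (2 * (1 + α ^ 2)), 1 / (α⁻¹ - α)⟩

/-- The point at the height of the base point and with abscissa `x`. -/
def level (α x : ℝ) : ℂ := ⟨x, (base α).im⟩

/-- A straight segment from `p` to `q` in a cell. -/
structure Leg where
  /-- The cell. -/
  i : Fin 6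
  /-- The initial point. -/
  p : ℂ
  /-- The final point. -/
  q : ℂ

/-- The curve `γ` on the blown-up surface is the lift of the polygonal curve with the given legs,
each run through at constant speed in an equal share of the time. -/
def Follows (α : ℝ) {x y : Xhat α} (γ : Path x y) (L : List Leg) : Prop :=
  ∀ (k : Fin L.length) (s : ℝ), 0 ≤ s → s ≤ 1 →
    At α (L.get k).i (AffineMap.lineMap (L.get k).p (L.get k).q s)
      (collapse α (γ.extend (((k : ℕ) + s) / (L.length : ℝ))))

/-- The closed curves `a, b, c, d, e, f, g`, in this order. They run through the bottom sides
`2`, `5`, `4`, `7` and then `1`, `6` and then `1`, `3`, `1`, respectively, passing above the slits. -/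
def loopLegs (α : ℝ) : Fin 7 → List Leg :=
  ![
    -- the curve a
    [⟨0, base α, ⟨α ^ 4 / 4, 0⟩⟩,
     ⟨1, ⟨α / 2 - α ^ 4 / 4, 1⟩, level α (slit1 α)⟩,
     ⟨0, level α (slit1 α), base α⟩],
    -- the curve b
    [⟨0, base α, ⟨α ^ 4 / 2 + α ^ 2 / 4, 0⟩⟩,
     ⟨3, ⟨α + 3 * α ^ 2 / 4, α + α ^ 2⟩, level α α⟩,
     ⟨2, level α α, level α (slit2 α)⟩,
     ⟨1, level α (slit2 α), level α (slit1 α)⟩,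
     ⟨0, level α (slit1 α), base α⟩],
    -- the curve c
    [⟨0, base α, level α (slit1 α)⟩,
     ⟨1, level α (slit1 α), ⟨slit1 α + α ^ 2 / 4, 0⟩⟩,
     ⟨3, ⟨α + α ^ 2 / 4, α + α ^ 2⟩, level α α⟩,
     ⟨2, level α α, level α (slit2 α)⟩,
     ⟨1, level α (slit2 α), level α (slit1 α)⟩,
     ⟨0, level α (slit1 α), base α⟩],
    -- the curve d
    [⟨0, base α, level α (slit1 α)⟩,
     ⟨1, level α (slit1 α), ⟨slit2 α - α ^ 3 / 4, 0⟩⟩,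
     ⟨5, ⟨1 - α ^ 3 / 4, α⟩, ⟨1 - α ^ 3 / 4, 0⟩⟩,
     ⟨0, ⟨1 - α ^ 3 / 4 - slit3 α, 1⟩, base α⟩],
    -- the curve e
    [⟨0, base α, level α (slit1 α)⟩,
     ⟨1, level α (slit1 α), level α (slit2 α)⟩,
     ⟨2, level α (slit2 α), ⟨slit2 α + α ^ 3 / 4, 0⟩⟩,
     ⟨5, ⟨α + α ^ 2 + α ^ 3 / 4, α⟩, ⟨α + α ^ 2 + α ^ 3 / 4, 0⟩⟩,
     ⟨0, ⟨α + α ^ 2 + α ^ 3 / 4 - slit3 α, 1⟩, base α⟩],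
    -- the curve f
    [⟨0, base α, level α (slit1 α)⟩,
     ⟨1, level α (slit1 α), level α (slit2 α)⟩,
     ⟨2, level α (slit2 α), level α α⟩,
     ⟨3, level α α, ⟨1 / 2 + α / 4, 0⟩⟩,
     ⟨1, ⟨3 * α / 4, 1⟩, level α (slit1 α)⟩,
     ⟨0, level α (slit1 α), base α⟩],
    -- the curve g
    [⟨0, base α, level α (slit1 α)⟩,
     ⟨1, level α (slit1 α), level α (slit2 α)⟩,
     ⟨2, level α (slit2 α), level α α⟩,
     ⟨3, level α α, level α (slit3 α)⟩,
     ⟨4, level α (slit3 α), ⟨slit3 α + α ^ 4 / 2, 0⟩⟩,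
     ⟨0, ⟨α ^ 4 / 2, 1⟩, base α⟩]]

/-- The path `ε` from the base point to its image, first horizontal and then vertical. -/
def epsLegs (α : ℝ) : List Leg :=
  [⟨0, base α, level α (slit1 α)⟩,
   ⟨1, level α (slit1 α), level α (slit2 α)⟩,
   ⟨2, level α (slit2 α), level α α⟩,
   ⟨3, level α α, level α (ayFormula α (base α)).re⟩,
   ⟨3, level α (ayFormula α (base α)).re, ayFormula α (base α)⟩]

/-- The Arnoux–Yoccoz map, its blow-up, the base point and the curves. All of them are determined
by `α`. -/
structure Data (α : ℝ) where
  /-- The Arnoux–Yoccoz map. -/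
  h : X α ≃ₜ X α
  isAYMap : IsAYMap α h
  /-- The blown-up map. -/
  hhat : Xhat α ≃ₜ Xhat α
  collapse_hhat : ∀ x, collapse α (hhat x) = h (collapse α x)
  /-- The base point on the blown-up surface. -/
  x₀ : Xhat α
  at_x₀ : At α 0 (base α) (collapse α x₀)
  /-- The loops `â, …, ĝ`. -/
  loop : Fin 7 → Path x₀ x₀
  follows_loop : ∀ k, Follows α (loop k) (loopLegs α k)
  /-- The path `ε̂` from the base point to its image. -/
  eps : Path x₀ (hhat x₀)
  follows_eps : Follows α eps (epsLegs α)

/-! ### Graphs: the wedge of seven circles and its covers -/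

section Graph

variable {Q : Type} [AddCommGroup Q] (ψ : Fin 7 → Q)

/-- `v` is the initial vertex `q` (at time `0`) or the final vertex `q + ψ k` (at time `1`) of the
edge `(q, k)`. -/
def IsEnd (x : Σ _ : Q × Fin 7, I) (v : Q) : Prop :=
  (x.2 = 0 ∧ v = x.1.1) ∨ (x.2 = 1 ∧ v = x.1.1 + ψ x.1.2)

/-- The one-dimensional CW complex with vertex set `Q` and with an edge `(q, k)` from `q` to
`q + ψ k` for each `q` in `Q` and each `k` among seven indices. If the `ψ k` generate `Q`, this is
the connected regular cover with deck group `Q` of the wedge of seven circles (the case `Q = 0`)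
belonging to the homomorphism from its fundamental group to `Q` that sends the `k`-th circle to
`ψ k`; an element `g` of `Q` sends the edge `(q, k)` to `(g + q, k)`. -/
def Graph : Type := Quot fun x y : (Σ _ : Q × Fin 7, I) => ∃ v, IsEnd ψ x v ∧ IsEnd ψ y v

instance : TopologicalSpace (Graph ψ) :=
  inferInstanceAs (TopologicalSpace (Quot fun x y : (Σ _ : Q × Fin 7, I) =>
    ∃ v, IsEnd ψ x v ∧ IsEnd ψ y v))

/-- The point at time `t` of the edge `(q, k)`. -/
def edgePt (q : Q) (k : Fin 7) (t : I) : Graph ψ := Quot.mk _ ⟨(q, k), t⟩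

/-- The vertex `q`. -/
def vertex (q : Q) : Graph ψ := edgePt ψ q 0 0

/-- The wedge of seven circles. -/
abbrev Rose : Type := Graph (Q := PUnit) (fun _ => 0)

/-- The common point of the seven circles. -/
def rosePt : Rose := vertex _ 0

/-- The covering projection to the wedge of circles. -/
def proj : Graph ψ → Rose :=
  Quot.map (fun x => ⟨(0, x.1.2), x.2⟩) (by
    rintro x y ⟨v, hx, hy⟩
    refine ⟨0, ?_, ?_⟩
    · rcases hx with h | h
      · exact Or.inl ⟨h.1, rfl⟩
      · exact Or.inr ⟨h.1, rfl⟩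
    · rcases hy with h | h
      · exact Or.inl ⟨h.1, rfl⟩
      · exact Or.inr ⟨h.1, rfl⟩)

open Classical in
/-- The map to the circle `ℝ / ℤ` that wraps the edge `(q, j)` once around it and collapses the
rest of the graph to a point. -/
def wrap (q : Q) (j : Fin 7) : Graph ψ → UnitAddCircle :=
  Quot.lift (fun x => if x.1 = (q, j) then (((x.2 : I) : ℝ) : UnitAddCircle) else 0) (by
    have key : ∀ (x : Σ _ : Q × Fin 7, I) (v : Q), IsEnd ψ x v →
        (if x.1 = (q, j) then (((x.2 : I) : ℝ) : UnitAddCircle) else 0) = 0 := by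
      rintro x v (h | h)
      · simp [h.1]
      · simp [h.1]
    rintro x y ⟨v, hx, hy⟩
    exact (key x v hx).trans (key y v hy).symm)

/-- The closed curve `γ` in `ℝ / ℤ` has degree `d`. -/
def HasDegree (γ : I → UnitAddCircle) (d : ℤ) : Prop :=
  ∃ θ : C(I, ℝ), (∀ t, ((θ t : ℝ) : UnitAddCircle) = γ t) ∧ θ 1 - θ 0 = d

open Classical in
/-- `F₀` is the matrix over `ℤ[Q]` of the action of the cellular map `f` on the `0`-cells, with
respect to the basis given by the vertex `0`. -/
def IsAction₀ (f : Graph ψ → Graph ψ) (F₀ : Matrix (Fin 1) (Fin 1) (AddMonoidAlgebra ℤ Q)) : Prop :=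
  ∀ q' q : Q, (F₀ 0 0).coeff (q - q') = if f (vertex ψ q') = vertex ψ q then 1 else 0

/-- `F₁` is the matrix over `ℤ[Q]` of the action of the cellular map `f` on the `1`-cells, with
respect to the basis given by the edges `(0, k)`: the coefficient of the edge `(q, j)` in the image
of the edge `(q', k)` is the degree with which `f` wraps `(q', k)` around `(q, j)`. -/
def IsAction₁ (f : Graph ψ → Graph ψ) (F₁ : Matrix (Fin 7) (Fin 7) (AddMonoidAlgebra ℤ Q)) : Prop :=
  ∀ (q' : Q) (k : Fin 7) (q : Q) (j : Fin 7),
    HasDegree (fun t => wrap ψ q j (f (edgePt ψ q' k t))) ((F₁ j k).coeff (q - q'))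

end Graph

/-! ### Fried's zeta function -/

/-- The product over `i ≥ 0` of `det (1 - τ Fᵢ) ^ ((-1) ^ (i + 1))` for a one-dimensional complex, as
a quotient of polynomials in `τ`. (`Matrix.charpolyRev F` is `det (1 - τ F)`.) -/
def friedZeta {R : Type} [CommRing R] {m n : ℕ} (F₀ : Matrix (Fin m) (Fin m) R)
    (F₁ : Matrix (Fin n) (Fin n) R) : FractionRing R[X] :=
  IsLocalization.mk' (FractionRing R[X]) F₁.charpolyRev
    (⟨F₀.charpolyRev, by
      apply Polynomial.mem_nonZeroDivisors_of_trailingCoeff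
      have h : F₀.charpolyRev.coeff 0 = 1 := by
        rw [Polynomial.coeff_zero_eq_eval_zero, Matrix.eval_charpolyRev]
      rcases subsingleton_or_nontrivial R with hR | hR
      · rw [Subsingleton.elim F₀.charpolyRev.trailingCoeff 1]
        exact one_mem _
      · rw [Polynomial.trailingCoeff,
          Polynomial.natTrailingDegree_eq_zero.2 (Or.inr (by rw [h]; exact one_ne_zero)), h]
        exact one_mem _⟩ : nonZeroDivisors R[X])

namespace Data

variable {α : ℝ} (D : Data α)

/-! ### Fundamental group, first homology, cokernel -/

/-- `ε̂⁻¹ γ ε̂`, a loop at the image of the base point. -/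
def conj (γ : Path D.x₀ D.x₀) : Path (D.hhat D.x₀) (D.hhat D.x₀) :=
  (D.eps.symm.trans γ).trans D.eps

/-- The image under `ĥ` of the `k`-th loop. -/
def imageLoop (k : Fin 7) : Path (D.hhat D.x₀) (D.hhat D.x₀) :=
  (D.loop k).map D.hhat.continuous

/-- The class in the fundamental group of a loop. -/
def piClass (γ : Path D.x₀ D.x₀) : FundamentalGroup (Xhat α) D.x₀ :=
  FundamentalGroup.fromPath (Path.Homotopic.Quotient.mk γ)

/-- The first integral homology group of the blown-up surface: the abelianized fundamental group,
written additively. -/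
abbrev H1 : Type := Additive (Abelianization (FundamentalGroup (Xhat α) D.x₀))

/-- The homology classes `A, …, G` of the seven loops. -/
def cls (k : Fin 7) : D.H1 := Additive.ofMul (Abelianization.of (D.piClass (D.loop k)))

/-- The map induced by `ĥ` on the first homology. (The base points are joined by `ε̂`; on the
abelianization the choice of the path does not matter.) -/
def hStar : D.H1 →+ D.H1 :=
  MonoidHom.toAdditive (Abelianization.map
    ((FundamentalGroup.fundamentalGroupMulEquivOfPath D.eps.symm).toMonoidHom.comp
      (FundamentalGroup.map (D.hhat : C(Xhat α, Xhat α)) D.x₀)))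

/-- The cokernel of `ĥ_* - Id`. -/
abbrev Coker : Type := D.H1 ⧸ (D.hStar - AddMonoidHom.id D.H1).range

/-- The class in the cokernel of a homology class. -/
def toCoker : D.H1 →+ D.Coker := QuotientAddGroup.mk' _

/-- The torsion-free quotient `Q` of the cokernel. -/
abbrev Q : Type := D.Coker ⧸ AddCommGroup.torsion D.Coker

/-- The quotient homomorphism from the first homology to `Q`. -/
def psiQ : D.H1 →+ D.Q := (QuotientAddGroup.mk' (AddCommGroup.torsion D.Coker)).comp D.toCoker

/-- The list `-A+C+F, -B+D+F-G, -C+E+F-G, C-D+2F, A+C-E+G, F, G` of homology classes. -/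
def cls' : Fin 7 → D.H1 :=
  ![-D.cls 0 + D.cls 2 + D.cls 5,
    -D.cls 1 + D.cls 3 + D.cls 5 - D.cls 6,
    -D.cls 2 + D.cls 4 + D.cls 5 - D.cls 6,
    D.cls 2 - D.cls 3 + 2 • D.cls 5,
    D.cls 0 + D.cls 2 - D.cls 4 + D.cls 6,
    D.cls 5,
    D.cls 6]

/-- The group ring `ℤ[Q]`. -/
abbrev GroupRing : Type := AddMonoidAlgebra ℤ D.Q

/-- The class `ν` of `G` in `Q`, as an element of the group ring. -/
def nu : D.GroupRing := AddMonoidAlgebra.single (D.psiQ (D.cls 6)) 1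

/-- The inverse of `ν`. -/
def nuInv : D.GroupRing := AddMonoidAlgebra.single (-D.psiQ (D.cls 6)) 1

/-! ### Cellular models -/

/-- The map from the wedge of seven circles to the blown-up surface given by the seven loops. -/
def roseMap : C(Rose, Xhat α) where
  toFun := Quot.lift (fun x => D.loop x.1.2 x.2) (by
    have key : ∀ (x : Σ _ : PUnit × Fin 7, I) (v : PUnit), IsEnd (fun _ => 0) x v →
        D.loop x.1.2 x.2 = D.x₀ := by
      rintro x v (h | h)
      · rw [h.1]; exact (D.loop _).source
      · rw [h.1]; exact (D.loop _).target
    rintro x y ⟨v, hx, hy⟩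
    exact (key x v hx).trans (key y v hy).symm)
  continuous_toFun := by
    refine continuous_coinduced_dom.2 ?_
    refine continuous_sigma fun q => ?_
    exact (D.loop q.2).continuous

/-- The maximal free abelian cover of the wedge of circles on which the map induced by `ĥ` on the
deck group is trivial: the cover with deck group `Q`. -/
abbrev RoseQ : Type := Graph (fun k => D.psiQ (D.cls k))

/-- A cellular version of `ĥ` together with its elevation to the cover with deck group `Q` and the
actions on cells: a cellular self-map `f` of the wedge of seven circles, homotopic to `ĥ` through
the map `roseMap`, where the homotopy moves the base point along `ε̂` up to homotopy, and the
elevation `fQ` of `f` fixing the base vertex. -/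
structure CellularModel where
  /-- The cellular map. -/
  f : C(Rose, Rose)
  f_pt : f rosePt = rosePt
  /-- The homotopy from `f` to `ĥ`. -/
  H : ContinuousMap.Homotopy (D.roseMap.comp f)
    ((D.hhat : C(Xhat α, Xhat α)).comp D.roseMap)
  H_pt : ∃ (h₀ : D.x₀ = D.roseMap.comp f rosePt)
    (h₁ : D.hhat D.x₀ = ((D.hhat : C(Xhat α, Xhat α)).comp D.roseMap) rosePt),
    ((H.evalAt rosePt).cast h₀ h₁).Homotopic D.eps
  /-- The elevation. -/
  fQ : C(D.RoseQ, D.RoseQ)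
  proj_fQ : ∀ x, proj _ (fQ x) = f (proj _ x)
  fQ_zero : fQ (vertex _ 0) = vertex _ 0
  /-- The action on the `0`-cells. -/
  F₀ : Matrix (Fin 1) (Fin 1) D.GroupRing
  isAction₀ : IsAction₀ _ fQ F₀
  /-- The action on the `1`-cells. -/
  F₁ : Matrix (Fin 7) (Fin 7) D.GroupRing
  isAction₁ : IsAction₁ _ fQ F₁

/-- The matrix asserted for the action on the `1`-cells. -/
def actionMatrix : Matrix (Fin 7) (Fin 7) D.GroupRing :=
  !![0, 0, 0, 0, D.nu, 0, 0;
     0, 0, 0, 0, 0, D.nu, 0;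
     1, 0, 0, 1, D.nu, 0, D.nu;
     0, 1, 0, 0, 0, 0, 0;
     0, 0, 1, 0, 0, 0, 0;
     1, 1, 1, 2, 0, 0, 0;
     0, -D.nuInv, -1, 0, 1, 1, 1]

end Data

/-- The matrix asserted for `ĥ_* - Id` on the first homology. -/
def homologyMatrix : Matrix (Fin 7) (Fin 7) ℤ :=
  !![-1, 0, 0, 0, 1, 0, 0;
     0, -1, 0, 0, 0, 1, 0;
     1, 0, -1, 1, 1, 0, 1;
     0, 1, 0, -1, 0, 0, 0;
     0, 0, 1, 0, -1, 0, 0;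
     1, 1, 1, 2, 0, -1, 0;
     0, -1, -1, 0, 1, 1, 0]

end AY

end

noncomputable section
open scoped unitInterval Polynomial
open Topology Filter

namespace AY

/-! ### Blow-ups and diagonal affine maps -/

/-- The diagonal linear map with factors `s.re` and `s.im`. -/
def diag (s z : ℂ) : ℂ := ⟨s.re * z.re, s.im * z.im⟩

/-- The unit vector in the direction of `z`. -/
def nrm (z : ℂ) : ℂ := z / (‖z‖ : ℂ)

theorem diag_add (s z w : ℂ) : diag s (z + w) = diag s z + diag s w := by
  apply Complex.ext <;> simp [diag, mul_add]

theorem diag_sub (s z w : ℂ) : diag s (z - w) = diag s z - diag s w := by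
  apply Complex.ext <;> simp [diag, mul_sub]

theorem diag_real_mul (s : ℂ) (r : ℝ) (z : ℂ) : diag s (r * z) = r * diag s z := by
  apply Complex.ext <;> simp [diag] <;> ring

theorem diag_ne_zero {s z : ℂ} (h1 : 0 < s.re) (h2 : 0 < s.im) (hz : z ≠ 0) : diag s z ≠ 0 := by
  intro h
  apply hz
  have h3 := congrArg Complex.re h
  have h4 := congrArg Complex.im h
  simp [diag] at h3 h4
  apply Complex.ext
  · simpa using h3.resolve_left h1.ne'
  · simpa using h4.resolve_left h2.ne'

theorem continuous_diag (s : ℂ) : Continuous (diag s) := by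
  have : diag s = fun z : ℂ => ((s.re * z.re : ℝ) : ℂ) + ((s.im * z.im : ℝ) : ℂ) * Complex.I := by
    funext z; apply Complex.ext <;> simp [diag]
  rw [this]; fun_prop

theorem diag_inv_diag {s : ℂ} (h1 : 0 < s.re) (h2 : 0 < s.im) (z : ℂ) :
    diag ⟨s.re⁻¹, s.im⁻¹⟩ (diag s z) = z := by
  apply Complex.ext <;> simp [diag, h1.ne', h2.ne']

theorem norm_nrm {z : ℂ} (hz : z ≠ 0) : ‖nrm z‖ = 1 := by
  simp [nrm, hz]

theorem norm_mul_nrm {z : ℂ} (hz : z ≠ 0) : (‖z‖ : ℂ) * nrm z = z := by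
  have : (‖z‖ : ℂ) ≠ 0 := by simpa using hz
  rw [nrm]; field_simp

theorem nrm_of_norm_one {z : ℂ} (hz : ‖z‖ = 1) : nrm z = z := by
  simp [nrm, hz]

theorem nrm_real_mul {r : ℝ} (hr : 0 < r) (z : ℂ) : nrm (r * z) = nrm z := by
  have : (r : ℂ) ≠ 0 := by exact_mod_cast hr.ne'
  simp only [nrm, norm_mul, Complex.norm_real, Real.norm_eq_abs, abs_of_pos hr, Complex.ofReal_mul]
  rw [mul_div_mul_left _ _ this]

theorem nrm_of_nonneg {r : ℝ} (hr : 0 ≤ r) {z u : ℂ} (hz : z ≠ 0) (hu : ‖u‖ = 1)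
    (h : z = r * u) : u = nrm z := by
  have hr' : r ≠ 0 := by rintro rfl; simp at h; exact hz h
  rw [h, nrm_real_mul (lt_of_le_of_ne hr hr'.symm), nrm_of_norm_one hu]

variable {n n' : ℕ} {v : Fin n → ℂ} {v' : Fin n' → ℂ} {S T : Set ℂ}

theorem blowUp.dir {x : ℂ × (Fin n → ℂ)} (hx : x ∈ blowUp v S) {k : Fin n} (h : x.1 ≠ v k) :
    x.2 k = nrm (x.1 - v k) := by
  obtain ⟨h1, h2, -⟩ := hx.2 k
  exact nrm_of_nonneg (norm_nonneg _) (sub_ne_zero.2 h) h1 (by rw [sub_eq_iff_eq_add']; exact h2)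

theorem blowUp.ext {x y : ℂ × (Fin n → ℂ)} (hx : x ∈ blowUp v S) (hy : y ∈ blowUp v T)
    (h1 : x.1 = y.1) (h2 : ∀ k, x.1 = v k → x.2 k = y.2 k) : x = y := by
  refine Prod.ext h1 (funext fun k => ?_)
  by_cases h : x.1 = v k
  · exact h2 k h
  · rw [blowUp.dir hx h, blowUp.dir hy (h1 ▸ h), h1]

theorem blowUp.mono (h : S ⊆ T) : blowUp v S ⊆ blowUp v T := fun _ hx =>
  ⟨h hx.1, fun k => ⟨(hx.2 k).1, (hx.2 k).2.1, (hx.2 k).2.2.imp fun _ hr => ⟨hr.1, h hr.2⟩⟩⟩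

/-- To lie in a smaller blow-up only matters at the point itself and, if this point is blown up,
for its direction. -/
theorem blowUp.restrict {x : ℂ × (Fin n → ℂ)} (hx : x ∈ blowUp v S) (hT : x.1 ∈ T)
    (h : ∀ k, x.1 = v k → ∃ r : ℝ, 0 < r ∧ v k + (r : ℂ) * x.2 k ∈ T) : x ∈ blowUp v T := by
  refine ⟨hT, fun k => ⟨(hx.2 k).1, (hx.2 k).2.1, ?_⟩⟩
  by_cases hk : x.1 = v k
  · exact h k hk
  · refine ⟨‖x.1 - v k‖, norm_pos_iff.2 (sub_ne_zero.2 hk), ?_⟩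
    rw [← (hx.2 k).2.1]; exact hT

theorem blowUp.ray (hS : Convex ℝ S) {x : ℂ × (Fin n → ℂ)} (hx : x ∈ blowUp v S) {k : Fin n}
    (hk : x.1 = v k) : ∃ r : ℝ, 0 < r ∧ ∀ ρ : ℝ, 0 ≤ ρ → ρ ≤ r → v k + (ρ : ℂ) * x.2 k ∈ S := by
  obtain ⟨r, hr, hrS⟩ := (hx.2 k).2.2
  refine ⟨r, hr, fun ρ h0 h1 => ?_⟩
  have := hS (hk ▸ hx.1) hrS (a := 1 - ρ / r) (b := ρ / r)
    (by rw [sub_nonneg, div_le_one hr]; exact h1) (by positivity) (by ring)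
  convert this using 1
  have hr' : (r : ℂ) ≠ 0 := by exact_mod_cast hr.ne'
  simp only [Complex.real_smul]; push_cast; field_simp; ring

theorem blowUp.inter (hS : Convex ℝ S) (hT : Convex ℝ T) {x : ℂ × (Fin n → ℂ)}
    (hx : x ∈ blowUp v S) (hy : x ∈ blowUp v T) : x ∈ blowUp v (S ∩ T) := by
  refine blowUp.restrict hx ⟨hx.1, hy.1⟩ fun k hk => ?_
  obtain ⟨r, hr, h⟩ := blowUp.ray hS hx hk
  obtain ⟨r', hr', h'⟩ := blowUp.ray hT hy hk
  exact ⟨min r r', lt_min hr hr', h _ (lt_min hr hr').le (min_le_left _ _),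
    h' _ (lt_min hr hr').le (min_le_right _ _)⟩

/-- If finitely many closed sets cover a convex set up to the blown-up points, their blow-ups cover
its blow-up. -/
theorem blowUp.cover {ι : Type*} [Finite ι] (hv : Function.Injective v) (hS : Convex ℝ S)
    {C : ι → Set ℂ} (hC : ∀ a, IsClosed (C a)) (hcov : ∀ z ∈ S, z ∉ Set.range v → ∃ a, z ∈ C a)
    {x : ℂ × (Fin n → ℂ)} (hx : x ∈ blowUp v S) : ∃ a, x ∈ blowUp v (C a) := by
  by_cases hz : x.1 ∈ Set.range v
  · obtain ⟨k, hk⟩ := hz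
    obtain ⟨r, hr, h⟩ := blowUp.ray hS hx hk.symm
    have hu : x.2 k ≠ 0 := by intro h0; simpa [h0] using (hx.2 k).1
    have hcont : Continuous fun ρ : ℝ => v k + (ρ : ℂ) * x.2 k := by fun_prop
    have htend : Tendsto (fun ρ : ℝ => v k + (ρ : ℂ) * x.2 k) (𝓝[>] 0) (𝓝 (v k)) := by
      have := hcont.tendsto 0
      simp only [Complex.ofReal_zero, zero_mul, add_zero] at this
      exact this.mono_left nhdsWithin_le_nhds
    have hev : ∀ᶠ ρ : ℝ in 𝓝[>] 0, ∃ a, v k + (ρ : ℂ) * x.2 k ∈ C a := by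
      have h1 : ∀ᶠ ρ : ℝ in 𝓝[>] 0, ∀ l, l ≠ k → v k + (ρ : ℂ) * x.2 k ≠ v l := by
        rw [eventually_all]
        intro l
        by_cases hl : l = k
        · exact Eventually.of_forall fun _ h => absurd hl h
        · have : v k ≠ v l := fun h => hl (hv h).symm
          filter_upwards [htend.eventually_ne this] with ρ hρ _ using hρ
      filter_upwards [h1, Ioc_mem_nhdsGT hr, self_mem_nhdsWithin] with ρ h1 h2 h3
      refine hcov _ (h ρ h2.1.le h2.2) ?_
      rintro ⟨l, hl⟩
      by_cases hlk : l = k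
      · subst hlk
        have h3' : (ρ : ℂ) ≠ 0 := by exact_mod_cast (Set.mem_Ioi.1 h3).ne'
        rw [left_eq_add] at hl
        exact (mul_ne_zero h3' hu) hl
      · exact h1 l hlk hl.symm
    have hfr : ∃ a, ∃ᶠ ρ : ℝ in 𝓝[>] 0, v k + (ρ : ℂ) * x.2 k ∈ C a := by
      by_contra hcon
      push Not at hcon
      have := (eventually_all.2 hcon).and hev
      obtain ⟨ρ, h1, a, h2⟩ := this.exists
      exact h1 a h2
    obtain ⟨a, ha⟩ := hfr
    refine ⟨a, blowUp.restrict hx ?_ fun l hl => ?_⟩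
    · rw [← hk]; exact (hC a).mem_of_frequently_of_tendsto ha htend
    · have : l = k := hv (by rw [hk, ← hl])
      subst this
      obtain ⟨ρ, h1, h2⟩ := (ha.and_eventually self_mem_nhdsWithin).exists
      exact ⟨ρ, h2, h1⟩
  · obtain ⟨a, ha⟩ := hcov _ hx.1 hz
    exact ⟨a, blowUp.restrict hx ha fun k hk => absurd ⟨k, hk.symm⟩ hz⟩

open Classical in
/-- The map of blow-ups induced by the affine map `φ` with linear part `diag s` on the set `S`. -/
def lift (v : Fin n → ℂ) (v' : Fin n' → ℂ) (s : ℂ) (φ : ℂ → ℂ) (S : Set ℂ)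
    (x : ℂ × (Fin n → ℂ)) : ℂ × (Fin n' → ℂ) :=
  (φ x.1, fun k' => if h : ∃ k, v k ∈ S ∧ φ (v k) = v' k' then nrm (diag s (x.2 h.choose))
    else nrm (φ x.1 - v' k'))

section Lift

variable {s : ℂ} {φ : ℂ → ℂ}

/-- The affine map `φ` has linear part `diag s` with positive factors and matches the blown-up
points in the set `S`. -/
structure Matches (v : Fin n → ℂ) (v' : Fin n' → ℂ) (s : ℂ) (φ : ℂ → ℂ) (S : Set ℂ) : Prop where
  inj : Function.Injective v
  inj' : Function.Injective v'
  re : 0 < s.re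
  im : 0 < s.im
  aff : ∀ z w, φ z - φ w = diag s (z - w)
  sing : ∀ z ∈ S, z ∈ Set.range v ↔ φ z ∈ Set.range v'

namespace Matches

theorem phi_inj (h : Matches v v' s φ S) : Function.Injective φ := by
  intro z w hzw
  by_contra hne
  exact diag_ne_zero h.re h.im (sub_ne_zero.2 hne) (by rw [← h.aff, hzw, sub_self])

theorem phi_cont (h : Matches v v' s φ S) : Continuous φ := by
  have : φ = fun z => φ 0 + diag s z := by
    funext z; have := h.aff z 0; rw [sub_zero] at this; rw [← this]; ring
  rw [this]
  exact continuous_const.add (continuous_diag s)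

theorem lift_dir (h : Matches v v' s φ S) {x : ℂ × (Fin n → ℂ)} {k : Fin n} {k' : Fin n'}
    (hk : v k ∈ S) (hkk : φ (v k) = v' k') :
    (lift v v' s φ S x).2 k' = nrm (diag s (x.2 k)) := by
  have hex : ∃ k, v k ∈ S ∧ φ (v k) = v' k' := ⟨k, hk, hkk⟩
  simp only [lift, dif_pos hex]
  rw [show hex.choose = k from h.inj (h.phi_inj (hex.choose_spec.2.trans hkk.symm))]

theorem lift_mem (h : Matches v v' s φ S) {S₀ T₀ : Set ℂ} (hS : S₀ ⊆ S)
    (hT : ∀ z ∈ S₀, φ z ∈ T₀) {x : ℂ × (Fin n → ℂ)} (hx : x ∈ blowUp v S₀) :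
    lift v v' s φ S x ∈ blowUp v' T₀ := by
  refine ⟨hT _ hx.1, fun k' => ?_⟩
  by_cases hex : ∃ k, v k ∈ S ∧ φ (v k) = v' k'
  · obtain ⟨k, hk, hkk⟩ := hex
    rw [h.lift_dir hk hkk]
    obtain ⟨h1, h2, r, hr, h3⟩ := hx.2 k
    have hu : x.2 k ≠ 0 := by intro h0; simp [h0] at h1
    have hA := diag_ne_zero h.re h.im hu
    have key : ∀ ρ : ℝ, φ (v k + ρ * x.2 k) = v' k' + ρ * diag s (x.2 k) := by
      intro ρ
      have := h.aff (v k + ρ * x.2 k) (v k)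
      rw [add_sub_cancel_left, diag_real_mul, sub_eq_iff_eq_add', hkk] at this
      exact this
    refine ⟨norm_nrm hA, ?_, r * ‖diag s (x.2 k)‖, by positivity, ?_⟩
    · have e : φ x.1 = v' k' + ‖x.1 - v k‖ * diag s (x.2 k) := by
        conv_lhs => rw [h2]
        exact key _
      show φ x.1 = v' k' + (‖φ x.1 - v' k'‖ : ℂ) * nrm (diag s (x.2 k))
      have e2 : ‖φ x.1 - v' k'‖ = ‖x.1 - v k‖ * ‖diag s (x.2 k)‖ := by
        rw [e, add_sub_cancel_left, norm_mul, Complex.norm_real, norm_norm]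
      rw [e2, e]
      push_cast
      rw [mul_assoc, norm_mul_nrm hA]
    · push_cast
      rw [mul_assoc, norm_mul_nrm hA, ← key]
      exact hT _ h3
  · have hne : φ x.1 - v' k' ≠ 0 := by
      intro h0
      obtain ⟨k, hk⟩ := (h.sing x.1 (hS hx.1)).2 ⟨k', (sub_eq_zero.1 h0).symm⟩
      exact hex ⟨k, hk ▸ hS hx.1, by rw [hk]; exact sub_eq_zero.1 h0⟩
    simp only [lift, dif_neg hex]
    refine ⟨norm_nrm hne, by rw [norm_mul_nrm hne]; ring, ‖φ x.1 - v' k'‖, norm_pos_iff.2 hne, ?_⟩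
    rw [norm_mul_nrm hne, add_sub_cancel]
    exact hT _ hx.1

theorem continuousOn_lift (h : Matches v v' s φ S) :
    ContinuousOn (lift v v' s φ S) (blowUp v S) := by
  have hφ := h.phi_cont
  have hnrm : ∀ f : ℂ × (Fin n → ℂ) → ℂ, ContinuousOn f (blowUp v S) →
      (∀ x ∈ blowUp v S, f x ≠ 0) → ContinuousOn (fun x => nrm (f x)) (blowUp v S) := by
    intro f hf h0
    refine hf.div (Complex.continuous_ofReal.comp_continuousOn hf.norm) ?_
    intro x hx
    simpa using h0 x hx
  refine (hφ.comp continuous_fst).continuousOn.prodMk (continuousOn_pi.2 fun k' => ?_)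
  by_cases hex : ∃ k, v k ∈ S ∧ φ (v k) = v' k'
  · simp only [dif_pos hex]
    refine hnrm _ ?_ ?_
    · exact ((continuous_diag s).comp ((continuous_apply _).comp continuous_snd)).continuousOn
    · intro x hx
      refine diag_ne_zero h.re h.im ?_
      intro h0
      simpa [h0] using (hx.2 hex.choose).1
  · simp only [dif_neg hex]
    refine hnrm _ ?_ ?_
    · exact ((hφ.comp continuous_fst).sub continuous_const).continuousOn
    · intro x hx h0
      obtain ⟨k, hk⟩ := (h.sing x.1 hx.1).2 ⟨k', (sub_eq_zero.1 h0).symm⟩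
      exact hex ⟨k, hk ▸ hx.1, by rw [hk]; exact sub_eq_zero.1 h0⟩

end Matches

end Lift

/-! ### Polyhedral sets -/

/-- A finite intersection of closed half-planes. -/
def IsPoly (S : Set ℂ) : Prop :=
  ∃ L : List (ℝ × ℝ × ℝ), S = {z | ∀ l ∈ L, 0 ≤ l.1 * z.re + l.2.1 * z.im + l.2.2}

namespace IsPoly

theorem inter (hS : IsPoly S) (hT : IsPoly T) : IsPoly (S ∩ T) := by
  obtain ⟨L, rfl⟩ := hS
  obtain ⟨L', rfl⟩ := hT
  refine ⟨L ++ L', ?_⟩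
  ext z
  simp only [Set.mem_inter_iff, Set.mem_ofPred_eq, List.mem_append]
  constructor
  · rintro ⟨h1, h2⟩ l (h | h)
    · exact h1 l h
    · exact h2 l h
  · exact fun h => ⟨fun l hl => h l (.inl hl), fun l hl => h l (.inr hl)⟩

theorem preimage (hS : IsPoly S) {s : ℂ} {φ : ℂ → ℂ} (hφ : ∀ z, φ z = diag s z + φ 0) :
    IsPoly (φ ⁻¹' S) := by
  obtain ⟨L, rfl⟩ := hS
  refine ⟨L.map fun l => (l.1 * s.re, l.2.1 * s.im, l.1 * (φ 0).re + l.2.1 * (φ 0).im + l.2.2), ?_⟩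
  ext z
  simp only [Set.mem_preimage, Set.mem_ofPred_eq, List.forall_mem_map]
  refine forall₂_congr fun l _ => ?_
  rw [hφ z]
  simp only [diag, Complex.add_re, Complex.add_im]
  rw [show l.1 * (s.re * z.re + (φ 0).re) + l.2.1 * (s.im * z.im + (φ 0).im) + l.2.2
    = l.1 * s.re * z.re + l.2.1 * s.im * z.im + (l.1 * (φ 0).re + l.2.1 * (φ 0).im + l.2.2) by ring]

theorem isClosed (hS : IsPoly S) : IsClosed S := by
  obtain ⟨L, rfl⟩ := hS
  have : {z : ℂ | ∀ l ∈ L, 0 ≤ l.1 * z.re + l.2.1 * z.im + l.2.2}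
      = ⋂ l ∈ L, {z : ℂ | 0 ≤ l.1 * z.re + l.2.1 * z.im + l.2.2} := by ext; simp
  rw [this]
  refine isClosed_biInter fun l _ => isClosed_le continuous_const ?_
  fun_prop

theorem convex (hS : IsPoly S) : Convex ℝ S := by
  obtain ⟨L, rfl⟩ := hS
  intro x hx y hy a b ha hb hab l hl
  have h1 := mul_nonneg ha (hx l hl)
  have h2 := mul_nonneg hb (hy l hl)
  simp only [Complex.add_re, Complex.add_im, Complex.real_smul, Complex.mul_re, Complex.mul_im,
    Complex.ofReal_re, Complex.ofReal_im]
  have : l.2.2 = a * l.2.2 + b * l.2.2 := by rw [← add_mul, hab, one_mul]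
  rw [this]
  nlinarith

/-- The directions into a polyhedral set at one of its points form a closed set. -/
theorem isClosed_dirs (hS : IsPoly S) {z : ℂ} (hz : z ∈ S) :
    IsClosed {u : ℂ | ∃ r : ℝ, 0 < r ∧ z + (r : ℂ) * u ∈ S} := by
  obtain ⟨L, rfl⟩ := hS
  have : {u : ℂ | ∃ r : ℝ, 0 < r ∧
        z + (r : ℂ) * u ∈ {z : ℂ | ∀ l ∈ L, 0 ≤ l.1 * z.re + l.2.1 * z.im + l.2.2}}
      = ⋂ l ∈ L, {u : ℂ | l.1 * z.re + l.2.1 * z.im + l.2.2 = 0 → 0 ≤ l.1 * u.re + l.2.1 * u.im} := by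
    ext u
    simp only [Set.mem_ofPred_eq, Set.mem_iInter]
    constructor
    · rintro ⟨r, hr, h⟩ l hl h0
      have := h l hl
      simp only [Complex.add_re, Complex.mul_re, Complex.ofReal_re, Complex.ofReal_im,
        Complex.add_im, Complex.mul_im] at this
      have h3 : 0 ≤ r * (l.1 * u.re + l.2.1 * u.im) := by nlinarith
      exact nonneg_of_mul_nonneg_right h3 hr
    · intro h
      have hev : ∀ᶠ r : ℝ in 𝓝[>] 0, ∀ l ∈ L,
          0 ≤ l.1 * (z + (r : ℂ) * u).re + l.2.1 * (z + (r : ℂ) * u).im + l.2.2 := by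
        rw [show (∀ᶠ r : ℝ in 𝓝[>] 0, ∀ l ∈ L,
          0 ≤ l.1 * (z + (r : ℂ) * u).re + l.2.1 * (z + (r : ℂ) * u).im + l.2.2) ↔
          (∀ᶠ r : ℝ in 𝓝[>] 0, ∀ l ∈ {l | l ∈ L},
          0 ≤ l.1 * (z + (r : ℂ) * u).re + l.2.1 * (z + (r : ℂ) * u).im + l.2.2) from Iff.rfl,
          eventually_all_finite (List.finite_toSet L)]
        intro l hl
        by_cases h0 : l.1 * z.re + l.2.1 * z.im + l.2.2 = 0
        · filter_upwards [self_mem_nhdsWithin] with r hr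
          have h3 := mul_nonneg (le_of_lt (Set.mem_Ioi.1 hr)) (h l hl h0)
          simp only [Complex.add_re, Complex.mul_re, Complex.ofReal_re, Complex.ofReal_im,
            Complex.add_im, Complex.mul_im]
          nlinarith
        · have hpos : 0 < l.1 * z.re + l.2.1 * z.im + l.2.2 :=
            lt_of_le_of_ne (hz l hl) (Ne.symm h0)
          have hc : Continuous fun r : ℝ =>
              l.1 * (z + (r : ℂ) * u).re + l.2.1 * (z + (r : ℂ) * u).im + l.2.2 := by fun_prop
          have := hc.tendsto 0
          simp only [Complex.ofReal_zero, zero_mul, add_zero] at this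
          filter_upwards [(this.mono_left nhdsWithin_le_nhds).eventually (lt_mem_nhds hpos)] with
            r hr using hr.le
      obtain ⟨r, h1, h2⟩ := (hev.and self_mem_nhdsWithin).exists
      exact ⟨r, h2, h1⟩
  rw [this]
  refine isClosed_biInter fun l _ => ?_
  by_cases h0 : l.1 * z.re + l.2.1 * z.im + l.2.2 = 0
  · simp only [h0, forall_const]
    exact isClosed_le continuous_const (by fun_prop)
  · simp [h0]

theorem isClosed_blowUp (hS : IsPoly S) : IsClosed (blowUp v S) := by
  have : blowUp v S = {w | w.1 ∈ S} ∩ ⋂ k, ({w | ‖w.2 k‖ = 1} ∩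
      {w | w.1 = v k + (‖w.1 - v k‖ : ℂ) * w.2 k} ∩
      {w | v k ∈ S → ∃ r : ℝ, 0 < r ∧ v k + (r : ℂ) * w.2 k ∈ S}) := by
    ext w
    simp only [blowUp, Set.mem_ofPred_eq, Set.mem_inter_iff, Set.mem_iInter]
    refine and_congr_right fun hw => forall_congr' fun k => ?_
    constructor
    · rintro ⟨h1, h2, h3⟩
      exact ⟨⟨h1, h2⟩, fun _ => h3⟩
    · rintro ⟨⟨h1, h2⟩, h3⟩
      refine ⟨h1, h2, ?_⟩
      by_cases hk : v k ∈ S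
      · exact h3 hk
      · refine ⟨‖w.1 - v k‖, norm_pos_iff.2 (sub_ne_zero.2 ?_), h2 ▸ hw⟩
        rintro h; exact hk (h ▸ hw)
  rw [this]
  refine (hS.isClosed.preimage continuous_fst).inter (isClosed_iInter fun k => ?_)
  refine ((isClosed_eq (by fun_prop) (by fun_prop)).inter
    (isClosed_eq (by fun_prop) (by fun_prop))).inter ?_
  by_cases hk : v k ∈ S
  · simp only [hk, forall_const]
    exact (hS.isClosed_dirs hk).preimage (f := fun w : ℂ × (Fin n → ℂ) => w.2 k) (by fun_prop)
  · simp [hk]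

end IsPoly

end AY

namespace AY

/-! ### Surfaces glued from blown-up polygons, and scissor congruences between them -/

/-- Six polygons in the plane glued by translations of segments, with points to be blown up. -/
structure Pres (n : ℕ) where
  v : Fin n → ℂ
  cell : Fin 6 → Set ℂ
  gl : List Gluing

namespace Pres

variable {n n' : ℕ}

/-- The gluing relation. -/
def Glued (P : Pres n) (x y : Σ i : Fin 6, blowUp P.v (P.cell i)) : Prop :=
  ∃ g ∈ P.gl, x.1 = g.src ∧ y.1 = g.tgt ∧
    (x.2 : ℂ × (Fin n → ℂ)) ∈ blowUp P.v (segment ℝ g.p g.q) ∧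
    (y.2 : ℂ × (Fin n → ℂ)) ∈ blowUp P.v (segment ℝ (g.p + g.t) (g.q + g.t)) ∧
    (y.2 : ℂ × (Fin n → ℂ)).1 = (x.2 : ℂ × (Fin n → ℂ)).1 + g.t

/-- The glued surface. -/
def Space (P : Pres n) : Type := Quot P.Glued

instance (P : Pres n) : TopologicalSpace P.Space :=
  inferInstanceAs (TopologicalSpace (Quot P.Glued))

/-- The class of a point of a polygon. -/
def pt (P : Pres n) (i : Fin 6) (x : ℂ × (Fin n → ℂ)) (hx : x ∈ blowUp P.v (P.cell i)) : P.Space :=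
  Quot.mk _ ⟨i, x, hx⟩

/-- Conditions under which the gluings behave well. -/
structure Good (P : Pres n) : Prop where
  inj : Function.Injective P.v
  poly : ∀ i, IsPoly (P.cell i)
  ne : ∀ g ∈ P.gl, g.p ≠ g.q
  ends : ∀ g ∈ P.gl, ∀ z ∈ segment ℝ g.p g.q, z ∈ Set.range P.v → z = g.p ∨ z = g.q
  sing : ∀ g ∈ P.gl, ∀ z ∈ segment ℝ g.p g.q, z ∈ Set.range P.v ↔ z + g.t ∈ Set.range P.v

end Pres

/-- At an end of a segment there is only one direction into it. -/
theorem blowUp.dir_segment {n : ℕ} {v : Fin n → ℂ} {p q : ℂ}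
    {x : ℂ × (Fin n → ℂ)} (hx : x ∈ blowUp v (segment ℝ p q)) {k : Fin n} (hk : v k = p) :
    x.2 k = nrm (q - p) := by
  obtain ⟨h1, h2, r, hr, h3⟩ := hx.2 k
  rw [hk, segment_eq_image'] at h3
  obtain ⟨θ, ⟨hθ, -⟩, h4⟩ := h3
  simp only [Complex.real_smul] at h4
  have h5 : (r : ℂ) * x.2 k = θ * (q - p) := by linear_combination -h4
  have hu : x.2 k ≠ 0 := by intro h0; simp [h0] at h1
  have hθ' : 0 < θ := by
    refine lt_of_le_of_ne hθ fun h0 => ?_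
    rw [← h0] at h5
    simp [hu, hr.ne'] at h5
  rw [← nrm_real_mul hθ', ← h5, nrm_real_mul hr, nrm_of_norm_one h1]

/-- A piece of a scissor congruence: part of the polygon `i` is sent to the polygon `j` by an affine
map with fixed diagonal linear part and translation part `w`. -/
structure Part where
  i : Fin 6
  j : Fin 6
  w : ℂ

/-- The affine map of a part. -/
def Part.map (p : Part) (s z : ℂ) : ℂ := diag s z + p.w

/-- The inverse part. -/
def Part.inv (p : Part) (s : ℂ) : Part := ⟨p.j, p.i, -diag ⟨s.re⁻¹, s.im⁻¹⟩ p.w⟩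

theorem Part.map_sub (p : Part) (s z w : ℂ) : p.map s z - p.map s w = diag s (z - w) := by
  simp [Part.map, diag_sub]

theorem Part.continuous_map (p : Part) (s : ℂ) : Continuous (p.map s) :=
  (continuous_diag s).add continuous_const

theorem Part.inv_map (p : Part) {s : ℂ} (h1 : 0 < s.re) (h2 : 0 < s.im) (z : ℂ) :
    (p.inv s).map ⟨s.re⁻¹, s.im⁻¹⟩ (p.map s z) = z := by
  simp only [Part.map, Part.inv, diag_add, diag_inv_diag h1 h2]; ring

theorem Part.inv_inv (p : Part) {s : ℂ} (h1 : 0 < s.re) (h2 : 0 < s.im) :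
    (p.inv s).inv ⟨s.re⁻¹, s.im⁻¹⟩ = p := by
  obtain ⟨i, j, w⟩ := p
  simp only [Part.inv, Part.mk.injEq, true_and]
  apply Complex.ext <;> simp [diag] <;> field_simp

namespace Pres

variable {n n' : ℕ} (P : Pres n) (P' : Pres n') (s : ℂ)

/-- The domain of a part. -/
def dom (p : Part) : Set ℂ := P.cell p.i ∩ p.map s ⁻¹' P'.cell p.j

/-- Two points in polygons are equal or are related by a gluing. -/
def Rel (j : Fin 6) (z : ℂ) (j' : Fin 6) (z' : ℂ) : Option (Gluing × Bool) → Prop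
  | none => j = j' ∧ z = z'
  | some (g, true) => j = g.src ∧ j' = g.tgt ∧ z ∈ segment ℝ g.p g.q ∧ z' = z + g.t
  | some (g, false) => j' = g.src ∧ j = g.tgt ∧ z' ∈ segment ℝ g.p g.q ∧ z = z' + g.t

/-- The finitely many ways in which points can be related. -/
abbrev Way : Type := Option ({g // g ∈ P.gl} × Bool)

/-- The underlying gluing of a way. -/
def Way.val {P : Pres n} (κ : P.Way) : Option (Gluing × Bool) := κ.map fun a => (a.1.1, a.2)

/-- The conditions for a list of parts to define a map of glued surfaces. -/
structure Compat (L : List Part) : Prop where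
  good : P.Good
  good' : P'.Good
  re : 0 < s.re
  im : 0 < s.im
  sing : ∀ p ∈ L, ∀ z ∈ P.dom P' s p, z ∈ Set.range P.v ↔ p.map s z ∈ Set.range P'.v
  cover : ∀ i, ∀ z ∈ P.cell i, z ∉ Set.range P.v → ∃ p ∈ L, p.i = i ∧ p.map s z ∈ P'.cell p.j
  overlap : ∀ p ∈ L, ∀ p' ∈ L, p.i = p'.i → ∀ z ∈ P.dom P' s p ∩ P.dom P' s p',
    z ∉ Set.range P.v → ∃ κ : P'.Way, Rel p.j (p.map s z) p'.j (p'.map s z) κ.val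
  glue : ∀ g ∈ P.gl, ∀ z ∈ segment ℝ g.p g.q, z ∈ P.cell g.src → z + g.t ∈ P.cell g.tgt →
    z ∉ Set.range P.v → ∃ p ∈ L, ∃ p' ∈ L, p.i = g.src ∧ p'.i = g.tgt ∧ p.map s z ∈ P'.cell p.j ∧
      p'.map s (z + g.t) ∈ P'.cell p'.j ∧
      ∃ κ : P'.Way, Rel p.j (p.map s z) p'.j (p'.map s (z + g.t)) κ.val

instance : Finite P.Way := by
  have : Finite {g // g ∈ P.gl} := List.finite_toSet P.gl
  infer_instance

theorem isPoly_segment_isClosed (p q : ℂ) : IsClosed (segment ℝ p q) := by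
  rw [segment_eq_image']
  exact (isCompact_Icc.image (by fun_prop)).isClosed

theorem isClosed_rel {f f' : ℂ → ℂ} (hf : Continuous f) (hf' : Continuous f') (j j' : Fin 6)
    (κ : Option (Gluing × Bool)) : IsClosed {z | Rel j (f z) j' (f' z) κ} := by
  match κ with
  | none => exact isClosed_const.inter (isClosed_eq hf hf')
  | some (g, true) =>
    exact isClosed_const.inter (isClosed_const.inter
      (((isPoly_segment_isClosed _ _).preimage hf).inter
        (isClosed_eq hf' (hf.add continuous_const))))
  | some (g, false) =>
    exact isClosed_const.inter (isClosed_const.inter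
      (((isPoly_segment_isClosed _ _).preimage hf').inter
        (isClosed_eq hf (hf'.add continuous_const))))

/-- Two points of blow-ups over `z` and `z + t` with the same directions. -/
structure Shift (t : ℂ) (x y : ℂ × (Fin n → ℂ)) : Prop where
  base : y.1 = x.1 + t
  sing : x.1 ∈ Set.range P.v ↔ y.1 ∈ Set.range P.v
  dir : ∀ k l, x.1 = P.v k → y.1 = P.v l → y.2 l = x.2 k

variable {P P' s}

theorem Shift.refl (hP : P.Good) (x : ℂ × (Fin n → ℂ)) : P.Shift 0 x x :=
  ⟨by simp, Iff.rfl, fun k l h1 h2 => by rw [hP.inj (h1.symm.trans h2)]⟩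

theorem Shift.mem {t : ℂ} {x y : ℂ × (Fin n → ℂ)} (h : P.Shift t x y) {S T : Set ℂ}
    (hy : y ∈ blowUp P.v S) (hx : x ∈ blowUp P.v {z | z + t ∈ T}) : y ∈ blowUp P.v T := by
  refine blowUp.restrict hy (h.base ▸ hx.1) fun l hl => ?_
  obtain ⟨k, hk⟩ := h.sing.2 ⟨l, hl.symm⟩
  rw [h.dir k l hk.symm hl]
  obtain ⟨-, -, r, hr, h3⟩ := hx.2 k
  refine ⟨r, hr, ?_⟩
  have : P.v l = P.v k + t := by rw [← hl, hk, h.base]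
  have e : P.v l + (r : ℂ) * x.2 k = P.v k + r * x.2 k + t := by rw [this]; ring
  rw [e]
  exact h3

theorem Shift.of_glued (hP : P.Good) {g : Gluing} (hg : g ∈ P.gl) {x y : ℂ × (Fin n → ℂ)}
    (hx : x ∈ blowUp P.v (segment ℝ g.p g.q))
    (hy : y ∈ blowUp P.v (segment ℝ (g.p + g.t) (g.q + g.t))) (h : y.1 = x.1 + g.t) :
    P.Shift g.t x y := by
  refine ⟨h, h ▸ hP.sing g hg _ hx.1, fun k l hk hl => ?_⟩
  rcases hP.ends g hg _ hx.1 ⟨k, hk.symm⟩ with h1 | h1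
  · rw [blowUp.dir_segment hx (hk.symm.trans h1),
      blowUp.dir_segment hy (k := l) (by rw [← hl, h, h1])]
    simp
  · rw [segment_symm] at hx hy
    rw [blowUp.dir_segment hx (hk.symm.trans h1),
      blowUp.dir_segment hy (k := l) (by rw [← hl, h, h1])]
    simp

theorem pt_eq {i i' : Fin 6} {x x' : ℂ × (Fin n → ℂ)} (hi : i = i') (hx : x = x')
    (h : x ∈ blowUp P.v (P.cell i)) (h' : x' ∈ blowUp P.v (P.cell i')) :
    P.pt i x h = P.pt i' x' h' := by
  subst hi; subst hx; rfl

/-- The map of blow-ups given by a part. -/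
def liftPart (P : Pres n) (P' : Pres n') (s : ℂ) (p : Part) (x : ℂ × (Fin n → ℂ)) :
    ℂ × (Fin n' → ℂ) :=
  lift P.v P'.v s (p.map s) (P.dom P' s p) x

namespace Compat

variable {L : List Part} (H : Compat P P' s L)

include H

theorem matches_part {p : Part} (hp : p ∈ L) : Matches P.v P'.v s (p.map s) (P.dom P' s p) :=
  ⟨H.good.inj, H.good'.inj, H.re, H.im, p.map_sub s, H.sing p hp⟩

theorem isPoly_dom (p : Part) : IsPoly (P.dom P' s p) :=
  (H.good.poly _).inter ((H.good'.poly _).preimage (s := s) fun z => by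
    apply Complex.ext <;> simp [Part.map, diag])

theorem liftPart_mem {p : Part} (hp : p ∈ L) {S₀ T₀ : Set ℂ} (hS : S₀ ⊆ P.dom P' s p)
    (hT : ∀ z ∈ S₀, p.map s z ∈ T₀) {x : ℂ × (Fin n → ℂ)} (hx : x ∈ blowUp P.v S₀) :
    liftPart P P' s p x ∈ blowUp P'.v T₀ :=
  (H.matches_part hp).lift_mem hS hT hx

theorem liftPart_mem_cell {p : Part} (hp : p ∈ L) {x : ℂ × (Fin n → ℂ)}
    (hx : x ∈ blowUp P.v (P.dom P' s p)) : liftPart P P' s p x ∈ blowUp P'.v (P'.cell p.j) :=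
  H.liftPart_mem hp subset_rfl (fun _ hz => hz.2) hx

theorem pt_eq_of_rel {p p' : Part} (hp : p ∈ L) (hp' : p' ∈ L) {t : ℂ} {x y : ℂ × (Fin n → ℂ)}
    (hxy : P.Shift t x y) (κ : P'.Way)
    (hx : x ∈ blowUp P.v (P.dom P' s p)) (hy : y ∈ blowUp P.v (P.dom P' s p'))
    (hκ : x ∈ blowUp P.v {z | z ∈ P.dom P' s p ∧ z + t ∈ P.dom P' s p' ∧
      Rel p.j (p.map s z) p'.j (p'.map s (z + t)) κ.val}) :
    P'.pt p.j (liftPart P P' s p x) (H.liftPart_mem_cell hp hx) =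
      P'.pt p'.j (liftPart P P' s p' y) (H.liftPart_mem_cell hp' hy) := by
  have hyT : ∀ T : Set ℂ, (∀ z, z ∈ P.dom P' s p → z + t ∈ P.dom P' s p' →
      Rel p.j (p.map s z) p'.j (p'.map s (z + t)) κ.val → p'.map s (z + t) ∈ T) →
      liftPart P P' s p' y ∈ blowUp P'.v T := by
    intro T hT
    have : y ∈ blowUp P.v (P.dom P' s p' ∩ {z | p'.map s z ∈ T}) :=
      hxy.mem (T := P.dom P' s p' ∩ {z | p'.map s z ∈ T}) hy
        (blowUp.mono (T := {z | z + t ∈ P.dom P' s p' ∩ {z | p'.map s z ∈ T}})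
          (fun z hz => ⟨hz.2.1, hT z hz.1 hz.2.1 hz.2.2⟩) hκ)
    exact H.liftPart_mem hp' Set.inter_subset_left (fun z hz => hz.2) this
  have hxT : ∀ T : Set ℂ, (∀ z, z ∈ P.dom P' s p → z + t ∈ P.dom P' s p' →
      Rel p.j (p.map s z) p'.j (p'.map s (z + t)) κ.val → p.map s z ∈ T) →
      liftPart P P' s p x ∈ blowUp P'.v T :=
    fun T hT => H.liftPart_mem hp (fun z hz => hz.1) (fun z hz => hT z hz.1 hz.2.1 hz.2.2) hκ
  have hseg : ∀ {p q t z : ℂ}, z ∈ segment ℝ p q → z + t ∈ segment ℝ (p + t) (q + t) := by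
    intro p q t z hz
    simp only [add_comm _ t]
    exact (mem_segment_translate ℝ t).2 hz
  match κ with
  | none =>
    obtain ⟨-, -, hj, h1⟩ := hκ.1
    refine pt_eq hj (blowUp.ext (H.liftPart_mem_cell hp hx) (H.liftPart_mem_cell hp' hy) ?_ ?_) _ _
    · show p.map s x.1 = p'.map s y.1
      rw [h1, hxy.base]
    · intro k' hk'
      obtain ⟨k, hk⟩ := (H.sing p hp _ hx.1).2 ⟨k', hk'.symm⟩
      obtain ⟨l, hl⟩ := hxy.sing.1 ⟨k, hk⟩
      change p.map s x.1 = _ at hk'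
      have e1 := (H.matches_part hp).lift_dir (x := x) (k := k) (k' := k') (hk ▸ hx.1)
        (by rw [hk]; exact hk')
      have e2 := (H.matches_part hp').lift_dir (x := y) (k := l) (k' := k') (hl ▸ hy.1)
        (by rw [hl, ← hk', h1, hxy.base])
      rw [hxy.dir k l hk.symm hl.symm] at e2
      exact e1.trans e2.symm
  | some (⟨g, hg⟩, true) =>
    obtain ⟨-, -, hj, hj', h1, h2⟩ := hκ.1
    refine Quot.sound ⟨g, hg, hj, hj', hxT _ fun z _ _ hz => hz.2.2.1, hyT _ fun z _ _ hz => ?_, ?_⟩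
    · rw [hz.2.2.2]; exact hseg hz.2.2.1
    · show p'.map s y.1 = p.map s x.1 + g.t
      rw [hxy.base]; exact h2
  | some (⟨g, hg⟩, false) =>
    obtain ⟨-, -, hj, hj', h1, h2⟩ := hκ.1
    refine (Quot.sound ⟨g, hg, hj, hj', hyT _ fun z _ _ hz => hz.2.2.1,
      hxT _ fun z _ _ hz => ?_, ?_⟩).symm
    · rw [hz.2.2.2]; exact hseg hz.2.2.1
    · show p.map s x.1 = p'.map s y.1 + g.t
      rw [hxy.base]; exact h2

theorem isClosed_rel_set (p p' : Part) (t : ℂ) (κ : P'.Way) :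
    IsClosed {z | z ∈ P.dom P' s p ∧ z + t ∈ P.dom P' s p' ∧
      Rel p.j (p.map s z) p'.j (p'.map s (z + t)) κ.val} :=
  (H.isPoly_dom p).isClosed.inter
    (((H.isPoly_dom p').isClosed.preimage (continuous_id.add continuous_const)).inter
      (isClosed_rel (p.continuous_map s)
        ((p'.continuous_map s).comp (continuous_id.add continuous_const)) _ _ _))

theorem exists_part {i : Fin 6} {x : ℂ × (Fin n → ℂ)} (hx : x ∈ blowUp P.v (P.cell i)) :
    ∃ p, p ∈ L ∧ p.i = i ∧ x ∈ blowUp P.v (P.dom P' s p) := by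
  have : Finite {p // p ∈ L} := List.finite_toSet L
  obtain ⟨a, ha⟩ := blowUp.cover (ι := {p // p ∈ L}) H.good.inj (H.good.poly i).convex
    (C := fun p => {z | p.1.i = i ∧ z ∈ P.dom P' s p.1})
    (fun p => isClosed_const.inter (H.isPoly_dom p.1).isClosed)
    (fun z hz hv => by
      obtain ⟨p, hp, hpi, h⟩ := H.cover i z hz hv
      exact ⟨⟨p, hp⟩, hpi, ⟨hpi ▸ hz, h⟩⟩) hx
  exact ⟨a.1, a.2, ha.1.1, blowUp.mono (fun z hz => hz.2) ha⟩

theorem pt_eq_pt {p p' : Part} (hp : p ∈ L) (hp' : p' ∈ L) (hi : p.i = p'.i)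
    {x : ℂ × (Fin n → ℂ)} (hx : x ∈ blowUp P.v (P.dom P' s p))
    (hx' : x ∈ blowUp P.v (P.dom P' s p')) :
    P'.pt p.j (liftPart P P' s p x) (H.liftPart_mem_cell hp hx) =
      P'.pt p'.j (liftPart P P' s p' x) (H.liftPart_mem_cell hp' hx') := by
  obtain ⟨κ, hκ⟩ := blowUp.cover (ι := P'.Way) H.good.inj
    ((H.isPoly_dom p).convex.inter (H.isPoly_dom p').convex)
    (H.isClosed_rel_set p p' 0)
    (fun z hz hv => by
      obtain ⟨κ, h⟩ := H.overlap p hp p' hp' hi z hz hv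
      exact ⟨κ, hz.1, by simpa using hz.2, by simpa using h⟩)
    (blowUp.inter (H.isPoly_dom p).convex (H.isPoly_dom p').convex hx hx')
  exact H.pt_eq_of_rel hp hp' (Shift.refl H.good x) κ hx hx' hκ

/-- The map on the disjoint union of the polygons. -/
def fwdAux (x : Σ i : Fin 6, blowUp P.v (P.cell i)) : P'.Space :=
  have h := H.exists_part x.2.2
  P'.pt h.choose.j (liftPart P P' s h.choose x.2.1)
    (H.liftPart_mem_cell h.choose_spec.1 h.choose_spec.2.2)

theorem fwdAux_eq {i : Fin 6} {p : Part} (hp : p ∈ L) (hi : p.i = i) {x : ℂ × (Fin n → ℂ)}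
    (hx : x ∈ blowUp P.v (P.dom P' s p)) (hx' : x ∈ blowUp P.v (P.cell i)) :
    H.fwdAux ⟨i, x, hx'⟩ = P'.pt p.j (liftPart P P' s p x) (H.liftPart_mem_cell hp hx) := by
  have h := H.exists_part hx'
  exact H.pt_eq_pt h.choose_spec.1 hp (h.choose_spec.2.1.trans hi.symm) h.choose_spec.2.2 hx

theorem continuous_fwdAux : Continuous H.fwdAux := by
  refine continuous_sigma fun i => ?_
  have : Finite {p // p ∈ L} := List.finite_toSet L
  let A : {p // p ∈ L ∧ p.i = i} → Set (blowUp P.v (P.cell i)) :=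
    fun p => {x | x.1 ∈ blowUp P.v (P.dom P' s p.1)}
  have : Finite {p // p ∈ L ∧ p.i = i} :=
    Set.Finite.subset (List.finite_toSet L) (fun p hp => hp.1)
  refine LocallyFinite.continuous (f := A) (locallyFinite_of_finite _) ?_ ?_ ?_
  · refine Set.eq_univ_of_forall fun x => ?_
    obtain ⟨p, hp, hi, hx⟩ := H.exists_part x.2
    exact Set.mem_iUnion.2 ⟨⟨p, hp, hi⟩, hx⟩
  · exact fun p => (H.isPoly_dom p.1).isClosed_blowUp.preimage continuous_subtype_val
  · intro p
    rw [continuousOn_iff_continuous_domRestrict]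
    have h1 : Continuous fun x : A p => liftPart P P' s p.1 x.1.1 :=
      (H.matches_part p.2.1).continuousOn_lift.comp_continuous
        (continuous_subtype_val.comp continuous_subtype_val) fun x => x.2
    have h2 : Continuous fun x : A p => (⟨liftPart P P' s p.1 x.1.1,
        H.liftPart_mem_cell p.2.1 x.2⟩ : blowUp P'.v (P'.cell p.1.j)) := h1.subtype_mk _
    have h4 : Continuous (@Sigma.mk (Fin 6) (fun j => blowUp P'.v (P'.cell j)) p.1.j) :=
      @continuous_sigmaMk (Fin 6) (fun j => blowUp P'.v (P'.cell j)) _ p.1.j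
    have h3 : Continuous fun y : blowUp P'.v (P'.cell p.1.j) => P'.pt p.1.j y.1 y.2 :=
      continuous_quot_mk.comp h4
    refine (h3.comp h2).congr fun x => ?_
    exact (H.fwdAux_eq p.2.1 p.2.2 x.2 x.1.2).symm

/-- The map of glued surfaces. -/
def fwd : P.Space → P'.Space :=
  Quot.lift H.fwdAux (by
    rintro ⟨i, x, hx⟩ ⟨i', y, hy⟩ ⟨g, hg, rfl, rfl, hxs, hys, hb⟩
    dsimp only at hxs hys hb
    have hS := Shift.of_glued H.good hg hxs hys hb
    have hxy : x ∈ blowUp P.v ({z | z ∈ segment ℝ g.p g.q ∧ z ∈ P.cell g.src ∧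
        z + g.t ∈ P.cell g.tgt}) := by
      have hS' : P.Shift (-g.t) y x := ⟨by rw [hb]; ring, hS.sing.symm, fun k l h1 h2 =>
        (hS.dir l k h2 h1).symm⟩
      have h1 : x ∈ blowUp P.v {z | z + g.t ∈ P.cell g.tgt} :=
        hS'.mem hx (blowUp.mono (fun z hz => by simpa using hz) hy)
      have hc : Convex ℝ {z | z + g.t ∈ P.cell g.tgt} := by
        have := (H.good.poly g.tgt).convex.translate_preimage_left g.t
        exact this
      exact (blowUp.inter
        (convex_segment _ _) ((H.good.poly g.src).convex.inter hc) hxs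
        (blowUp.inter (H.good.poly g.src).convex hc hx h1))
    have : Finite {p // p ∈ L} := List.finite_toSet L
    obtain ⟨⟨p, p', κ⟩, hκ⟩ := blowUp.cover
      (ι := {p // p ∈ L} × {p // p ∈ L} × P'.Way) H.good.inj
      (S := {z | z ∈ segment ℝ g.p g.q ∧ z ∈ P.cell g.src ∧ z + g.t ∈ P.cell g.tgt})
      ((convex_segment _ _).inter ((H.good.poly g.src).convex.inter
        ((H.good.poly g.tgt).convex.translate_preimage_left g.t)))
      (C := fun a => {z | (a.1.1.i = g.src ∧ a.2.1.1.i = g.tgt) ∧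
        (z ∈ P.dom P' s a.1.1 ∧ z + g.t ∈ P.dom P' s a.2.1.1 ∧
      Rel a.1.1.j (a.1.1.map s z) a.2.1.1.j (a.2.1.1.map s (z + g.t)) a.2.2.val)})
      (fun a => isClosed_const.inter (H.isClosed_rel_set a.1.1 a.2.1.1 g.t a.2.2))
      (fun z hz hv => by
        obtain ⟨p, hp, p', hp', hi, hi', h1, h2, κ, h3⟩ := H.glue g hg z hz.1 hz.2.1 hz.2.2 hv
        exact ⟨⟨⟨p, hp⟩, ⟨p', hp'⟩, κ⟩, ⟨hi, hi'⟩, ⟨hi ▸ hz.2.1, h1⟩, ⟨hi' ▸ hz.2.2, h2⟩, h3⟩)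
      hxy
    have hi := hκ.1.1.1
    have hi' := hκ.1.1.2
    have hκ' := blowUp.mono (fun z hz => hz.2) hκ
    have hxp : x ∈ blowUp P.v (P.dom P' s p.1) := blowUp.mono (fun z hz => hz.1) hκ'
    have hyp : y ∈ blowUp P.v (P.dom P' s p'.1) :=
      hS.mem hy (blowUp.mono (fun z hz => hz.2.1) hκ')
    rw [H.fwdAux_eq p.2 hi hxp hx, H.fwdAux_eq p'.2 hi' hyp hy]
    exact H.pt_eq_of_rel p.2 p'.2 hS κ hxp hyp hκ')

theorem continuous_fwd : Continuous H.fwd :=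
  continuous_quot_lift _ H.continuous_fwdAux

theorem fwd_pt {i : Fin 6} {p : Part} (hp : p ∈ L) (hi : p.i = i) {x : ℂ × (Fin n → ℂ)}
    (hx : x ∈ blowUp P.v (P.dom P' s p)) (hx' : x ∈ blowUp P.v (P.cell i)) :
    H.fwd (P.pt i x hx') = P'.pt p.j (liftPart P P' s p x) (H.liftPart_mem_cell hp hx) :=
  H.fwdAux_eq hp hi hx hx'

theorem fwd_fwd (H' : Compat P' P ⟨s.re⁻¹, s.im⁻¹⟩ (L.map fun p => p.inv s)) (x : P.Space) :
    H'.fwd (H.fwd x) = x := by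
  induction x using Quot.ind with | mk x => ?_
  obtain ⟨i, x, hx⟩ := x
  obtain ⟨p, hp, rfl, hxp⟩ := H.exists_part hx
  have e1 := H.fwd_pt hp rfl hxp hx
  have hp' : p.inv s ∈ L.map fun p => p.inv s := List.mem_map_of_mem hp
  have hm : liftPart P P' s p x ∈ blowUp P'.v (P'.dom P ⟨s.re⁻¹, s.im⁻¹⟩ (p.inv s)) := by
    refine H.liftPart_mem hp subset_rfl (T₀ := P'.dom P ⟨s.re⁻¹, s.im⁻¹⟩ (p.inv s))
      (fun z hz => ⟨hz.2, ?_⟩) hxp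
    rw [Set.mem_preimage, Part.inv_map p H.re H.im]
    exact hz.1
  have e2 := H'.fwd_pt hp' (i := p.j) rfl hm (H.liftPart_mem_cell hp hxp)
  refine (congrArg H'.fwd e1).trans (e2.trans ?_)
  refine pt_eq rfl ?_ _ _
  have hb : (p.inv s).map ⟨s.re⁻¹, s.im⁻¹⟩ (p.map s x.1) = x.1 := Part.inv_map p H.re H.im _
  refine blowUp.ext (H'.liftPart_mem_cell hp' hm) hx hb fun k hk => ?_
  replace hk : x.1 = P.v k := hb.symm.trans hk
  obtain ⟨k', hk'⟩ := (H.sing p hp _ hxp.1).1 ⟨k, hk.symm⟩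
  have d1 := (H.matches_part hp).lift_dir (x := x) (k := k) (k' := k') (hk ▸ hxp.1)
    (by rw [← hk, hk'])
  have d2 := (H'.matches_part hp').lift_dir (x := liftPart P P' s p x) (k := k') (k' := k)
    (hk' ▸ hm.1) (by rw [hk', hb, hk])
  refine d2.trans ?_
  rw [show (liftPart P P' s p x).2 k' = nrm (diag s (x.2 k)) from d1]
  have h1 : ‖x.2 k‖ = 1 := (hx.2 k).1
  have h0 : x.2 k ≠ 0 := by intro h; simp [h] at h1
  have h2 := diag_ne_zero H.re H.im h0
  rw [show nrm (diag s (x.2 k))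
    = ((‖diag s (x.2 k)‖⁻¹ : ℝ) : ℂ) * diag s (x.2 k) by rw [nrm]; push_cast; field_simp,
    diag_real_mul, diag_inv_diag H.re H.im, nrm_real_mul (by positivity), nrm_of_norm_one h1]

/-- A scissor congruence defines a homeomorphism. -/
def homeo (H' : Compat P' P ⟨s.re⁻¹, s.im⁻¹⟩ (L.map fun p => p.inv s)) : P.Space ≃ₜ P'.Space where
  toFun := H.fwd
  invFun := H'.fwd
  left_inv := H.fwd_fwd H'
  right_inv := by
    have hs : s = ⟨(⟨s.re⁻¹, s.im⁻¹⟩ : ℂ).re⁻¹, (⟨s.re⁻¹, s.im⁻¹⟩ : ℂ).im⁻¹⟩ := by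
      apply Complex.ext <;> simp
    have hL : L = (L.map fun p => p.inv s).map fun p => p.inv ⟨s.re⁻¹, s.im⁻¹⟩ := by
      rw [List.map_map]
      conv_lhs => rw [← List.map_id L]
      refine List.map_congr_left fun p _ => ?_
      exact (p.inv_inv H.re H.im).symm
    have key : ∀ (s₁ : ℂ) (L₁ : List Part) (H₁ : Compat P P' s₁ L₁), s₁ = s → L₁ = L →
        H₁.fwd = H.fwd := by
      rintro s₁ L₁ H₁ rfl rfl; rfl
    intro x
    have := H'.fwd_fwd (hs ▸ hL ▸ H) x
    rwa [key _ _ _ hs.symm hL.symm] at this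
  continuous_toFun := H.continuous_fwd
  continuous_invFun := H'.continuous_fwd

end Compat

end Pres

end AY

namespace AY

/-! ### Exact arithmetic in `ℤ[α]` -/

/-- Elements `a + b α + c α²` of `ℤ[α]`. -/
structure Z3 where
  a : ℤ
  b : ℤ
  c : ℤ

namespace Z3

def add (x y : Z3) : Z3 := ⟨x.a + y.a, x.b + y.b, x.c + y.c⟩
def sub (x y : Z3) : Z3 := ⟨x.a - y.a, x.b - y.b, x.c - y.c⟩
def neg (x : Z3) : Z3 := ⟨-x.a, -x.b, -x.c⟩

/-- The product, reduced by `α³ = 1 - α - α²` and `α⁴ = 2 α - 1`. -/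
def mul (x y : Z3) : Z3 :=
  let u := x.b * y.c + x.c * y.b
  let w := x.c * y.c
  ⟨x.a * y.a + u - w, x.a * y.b + x.b * y.a - u + 2 * w, x.a * y.c + x.b * y.b + x.c * y.a - u⟩

/-- `10⁹` times a lower bound. -/
def low (x : Z3) : ℤ :=
  x.a * 1000000000 + (if 0 ≤ x.b then x.b * 543689012 else x.b * 543689013) +
    (if 0 ≤ x.c then x.c * 295597742 else x.c * 295597743)

def nonneg (x : Z3) : Bool := decide (0 ≤ x.low)
def pos (x : Z3) : Bool := decide (0 < x.low)
def eq (x y : Z3) : Bool := decide (x.a = y.a) && (decide (x.b = y.b) && decide (x.c = y.c))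

/-- The real value. -/
def ev (α : ℝ) (x : Z3) : ℝ := x.a + x.b * α + x.c * α ^ 2

end Z3

/-- `α` is the positive root of the cubic polynomial. -/
structure IsRoot3 (α : ℝ) : Prop where
  pos : 0 < α
  eq : α ^ 3 + α ^ 2 + α - 1 = 0

namespace IsRoot3

variable {α : ℝ} (A : IsRoot3 α)
include A

theorem cube : α ^ 3 = 1 - α - α ^ 2 := by linear_combination A.eq

theorem fourth : α ^ 4 = 2 * α - 1 := by linear_combination (α - 1) * A.eq

theorem inv : α⁻¹ = 1 + α + α ^ 2 := by
  refine inv_eq_of_mul_eq_one_right ?_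
  linear_combination A.eq

theorem lo : (0.543689012 : ℝ) < α := by
  by_contra h
  push Not at h
  have h0 := A.pos
  have := A.eq
  nlinarith [mul_nonneg h0.le h0.le, sq_nonneg α, pow_le_pow_left₀ h0.le h 3,
    pow_le_pow_left₀ h0.le h 2]

theorem hi : α < (0.543689013 : ℝ) := by
  by_contra h
  push Not at h
  have := A.eq
  nlinarith [pow_le_pow_left₀ (by norm_num : (0 : ℝ) ≤ 0.543689013) h 3,
    pow_le_pow_left₀ (by norm_num : (0 : ℝ) ≤ 0.543689013) h 2]

theorem lo2 : (0.295597742 : ℝ) < α ^ 2 := by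
  have := A.lo
  nlinarith [A.eq, A.pos]

theorem hi2 : α ^ 2 < (0.295597743 : ℝ) := by
  have := A.hi
  nlinarith [A.eq, A.pos]

end IsRoot3

namespace Z3

variable {α : ℝ}

theorem ev_add (x y : Z3) : (x.add y).ev α = x.ev α + y.ev α := by
  simp only [ev, add]; push_cast; ring

theorem ev_sub (x y : Z3) : (x.sub y).ev α = x.ev α - y.ev α := by
  simp only [ev, sub]; push_cast; ring

theorem ev_neg (x : Z3) : x.neg.ev α = -x.ev α := by
  simp only [ev, neg]; push_cast; ring

theorem ev_mul (A : IsRoot3 α) (x y : Z3) : (x.mul y).ev α = x.ev α * y.ev α := by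
  simp only [ev, mul]; push_cast
  linear_combination (-(x.b * y.c + x.c * y.b : ℝ)) * A.cube - (x.c * y.c : ℝ) * A.fourth

theorem low_le (A : IsRoot3 α) (x : Z3) : (x.low : ℝ) ≤ 1000000000 * x.ev α := by
  have h1 := A.lo; have h2 := A.hi; have h3 := A.lo2; have h4 := A.hi2
  have hb : (((if 0 ≤ x.b then x.b * 543689012 else x.b * 543689013 : ℤ)) : ℝ)
      ≤ 1000000000 * (x.b * α) := by
    split_ifs with h
    · have : (0 : ℝ) ≤ x.b := by exact_mod_cast h
      push_cast; nlinarith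
    · have : (x.b : ℝ) ≤ 0 := by exact_mod_cast (not_le.1 h).le
      push_cast; nlinarith
  have hc : (((if 0 ≤ x.c then x.c * 295597742 else x.c * 295597743 : ℤ)) : ℝ)
      ≤ 1000000000 * (x.c * α ^ 2) := by
    split_ifs with h
    · have : (0 : ℝ) ≤ x.c := by exact_mod_cast h
      push_cast; nlinarith
    · have : (x.c : ℝ) ≤ 0 := by exact_mod_cast (not_le.1 h).le
      push_cast; nlinarith
  simp only [low, ev]
  push_cast at hb hc ⊢
  linarith

theorem ev_nonneg (A : IsRoot3 α) {x : Z3} (h : x.nonneg = true) : 0 ≤ x.ev α := by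
  have h1 := low_le A x
  have h2 : (0 : ℝ) ≤ x.low := by exact_mod_cast of_decide_eq_true h
  linarith

theorem ev_pos (A : IsRoot3 α) {x : Z3} (h : x.pos = true) : 0 < x.ev α := by
  have h1 := low_le A x
  have h2 : (0 : ℝ) < x.low := by exact_mod_cast of_decide_eq_true h
  linarith

theorem eq_of_eq {x y : Z3} (h : x.eq y = true) : x = y := by
  obtain ⟨a, b, c⟩ := x
  obtain ⟨a', b', c'⟩ := y
  simp only [eq, Bool.and_eq_true, decide_eq_true_eq] at h
  obtain ⟨rfl, rfl, rfl⟩ := h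
  rfl

end Z3

/-- Points with coordinates in `½ ℤ[α]`, doubled. -/
structure Pt where
  x : Z3
  y : Z3

namespace Pt

variable {α : ℝ}

def add (p q : Pt) : Pt := ⟨p.x.add q.x, p.y.add q.y⟩
def sub (p q : Pt) : Pt := ⟨p.x.sub q.x, p.y.sub q.y⟩
def eq (p q : Pt) : Bool := p.x.eq q.x && p.y.eq q.y

/-- The coordinatewise product (of undoubled `s` and doubled `p`). -/
def diag (s p : Pt) : Pt := ⟨s.x.mul p.x, s.y.mul p.y⟩

/-- The point of the plane. -/
def ev (α : ℝ) (p : Pt) : ℂ := ⟨p.x.ev α / 2, p.y.ev α / 2⟩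

/-- The undoubled pair. -/
def scale (α : ℝ) (p : Pt) : ℂ := ⟨p.x.ev α, p.y.ev α⟩

theorem ev_add (p q : Pt) : (p.add q).ev α = p.ev α + q.ev α := by
  apply Complex.ext <;> simp [ev, add, Z3.ev_add] <;> ring

theorem ev_sub (p q : Pt) : (p.sub q).ev α = p.ev α - q.ev α := by
  apply Complex.ext <;> simp [ev, sub, Z3.ev_sub] <;> ring

theorem ev_diag (A : IsRoot3 α) (s p : Pt) :
    (diag s p).ev α = AY.diag (s.scale α) (p.ev α) := by
  apply Complex.ext <;> simp [ev, diag, scale, AY.diag, Z3.ev_mul A] <;> ring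

theorem eq_of_eq {p q : Pt} (h : p.eq q = true) : p = q := by
  obtain ⟨a, b⟩ := p
  obtain ⟨a', b'⟩ := q
  simp only [eq, Bool.and_eq_true] at h
  rw [Z3.eq_of_eq h.1, Z3.eq_of_eq h.2]

/-- A sufficient criterion for being different. -/
def ne (p q : Pt) : Bool :=
  (p.x.sub q.x).pos || ((q.x.sub p.x).pos || ((p.y.sub q.y).pos || (q.y.sub p.y).pos))

theorem ne_of_ne (A : IsRoot3 α) {p q : Pt} (h : p.ne q = true) : p.ev α ≠ q.ev α := by
  intro he
  have hx := congrArg Complex.re he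
  have hy := congrArg Complex.im he
  simp only [ev] at hx hy
  simp only [ne, Bool.or_eq_true] at h
  rcases h with h | h | h | h <;>
  · have := Z3.ev_pos A h
    rw [Z3.ev_sub] at this
    linarith

end Pt

/-- The affine function `a X + b Y + c` of the doubled coordinates. -/
structure Form where
  a : Z3
  b : Z3
  c : Z3

namespace Form

variable {α : ℝ}

def neg (f : Form) : Form := ⟨f.a.neg, f.b.neg, f.c.neg⟩
def eq (f g : Form) : Bool := f.c.eq g.c && (f.a.eq g.a && f.b.eq g.b)

/-- The value at a point. -/
def val (α : ℝ) (f : Form) (z : ℂ) : ℝ :=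
  f.a.ev α * (2 * z.re) + f.b.ev α * (2 * z.im) + f.c.ev α

/-- The value at an exact point. -/
def evalAt (f : Form) (p : Pt) : Z3 := ((f.a.mul p.x).add (f.b.mul p.y)).add f.c

theorem ev_evalAt (A : IsRoot3 α) (f : Form) (p : Pt) : (f.evalAt p).ev α = f.val α (p.ev α) := by
  simp only [evalAt, Z3.ev_add, Z3.ev_mul A, val, Pt.ev]; ring

theorem val_neg (f : Form) (z : ℂ) : f.neg.val α z = -f.val α z := by
  simp only [val, neg, Z3.ev_neg]; ring

theorem eq_of_eq {f g : Form} (h : f.eq g = true) : f = g := by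
  obtain ⟨a, b, c⟩ := f
  obtain ⟨a', b', c'⟩ := g
  simp only [eq, Bool.and_eq_true] at h
  rw [Z3.eq_of_eq h.1, Z3.eq_of_eq h.2.1, Z3.eq_of_eq h.2.2]

/-- The composition with `z ↦ diag s z + w`. -/
def pull (s w : Pt) (f : Form) : Form :=
  ⟨f.a.mul s.x, f.b.mul s.y, ((f.a.mul w.x).add (f.b.mul w.y)).add f.c⟩

theorem val_pull (A : IsRoot3 α) (s w : Pt) (f : Form) (z : ℂ) :
    (f.pull s w).val α z = f.val α (AY.diag (s.scale α) z + w.ev α) := by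
  simp only [val, pull, Z3.ev_add, Z3.ev_mul A, AY.diag, Pt.scale, Pt.ev, Complex.add_re,
    Complex.add_im]
  ring

/-- The forms that are nonnegative on the segment. -/
def segment (p q : Pt) : List Form :=
  let d := q.sub p
  let e := (d.x.mul p.y).sub (d.y.mul p.x)
  [⟨d.y.neg, d.x, e.neg⟩, ⟨d.y, d.x.neg, e⟩,
   ⟨d.x, d.y, ((d.x.mul p.x).add (d.y.mul p.y)).neg⟩,
   ⟨d.x.neg, d.y.neg, (d.x.mul q.x).add (d.y.mul q.y)⟩]

theorem _root_.AY.mem_segment_iff_cross {p q z : ℂ} (h : p ≠ q) : z ∈ _root_.segment ℝ p q ↔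
    (q - p).re * (z - p).im = (q - p).im * (z - p).re ∧
    0 ≤ (q - p).re * (z - p).re + (q - p).im * (z - p).im ∧
    0 ≤ (q - p).re * (q - z).re + (q - p).im * (q - z).im := by
  have hn : 0 < (q - p).re ^ 2 + (q - p).im ^ 2 := by
    have h1 : 0 < Complex.normSq (q - p) := Complex.normSq_pos.2 (sub_ne_zero.2 h.symm)
    rw [Complex.normSq_apply] at h1
    nlinarith
  rw [segment_eq_image']
  constructor
  · rintro ⟨θ, ⟨h0, h1⟩, rfl⟩
    simp only [Complex.real_smul, Complex.sub_re, Complex.sub_im, Complex.add_re, Complex.add_im,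
      Complex.mul_re, Complex.mul_im, Complex.ofReal_re, Complex.ofReal_im] at hn ⊢
    refine ⟨by ring, ?_, ?_⟩
    · have := mul_nonneg h0 hn.le
      nlinarith
    · have := mul_nonneg (sub_nonneg.2 h1) hn.le
      nlinarith
  · rintro ⟨h1, h2, h3⟩
    set d := q - p with hd
    have e3 : (q - z).re = d.re - (z - p).re := by simp [hd]
    have e4 : (q - z).im = d.im - (z - p).im := by simp [hd]
    rw [e3, e4] at h3
    refine ⟨(d.re * (z - p).re + d.im * (z - p).im) / (d.re ^ 2 + d.im ^ 2),
      ⟨by positivity, (div_le_one hn).2 (by nlinarith)⟩, ?_⟩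
    have key : ((d.re * (z - p).re + d.im * (z - p).im) / (d.re ^ 2 + d.im ^ 2)) • d = z - p := by
      apply Complex.ext
      · simp only [Complex.real_smul, Complex.mul_re, Complex.ofReal_re, Complex.ofReal_im]
        field_simp
        linear_combination (d.im) * h1
      · simp only [Complex.real_smul, Complex.mul_im, Complex.ofReal_re, Complex.ofReal_im]
        field_simp
        linear_combination (-d.re) * h1
    show p + _ • d = z
    rw [key]; ring

theorem segment_iff (A : IsRoot3 α) {p q : Pt} (h : p.ne q = true) (z : ℂ) :
    (∀ f ∈ segment p q, 0 ≤ f.val α z) ↔ z ∈ _root_.segment ℝ (p.ev α) (q.ev α) := by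
  rw [mem_segment_iff_cross (Pt.ne_of_ne A h)]
  simp only [segment, List.mem_cons, List.not_mem_nil, or_false, forall_eq_or_imp, forall_eq, val,
    Z3.ev_neg, Z3.ev_add, Z3.ev_mul A, Z3.ev_sub, Pt.sub, Pt.ev, Complex.sub_re, Complex.sub_im]
  constructor
  · rintro ⟨h1, h2, h3, h4⟩
    exact ⟨by linarith, by linarith, by linarith⟩
  · rintro ⟨h1, h2, h3⟩
    exact ⟨by linarith, by linarith, by linarith, by linarith⟩

end Form

/-! ### Certificates for covering statements -/

/-- A proof that a polygon is covered by some polygons: it is empty (with three assumptions that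
contradict each other), or contained in one of them, or consists of a blown-up point only, or it is
cut in two by a line. -/
inductive Cert where
  | empty (i j k : ℕ)
  | hit (c : ℕ)
  | sing (k : ℕ) (t : List (ℕ × ℕ × ℕ))
  | split (c m : ℕ) (l r : Cert)

/-- The three assumptions (whether strict or not) contradict each other. -/
def farkas (x y z : Form × Bool) : Bool :=
  let l := (y.1.a.mul z.1.b).sub (y.1.b.mul z.1.a)
  let m := (z.1.a.mul x.1.b).sub (z.1.b.mul x.1.a)
  let n := (x.1.a.mul y.1.b).sub (x.1.b.mul y.1.a)
  let t := (((l.mul x.1.c).add (m.mul y.1.c)).add (n.mul z.1.c)).neg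
  l.nonneg && (m.nonneg && (n.nonneg && (t.pos || (t.nonneg &&
    ((x.2 && l.pos) || ((y.2 && m.pos) || (z.2 && n.pos)))))))

/-- The assumption holds at a point. -/
def Holds (α : ℝ) (z : ℂ) (x : Form × Bool) : Prop :=
  0 ≤ x.1.val α z ∧ (x.2 = true → 0 < x.1.val α z)

theorem not_holds_of_farkas {α : ℝ} (A : IsRoot3 α) {x y z : Form × Bool}
    (h : farkas x y z = true) {w : ℂ} (hx : Holds α w x) (hy : Holds α w y) (hz : Holds α w z) :
    False := by
  simp only [farkas, Bool.and_eq_true, Bool.or_eq_true] at h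
  obtain ⟨h1, h2, h3, h4⟩ := h
  have e1 := Z3.ev_nonneg A h1
  have e2 := Z3.ev_nonneg A h2
  have e3 := Z3.ev_nonneg A h3
  have K : ((y.1.a.mul z.1.b).sub (y.1.b.mul z.1.a)).ev α * x.1.val α w +
      ((z.1.a.mul x.1.b).sub (z.1.b.mul x.1.a)).ev α * y.1.val α w +
      ((x.1.a.mul y.1.b).sub (x.1.b.mul y.1.a)).ev α * z.1.val α w =
      -(((((y.1.a.mul z.1.b).sub (y.1.b.mul z.1.a)).mul x.1.c).add
        (((z.1.a.mul x.1.b).sub (z.1.b.mul x.1.a)).mul y.1.c)).add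
        (((x.1.a.mul y.1.b).sub (x.1.b.mul y.1.a)).mul z.1.c)).neg.ev α := by
    simp only [Z3.ev_neg, Z3.ev_add, Z3.ev_sub, Z3.ev_mul A, Form.val]
    ring
  have m1 := mul_nonneg e1 hx.1
  have m2 := mul_nonneg e2 hy.1
  have m3 := mul_nonneg e3 hz.1
  rcases h4 with h4 | ⟨h4, h5⟩
  · have := Z3.ev_pos A h4
    linarith
  · have e4 := Z3.ev_nonneg A h4
    rcases h5 with h5 | h5 | h5
    · have := mul_pos (Z3.ev_pos A h5.2) (hx.2 h5.1)
      linarith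
    · have := mul_pos (Z3.ev_pos A h5.2) (hy.2 h5.1)
      linarith
    · have := mul_pos (Z3.ev_pos A h5.2) (hz.2 h5.1)
      linarith

/-- The assumptions with the given indices contradict each other. -/
def farkasAt (L : List (Form × Bool)) (i j k : ℕ) : Bool :=
  match L[i]?, L[j]?, L[k]? with
  | some x, some y, some z => farkas x y z
  | _, _, _ => false

theorem not_holds_of_farkasAt {α : ℝ} (A : IsRoot3 α) {L : List (Form × Bool)} {i j k : ℕ}
    (h : farkasAt L i j k = true) {w : ℂ} (hL : ∀ x ∈ L, Holds α w x) : False := by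
  unfold farkasAt at h
  split at h
  · next x y z hx hy hz =>
    exact not_holds_of_farkas A h (hL _ (List.mem_of_getElem? hx)) (hL _ (List.mem_of_getElem? hy))
      (hL _ (List.mem_of_getElem? hz))
  · simp at h

/-- The forms that are positive outside a point. -/
def pointForms (p : Pt) : List Form :=
  [⟨⟨1, 0, 0⟩, ⟨0, 0, 0⟩, p.x.neg⟩, ⟨⟨-1, 0, 0⟩, ⟨0, 0, 0⟩, p.x⟩,
   ⟨⟨0, 0, 0⟩, ⟨1, 0, 0⟩, p.y.neg⟩, ⟨⟨0, 0, 0⟩, ⟨-1, 0, 0⟩, p.y⟩]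

namespace Cert

/-- The certificate is correct for the blown-up points `V`, the covering polygons `C` and the
polygon given by the assumptions `L`. -/
def check (V : List Pt) (C : List (List Form)) : Cert → List (Form × Bool) → Bool
  | empty i j k, L => farkasAt L i j k
  | hit c, L => match C[c]? with
    | some F => F.all fun f => L.any fun x => x.1.eq f
    | none => false
  | sing k t, L => match V[k]? with
    | some p => decide (t.length = 4) && (List.zip (pointForms p) t).all fun x =>
        farkasAt ((x.1, true) :: L) x.2.1 x.2.2.1 x.2.2.2
    | none => false
  | split c m l r, L => match C[c]? with
    | some F => match F[m]? with
      | some f => check V C l ((f, false) :: L) && check V C r ((f.neg, true) :: L)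
      | none => false
    | none => false

theorem sound {α : ℝ} (A : IsRoot3 α) {V : List Pt} {C : List (List Form)} (c : Cert) :
    ∀ {L : List (Form × Bool)}, c.check V C L = true → ∀ {z : ℂ}, (∀ x ∈ L, Holds α z x) →
      (∀ p ∈ V, z ≠ p.ev α) → ∃ k : ℕ, ∃ F : List Form, C[k]? = some F ∧ ∀ f ∈ F, 0 ≤ f.val α z := by
  induction c with
  | empty i j k => exact fun h _ hL _ => (not_holds_of_farkasAt A h hL).elim
  | hit c =>
    intro L h z hL _
    rw [check] at h
    split at h
    · next F hF =>
      refine ⟨c, F, hF, fun f hf => ?_⟩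
      have h1 := List.all_eq_true.1 h f hf
      obtain ⟨x, hx, hxf⟩ := List.any_eq_true.1 h1
      rw [← Form.eq_of_eq hxf]
      exact (hL x hx).1
    · simp at h
  | sing k t =>
    intro L h z hL hV
    rw [check] at h
    split at h
    · next p hp =>
      rw [Bool.and_eq_true, decide_eq_true_eq] at h
      obtain ⟨ht, h⟩ := h
      match t, ht with
      | [a, b, c, d], _ =>
        exfalso
        simp only [pointForms, List.zip_cons_cons, List.zip_nil_right, List.all_cons,
          List.all_nil, Bool.and_true, Bool.and_eq_true] at h
        have key : ∀ (f : Form) (i : ℕ × ℕ × ℕ),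
            farkasAt ((f, true) :: L) i.1 i.2.1 i.2.2 = true → f.val α z ≤ 0 := by
          intro f i hf
          by_contra hn
          push Not at hn
          refine not_holds_of_farkasAt A hf (w := z) ?_
          rintro x (_ | ⟨_, hx⟩)
          · exact ⟨hn.le, fun _ => hn⟩
          · exact hL x hx
        have k1 := key _ _ h.1
        have k2 := key _ _ h.2.1
        have k3 := key _ _ h.2.2.1
        have k4 := key _ _ h.2.2.2
        simp only [Form.val, Z3.ev_neg] at k1 k2 k3 k4
        simp only [Z3.ev] at k1 k2 k3 k4
        push_cast at k1 k2 k3 k4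
        refine hV p (List.mem_of_getElem? hp) (Complex.ext ?_ ?_) <;>
        · simp only [Pt.ev, Z3.ev]; linarith
    · simp at h
  | split c m l r ihl ihr =>
    intro L h z hL hV
    rw [check] at h
    split at h
    · next F hF =>
      split at h
      · next f hf =>
        rw [Bool.and_eq_true] at h
        rcases le_or_gt 0 (f.val α z) with h0 | h0
        · refine ihl h.1 ?_ hV
          rintro x (_ | ⟨_, hx⟩)
          · exact ⟨h0, fun h => by simp at h⟩
          · exact hL x hx
        · refine ihr h.2 ?_ hV
          rintro x (_ | ⟨_, hx⟩)
          · have : 0 < f.neg.val α z := by rw [Form.val_neg]; linarith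
            exact ⟨this.le, fun _ => this⟩
          · exact hL x hx
      · simp at h
    · simp at h

end Cert

end AY

namespace AY

/-! ### Verified scissor congruences -/

/-- An exact gluing. -/
structure GD where
  src : Fin 6
  tgt : Fin 6
  p : Pt
  q : Pt
  t : Pt

/-- An exact presentation of a surface. -/
structure PD (n : ℕ) where
  v : Fin n → Pt
  cell : Fin 6 → List Form
  gl : List GD

/-- An exact part of a scissor congruence. -/
structure PartD where
  i : Fin 6
  j : Fin 6
  w : Pt

/-- The gluing given by exact data. -/
def GD.real (α : ℝ) (g : GD) : Gluing := ⟨g.src, g.tgt, g.p.ev α, g.q.ev α, g.t.ev α⟩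

/-- The part given by exact data. -/
def PartD.real (α : ℝ) (p : PartD) : Part := ⟨p.i, p.j, p.w.ev α⟩

/-- The inverse part, where `si` is inverse to the linear part. -/
def PartD.inv (si : Pt) (p : PartD) : PartD := ⟨p.j, p.i, Pt.sub ⟨⟨0, 0, 0⟩, ⟨0, 0, 0⟩⟩ (Pt.diag si p.w)⟩

/-- The presentation given by exact data. -/
def PD.real (α : ℝ) {n : ℕ} (P : PD n) : Pres n :=
  ⟨fun k => (P.v k).ev α, fun i => {z | ∀ f ∈ P.cell i, 0 ≤ f.val α z}, P.gl.map (GD.real α)⟩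

/-- All assumptions are non-strict. -/
def weak (L : List Form) : List (Form × Bool) := L.map fun f => (f, false)

/-- The trivial linear part. -/
def onePt : Pt := ⟨⟨1, 0, 0⟩, ⟨1, 0, 0⟩⟩

/-- The point lies outside the polygon. -/
def outside (L : List Form) (u : Pt) : Bool := L.any fun f => (f.evalAt u).neg.pos

/-- The point is among the given ones. -/
def among {n : ℕ} (v : Fin n → Pt) (u : Pt) : Bool := (List.ofFn v).any fun w => u.eq w

/-- All pairs of parts with the same source. -/
def pairs : List PartD → List (PartD × PartD)
  | [] => []
  | p :: L => ((L.filter fun q => decide (p.i = q.i)).map fun q => (p, q)) ++ pairs L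

namespace PD

variable {n n' : ℕ} {α : ℝ}

theorem weak_holds {L : List Form} {z : ℂ} :
    (∀ x ∈ weak L, Holds α z x) ↔ ∀ f ∈ L, 0 ≤ f.val α z := by
  simp [weak, Holds]

theorem not_outside (A : IsRoot3 α) {L : List Form} {u : Pt}
    (h : ∀ f ∈ L, 0 ≤ f.val α (u.ev α)) : outside L u = false := by
  rw [Bool.eq_false_iff]
  intro ho
  obtain ⟨f, hf, h1⟩ := List.any_eq_true.1 ho
  have h2 := Z3.ev_pos A h1
  rw [Z3.ev_neg, Form.ev_evalAt A] at h2
  linarith [h f hf]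

theorem among_spec {v : Fin n → Pt} {u : Pt} (h : among v u = true) :
    ∃ k, (v k).ev α = u.ev α := by
  obtain ⟨w, hw, h1⟩ := List.any_eq_true.1 h
  obtain ⟨k, rfl⟩ := (List.mem_ofFn' _ _).1 hw
  exact ⟨k, by rw [Pt.eq_of_eq h1]⟩

/-- A check that the gluings behave well. -/
def goodCheck (P : PD n) : Bool :=
  ((List.finRange n).all fun k => (List.finRange n).all fun l => decide (k = l) || (P.v k).ne (P.v l))
  && P.gl.all fun g => g.p.ne g.q && (List.finRange n).all fun k =>
    (outside (Form.segment g.p g.q) (P.v k) ||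
      (((P.v k).eq g.p || (P.v k).eq g.q) && among P.v ((P.v k).add g.t))) &&
    (outside (Form.segment g.p g.q) ((P.v k).sub g.t) || among P.v ((P.v k).sub g.t))

theorem isPoly_forms (L : List Form) : IsPoly {z | ∀ f ∈ L, 0 ≤ f.val α z} := by
  refine ⟨L.map fun f => (f.a.ev α * 2, f.b.ev α * 2, f.c.ev α), ?_⟩
  ext z
  simp only [Set.mem_ofPred_eq, List.forall_mem_map, Form.val, mul_assoc]

theorem good (A : IsRoot3 α) {P : PD n} (h : P.goodCheck = true) : (P.real α).Good := by
  rw [goodCheck, Bool.and_eq_true] at h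
  obtain ⟨h1, h2⟩ := h
  have H : ∀ g ∈ P.gl, g.p.ne g.q = true ∧ ∀ k, _ := fun g hg => by
    have := List.all_eq_true.1 h2 g hg
    rw [Bool.and_eq_true] at this
    exact ⟨this.1, fun k => List.all_eq_true.1 this.2 k (List.mem_finRange k)⟩
  refine ⟨?_, fun i => isPoly_forms _, ?_, ?_, ?_⟩
  · intro k l hkl
    by_contra hne
    have := List.all_eq_true.1 (List.all_eq_true.1 h1 k (List.mem_finRange k)) l
      (List.mem_finRange l)
    rw [Bool.or_eq_true, decide_eq_true_eq] at this
    exact Pt.ne_of_ne A (this.resolve_left hne) hkl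
  all_goals
    intro g' hg'
    obtain ⟨g, hg, rfl⟩ := List.mem_map.1 hg'
    obtain ⟨hne, hk⟩ := H g hg
  · exact Pt.ne_of_ne A hne
  · rintro z hz ⟨k, rfl⟩
    have := hk k
    rw [Bool.and_eq_true, Bool.or_eq_true] at this
    rcases this.1 with h3 | h3
    · rw [not_outside A ((Form.segment_iff A hne _).2 hz)] at h3
      simp at h3
    · rw [Bool.and_eq_true, Bool.or_eq_true] at h3
      rcases h3.1 with h4 | h4
      · exact .inl (congrArg (Pt.ev α) (Pt.eq_of_eq h4))
      · exact .inr (congrArg (Pt.ev α) (Pt.eq_of_eq h4))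
  · intro z hz
    constructor
    · rintro ⟨k, rfl⟩
      have := hk k
      rw [Bool.and_eq_true, Bool.or_eq_true] at this
      rcases this.1 with h3 | h3
      · rw [not_outside A ((Form.segment_iff A hne _).2 hz)] at h3
        simp at h3
      · rw [Bool.and_eq_true] at h3
        obtain ⟨l, hl⟩ := among_spec (α := α) h3.2
        exact ⟨l, hl.trans (Pt.ev_add _ _)⟩
    · rintro ⟨k, hkz⟩
      have hz' : z = ((P.v k).sub g.t).ev α := by
        rw [Pt.ev_sub]; exact eq_sub_of_add_eq hkz.symm
      have := hk k
      rw [Bool.and_eq_true] at this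
      have h4 := this.2
      rw [Bool.or_eq_true] at h4
      rcases h4 with h3 | h3
      · rw [not_outside A ((Form.segment_iff A hne _).2 (hz' ▸ hz))] at h3
        simp at h3
      · obtain ⟨l, hl⟩ := among_spec (α := α) h3
        exact ⟨l, hl.trans hz'.symm⟩

section Compat

variable (P : PD n) (Q : PD n') (s si : Pt)

/-- The forms defining the preimage of the target polygon of a part. -/
def pullCell (p : PartD) : List Form := (Q.cell p.j).map (Form.pull s p.w)

/-- The forms defining the domain of a part. -/
def domForms (p : PartD) : List Form := P.cell p.i ++ pullCell Q s p

/-- The possible relations between the image of `z` under `p` and that of `z + t` under `q`, with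
the conditions on `z` under which they hold. -/
def ways (p q : PartD) (t : Pt) : List (Option (GD × Bool) × List Form) :=
  let d := ((Pt.diag s t).add q.w).sub p.w
  let e := p.w.sub ((Pt.diag s t).add q.w)
  (if p.j = q.j && d.eq ⟨⟨0, 0, 0⟩, ⟨0, 0, 0⟩⟩ then [(none, [])] else []) ++
  Q.gl.flatMap fun g =>
    (if g.src = p.j && (g.tgt = q.j && d.eq g.t) then
      [(some (g, true), (Form.segment g.p g.q).map (Form.pull s p.w))] else []) ++
    (if g.src = q.j && (g.tgt = p.j && e.eq g.t) then
      [(some (g, false), (Form.segment g.p g.q).map (Form.pull s ((Pt.diag s t).add q.w)))] else [])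

/-- A check that the blown-up points correspond. -/
def singCheck (p : PartD) : Bool :=
  ((List.finRange n).all fun k => outside (domForms P Q s p) (P.v k) ||
    among Q.v ((Pt.diag s (P.v k)).add p.w)) &&
  ((List.finRange n').all fun k => outside (domForms P Q s p) (Pt.diag si ((Q.v k).sub p.w)) ||
    among P.v (Pt.diag si ((Q.v k).sub p.w)))

/-- A check that the parts cover a polygon. -/
def coverCheck (L : List PartD) (c : List Cert) : Bool :=
  (List.zip (List.finRange 6) c).all fun x =>
    x.2.check (List.ofFn P.v) ((L.filter fun p => decide (p.i = x.1)).map (pullCell Q s))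
      (weak (P.cell x.1))

/-- A check that two parts agree on overlaps. -/
def overlapCheck (p q : PartD) (c : Cert) : Bool :=
  c.check (List.ofFn P.v) ((ways Q s p q ⟨⟨0, 0, 0⟩, ⟨0, 0, 0⟩⟩).map fun x => x.2)
    (weak (domForms P Q s p ++ domForms P Q s q))

/-- The ways in which points glued to each other can have related images. -/
def glueWays (L : List PartD) (g : GD) :
    List ((PartD × PartD × Option (GD × Bool)) × List Form) :=
  (L.filter fun p => decide (p.i = g.src)).flatMap fun p =>
    (L.filter fun q => decide (q.i = g.tgt)).flatMap fun q => (ways Q s p q g.t).map fun x =>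
      ((p, q, x.1), pullCell Q s p ++ ((pullCell Q s q).map (Form.pull onePt g.t) ++ x.2))

/-- A check that a gluing is respected. -/
def glueCheck (L : List PartD) (g : GD) (c : Cert) : Bool :=
  c.check (List.ofFn P.v) ((glueWays Q s L g).map fun x => x.2)
    (weak (Form.segment g.p g.q ++ (P.cell g.src ++ (P.cell g.tgt).map (Form.pull onePt g.t))))

/-- A check that `si` is inverse to `s`, with positive entries. -/
def linCheck : Bool :=
  s.x.pos && (s.y.pos && ((s.x.mul si.x).eq ⟨1, 0, 0⟩ && (s.y.mul si.y).eq ⟨1, 0, 0⟩))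

/-- A check that a list of parts defines a map. -/
def compatCheck (L : List PartD) (cov ov gl : List Cert) : Bool :=
  (linCheck s si && L.all (singCheck P Q s si)) &&
  ((decide (cov.length = 6) && coverCheck P Q s L cov) &&
  ((decide (ov.length = (pairs L).length) &&
    (List.zip (pairs L) ov).all fun x => overlapCheck P Q s x.1.1 x.1.2 x.2) &&
  (decide (gl.length = P.gl.length) &&
    (List.zip P.gl gl).all fun x => glueCheck P Q s L x.1 x.2)))

variable {P Q s si}

theorem scale_one : onePt.scale α = ⟨1, 1⟩ := by
  simp [onePt, Pt.scale, Z3.ev]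

theorem val_pull_one (A : IsRoot3 α) (t : Pt) (f : Form) (z : ℂ) :
    (f.pull onePt t).val α z = f.val α (z + t.ev α) := by
  rw [Form.val_pull A, scale_one]
  congr 2
  apply Complex.ext <;> simp [AY.diag]

theorem pullCell_iff (A : IsRoot3 α) (p : PartD) (z : ℂ) :
    (∀ f ∈ pullCell Q s p, 0 ≤ f.val α z) ↔
      (p.real α).map (s.scale α) z ∈ (Q.real α).cell p.j := by
  simp only [pullCell, List.forall_mem_map, Form.val_pull A]
  rfl

theorem domForms_iff (A : IsRoot3 α) (p : PartD) (z : ℂ) :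
    (∀ f ∈ domForms P Q s p, 0 ≤ f.val α z) ↔
      z ∈ (P.real α).dom (Q.real α) (s.scale α) (p.real α) := by
  simp only [domForms, List.forall_mem_append, pullCell_iff A]
  rfl

theorem of_zip_all {β γ : Type*} {L : List β} {c : List γ} {f : β × γ → Bool}
    (hl : c.length = L.length) (h : (List.zip L c).all f = true) {b : β} (hb : b ∈ L) :
    ∃ y, f (b, y) = true := by
  obtain ⟨k, hk, rfl⟩ := List.getElem_of_mem hb
  refine ⟨c.get ⟨k, by omega⟩, List.all_eq_true.1 h _ ?_⟩
  rw [List.mem_iff_getElem]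
  exact ⟨k, by simp; omega, by simp⟩

theorem mem_pairs {L : List PartD} {p q : PartD} (hp : p ∈ L) (hq : q ∈ L) (hi : p.i = q.i) :
    p = q ∨ (p, q) ∈ pairs L ∨ (q, p) ∈ pairs L := by
  induction L with
  | nil => simp at hp
  | cons r L ih =>
    simp only [pairs, List.mem_append, List.mem_map, List.mem_filter, decide_eq_true_eq]
    rcases List.mem_cons.1 hp with rfl | hp' <;> rcases List.mem_cons.1 hq with rfl | hq'
    · exact .inl rfl
    · exact .inr (.inl (.inl ⟨q, ⟨hq', hi⟩, rfl⟩))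
    · exact .inr (.inr (.inl ⟨p, ⟨hp', hi.symm⟩, rfl⟩))
    · rcases ih hp' hq' with h | h | h
      · exact .inl h
      · exact .inr (.inl (.inr h))
      · exact .inr (.inr (.inr h))

theorem rel_symm {j j' : Fin 6} {z z' : ℂ} {κ : (Q.real α).Way}
    (h : Pres.Rel j z j' z' κ.val) : ∃ κ' : (Q.real α).Way, Pres.Rel j' z' j z κ'.val := by
  match κ with
  | none => exact ⟨none, h.1.symm, h.2.symm⟩
  | some (g, true) => exact ⟨some (g, false), h⟩
  | some (g, false) => exact ⟨some (g, true), h⟩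

theorem rel_of_ways (A : IsRoot3 α) (hQ : Q.goodCheck = true) {p q : PartD} {t : Pt}
    {x : Option (GD × Bool) × List Form} (hx : x ∈ ways Q s p q t) {z : ℂ}
    (hz : ∀ f ∈ x.2, 0 ≤ f.val α z) :
    ∃ κ : (Q.real α).Way, Pres.Rel p.j ((p.real α).map (s.scale α) z) q.j
      ((q.real α).map (s.scale α) (z + t.ev α)) κ.val := by
  have hne : ∀ g ∈ Q.gl, g.p.ne g.q = true := fun g hg => by
    rw [goodCheck, Bool.and_eq_true] at hQ
    have := List.all_eq_true.1 hQ.2 g hg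
    rw [Bool.and_eq_true] at this
    exact this.1
  have hd : ∀ u : Pt, ((Pt.diag s t).add q.w).sub p.w = u →
      (q.real α).map (s.scale α) (z + t.ev α) = (p.real α).map (s.scale α) z + u.ev α := by
    rintro u rfl
    simp only [Part.map, PartD.real, diag_add, Pt.ev_sub, Pt.ev_add, Pt.ev_diag A]; ring
  have he : ∀ u : Pt, p.w.sub ((Pt.diag s t).add q.w) = u →
      (p.real α).map (s.scale α) z = (q.real α).map (s.scale α) (z + t.ev α) + u.ev α := by
    rintro u rfl
    simp only [Part.map, PartD.real, diag_add, Pt.ev_sub, Pt.ev_add, Pt.ev_diag A]; ring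
  rw [ways] at hx
  rcases List.mem_append.1 hx with hx | hx
  · split_ifs at hx with h
    · rw [Bool.and_eq_true, decide_eq_true_eq] at h
      refine ⟨none, h.1, ?_⟩
      rw [hd _ (Pt.eq_of_eq h.2)]
      simp only [Pt.ev, Z3.ev, Int.cast_zero, zero_mul, add_zero, zero_div]
      exact (add_zero _).symm
    · simp at hx
  · obtain ⟨g, hg, hx⟩ := List.mem_flatMap.1 hx
    have hg' : g.real α ∈ (Q.real α).gl := List.mem_map_of_mem hg
    rcases List.mem_append.1 hx with hx | hx
    · split_ifs at hx with h
      · simp only [Bool.and_eq_true, decide_eq_true_eq] at h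
        rw [List.mem_singleton.1 hx] at hz
        refine ⟨some (⟨g.real α, hg'⟩, true), h.1.symm, h.2.1.symm, ?_, hd _ (Pt.eq_of_eq h.2.2)⟩
        refine (Form.segment_iff A (hne g hg) _).1 fun f hf => ?_
        have := hz _ (List.mem_map_of_mem hf)
        rwa [Form.val_pull A] at this
      · simp at hx
    · split_ifs at hx with h
      · simp only [Bool.and_eq_true, decide_eq_true_eq] at h
        rw [List.mem_singleton.1 hx] at hz
        refine ⟨some (⟨g.real α, hg'⟩, false), h.1.symm, h.2.1.symm, ?_, he _ (Pt.eq_of_eq h.2.2)⟩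
        refine (Form.segment_iff A (hne g hg) _).1 fun f hf => ?_
        have := hz _ (List.mem_map_of_mem hf)
        rw [Form.val_pull A, Pt.ev_add, Pt.ev_diag A] at this
        simp only [Part.map, PartD.real, diag_add]
        rwa [add_assoc]
      · simp at hx

theorem compat (A : IsRoot3 α) (hP : P.goodCheck = true) (hQ : Q.goodCheck = true)
    {L : List PartD} {cov ov gl : List Cert} (h : compatCheck P Q s si L cov ov gl = true) :
    (P.real α).Compat (Q.real α) (s.scale α) (L.map (PartD.real α)) := by
  simp only [compatCheck, Bool.and_eq_true, decide_eq_true_eq, linCheck] at h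
  obtain ⟨⟨⟨hl1, hl2, hl3, hl4⟩, hs⟩, ⟨hc0, hc⟩, ⟨ho0, ho⟩, hg0, hg⟩ := h
  have hV : ∀ z, z ∉ Set.range (P.real α).v → ∀ p ∈ List.ofFn P.v, z ≠ p.ev α := by
    rintro z hz p hp rfl
    obtain ⟨k, rfl⟩ := (List.mem_ofFn' _ _).1 hp
    exact hz ⟨k, rfl⟩
  have i1 := congrArg (Z3.ev α) (Z3.eq_of_eq hl3)
  have i2 := congrArg (Z3.ev α) (Z3.eq_of_eq hl4)
  rw [Z3.ev_mul A] at i1 i2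
  have i3 : Z3.ev α ⟨1, 0, 0⟩ = 1 := by simp [Z3.ev]
  rw [i3] at i1 i2
  refine ⟨good A hP, good A hQ, Z3.ev_pos A hl1, Z3.ev_pos A hl2, ?_, ?_, ?_, ?_⟩
  · intro p' hp'
    obtain ⟨p, hp, rfl⟩ := List.mem_map.1 hp'
    have := List.all_eq_true.1 hs p hp
    rw [singCheck, Bool.and_eq_true] at this
    intro z hz
    constructor
    · rintro ⟨k, rfl⟩
      have h1 := List.all_eq_true.1 this.1 k (List.mem_finRange k)
      rw [Bool.or_eq_true, not_outside A ((domForms_iff A p _).2 hz)] at h1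
      obtain ⟨l, hl⟩ := among_spec (α := α) (h1.resolve_left (by simp))
      refine ⟨l, hl.trans ?_⟩
      rw [Pt.ev_add, Pt.ev_diag A]; rfl
    · rintro ⟨k, hk⟩
      have hz' : z = (Pt.diag si ((Q.v k).sub p.w)).ev α := by
        rw [Pt.ev_diag A, Pt.ev_sub, show (Q.v k).ev α = _ from hk]
        apply Complex.ext
        · simp only [Part.map, PartD.real, add_sub_cancel_right, AY.diag, Pt.scale]
          linear_combination (-z.re) * i1
        · simp only [Part.map, PartD.real, add_sub_cancel_right, AY.diag, Pt.scale]
          linear_combination (-z.im) * i2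
      have h1 := List.all_eq_true.1 this.2 k (List.mem_finRange k)
      rw [Bool.or_eq_true, not_outside A ((domForms_iff A p _).2 (hz' ▸ hz))] at h1
      obtain ⟨l, hl⟩ := among_spec (α := α) (h1.resolve_left (by simp))
      exact ⟨l, hl.trans hz'.symm⟩
  · intro i z hz hv
    obtain ⟨c, h1⟩ := of_zip_all (b := i) (by simpa using hc0) hc (List.mem_finRange i)
    obtain ⟨k, F, hF, h2⟩ := Cert.sound A c h1 (weak_holds.2 hz) (hV z hv)
    obtain ⟨p, hp, rfl⟩ := List.mem_map.1 (List.mem_of_getElem? hF)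
    rw [List.mem_filter, decide_eq_true_eq] at hp
    exact ⟨_, List.mem_map_of_mem hp.1, hp.2, (pullCell_iff A p z).1 h2⟩
  · have key : ∀ p q, (p, q) ∈ pairs L →
        ∀ z ∈ (P.real α).dom (Q.real α) (s.scale α) (p.real α) ∩
          (P.real α).dom (Q.real α) (s.scale α) (q.real α), z ∉ Set.range (P.real α).v →
        ∃ κ : (Q.real α).Way, Pres.Rel p.j ((p.real α).map (s.scale α) z) q.j
          ((q.real α).map (s.scale α) z) κ.val := by
      intro p q hpq z hz hv
      obtain ⟨c, h1⟩ := of_zip_all ho0 ho hpq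
      obtain ⟨k, F, hF, h2⟩ := Cert.sound A c h1 (z := z)
        (weak_holds.2 (List.forall_mem_append.2 ⟨(domForms_iff A p z).2 hz.1,
          (domForms_iff A q z).2 hz.2⟩)) (hV z hv)
      obtain ⟨x, hx, rfl⟩ := List.mem_map.1 (List.mem_of_getElem? hF)
      have := rel_of_ways A hQ hx h2
      have h0 : Pt.ev α ⟨⟨0, 0, 0⟩, ⟨0, 0, 0⟩⟩ = 0 := by
        apply Complex.ext <;> simp [Pt.ev, Z3.ev]
      rwa [h0, add_zero] at this
    intro p' hp' q' hq' hi z hz hv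
    obtain ⟨p, hp, rfl⟩ := List.mem_map.1 hp'
    obtain ⟨q, hq, rfl⟩ := List.mem_map.1 hq'
    rcases mem_pairs hp hq hi with rfl | h1 | h1
    · exact ⟨none, rfl, rfl⟩
    · exact key p q h1 z hz hv
    · obtain ⟨κ, h2⟩ := key q p h1 z hz.symm hv
      exact rel_symm h2
  · intro g' hg' z hz h1 h2 hv
    obtain ⟨g, hgm, rfl⟩ := List.mem_map.1 hg'
    have hne : g.p.ne g.q = true := by
      rw [goodCheck, Bool.and_eq_true] at hP
      have := List.all_eq_true.1 hP.2 g hgm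
      rw [Bool.and_eq_true] at this
      exact this.1
    obtain ⟨c, hc⟩ := of_zip_all hg0 hg hgm
    obtain ⟨k, F, hF, h3⟩ := Cert.sound A c hc (z := z)
      (weak_holds.2 (List.forall_mem_append.2 ⟨(Form.segment_iff A hne z).2 hz,
        List.forall_mem_append.2 ⟨h1, List.forall_mem_map.2 fun f hf => by
          rw [val_pull_one A]; exact h2 f hf⟩⟩)) (hV z hv)
    obtain ⟨x, hx, rfl⟩ := List.mem_map.1 (List.mem_of_getElem? hF)
    obtain ⟨p, hp, hx⟩ := List.mem_flatMap.1 hx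
    obtain ⟨q, hq, hx⟩ := List.mem_flatMap.1 hx
    obtain ⟨y, hy, rfl⟩ := List.mem_map.1 hx
    rw [List.mem_filter, decide_eq_true_eq] at hp hq
    obtain ⟨h4, h5⟩ := List.forall_mem_append.1 h3
    obtain ⟨h5, h6⟩ := List.forall_mem_append.1 h5
    refine ⟨_, List.mem_map_of_mem hp.1, _, List.mem_map_of_mem hq.1, hp.2, hq.2,
      (pullCell_iff A p z).1 h4, (pullCell_iff A q _).1 fun f hf => ?_, rel_of_ways A hQ hy h6⟩
    have := h5 _ (List.mem_map_of_mem hf)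
    rwa [val_pull_one A] at this

theorem inv_scale (A : IsRoot3 α) (h : linCheck s si = true) :
    si.scale α = ⟨(s.scale α).re⁻¹, (s.scale α).im⁻¹⟩ := by
  simp only [linCheck, Bool.and_eq_true] at h
  have i1 := congrArg (Z3.ev α) (Z3.eq_of_eq h.2.2.1)
  have i2 := congrArg (Z3.ev α) (Z3.eq_of_eq h.2.2.2)
  rw [Z3.ev_mul A] at i1 i2
  have i3 : Z3.ev α ⟨1, 0, 0⟩ = 1 := by simp [Z3.ev]
  rw [i3] at i1 i2
  apply Complex.ext
  · exact (inv_eq_of_mul_eq_one_right i1).symm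
  · exact (inv_eq_of_mul_eq_one_right i2).symm

theorem map_inv (A : IsRoot3 α) (h : linCheck s si = true) (L : List PartD) :
    (L.map (PartD.inv si)).map (PartD.real α) =
      (L.map (PartD.real α)).map fun p => p.inv (s.scale α) := by
  simp only [List.map_map]
  refine List.map_congr_left fun p _ => ?_
  simp only [Function.comp, PartD.inv, PartD.real, Part.inv, Part.mk.injEq, true_and]
  rw [Pt.ev_sub, Pt.ev_diag A, inv_scale A h]
  apply Complex.ext <;> simp [Pt.ev, Z3.ev]

end Compat

end PD

end AY

namespace AY

/-! ### The scissor congruences of the surface -/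

/-- The Arnoux–Yoccoz surface, with its singularities. -/
def surfD : PD 9 where
  v := ![⟨⟨-1, 2, 0⟩, 0, 0, 0⟩, ⟨⟨-1, 2, 2⟩, 0, 0, 0⟩, ⟨⟨1, 0, 0⟩, 0, 0, 0⟩,
    ⟨⟨0, 1, 0⟩, 2, 0, 0⟩, ⟨⟨0, 2, 1⟩, 0, 2, 2⟩, ⟨⟨1, 1, 1⟩, 0, 2, 0⟩,
    ⟨⟨-1, 2, 1⟩, 1, 0, -1⟩, ⟨⟨0, 1, 1⟩, 1, 0, 1⟩, ⟨⟨1, 1, 0⟩, -1, 2, 1⟩]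
  cell := ![
    [⟨⟨1, 0, 0⟩, ⟨0, 0, 0⟩, 0, 0, 0⟩, ⟨⟨-1, 0, 0⟩, ⟨0, 0, 0⟩, -1, 2, 1⟩,
      ⟨⟨0, 0, 0⟩, ⟨1, 0, 0⟩, 0, 0, 0⟩, ⟨⟨0, 0, 0⟩, ⟨-1, 0, 0⟩, 2, 0, 0⟩],
    [⟨⟨1, 0, 0⟩, ⟨0, 0, 0⟩, 1, -2, -1⟩, ⟨⟨-1, 0, 0⟩, ⟨0, 0, 0⟩, 0, 1, 1⟩,
      ⟨⟨0, 0, 0⟩, ⟨1, 0, 0⟩, 0, 0, 0⟩, ⟨⟨0, 0, 0⟩, ⟨-1, 0, 0⟩, 2, 0, 0⟩],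
    [⟨⟨1, 0, 0⟩, ⟨0, 0, 0⟩, 0, -1, -1⟩, ⟨⟨-1, 0, 0⟩, ⟨0, 0, 0⟩, 0, 2, 0⟩,
      ⟨⟨0, 0, 0⟩, ⟨1, 0, 0⟩, 0, 0, 0⟩, ⟨⟨0, 0, 0⟩, ⟨-1, 0, 0⟩, 2, 0, 0⟩],
    [⟨⟨1, 0, 0⟩, ⟨0, 0, 0⟩, 0, -2, 0⟩, ⟨⟨-1, 0, 0⟩, ⟨0, 0, 0⟩, 1, 1, 0⟩,
      ⟨⟨0, 0, 0⟩, ⟨1, 0, 0⟩, 0, 0, 0⟩, ⟨⟨0, 0, 0⟩, ⟨-1, 0, 0⟩, 0, 2, 2⟩],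
    [⟨⟨1, 0, 0⟩, ⟨0, 0, 0⟩, -1, -1, 0⟩, ⟨⟨-1, 0, 0⟩, ⟨0, 0, 0⟩, 0, 2, 2⟩,
      ⟨⟨0, 0, 0⟩, ⟨1, 0, 0⟩, 0, 0, 0⟩, ⟨⟨0, 0, 0⟩, ⟨-1, 0, 0⟩, 0, 2, 2⟩],
    [⟨⟨1, 0, 0⟩, ⟨0, 0, 0⟩, 0, -2, -2⟩, ⟨⟨-1, 0, 0⟩, ⟨0, 0, 0⟩, 2, 0, 0⟩,
      ⟨⟨0, 0, 0⟩, ⟨1, 0, 0⟩, 0, 0, 0⟩, ⟨⟨0, 0, 0⟩, ⟨-1, 0, 0⟩, 0, 2, 0⟩]]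
  gl := [⟨0, 1, ⟨⟨-1, 2, 1⟩, 1, 0, -1⟩, ⟨⟨-1, 2, 1⟩, 2, 0, 0⟩, ⟨0, 0, 0⟩, 0, 0, 0⟩,
    ⟨1, 2, ⟨⟨0, 1, 1⟩, 1, 0, 1⟩, ⟨⟨0, 1, 1⟩, 2, 0, 0⟩, ⟨0, 0, 0⟩, 0, 0, 0⟩,
    ⟨2, 3, ⟨⟨0, 2, 0⟩, 0, 0, 0⟩, ⟨⟨0, 2, 0⟩, 0, 2, 2⟩, ⟨0, 0, 0⟩, 0, 0, 0⟩,
    ⟨3, 4, ⟨⟨1, 1, 0⟩, -1, 2, 1⟩, ⟨⟨1, 1, 0⟩, 0, 2, 2⟩, ⟨0, 0, 0⟩, 0, 0, 0⟩,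
    ⟨4, 5, ⟨⟨0, 2, 2⟩, 0, 0, 0⟩, ⟨⟨0, 2, 2⟩, 0, 2, 0⟩, ⟨0, 0, 0⟩, 0, 0, 0⟩,
    ⟨5, 0, ⟨⟨2, 0, 0⟩, 0, 0, 0⟩, ⟨⟨2, 0, 0⟩, 0, 2, 0⟩, ⟨-2, 0, 0⟩, 0, 0, 0⟩,
    ⟨4, 2, ⟨⟨0, 2, 2⟩, 0, 2, 0⟩, ⟨⟨0, 2, 2⟩, 0, 2, 2⟩, ⟨0, -1, -1⟩, 0, -2, 0⟩,
    ⟨2, 1, ⟨⟨0, 2, 0⟩, 0, 2, 2⟩, ⟨⟨0, 2, 0⟩, 2, 0, 0⟩, ⟨-1, 0, 1⟩, 0, -2, -2⟩,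
    ⟨1, 0, ⟨⟨0, 1, 1⟩, 0, 0, 0⟩, ⟨⟨0, 1, 1⟩, 2, -2, 0⟩, ⟨0, -1, -1⟩, 0, 2, 0⟩,
    ⟨0, 2, ⟨⟨-1, 2, 1⟩, 0, 0, 0⟩, ⟨⟨-1, 2, 1⟩, 1, 0, -1⟩, ⟨1, -1, 0⟩, 0, 0, 2⟩,
    ⟨1, 4, ⟨⟨0, 1, 1⟩, 2, -2, 0⟩, ⟨⟨0, 1, 1⟩, 1, 0, 1⟩, ⟨1, 0, -1⟩, -2, 2, 0⟩,
    ⟨3, 1, ⟨⟨1, 1, 0⟩, 0, 0, 0⟩, ⟨⟨1, 1, 0⟩, -1, 2, 1⟩, ⟨-2, 1, 1⟩, 2, -2, -2⟩,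
    ⟨0, 4, ⟨⟨0, 0, 0⟩, 2, 0, 0⟩, ⟨⟨1, -1, 0⟩, 2, 0, 0⟩, ⟨1, 1, 0⟩, -2, 0, 0⟩,
    ⟨0, 5, ⟨⟨0, 0, 0⟩, 2, 0, 0⟩, ⟨⟨1, -1, 0⟩, 2, 0, 0⟩, ⟨1, 1, 0⟩, -2, 0, 0⟩,
    ⟨1, 5, ⟨⟨0, 0, 0⟩, 2, 0, 0⟩, ⟨⟨1, -1, 0⟩, 2, 0, 0⟩, ⟨1, 1, 0⟩, -2, 0, 0⟩,
    ⟨1, 0, ⟨⟨1, -1, 0⟩, 2, 0, 0⟩, ⟨⟨0, 1, 0⟩, 2, 0, 0⟩, ⟨-1, 1, 0⟩, -2, 0, 0⟩,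
    ⟨1, 2, ⟨⟨0, 1, 0⟩, 2, 0, 0⟩, ⟨⟨0, 2, 0⟩, 2, 0, 0⟩, ⟨1, -1, 0⟩, -2, 0, 0⟩,
    ⟨1, 3, ⟨⟨0, 1, 0⟩, 2, 0, 0⟩, ⟨⟨0, 2, 0⟩, 2, 0, 0⟩, ⟨1, -1, 0⟩, -2, 0, 0⟩,
    ⟨2, 3, ⟨⟨0, 1, 0⟩, 2, 0, 0⟩, ⟨⟨0, 2, 0⟩, 2, 0, 0⟩, ⟨1, -1, 0⟩, -2, 0, 0⟩,
    ⟨3, 1, ⟨⟨0, 2, 0⟩, 0, 2, 2⟩, ⟨⟨0, 2, 1⟩, 0, 2, 2⟩, ⟨-1, 0, 1⟩, 0, -2, -2⟩,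
    ⟨3, 0, ⟨⟨0, 2, 1⟩, 0, 2, 2⟩, ⟨⟨0, 2, 2⟩, 0, 2, 2⟩, ⟨-1, 0, -1⟩, 0, -2, -2⟩,
    ⟨4, 0, ⟨⟨0, 2, 1⟩, 0, 2, 2⟩, ⟨⟨0, 2, 2⟩, 0, 2, 2⟩, ⟨-1, 0, -1⟩, 0, -2, -2⟩,
    ⟨5, 2, ⟨⟨0, 2, 2⟩, 0, 2, 0⟩, ⟨⟨1, 1, 1⟩, 0, 2, 0⟩, ⟨0, -1, -1⟩, 0, -2, 0⟩,
    ⟨5, 1, ⟨⟨1, 1, 1⟩, 0, 2, 0⟩, ⟨⟨2, 0, 0⟩, 0, 2, 0⟩, ⟨-2, 1, 1⟩, 0, -2, 0⟩]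

/-- The Arnoux–Yoccoz surface, without points to be blown up. -/
def surfD₀ : PD 0 := ⟨![], surfD.cell, surfD.gl⟩

/-- A surface glued from six parallelograms whose vertices are blown up. -/
def modelD : PD 14 where
  v := ![⟨⟨-1, 2, 1⟩, 1, 0, -1⟩, ⟨⟨-1, 2, 2⟩, 0, 0, 0⟩, ⟨⟨0, 1, 1⟩, 1, 0, 1⟩,
    ⟨⟨1, 0, 0⟩, 0, 0, 0⟩, ⟨⟨1, 1, 0⟩, -1, 2, 1⟩, ⟨⟨1, 2, 0⟩, 0, 0, 0⟩,
    ⟨⟨1, 2, 1⟩, 1, 0, -1⟩, ⟨⟨2, 1, 0⟩, 2, 0, 0⟩, ⟨⟨2, 0, 0⟩, 1, 2, 1⟩,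
    ⟨⟨1, 1, 1⟩, 0, 2, 0⟩, ⟨⟨0, 2, 2⟩, 1, 2, 1⟩, ⟨⟨0, 2, 1⟩, 0, 2, 2⟩,
    ⟨⟨0, 2, 0⟩, 1, 2, 1⟩, ⟨⟨0, 1, 0⟩, 2, 0, 0⟩]
  cell := ![
    [⟨⟨1, 0, 1⟩, ⟨-1, 1, 1⟩, 1, -2, -1⟩, ⟨⟨-1, 0, -1⟩, ⟨1, -1, -1⟩, -1, 4, -1⟩,
      ⟨⟨1, 0, -1⟩, ⟨0, 0, 1⟩, 1, 0, -5⟩, ⟨⟨-1, 0, 1⟩, ⟨0, 0, -1⟩, -1, 2, 3⟩],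
    [⟨⟨-1, 2, 1⟩, ⟨0, -1, 0⟩, -1, 2, 1⟩, ⟨⟨1, -2, -1⟩, ⟨0, 1, 0⟩, -1, 2, 1⟩,
      ⟨⟨1, 0, 1⟩, ⟨1, -1, -1⟩, -1, 0, -1⟩, ⟨⟨-1, 0, -1⟩, ⟨-1, 1, 1⟩, -1, 4, 3⟩],
    [⟨⟨1, 0, -1⟩, ⟨0, 0, -1⟩, 1, 0, -5⟩, ⟨⟨-1, 0, 1⟩, ⟨0, 0, 1⟩, -1, 2, 3⟩,
      ⟨⟨1, 0, 1⟩, ⟨1, -1, -1⟩, 1, -4, -3⟩, ⟨⟨-1, 0, -1⟩, ⟨-1, 1, 1⟩, -1, 6, 1⟩],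
    [⟨⟨-1, 2, 1⟩, ⟨0, -1, 0⟩, -1, 4, -1⟩, ⟨⟨1, -2, -1⟩, ⟨0, 1, 0⟩, 1, -2, -1⟩,
      ⟨⟨1, 0, -1⟩, ⟨0, 0, 1⟩, 1, -2, -3⟩, ⟨⟨-1, 0, 1⟩, ⟨0, 0, -1⟩, -1, 4, 1⟩],
    [⟨⟨1, 0, -1⟩, ⟨0, 0, -1⟩, 1, -2, -3⟩, ⟨⟨-1, 0, 1⟩, ⟨0, 0, 1⟩, -1, 4, 1⟩,
      ⟨⟨-1, 2, 1⟩, ⟨0, 1, 0⟩, -1, 2, -3⟩, ⟨⟨1, -2, -1⟩, ⟨0, -1, 0⟩, 1, 0, 1⟩],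
    [⟨⟨1, 0, 1⟩, ⟨-1, 1, 1⟩, -3, 2, -1⟩, ⟨⟨-1, 0, -1⟩, ⟨1, -1, -1⟩, 1, 2, 3⟩,
      ⟨⟨-1, 2, 1⟩, ⟨0, 1, 0⟩, -1, 0, -1⟩, ⟨⟨1, -2, -1⟩, ⟨0, -1, 0⟩, -1, 4, 3⟩]]
  gl := [⟨0, 5, ⟨⟨-1, 2, 2⟩, 0, 0, 0⟩, ⟨⟨0, 1, 1⟩, 1, 0, 1⟩, ⟨2, -1, -1⟩, 0, 2, 0⟩,
    ⟨1, 3, ⟨⟨1, 0, 0⟩, 0, 0, 0⟩, ⟨⟨1, 1, 0⟩, -1, 2, 1⟩, ⟨-1, 1, 0⟩, 2, 0, 0⟩,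
    ⟨2, 4, ⟨⟨1, 1, 0⟩, -1, 2, 1⟩, ⟨⟨1, 1, 1⟩, 0, 2, 0⟩, ⟨0, 0, 0⟩, 0, 0, 0⟩,
    ⟨3, 1, ⟨⟨0, 1, 1⟩, 1, 0, 1⟩, ⟨⟨0, 2, 1⟩, 0, 2, 2⟩, ⟨0, 0, 0⟩, 0, 0, 0⟩,
    ⟨4, 2, ⟨⟨1, 2, 0⟩, 0, 0, 0⟩, ⟨⟨1, 2, 1⟩, 1, 0, -1⟩, ⟨-1, 0, 1⟩, 0, 2, 2⟩,
    ⟨5, 0, ⟨⟨1, 2, 1⟩, 1, 0, -1⟩, ⟨⟨2, 1, 0⟩, 2, 0, 0⟩, ⟨-2, 0, 0⟩, 0, 0, 0⟩,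
    ⟨0, 3, ⟨⟨0, 1, 0⟩, 2, 0, 0⟩, ⟨⟨0, 1, 1⟩, 1, 0, 1⟩, ⟨0, 0, 0⟩, 0, 0, 0⟩,
    ⟨1, 2, ⟨⟨0, 2, 1⟩, 0, 2, 2⟩, ⟨⟨1, 1, 0⟩, -1, 2, 1⟩, ⟨0, 0, 0⟩, 0, 0, 0⟩,
    ⟨2, 1, ⟨⟨0, 2, 2⟩, 1, 2, 1⟩, ⟨⟨1, 1, 1⟩, 0, 2, 0⟩, ⟨0, -1, -1⟩, 0, -2, 0⟩,
    ⟨3, 0, ⟨⟨0, 2, 0⟩, 1, 2, 1⟩, ⟨⟨0, 2, 1⟩, 0, 2, 2⟩, ⟨-1, 0, 1⟩, 0, -2, -2⟩,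
    ⟨4, 5, ⟨⟨1, 1, 1⟩, 0, 2, 0⟩, ⟨⟨1, 2, 1⟩, 1, 0, -1⟩, ⟨0, 0, 0⟩, 0, 0, 0⟩,
    ⟨5, 4, ⟨⟨2, 0, 0⟩, 1, 2, 1⟩, ⟨⟨2, 1, 0⟩, 2, 0, 0⟩, ⟨-1, 1, 0⟩, -2, 0, 0⟩]

/-- The linear part of the Arnoux–Yoccoz map. -/
def stretch : Pt := ⟨⟨0, 1, 0⟩, 1, 1, 1⟩

/-- The linear part of its inverse. -/
def shrink : Pt := ⟨⟨1, 1, 1⟩, 0, 1, 0⟩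

/-- The parts of the Arnoux–Yoccoz map. -/
def mapParts : List PartD := [⟨0, 3, ⟨0, 2, 0⟩, -2, 0, 0⟩, ⟨1, 3, ⟨0, 2, 0⟩, -2, 0, 0⟩,
   ⟨2, 4, ⟨0, 2, 0⟩, -2, 0, 0⟩, ⟨3, 5, ⟨0, 2, 0⟩, -2, 0, 0⟩,
   ⟨4, 5, ⟨0, 2, 0⟩, -2, 0, 0⟩, ⟨0, 1, ⟨-1, 3, 0⟩, 0, 0, 0⟩,
   ⟨1, 2, ⟨-1, 3, 0⟩, 0, 0, 0⟩, ⟨2, 0, ⟨-1, 1, 0⟩, 0, 0, 0⟩,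
   ⟨3, 0, ⟨-1, 1, 0⟩, 0, 0, 0⟩, ⟨4, 1, ⟨-1, 1, 0⟩, 0, 0, 0⟩,
   ⟨5, 1, ⟨-1, 1, 0⟩, 0, 0, 0⟩]

/-- The parts of the congruence with six parallelograms. -/
def modelParts : List PartD := [⟨0, 5, ⟨2, 0, 0⟩, 0, 0, 0⟩, ⟨0, 5, ⟨3, -1, 0⟩, 2, 0, 0⟩,
   ⟨0, 4, ⟨2, 0, 0⟩, 0, 0, 0⟩, ⟨0, 2, ⟨1, 0, 1⟩, 0, 2, 2⟩, ⟨1, 0, ⟨0, 0, 0⟩, 0, 0, 0⟩,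
   ⟨1, 3, ⟨1, 0, -1⟩, 0, 2, 2⟩, ⟨1, 5, ⟨2, -1, -1⟩, 0, 2, 0⟩,
   ⟨1, 5, ⟨2, 0, 0⟩, 0, 0, 0⟩, ⟨1, 3, ⟨0, 0, 0⟩, 0, 0, 0⟩, ⟨2, 2, ⟨0, 1, 1⟩, 0, 2, 0⟩,
   ⟨2, 1, ⟨0, 0, 0⟩, 0, 0, 0⟩, ⟨2, 3, ⟨0, 0, 0⟩, 0, 0, 0⟩,
   ⟨2, 3, ⟨-1, 1, 0⟩, 2, 0, 0⟩, ⟨3, 3, ⟨0, 0, 0⟩, 0, 0, 0⟩,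
   ⟨3, 1, ⟨0, 0, 0⟩, 0, 0, 0⟩, ⟨3, 2, ⟨0, 0, 0⟩, 0, 0, 0⟩,
   ⟨3, 3, ⟨-1, 1, 0⟩, 2, 0, 0⟩, ⟨4, 2, ⟨0, 0, 0⟩, 0, 0, 0⟩,
   ⟨4, 4, ⟨0, 0, 0⟩, 0, 0, 0⟩, ⟨4, 5, ⟨1, -1, 0⟩, 2, 0, 0⟩,
   ⟨5, 2, ⟨0, 0, 0⟩, 0, 0, 0⟩, ⟨5, 4, ⟨0, 0, 0⟩, 0, 0, 0⟩, ⟨5, 5, ⟨0, 0, 0⟩, 0, 0, 0⟩,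
   ⟨5, 5, ⟨1, -1, 0⟩, 2, 0, 0⟩]

/-- Successive distinctions, in each of which the second case is void. -/
def Cert.chain (k : ℕ) : List ℕ → Cert → Cert
  | j :: a :: b :: L, t => .split k j (chain k L t) (.empty 0 a b)
  | _, t => t

/-- Certificates for the Arnoux–Yoccoz map. -/
def mapCerts : List Cert × List Cert × List Cert :=
  let h := Cert.hit; let p := Cert.split; let d := Cert.chain
  let c := fun k L => d k L (h k)
  let a := [0, 2, 1, 1, 2, 4, 3, 1, 7]
  let b := [0, 1, 2, 1, 4, 2, 2, 6, 1]
  let f := [0, 7, 14, 1, 15, 17, 2, 1, 15, 3, 17, 2]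
  let g := [0, 12, 9, 1, 11, 13, 2, 13, 1, 3, 2, 11, 6, 15, 3, 7, 4, 2, 8, 2, 5, 9, 6, 4, 10, 1,
    8, 11, 19, 2]
  let i := [0, 10, 1, 1, 2, 12, 3, 1, 15]
  ([p 0 2 (c 0 a) (c 1 b), p 0 2 (c 0 a) (c 1 b), p 0 2 (c 0 a) (c 1 b), p 0 2 (c 0 a) (c 1 b),
   p 0 2 (c 0 a) (c 1 b), c 0 [0, 4, 1, 1, 3, 5, 2, 5, 1, 3, 2, 7]], [c 0 [0, 7, 14, 1, 15, 17,
   2, 1, 11, 3, 17, 2], c 0 f, c 0 f, c 0 f, c 0 [0, 7, 14, 1, 15, 17, 2, 1, 15, 3, 13, 2]], [p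
   0 2 (c 0 i) (c 3 [0, 1, 10, 1, 8, 2, 2, 14, 1, 4, 13, 1, 5, 2, 3, 8, 3, 4, 9, 3, 4, 11, 8,
   1]), c 0 [0, 12, 9, 1, 7, 13, 2, 5, 1, 3, 2, 15, 4, 1, 13, 5, 4, 2, 10, 9, 1, 11, 2, 4], p 3
   3 (c 3 [0, 1, 10, 1, 12, 2, 2, 14, 1]) (c 0 [0, 10, 1, 1, 2, 8, 3, 1, 15, 4, 1, 13, 5, 3, 2,
   7, 1, 18, 8, 5, 1, 9, 2, 4, 10, 1, 9, 11, 4, 2]), p 0 2 (c 0 i) (c 3 [0, 1, 10, 1, 8, 2, 2,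
   14, 1, 4, 13, 1, 5, 2, 3, 8, 3, 4, 9, 3, 4, 10, 1, 11, 11, 9, 2]), c 1 [0, 12, 9, 1, 11, 13,
   2, 13, 1, 3, 2, 15], c 1 [0, 12, 9, 1, 11, 13, 2, 13, 1, 3, 2, 11], c 0 [0, 12, 9, 1, 7, 13,
   2, 13, 1, 3, 2, 11, 4, 1, 13, 5, 4, 2, 7, 1, 3, 10, 5, 2, 11, 3, 5], c 0 [0, 12, 9, 1, 7, 13,
   2, 13, 1, 3, 2, 11, 4, 1, 13, 5, 4, 2, 6, 17, 1, 7, 2, 4, 10, 2, 3, 11, 4, 6], c 0 [0, 12, 9,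
   1, 7, 13, 2, 9, 1, 3, 2, 15, 4, 1, 13, 5, 4, 2, 7, 1, 18, 10, 5, 2, 11, 3, 2], p 0 6 (c 0 [0,
   10, 1, 1, 2, 8, 2, 3, 1, 3, 2, 8, 4, 1, 14, 5, 4, 2, 7, 1, 3, 8, 6, 1, 9, 2, 4, 10, 1, 10])
   (c 1 [0, 1, 10, 1, 8, 2, 2, 10, 1, 3, 2, 4, 4, 1, 14, 5, 4, 2, 6, 4, 1, 8, 1, 6, 9, 4, 2, 10,
   1, 7, 11, 11, 2]), p 0 2 (c 0 [0, 10, 1, 1, 2, 8, 3, 1, 11, 4, 1, 13, 5, 3, 2, 6, 6, 1, 8, 1,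
   5, 9, 4, 2, 10, 1, 9, 11, 14, 2]) (c 1 [0, 1, 10, 1, 8, 2, 2, 14, 1, 4, 13, 1, 5, 2, 3, 6,
   17, 1, 7, 2, 7, 8, 6, 1, 9, 2, 5, 10, 1, 4, 11, 11, 2]), c 0 [0, 12, 9, 1, 7, 13, 2, 9, 1, 3,
   2, 7, 4, 1, 13, 5, 4, 2, 6, 4, 1, 7, 2, 11, 10, 6, 3, 11, 4, 13], c 0 g, c 0 g, c 0 g, c 0
   [0, 12, 9, 1, 11, 13, 2, 13, 1, 3, 2, 11, 6, 15, 3, 7, 4, 2, 8, 2, 5, 9, 6, 4, 10, 1, 8, 11,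
   13, 2], c 0 [0, 12, 9, 1, 11, 13, 2, 13, 1, 3, 2, 11, 4, 1, 13, 6, 1, 16, 7, 3, 2, 10, 1, 10,
   11, 7, 2], c 0 [0, 12, 9, 1, 7, 13, 2, 13, 1, 3, 2, 11, 4, 1, 13, 6, 1, 16, 7, 3, 2, 10, 1,
   16, 11, 7, 2], c 0 [0, 12, 5, 2, 1, 12, 3, 10, 2, 4, 1, 3, 6, 1, 15, 7, 3, 2, 10, 1, 6, 11,
   17, 2], c 0 [0, 12, 9, 1, 11, 13, 2, 13, 1, 3, 2, 11, 5, 14, 1, 6, 16, 1, 7, 2, 3, 10, 1, 7,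
   11, 12, 2], c 0 [0, 12, 9, 1, 11, 13, 2, 13, 1, 3, 2, 11, 4, 1, 4, 6, 1, 16, 7, 3, 2, 10, 1,
   10, 11, 7, 2], c 0 [0, 12, 9, 1, 11, 13, 2, 13, 1, 3, 2, 11, 4, 1, 4, 6, 1, 16, 7, 3, 2, 10,
   1, 12, 11, 7, 2], c 0 [0, 12, 9, 1, 11, 13, 2, 13, 1, 3, 2, 11, 4, 1, 13, 6, 1, 16, 7, 3, 2,
   10, 1, 3, 11, 12, 2], c 0 [0, 12, 9, 1, 11, 13, 2, 13, 1, 3, 2, 11, 5, 14, 1, 6, 16, 1, 7, 2,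
   3, 10, 1, 10, 11, 4, 2]])

/-- Certificates for its inverse. -/
def mapCertsInv : List Cert × List Cert × List Cert :=
  let e := Cert.empty; let h := Cert.hit; let p := Cert.split; let d := Cert.chain
  let c := fun k L => d k L (h k)
  let a := [1, 3, 5, 2, 5, 1, 3, 2, 7]
  let b := [0, 5, 2, 2, 1, 5, 3, 7, 2]
  let f := [0, 4, 1, 1, 3, 5, 2, 5, 1, 3, 2, 7]
  let g := [0, 6, 16, 1, 17, 14, 2, 1, 13, 3, 19, 2]
  let i := [0, 6, 16, 1, 17, 14, 2, 1, 17, 3, 19, 2]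
  let j := [0, 12, 9, 1, 7, 13, 2, 13, 1, 3, 2, 11, 4, 1, 13, 5, 4, 2, 6, 17, 1, 7, 2, 4, 10, 2,
    3, 11, 4, 6]
  let k := [0, 12, 9, 1, 7, 13, 2, 13, 1, 3, 2, 15]
  let l := [0, 12, 5, 1, 11, 13, 2, 13, 1, 3, 2, 15]
  ([p 0 1 (c 0 b) (c 1 a), p 0 0 (c 0 a) (p 2 0 (c 2 [2, 1, 5, 3, 7, 2]) (c 1 [0, 6, 3, 2, 1, 6,
   3, 8, 2])), c 0 f, p 0 1 (c 0 b) (c 1 a), c 0 f, p 0 1 (c 0 b) (c 1 a)], [c 0 g, c 0 g, e 15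
   4 13, c 0 [0, 14, 16, 1, 17, 6, 2, 1, 17, 3, 19, 2], c 0 i, c 0 i], [c 0 [0, 12, 9, 1, 7, 13,
   2, 13, 1, 3, 2, 15, 4, 1, 13, 5, 4, 2, 8, 5, 3, 9, 4, 3, 10, 1, 11, 11, 6, 2], c 0 [0, 12, 9,
   1, 7, 13, 2, 13, 1, 3, 2, 15, 4, 1, 13, 5, 4, 2, 8, 5, 3, 9, 4, 3, 11, 5, 1], c 0 [0, 12, 9,
   1, 7, 13, 2, 13, 1, 3, 2, 15, 4, 1, 13, 5, 4, 2, 6, 4, 1, 7, 2, 19, 10, 6, 3, 11, 4, 2], c 0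
   [0, 12, 9, 1, 7, 13, 2, 13, 1, 3, 2, 15, 4, 1, 13, 5, 4, 2, 10, 9, 1, 11, 2, 4], c 0 [0, 12,
   9, 1, 7, 13, 2, 13, 1, 3, 2, 15, 4, 1, 13, 5, 4, 2, 7, 1, 18, 8, 6, 1, 9, 2, 4, 10, 1, 7, 11,
   4, 2], c 0 j, c 0 j, c 0 [0, 12, 9, 1, 7, 13, 2, 13, 1, 3, 2, 15, 4, 1, 13, 5, 4, 2, 6, 17,
   1, 7, 2, 4, 8, 7, 1, 9, 2, 5, 10, 1, 4, 11, 19, 2], c 0 [0, 12, 9, 1, 7, 13, 2, 9, 1, 3, 2,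
   15, 4, 1, 13, 5, 4, 2, 6, 4, 1, 7, 2, 19, 8, 7, 1, 9, 2, 5, 10, 1, 8, 11, 23, 2], c 0 [0, 12,
   9, 1, 7, 13, 2, 9, 1, 3, 2, 15, 4, 1, 13, 5, 4, 2, 6, 4, 1, 10, 5, 2, 11, 3, 12], c 0 [0, 12,
   9, 1, 7, 13, 2, 13, 1, 3, 2, 15, 4, 1, 13, 5, 4, 2, 6, 4, 1, 7, 2, 19, 8, 7, 1, 9, 2, 5, 10,
   1, 8], c 0 [0, 12, 9, 1, 7, 13, 2, 13, 1, 3, 2, 15, 4, 1, 13, 5, 4, 2, 6, 17, 1, 7, 2, 4, 8,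
   7, 1, 9, 2, 5, 10, 1, 4, 11, 15, 2], c 0 [0, 12, 9, 1, 11, 13, 2, 13, 1, 3, 2, 15], c 1 k, c
   1 l, c 1 [0, 12, 9, 1, 5, 13, 2, 13, 1, 3, 2, 11, 5, 8, 1, 6, 16, 1, 7, 2, 3, 10, 1, 7, 11,
   12, 2], c 1 [0, 12, 3, 1, 11, 13, 2, 13, 1, 4, 3, 1, 7, 16, 1, 8, 2, 16, 9, 14, 3, 10, 1, 10,
   11, 7, 2], c 0 k, c 1 l, p 0 1 (p 0 5 (c 0 [0, 14, 11, 2, 1, 14, 3, 12, 2, 6, 3, 16, 7, 2, 4,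
   8, 5, 2, 9, 4, 6, 10, 1, 7, 11, 9, 2]) (c 1 [0, 14, 1, 2, 1, 14, 3, 12, 2, 5, 5, 1, 6, 17, 1,
   7, 2, 3, 8, 2, 3, 9, 4, 5, 10, 1, 8, 11, 6, 2])) (p 2 4 (c 2 [1, 12, 14, 2, 14, 1, 3, 2, 12,
   6, 16, 3, 7, 4, 2, 8, 2, 5, 9, 6, 4, 10, 1, 8, 11, 14, 2]) (c 3 [1, 1, 14, 2, 14, 1, 3, 2,
   12, 4, 1, 5, 6, 1, 17, 7, 3, 2, 8, 3, 2, 9, 5, 4, 10, 1, 5, 11, 10, 2])), p 0 5 (c 0 [0, 13,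
   10, 1, 2, 14, 2, 14, 1, 3, 2, 12, 6, 16, 3, 7, 4, 2, 10, 1, 10]) (c 1 [0, 13, 1, 1, 8, 14, 2,
   14, 1, 3, 2, 12, 5, 3, 1, 6, 17, 1, 7, 2, 3, 10, 1, 8]), c 0 [0, 12, 5, 1, 11, 13, 2, 13, 1,
   3, 2, 11, 4, 1, 4, 6, 1, 16, 7, 3, 2, 10, 1, 3], c 0 [0, 12, 9, 1, 11, 13, 2, 13, 1, 3, 2,
   11, 6, 15, 3, 7, 4, 2, 10, 1, 6, 11, 11, 2], p 0 1 (c 0 [0, 13, 6, 2, 1, 13, 3, 11, 2, 4, 1,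
   7, 5, 5, 2, 6, 17, 1, 7, 2, 4, 10, 1, 11, 11, 4, 2]) (c 1 [1, 11, 13, 2, 13, 1, 3, 2, 11, 4,
   1, 4, 6, 1, 16, 7, 3, 2, 10, 1, 7, 11, 7, 2])])

/-- Certificates for the congruence with six parallelograms. -/
def modelCerts : List Cert × List Cert × List Cert :=
  let e := Cert.empty; let h := Cert.hit; let s := Cert.sing; let p := Cert.split
  let d := Cert.chain
  let c := fun k L => d k L (h k)
  let a := [2, 15, 11, 3, 17, 14]
  let b := [2, 16, 13, 3, 12, 17]
  let f := [2, 12, 15, 3, 16, 15]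
  let g := [2, 15, 6, 3, 17, 14]
  let i := [0, 5, 2, 2, 3, 2, 3, 5, 2]
  let j := [0, 6, 3, 2, 4, 2, 3, 3, 8]
  let k := [0, 12, 9, 1, 4, 7, 2, 11, 1, 3, 13, 3]
  let l := [0, 13, 10, 2, 11, 2, 3, 9, 2]
  let m := [0, 8, 9, 1, 12, 7, 2, 11, 1, 3, 9, 3]
  let n := [0, 4, 9, 1, 12, 7, 2, 11, 1, 3, 9, 3]
  let o := [0, 8, 3, 1, 12, 11, 2, 2, 13, 3, 13, 3]
  let q := [0, 8, 9, 1, 12, 5, 2, 11, 1, 3, 2, 11]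
  ([p 0 1 (p 0 2 (c 0 [0, 6, 3, 3, 3, 7]) (p 2 1 (p 2 2 (c 2 [0, 3, 5]) (c 1 [0, 1, 5, 1, 3, 2,
   2, 7, 1])) (c 3 [1, 6, 3, 2, 2, 7, 3, 5, 3]))) (c 3 [0, 3, 1, 1, 5, 4, 2, 2, 6, 3, 6, 3]), p
   1 0 (p 1 1 (p 1 3 (c 1 [2, 4, 2]) (p 0 1 (c 0 [0, 4, 2, 3, 2, 5]) (c 2 [1, 2, 6, 2, 2, 4, 3,
   8, 3]))) (c 2 [0, 1, 5, 1, 6, 5, 2, 2, 7, 3, 2, 4])) (p 2 0 (c 2 [1, 2, 4, 2, 2, 3, 3, 6, 3])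
   (p 0 0 (p 0 3 (c 0 [2, 2, 4]) (c 4 [0, 8, 1, 1, 2, 4, 3, 5, 2])) (c 3 [0, 7, 4, 2, 5, 2, 3,
   3, 9]))), p 2 1 (c 2 i) (p 1 1 (p 1 2 (c 1 [3, 5, 3]) (c 0 [0, 1, 4, 1, 3, 2, 2, 6, 1])) (c 3
   [1, 5, 4, 2, 2, 6, 3, 6, 3])), p 3 0 (c 3 [1, 4, 3, 2, 2, 5, 3, 5, 3]) (p 1 0 (p 1 3 (c 1 [2,
   4, 3]) (c 2 [0, 2, 1, 1, 2, 6, 3, 7, 2])) (c 0 j)), p 0 1 (c 0 i) (p 1 2 (c 1 [1, 1, 4, 3, 5,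
   3]) (c 2 [0, 1, 3, 1, 6, 2, 2, 2, 7])), p 3 3 (c 3 [0, 1, 2, 1, 5, 2, 2, 2, 6]) (p 1 0 (p 1 3
   (c 1 [1, 3, 5]) (c 2 [0, 2, 1, 1, 2, 6, 3, 1, 9])) (c 0 j))], [e 15 6 13, c 0 [2, 16, 13, 3,
   8, 15], s 6 [(0, 10, 16), (0, 13, 7), (0, 16, 13), (0, 7, 16)], c 0 [2, 16, 9, 3, 16, 15], s
   0 [(0, 6, 13), (0, 13, 15), (0, 8, 15), (0, 11, 16)], c 0 a, c 0 b, c 0 a, c 0 [2, 15, 14, 3,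
   17, 13], c 0 f, s 1 [(0, 15, 8), (0, 13, 15), (0, 8, 13), (0, 11, 16)], s 6 [(0, 15, 8), (0,
   16, 9), (0, 14, 5), (0, 15, 14)], e 15 4 13, e 15 4 13, s 7 [(0, 10, 16), (0, 8, 15), (0, 8,
   15), (0, 15, 14)], s 3 [(0, 6, 13), (0, 13, 15), (0, 16, 12), (0, 15, 6)], c 0 [2, 8, 13, 3,
   16, 15], s 7 [(0, 15, 8), (0, 16, 9), (0, 8, 9), (0, 15, 14)], s 2 [(0, 15, 8), (0, 13, 15),
   (0, 8, 13), (0, 11, 16)], c 0 [2, 15, 14, 3, 17, 6], c 0 a, e 15 12 5, c 0 g, s 4 [(0, 6,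
   12), (0, 13, 15), (0, 16, 12), (0, 15, 6)], e 15 12 5, c 0 f, c 0 a, s 8 [(0, 10, 16), (0,
   16, 7), (0, 16, 13), (0, 7, 10)], c 0 g, s 8 [(0, 6, 16), (0, 16, 9), (0, 16, 13), (0, 13,
   6)], c 0 b, c 0 g, s 5 [(0, 15, 8), (0, 13, 15), (0, 16, 12), (0, 15, 8)], e 15 8 5, c 0 f, c
   0 b, e 15 6 13], [c 1 [0, 12, 9, 1, 4, 7, 2, 11, 1, 3, 2, 15], c 2 k, p 2 0 (p 2 1 (c 2 [2,
   11, 1, 3, 9, 3]) (c 8 [1, 13, 12, 2, 2, 14, 3, 14, 3])) (c 5 l), c 1 k, p 0 1 (c 0 l) (p 3 2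
   (c 3 [1, 1, 12, 3, 9, 3]) (c 7 [0, 1, 11, 1, 14, 2, 2, 2, 15])), p 5 2 (c 5 [0, 9, 1, 1, 2,
   12, 3, 1, 15]) (p 3 2 (c 3 [0, 2, 11, 1, 2, 9]) (c 7 [0, 1, 11, 1, 14, 2, 2, 13, 1])), c 0 m,
   c 2 m, c 1 [0, 12, 9, 1, 12, 7, 2, 2, 9, 3, 2, 15], c 1 n, c 2 [0, 4, 9, 1, 12, 11, 2, 2, 13,
   3, 9, 3], c 2 n, c 1 [0, 8, 9, 1, 12, 11, 2, 2, 13, 3, 2, 11], c 1 [0, 12, 9, 1, 12, 11, 2,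
   2, 13, 3, 2, 11], c 2 [0, 12, 9, 1, 12, 11, 2, 7, 1, 3, 2, 11], c 1 [0, 12, 9, 1, 12, 5, 2,
   11, 1, 3, 2, 11], c 2 o, c 2 [0, 8, 9, 1, 12, 11, 2, 2, 13, 3, 13, 3], c 2 [0, 8, 9, 1, 12,
   11, 2, 7, 1, 3, 13, 3], c 1 q, c 2 o, c 1 [0, 8, 5, 1, 12, 11, 2, 7, 1, 3, 13, 3], c 0 q, c 2
   [0, 8, 3, 1, 12, 11, 2, 2, 13, 3, 2, 11]])

/-- Certificates for its inverse. -/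
def modelCertsInv : List Cert × List Cert × List Cert :=
  let e := Cert.empty; let h := Cert.hit; let p := Cert.split; let d := Cert.chain
  let c := fun k L => d k L (h k)
  let a := [0, 6, 16, 1, 17, 14, 2, 1, 17, 3, 19, 2]
  let b := [0, 15, 14, 1, 15, 9, 2, 1, 15, 3, 17, 2]
  let f := [0, 6, 16, 1, 17, 14, 2, 1, 12, 3, 19, 2]
  let g := [0, 14, 16, 1, 17, 6, 2, 1, 17, 3, 19, 2]
  let i := [1, 1, 6, 3, 1, 4]
  let j := [1, 4, 1, 2, 3, 5]
  let k := [0, 7, 14, 1, 15, 17, 2, 1, 13, 3, 17, 2]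
  let l := [0, 14, 16, 1, 17, 6, 2, 1, 9, 3, 19, 2]
  let m := [0, 7, 14, 1, 15, 17, 2, 1, 15, 3, 13, 2]
  let n := [0, 9, 11, 1, 7, 13, 2, 13, 8, 3, 2, 12]
  let o := [0, 9, 11, 1, 11, 9, 2, 13, 1, 3, 11, 12]
  ([c 0 [0, 1, 3, 1, 3, 5, 2, 5, 4, 3, 7, 4], p 0 1 (c 0 [0, 2, 4, 2, 5, 4, 3, 3, 4]) (c 1 [1,
   3, 5, 2, 2, 4, 3, 7, 4]), p 0 1 (p 0 2 (c 0 [0, 3, 1, 3, 3, 4]) (p 3 0 (c 3 [2, 1, 5]) (c 2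
   [0, 2, 6, 2, 7, 2]))) (p 1 2 (c 1 i) (c 4 j)), p 0 0 (p 0 2 (c 0 i) (c 4 j)) (p 2 0 (p 2 3 (c
   2 [2, 2, 5]) (c 5 [0, 2, 1, 3, 8, 1])) (p 1 3 (c 1 [0, 1, 6, 2, 1, 6]) (p 5 0 (c 5 [3, 8, 1])
   (c 3 [0, 5, 2, 3, 2, 6])))), p 0 0 (c 0 [1, 3, 5, 2, 5, 4, 3, 7, 3]) (p 2 0 (c 2 [2, 5, 2, 3,
   7, 4]) (c 1 [0, 3, 5, 2, 6, 2, 3, 8, 2])), p 1 0 (p 1 2 (c 1 [1, 1, 6, 3, 7, 3]) (c 3 [0, 1,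
   2, 1, 5, 2, 2, 7, 1])) (p 6 0 (p 6 2 (c 6 [3, 7, 2]) (p 0 1 (c 0 [0, 2, 3, 2, 8, 2]) (c 3 [1,
   4, 2, 2, 8, 1]))) (p 4 0 (p 4 2 (c 4 [3, 8, 2]) (c 0 [1, 3, 1, 2, 8, 1])) (p 2 2 (c 2 [0, 5,
   1, 3, 9, 1]) (c 5 [0, 1, 7, 2, 8, 3]))))], [e 15 12 5, c 0 [0, 14, 16, 1, 17, 6, 2, 1, 17, 3,
   11, 2], c 0 f, c 0 b, c 0 g, c 0 b, e 15 4 13, c 0 [0, 7, 14, 1, 15, 17, 2, 1, 7, 3, 13, 2],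
   e 15 4 13, e 15 6 13, c 0 g, e 15 4 13, c 0 g, c 0 [0, 6, 16, 1, 17, 14, 2, 1, 9, 3, 15, 2],
   c 0 k, c 0 [0, 7, 14, 1, 15, 17, 2, 1, 15, 3, 17, 2], e 15 6 13, e 15 4 13, c 0 l, e 15 4 13,
   c 0 m, c 0 [0, 14, 16, 1, 17, 6, 2, 1, 17, 3, 15, 2], e 15 12 5, c 0 [0, 6, 16, 1, 17, 14, 2,
   1, 17, 3, 15, 2], c 0 k, e 15 12 5, e 15 4 13, e 15 4 13, c 0 b, c 0 f, c 0 [0, 15, 14, 1,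
   15, 9, 2, 1, 13, 3, 17, 2], e 15 12 5, c 0 b, e 15 4 13, c 0 l, c 0 m, c 0 a, e 15 4 13, c 0
   a, c 0 b, e 15 6 13, c 0 a, e 14 13 7, c 0 f, e 15 12 5, c 0 a, c 0 a, e 15 6 13, c 0 a, e 15
   12 5], [c 1 n, p 1 1 (c 1 [0, 10, 12, 2, 13, 8, 3, 7, 2]) (c 7 [1, 7, 13, 2, 2, 8, 3, 2,
   12]), p 4 1 (c 4 [0, 10, 12, 2, 1, 8, 3, 15, 2]) (c 8 [1, 7, 13, 2, 13, 1, 3, 15, 12]), p 3 1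
   (c 3 [0, 10, 12, 2, 1, 8, 3, 3, 12]) (c 6 [1, 11, 13, 2, 5, 1, 3, 15, 12]), c 0 n, c 2 [0, 9,
   11, 1, 11, 13, 2, 9, 1, 3, 15, 12], c 0 o, c 2 o, c 1 [0, 9, 11, 1, 11, 9, 2, 13, 12, 3, 2,
   12], c 0 [0, 9, 11, 1, 11, 13, 2, 13, 12, 3, 2, 8], p 0 0 (c 0 [1, 11, 9, 2, 13, 1, 3, 2, 6])
   (c 9 [0, 10, 12, 2, 13, 2, 3, 11, 12]), p 2 0 (c 2 [1, 11, 13, 2, 13, 12, 3, 2, 6]) (p 11 0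
   (c 11 [2, 13, 2, 3, 11, 2]) (c 7 [0, 11, 13, 2, 14, 2, 3, 16, 2]))])

theorem surfD_good : surfD.goodCheck = true := by decide +kernel

theorem surfD₀_good : surfD₀.goodCheck = true := by decide +kernel

theorem modelD_good : modelD.goodCheck = true := by decide +kernel

theorem map_check : PD.compatCheck surfD surfD stretch shrink mapParts mapCerts.1 mapCerts.2.1
    mapCerts.2.2 = true := by
  decide +kernel

theorem map_check_inv : PD.compatCheck surfD surfD shrink stretch
    (mapParts.map (PartD.inv shrink)) mapCertsInv.1 mapCertsInv.2.1
    mapCertsInv.2.2 = true := by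
  decide +kernel

theorem map_check₀ : PD.compatCheck surfD₀ surfD₀ stretch shrink mapParts mapCerts.1 mapCerts.2.1
    mapCerts.2.2 = true := by
  decide +kernel

theorem map_check_inv₀ : PD.compatCheck surfD₀ surfD₀ shrink stretch
    (mapParts.map (PartD.inv shrink)) mapCertsInv.1 mapCertsInv.2.1
    mapCertsInv.2.2 = true := by
  decide +kernel

theorem model_check : PD.compatCheck surfD modelD onePt onePt modelParts modelCerts.1 modelCerts.2.1
    modelCerts.2.2 = true := by
  decide +kernel

theorem model_check_inv : PD.compatCheck modelD surfD onePt onePt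
    (modelParts.map (PartD.inv onePt)) modelCertsInv.1 modelCertsInv.2.1
    modelCertsInv.2.2 = true := by
  decide +kernel

end AY

namespace AY

/-! ### Blown-up parallelograms are octagons -/

/-- A truncated square. -/
def Oct : Set (ℝ × ℝ) := {p | |p.1| ≤ 1 ∧ |p.2| ≤ 1 ∧ |p.1| + |p.2| ≤ 3 / 2}

/-- A parallelogram with centre `c` and half-sides `e` and `f`. -/
structure Frame where
  c : ℂ
  e : ℂ
  f : ℂ
  pos : 0 < e.re * f.im - e.im * f.re

/-- A sign. -/
def sg (b : Bool) : ℝ := if b then 1 else -1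

theorem sg_cases (b : Bool) : sg b = 1 ∨ sg b = -1 := by cases b <;> simp [sg]

theorem sg_mul_self (b : Bool) : sg b * sg b = 1 := by cases b <;> simp [sg]

/-- The distance (in the `ℓ¹`-norm) of a point of the square from a corner. -/
def cdist (b : Bool × Bool) (p : ℝ × ℝ) : ℝ := (1 - sg b.1 * p.1) + (1 - sg b.2 * p.2)

/-- A corner of the square. -/
def corner (b : Bool × Bool) : ℝ × ℝ := (sg b.1, sg b.2)

/-- A unit vector, in the `ℓ¹`-norm, pointing from a corner into the square. -/
def Inward (b : Bool × Bool) (u : ℝ × ℝ) : Prop :=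
  sg b.1 * u.1 ≤ 0 ∧ sg b.2 * u.2 ≤ 0 ∧ -(sg b.1 * u.1) - sg b.2 * u.2 = 1

theorem cdist_add_smul {b : Bool × Bool} {u : ℝ × ℝ} (hu : Inward b u) (r : ℝ) :
    cdist b (corner b + r • u) = r := by
  obtain ⟨-, -, h⟩ := hu
  have h1 := sg_mul_self b.1
  have h2 := sg_mul_self b.2
  simp only [cdist, corner, Prod.fst_add, Prod.snd_add, Prod.smul_fst, Prod.smul_snd, smul_eq_mul]
  linear_combination r * h - h1 - h2

theorem two_le_cdist {b b' : Bool × Bool} (h : b ≠ b') {p : ℝ × ℝ} (h1 : |p.1| ≤ 1)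
    (h2 : |p.2| ≤ 1) : 2 ≤ cdist b p + cdist b' p := by
  rw [abs_le] at h1 h2
  obtain ⟨b1, b2⟩ := b
  obtain ⟨c1, c2⟩ := b'
  revert h
  cases b1 <;> cases b2 <;> cases c1 <;> cases c2 <;> simp [cdist, sg] <;> linarith

theorem mem_Oct_iff {p : ℝ × ℝ} : p ∈ Oct ↔ |p.1| ≤ 1 ∧ |p.2| ≤ 1 ∧ ∀ b, 1 / 2 ≤ cdist b p := by
  refine and_congr_right fun h1 => and_congr_right fun h2 => ?_
  simp only [Prod.forall, Bool.forall_bool, cdist, sg, if_true]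
  simp only [Bool.false_eq_true, if_false]
  constructor
  · intro h
    have := abs_le.1 (le_refl |p.1|); have := abs_le.1 (le_refl |p.2|)
    refine ⟨⟨?_, ?_⟩, ?_, ?_⟩ <;> linarith
  · rintro ⟨⟨h3, h4⟩, h5, h6⟩
    rcases abs_cases p.1 with h | h <;> rcases abs_cases p.2 with h' | h' <;> linarith

/-- Pushing a point of the square away from the corners. -/
def push (p : ℝ × ℝ) (u : Bool × Bool → ℝ × ℝ) : ℝ × ℝ :=
  p + ∑ b, (max 0 (1 - cdist b p) / 2) • u b

theorem push_near {p : ℝ × ℝ} {u : Bool × Bool → ℝ × ℝ} (h1 : |p.1| ≤ 1) (h2 : |p.2| ≤ 1)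
    {b : Bool × Bool} (hb : cdist b p ≤ 1) (hp : p = corner b + cdist b p • u b) :
    push p u = corner b + ((1 + cdist b p) / 2) • u b := by
  rw [push, Finset.sum_eq_single b]
  · rw [max_eq_right (by linarith)]
    generalize cdist b p = d at hp
    rw [hp, add_assoc, ← add_smul]
    congr 2; ring
  · intro b' _ hb'
    have := two_le_cdist hb' h1 h2
    rw [max_eq_left (by linarith)]; simp
  · simp

theorem push_far {p : ℝ × ℝ} {u : Bool × Bool → ℝ × ℝ} (h : ∀ b, 1 ≤ cdist b p) :
    push p u = p := by
  rw [push, Finset.sum_eq_zero, add_zero]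
  intro b _
  rw [max_eq_left (by linarith [h b])]; simp

theorem inward_in_square {b : Bool × Bool} {u : ℝ × ℝ} (hu : Inward b u) {r : ℝ} (h0 : 0 ≤ r)
    (h1 : r ≤ 1) : |(corner b + r • u).1| ≤ 1 ∧ |(corner b + r • u).2| ≤ 1 := by
  obtain ⟨h2, h3, h4⟩ := hu
  simp only [corner, Prod.fst_add, Prod.snd_add, Prod.smul_fst, Prod.smul_snd, smul_eq_mul, abs_le]
  have k1 : 0 ≤ -(sg b.1 * u.1) := by linarith
  have k2 : 0 ≤ -(sg b.2 * u.2) := by linarith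
  have m1 := mul_nonneg h0 k1
  have m2 := mul_nonneg h0 k2
  have m3 := mul_le_mul h1 (by linarith : -(sg b.1 * u.1) ≤ 1) k1 zero_le_one
  have m4 := mul_le_mul h1 (by linarith : -(sg b.2 * u.2) ≤ 1) k2 zero_le_one
  rcases sg_cases b.1 with e1 | e1 <;> rcases sg_cases b.2 with e2 | e2 <;>
    rw [e1] at m1 m3 ⊢ <;> rw [e2] at m2 m4 ⊢ <;> refine ⟨⟨?_, ?_⟩, ?_, ?_⟩ <;> linarith

/-- A point of the square with compatible directions at the corners. -/
structure Dirs (p : ℝ × ℝ) (u : Bool × Bool → ℝ × ℝ) : Prop where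
  h1 : |p.1| ≤ 1
  h2 : |p.2| ≤ 1
  inw : ∀ b, Inward b (u b)
  eq : ∀ b, p = corner b + cdist b p • u b

theorem cdist_nonneg {p : ℝ × ℝ} (h1 : |p.1| ≤ 1) (h2 : |p.2| ≤ 1) (b : Bool × Bool) :
    0 ≤ cdist b p := by
  rw [abs_le] at h1 h2
  rcases sg_cases b.1 with e1 | e1 <;> rcases sg_cases b.2 with e2 | e2 <;>
    rw [cdist, e1, e2] <;> linarith

theorem Dirs.push_mem {p : ℝ × ℝ} {u : Bool × Bool → ℝ × ℝ} (h : Dirs p u) : push p u ∈ Oct := by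
  by_cases hb : ∃ b, cdist b p ≤ 1
  · obtain ⟨b, hb⟩ := hb
    have h0 := cdist_nonneg h.h1 h.h2 b
    have hs := inward_in_square (h.inw b) (r := (1 + cdist b p) / 2) (by linarith) (by linarith)
    rw [push_near h.h1 h.h2 hb (h.eq b), mem_Oct_iff]
    refine ⟨hs.1, hs.2, fun b' => ?_⟩
    have h3 := cdist_add_smul (h.inw b) ((1 + cdist b p) / 2)
    by_cases hbb : b' = b
    · rw [hbb, h3]; linarith
    · have := two_le_cdist hbb hs.1 hs.2
      rw [h3] at this
      linarith
  · push Not at hb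
    rw [push_far fun b => (hb b).le, mem_Oct_iff]
    exact ⟨h.h1, h.h2, fun b => by linarith [hb b]⟩

theorem Dirs.cdist_push {p : ℝ × ℝ} {u : Bool × Bool → ℝ × ℝ} (h : Dirs p u) (b : Bool × Bool) :
    (cdist b (push p u) < 1 ↔ cdist b p < 1) ∧
      (cdist b p < 1 → cdist b (push p u) = (1 + cdist b p) / 2) := by
  have key : cdist b p < 1 → cdist b (push p u) = (1 + cdist b p) / 2 := fun hb => by
    rw [push_near h.h1 h.h2 hb.le (h.eq b), cdist_add_smul (h.inw b)]
  refine ⟨⟨fun h1 => ?_, fun h1 => by rw [key h1]; linarith⟩, key⟩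
  by_contra h2
  push Not at h2
  by_cases hb : ∃ b, cdist b p < 1
  · obtain ⟨b', hb'⟩ := hb
    have hne : b ≠ b' := by rintro rfl; linarith
    have hs := inward_in_square (h.inw b') (r := (1 + cdist b' p) / 2)
      (by linarith [cdist_nonneg h.h1 h.h2 b']) (by linarith)
    have e := push_near h.h1 h.h2 hb'.le (h.eq b')
    rw [← e] at hs
    have := two_le_cdist hne hs.1 hs.2
    have h3 := cdist_add_smul (h.inw b') ((1 + cdist b' p) / 2)
    rw [← e] at h3
    linarith
  · push Not at hb
    rw [push_far hb] at h1
    linarith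

theorem Dirs.push_inj {p q : ℝ × ℝ} {u w : Bool × Bool → ℝ × ℝ} (hp : Dirs p u) (hq : Dirs q w)
    (h : push p u = push q w) : p = q ∧ ∀ b, p = corner b → u b = w b := by
  by_cases hb : ∃ b, cdist b p < 1
  · obtain ⟨b, hb⟩ := hb
    have hb' : cdist b q < 1 := by rw [← (hq.cdist_push b).1, ← h, (hp.cdist_push b).1]; exact hb
    have hd : cdist b p = cdist b q := by
      have h1 := (hp.cdist_push b).2 hb
      have h2 := (hq.cdist_push b).2 hb'
      rw [h] at h1
      linarith
    have h3 := push_near hp.h1 hp.h2 hb.le (hp.eq b)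
    have h4 := push_near hq.h1 hq.h2 hb'.le (hq.eq b)
    rw [h, h4, hd, add_right_inj] at h3
    have hu : u b = w b := by
      refine (smul_right_injective (ℝ × ℝ) (r := (1 + cdist b q) / 2) ?_ h3).symm
      have := cdist_nonneg hq.h1 hq.h2 b
      positivity
    refine ⟨by rw [hp.eq b, hq.eq b, hd, hu], fun b' hb'' => ?_⟩
    have : b' = b := by
      by_contra hne
      have h5 := two_le_cdist hne hp.h1 hp.h2
      have h6 : cdist b' p = 0 := by
        have := cdist_add_smul (hp.inw b') 0
        rwa [zero_smul, add_zero, ← hb''] at this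
      linarith
    rw [this, hu]
  · push Not at hb
    have hb' : ∀ b, 1 ≤ cdist b q := fun b => by
      by_contra h0
      push Not at h0
      rw [← (hq.cdist_push b).1, ← h, (hp.cdist_push b).1] at h0
      linarith [hb b]
    rw [push_far hb, push_far hb'] at h
    refine ⟨h, fun b hbp => ?_⟩
    have := cdist_add_smul (hp.inw b) 0
    rw [zero_smul, add_zero, ← hbp] at this
    linarith [hb b]

/-- Every point of the octagon is a pushed point. -/
theorem exists_push {o : ℝ × ℝ} (ho : o ∈ Oct) : ∃ p : ℝ × ℝ, |p.1| ≤ 1 ∧ |p.2| ≤ 1 ∧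
    ((∀ b, 0 < cdist b p) ∧ (∀ u, Dirs p u → push p u = o) ∨
      ∃ b, p = corner b ∧ ∃ w, Inward b w ∧ ∀ u, Dirs p u → u b = w → push p u = o) := by
  obtain ⟨h1, h2, h3⟩ := mem_Oct_iff.1 ho
  by_cases hb : ∃ b, cdist b o < 1
  · obtain ⟨b, hb⟩ := hb
    set r := cdist b o with hr
    have hr0 : 0 < r := by linarith [h3 b]
    set w : ℝ × ℝ := r⁻¹ • (o - corner b) with hw
    have how : o = corner b + r • w := by
      rw [hw, smul_smul, mul_inv_cancel₀ hr0.ne', one_smul]; abel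
    have hin : Inward b w := by
      have e1 : r * w.1 = o.1 - sg b.1 := by
        have := congrArg Prod.fst how
        simp only [corner, Prod.fst_add, Prod.smul_fst, smul_eq_mul] at this
        linarith
      have e2 : r * w.2 = o.2 - sg b.2 := by
        have := congrArg Prod.snd how
        simp only [corner, Prod.snd_add, Prod.smul_snd, smul_eq_mul] at this
        linarith
      rw [abs_le] at h1 h2
      have s1 := sg_mul_self b.1
      have s2 := sg_mul_self b.2
      have k1 : r * (sg b.1 * w.1) ≤ 0 := by
        have : r * (sg b.1 * w.1) = sg b.1 * o.1 - 1 := by linear_combination sg b.1 * e1 - s1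
        rcases sg_cases b.1 with e | e <;> rw [this, e] <;> linarith
      have k2 : r * (sg b.2 * w.2) ≤ 0 := by
        have : r * (sg b.2 * w.2) = sg b.2 * o.2 - 1 := by linear_combination sg b.2 * e2 - s2
        rcases sg_cases b.2 with e | e <;> rw [this, e] <;> linarith
      refine ⟨nonpos_of_mul_nonpos_right k1 hr0, nonpos_of_mul_nonpos_right k2 hr0, ?_⟩
      have : r * (-(sg b.1 * w.1) - sg b.2 * w.2) = r * 1 := by
        rw [mul_one]; conv_rhs => rw [hr, cdist]
        linear_combination -sg b.1 * e1 - sg b.2 * e2 + s1 + s2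
      exact mul_left_cancel₀ hr0.ne' this
    have hd0 : 0 ≤ 2 * r - 1 := by linarith [h3 b]
    have hd := cdist_add_smul hin (2 * r - 1)
    have hs := inward_in_square hin hd0 (by linarith)
    refine ⟨corner b + (2 * r - 1) • w, hs.1, hs.2, ?_⟩
    have key : ∀ u, Dirs (corner b + (2 * r - 1) • w) u → u b = w →
        push (corner b + (2 * r - 1) • w) u = o := by
      intro u hu hub
      rw [push_near hs.1 hs.2 (by rw [hd]; linarith) (hu.eq b), hub, hd, how]
      congr 2; ring
    rcases hd0.lt_or_eq with h0 | h0
    · refine .inl ⟨fun b' => ?_, fun u hu => key u hu ?_⟩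
      · by_cases hbb : b' = b
        · rw [hbb, hd]; exact h0
        · have := two_le_cdist hbb hs.1 hs.2
          rw [hd] at this
          linarith
      · have := hu.eq b
        rw [hd, add_right_inj] at this
        exact (smul_right_injective (ℝ × ℝ) h0.ne' this).symm
    · refine .inr ⟨b, by rw [← h0, zero_smul, add_zero], w, hin, key⟩
  · push Not at hb
    exact ⟨o, h1, h2, .inl ⟨fun b => by linarith [hb b], fun u _ => push_far hb⟩⟩

namespace Frame

variable (F : Frame)

/-- The first coordinate of a vector. -/
def lx (z : ℂ) : ℝ := (z.re * F.f.im - z.im * F.f.re) / (F.e.re * F.f.im - F.e.im * F.f.re)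

/-- The second coordinate of a vector. -/
def ly (z : ℂ) : ℝ := (F.e.re * z.im - F.e.im * z.re) / (F.e.re * F.f.im - F.e.im * F.f.re)

/-- The coordinates of a vector. -/
def vec (z : ℂ) : ℝ × ℝ := (F.lx z, F.ly z)

/-- The coordinates of a point. -/
def co (z : ℂ) : ℝ × ℝ := F.vec (z - F.c)

/-- The point with given coordinates. -/
def at_ (p : ℝ × ℝ) : ℂ := F.c + p.1 * F.e + p.2 * F.f

/-- The parallelogram. -/
def box : Set ℂ := {z | |(F.co z).1| ≤ 1 ∧ |(F.co z).2| ≤ 1}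

theorem vec_add (z w : ℂ) : F.vec (z + w) = F.vec z + F.vec w := by
  apply Prod.ext <;> simp [vec, lx, ly] <;> ring

theorem vec_sub (z w : ℂ) : F.vec (z - w) = F.vec z - F.vec w := by
  apply Prod.ext <;> simp [vec, lx, ly] <;> ring

theorem vec_smul (r : ℝ) (z : ℂ) : F.vec (r * z) = r • F.vec z := by
  apply Prod.ext <;> simp [vec, lx, ly] <;> ring

theorem vec_e : F.vec F.e = (1, 0) := by
  have := F.pos.ne'
  apply Prod.ext
  · simp [vec, lx, this]
  · simp only [vec, ly]; rw [div_eq_zero_iff]; left; ring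

theorem vec_f : F.vec F.f = (0, 1) := by
  have := F.pos.ne'
  apply Prod.ext
  · simp only [vec, lx]; rw [div_eq_zero_iff]; left; ring
  · simp [vec, ly, this]

theorem co_at (p : ℝ × ℝ) : F.co (F.at_ p) = p := by
  rw [co, at_, show F.c + p.1 * F.e + p.2 * F.f - F.c = p.1 * F.e + p.2 * F.f by ring,
    vec_add, vec_smul, vec_smul, vec_e, vec_f]
  simp

theorem vec_eq (z : ℂ) : z = (F.vec z).1 * F.e + (F.vec z).2 * F.f := by
  have := F.pos.ne'
  obtain ⟨D, hD⟩ : ∃ D, D = F.e.re * F.f.im - F.e.im * F.f.re := ⟨_, rfl⟩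
  rw [← hD] at this
  apply Complex.ext
  · simp only [vec, Complex.add_re, Complex.mul_re, Complex.ofReal_re, Complex.ofReal_im, lx, ly,
      ← hD]
    field_simp
    rw [hD]; ring
  · simp only [vec, Complex.add_im, Complex.mul_im, Complex.ofReal_re, Complex.ofReal_im, lx, ly,
      ← hD]
    field_simp
    rw [hD]; ring

theorem at_co (z : ℂ) : F.at_ (F.co z) = z := by
  rw [at_, add_assoc, co, ← F.vec_eq]; ring

theorem vec_ne_zero {z : ℂ} (hz : z ≠ 0) : F.vec z ≠ 0 := by
  intro h
  apply hz
  rw [F.vec_eq z, h]; simp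

theorem continuous_vec : Continuous F.vec := by
  unfold vec lx ly
  exact (by fun_prop : Continuous fun z : ℂ =>
    ((z.re * F.f.im - z.im * F.f.re) / (F.e.re * F.f.im - F.e.im * F.f.re),
      (F.e.re * z.im - F.e.im * z.re) / (F.e.re * F.f.im - F.e.im * F.f.re)))

theorem continuous_co : Continuous F.co := F.continuous_vec.comp (by fun_prop)

theorem continuous_at : Continuous F.at_ := by unfold at_; fun_prop

/-- The corner `b` is the blown-up point with index `k b`, and no other blown-up points lie in the
parallelogram. -/
structure Corners {n : ℕ} (v : Fin n → ℂ) (k : Bool × Bool → Fin n) : Prop where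
  inj : Function.Injective v
  eq : ∀ b, v (k b) = F.at_ (corner b)
  only : ∀ l, v l ∈ F.box → ∃ b, l = k b

variable {n : ℕ} {v : Fin n → ℂ} {k : Bool × Bool → Fin n}

/-- The normalized coordinates of a vector. -/
def unit (u : ℂ) : ℝ × ℝ := (|(F.vec u).1| + |(F.vec u).2|)⁻¹ • F.vec u

/-- The map from the blown-up parallelogram to the octagon. -/
def toOct (k : Bool × Bool → Fin n) (x : ℂ × (Fin n → ℂ)) : ℝ × ℝ :=
  push (F.co x.1) fun b => F.unit (x.2 (k b))

theorem abs_add_pos {u : ℂ} (hu : u ≠ 0) : 0 < |(F.vec u).1| + |(F.vec u).2| := by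
  have := F.vec_ne_zero hu
  by_contra h
  have h1 := abs_nonneg (F.vec u).1
  have h2 := abs_nonneg (F.vec u).2
  apply this
  apply Prod.ext
  · exact abs_eq_zero.1 (by linarith)
  · exact abs_eq_zero.1 (by linarith)

theorem inward_unit {b : Bool × Bool} {u : ℂ} (hu : u ≠ 0) {r : ℝ} (hr : 0 < r)
    (h : F.at_ (corner b) + r * u ∈ F.box) : Inward b (F.unit u) := by
  have h1 : F.co (F.at_ (corner b) + r * u) = corner b + r • F.vec u := by
    rw [co, show F.at_ (corner b) + r * u - F.c = (F.at_ (corner b) - F.c) + r * u by ring,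
      vec_add, vec_smul]
    congr 1
    exact F.co_at _
  obtain ⟨h2, h3⟩ := h
  rw [h1] at h2 h3
  simp only [corner, Prod.fst_add, Prod.snd_add, Prod.smul_fst, Prod.smul_snd, smul_eq_mul,
    abs_le] at h2 h3
  have hp := F.abs_add_pos hu
  have k1 : sg b.1 * (F.vec u).1 ≤ 0 := by
    rcases sg_cases b.1 with e | e <;> rw [e] at h2 ⊢
    · nlinarith [nonpos_of_mul_nonpos_right (by linarith : r * (F.vec u).1 ≤ 0) hr]
    · have := nonneg_of_mul_nonneg_right (by linarith : 0 ≤ r * (F.vec u).1) hr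
      linarith
  have k2 : sg b.2 * (F.vec u).2 ≤ 0 := by
    rcases sg_cases b.2 with e | e <;> rw [e] at h3 ⊢
    · nlinarith [nonpos_of_mul_nonpos_right (by linarith : r * (F.vec u).2 ≤ 0) hr]
    · have := nonneg_of_mul_nonneg_right (by linarith : 0 ≤ r * (F.vec u).2) hr
      linarith
  have e1 : |(F.vec u).1| = -(sg b.1 * (F.vec u).1) := by
    rw [← abs_of_nonpos k1, abs_mul]
    rcases sg_cases b.1 with e | e <;> simp [e]
  have e2 : |(F.vec u).2| = -(sg b.2 * (F.vec u).2) := by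
    rw [← abs_of_nonpos k2, abs_mul]
    rcases sg_cases b.2 with e | e <;> simp [e]
  have hi := inv_pos.2 hp
  simp only [Inward, unit, Prod.smul_fst, Prod.smul_snd, smul_eq_mul]
  refine ⟨?_, ?_, ?_⟩
  · have := mul_nonpos_of_nonneg_of_nonpos hi.le k1
    linarith
  · have := mul_nonpos_of_nonneg_of_nonpos hi.le k2
    linarith
  · have : (|(F.vec u).1| + |(F.vec u).2|)⁻¹ * (|(F.vec u).1| + |(F.vec u).2|) = 1 :=
      inv_mul_cancel₀ hp.ne'
    rw [← this]
    conv_rhs => rw [e1, e2]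
    rw [e1, e2]; ring

theorem dirs (C : F.Corners v k) {x : ℂ × (Fin n → ℂ)} (hx : x ∈ blowUp v F.box) :
    Dirs (F.co x.1) fun b => F.unit (x.2 (k b)) := by
  have hi : ∀ b, Inward b (F.unit (x.2 (k b))) := fun b => by
    obtain ⟨h1, -, r, hr, h3⟩ := hx.2 (k b)
    rw [C.eq] at h3
    exact F.inward_unit (by intro h; simp [h] at h1) hr h3
  refine ⟨hx.1.1, hx.1.2, hi, fun b => ?_⟩
  obtain ⟨h1, h2, -⟩ := hx.2 (k b)
  have hu : x.2 (k b) ≠ 0 := by intro h; simp [h] at h1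
  have hp := F.abs_add_pos hu
  have h3 : F.co x.1 = corner b + (‖x.1 - v (k b)‖ * (|(F.vec (x.2 (k b))).1| +
      |(F.vec (x.2 (k b))).2|)) • F.unit (x.2 (k b)) := by
    rw [unit, smul_smul, mul_assoc, mul_inv_cancel₀ hp.ne', mul_one, ← vec_smul]
    rw [← sub_eq_iff_eq_add', ← F.co_at (corner b), ← C.eq, co, co, ← vec_sub]
    congr 1
    rw [sub_sub_sub_cancel_right, sub_eq_iff_eq_add']
    exact h2
  have h4 := cdist_add_smul (hi b) (‖x.1 - v (k b)‖ * (|(F.vec (x.2 (k b))).1| +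
      |(F.vec (x.2 (k b))).2|))
  rw [← h3] at h4
  rw [h4]; exact h3

theorem unit_inj {u w : ℂ} (hu : ‖u‖ = 1) (hw : ‖w‖ = 1) (h : F.unit u = F.unit w) : u = w := by
  have hu0 : u ≠ 0 := by intro h; simp [h] at hu
  have hw0 : w ≠ 0 := by intro h; simp [h] at hw
  have pu := inv_pos.2 (F.abs_add_pos hu0)
  have pw := inv_pos.2 (F.abs_add_pos hw0)
  have : ((|(F.vec u).1| + |(F.vec u).2|)⁻¹ : ℝ) * u = ((|(F.vec w).1| + |(F.vec w).2|)⁻¹ : ℝ) * w := by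
    rw [F.vec_eq (((|(F.vec u).1| + |(F.vec u).2|)⁻¹ : ℝ) * u), vec_smul,
      F.vec_eq (((|(F.vec w).1| + |(F.vec w).2|)⁻¹ : ℝ) * w), vec_smul]
    rw [unit, unit] at h
    rw [h]
  rw [← nrm_of_norm_one hu, ← nrm_of_norm_one hw, ← nrm_real_mul pu, this, nrm_real_mul pw]

theorem exists_unit {b : Bool × Bool} {w : ℝ × ℝ} (hw : Inward b w) : ∃ u : ℂ, ‖u‖ = 1 ∧
    F.unit u = w ∧ ∃ r : ℝ, 0 < r ∧ F.at_ (corner b) + r * u ∈ F.box := by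
  set z : ℂ := w.1 * F.e + w.2 * F.f with hz
  have hv : F.vec z = w := by rw [hz, vec_add, vec_smul, vec_smul, vec_e, vec_f]; simp
  have hw1 : |w.1| + |w.2| = 1 := by
    obtain ⟨h1, h2, h3⟩ := hw
    rw [← h3]
    have e1 : |w.1| = -(sg b.1 * w.1) := by
      rw [← abs_of_nonpos h1, abs_mul]
      rcases sg_cases b.1 with e | e <;> simp [e]
    have e2 : |w.2| = -(sg b.2 * w.2) := by
      rw [← abs_of_nonpos h2, abs_mul]
      rcases sg_cases b.2 with e | e <;> simp [e]
    rw [e1, e2]; ring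
  have hz0 : z ≠ 0 := by
    intro h
    rw [← hv, h] at hw1
    have : F.vec 0 = 0 := by simpa using F.vec_sub 0 0
    rw [this] at hw1
    simp at hw1
  have hn := norm_pos_iff.2 hz0
  have hzn : nrm z = ((‖z‖⁻¹ : ℝ) : ℂ) * z := by rw [nrm]; push_cast; field_simp
  refine ⟨nrm z, norm_nrm hz0, ?_, ‖z‖, hn, ?_⟩
  · rw [unit, hzn, vec_smul, hv]
    simp only [Prod.smul_fst, Prod.smul_snd, smul_eq_mul, abs_mul, abs_inv, abs_norm]
    rw [← mul_add, hw1, smul_smul]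
    field_simp
    simp
  · rw [norm_mul_nrm hz0]
    have h1 : F.co (F.at_ (corner b) + z) = corner b + (1 : ℝ) • w := by
      rw [one_smul, ← hv, co, show F.at_ (corner b) + z - F.c = (F.at_ (corner b) - F.c) + z by ring,
        vec_add]
      congr 1
      exact F.co_at _
    have := inward_in_square hw zero_le_one le_rfl
    rw [← h1] at this
    exact this

theorem toOct_bijOn (C : F.Corners v k) : Set.BijOn (F.toOct k) (blowUp v F.box) Oct := by
  refine ⟨fun x hx => (F.dirs C hx).push_mem, fun x hx y hy h => ?_, fun o ho => ?_⟩
  · obtain ⟨h1, h2⟩ := (F.dirs C hx).push_inj (F.dirs C hy) h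
    have h3 : x.1 = y.1 := by rw [← F.at_co x.1, h1, F.at_co]
    refine blowUp.ext hx hy h3 fun l hl => ?_
    obtain ⟨b, rfl⟩ := C.only l (hl ▸ hx.1)
    refine F.unit_inj (hx.2 _).1 (hy.2 _).1 (h2 b ?_)
    rw [hl, C.eq, F.co_at]
  · obtain ⟨p, h1, h2, h⟩ := exists_push ho
    have hbox : F.at_ p ∈ F.box := by
      simp only [box, Set.mem_ofPred_eq, co_at]; exact ⟨h1, h2⟩
    rcases h with ⟨h3, h4⟩ | ⟨b, rfl, w, hw, h4⟩
    · have hne : ∀ l, F.at_ p ≠ v l := by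
        intro l hl
        obtain ⟨b, rfl⟩ := C.only l (hl ▸ hbox)
        have h5 := congrArg F.co hl
        rw [C.eq, F.co_at, F.co_at] at h5
        have h6 := h3 b
        rw [h5, cdist, corner] at h6
        simp only [sg_mul_self] at h6
        linarith
      have hx : (F.at_ p, fun l => nrm (F.at_ p - v l)) ∈ blowUp v F.box := by
        refine ⟨hbox, fun l => ⟨norm_nrm (sub_ne_zero.2 (hne l)), ?_, ‖F.at_ p - v l‖,
          norm_pos_iff.2 (sub_ne_zero.2 (hne l)), ?_⟩⟩
        · rw [norm_mul_nrm (sub_ne_zero.2 (hne l))]; ring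
        · show v l + ‖F.at_ p - v l‖ * nrm (F.at_ p - v l) ∈ F.box
          rw [norm_mul_nrm (sub_ne_zero.2 (hne l))]
          simpa using hbox
      have hd := F.dirs C hx
      refine ⟨_, hx, ?_⟩
      simp only [co_at] at hd
      have := h4 _ hd
      simp only [toOct, co_at]
      exact this
    · obtain ⟨u, hu, huw, r, hr, hru⟩ := F.exists_unit hw
      have hx : (F.at_ (corner b), fun l => if l = k b then u else nrm (F.at_ (corner b) - v l)) ∈
          blowUp v F.box := by
        refine ⟨hbox, fun l => ?_⟩
        by_cases hl : l = k b
        · subst hl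
          simp only [if_true]
          refine ⟨hu, by rw [C.eq]; simp, r, hr, by rw [C.eq]; exact hru⟩
        · simp only [if_neg hl]
          have hne : F.at_ (corner b) - v l ≠ 0 := by
            rw [← C.eq]
            exact sub_ne_zero.2 fun h => hl (C.inj h).symm
          refine ⟨norm_nrm hne, ?_, ‖F.at_ (corner b) - v l‖, norm_pos_iff.2 hne, ?_⟩
          · rw [norm_mul_nrm hne]; ring
          · rw [norm_mul_nrm hne]; simpa using hbox
      have hd := F.dirs C hx
      refine ⟨_, hx, ?_⟩
      simp only [co_at] at hd
      have := h4 _ hd (by simpa using huw)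
      simp only [toOct, co_at]
      exact this

theorem continuousOn_toOct : ContinuousOn (F.toOct k) (blowUp v F.box) := by
  have h1 : ∀ b, ContinuousOn (fun x : ℂ × (Fin n → ℂ) => F.unit (x.2 (k b)))
      (blowUp v F.box) := by
    intro b
    have h2 : Continuous fun x : ℂ × (Fin n → ℂ) => F.vec (x.2 (k b)) :=
      F.continuous_vec.comp (by fun_prop)
    have h3 : Continuous fun x : ℂ × (Fin n → ℂ) =>
        |(F.vec (x.2 (k b))).1| + |(F.vec (x.2 (k b))).2| :=
      (continuous_fst.comp h2).abs.add (continuous_snd.comp h2).abs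
    refine ContinuousOn.smul (h3.continuousOn.inv₀ fun x hx => ?_) h2.continuousOn
    have : x.2 (k b) ≠ 0 := by intro h; simpa [h] using (hx.2 (k b)).1
    exact (F.abs_add_pos this).ne'
  have h0 : Continuous fun x : ℂ × (Fin n → ℂ) => F.co x.1 := F.continuous_co.comp continuous_fst
  unfold toOct push cdist
  refine h0.continuousOn.add (continuousOn_finsetSum _ fun b _ => ?_)
  have h2 : Continuous fun p : ℝ × ℝ =>
      max 0 (1 - ((1 - sg b.1 * p.1) + (1 - sg b.2 * p.2))) / 2 := by fun_prop
  exact (h2.comp h0).continuousOn.smul (h1 b)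

theorem isCompact_blowUp (hc : IsClosed (blowUp v F.box)) : IsCompact (blowUp v F.box) := by
  have hb : F.box ⊆ F.at_ '' (Set.Icc (-1) 1) := by
    rintro z ⟨h1, h2⟩
    rw [abs_le] at h1 h2
    exact ⟨F.co z, ⟨⟨h1.1, h2.1⟩, ⟨h1.2, h2.2⟩⟩, F.at_co z⟩
  have hK : IsCompact ((F.at_ '' (Set.Icc (-1) 1)) ×ˢ
      (Set.univ.pi fun _ : Fin n => Metric.closedBall (0 : ℂ) 1)) :=
    (isCompact_Icc.image F.continuous_at).prod
      (isCompact_univ_pi fun _ => isCompact_closedBall _ _)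
  refine hK.of_isClosed_subset hc fun x hx => ⟨hb hx.1, fun l _ => ?_⟩
  rw [mem_closedBall_zero_iff, (hx.2 l).1]

/-- The blown-up parallelogram is homeomorphic to the octagon. -/
def octHomeo (C : F.Corners v k) (hc : IsClosed (blowUp v F.box)) : blowUp v F.box ≃ₜ Oct :=
  haveI : CompactSpace (blowUp v F.box) := isCompact_iff_compactSpace.1 (F.isCompact_blowUp hc)
  Continuous.homeoOfEquivCompactToT2 (f := (F.toOct_bijOn C).equiv)
    ((continuousOn_iff_continuous_domRestrict.1 F.continuousOn_toOct).subtype_mk _)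

end Frame

end AY

namespace AY

/-- Over every point of a segment there is a point of the blown-up segment. -/
theorem blowUp.exists_segment {n : ℕ} (v : Fin n → ℂ) {p q : ℂ} (h : p ≠ q) {z : ℂ}
    (hz : z ∈ segment ℝ p q) : ∃ x ∈ blowUp v (segment ℝ p q), x.1 = z := by
  obtain ⟨w, hw, hne⟩ : ∃ w ∈ segment ℝ p q, w - z ≠ 0 := by
    by_cases hp : p = z
    · exact ⟨q, right_mem_segment ℝ p q, sub_ne_zero.2 (hp ▸ h.symm)⟩
    · exact ⟨p, left_mem_segment ℝ p q, sub_ne_zero.2 hp⟩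
  classical
  refine ⟨(z, fun l => if z = v l then nrm (w - z) else nrm (z - v l)), ⟨hz, fun l => ?_⟩, rfl⟩
  by_cases hl : z = v l
  · simp only [if_pos hl]
    refine ⟨norm_nrm hne, by rw [← hl]; simp, ‖w - z‖, norm_pos_iff.2 hne, ?_⟩
    rw [norm_mul_nrm hne, ← hl]
    simpa using hw
  · simp only [if_neg hl]
    have hne := sub_ne_zero.2 hl
    refine ⟨norm_nrm hne, ?_, ‖z - v l‖, norm_pos_iff.2 hne, ?_⟩
    · rw [norm_mul_nrm hne]; ring
    · rw [norm_mul_nrm hne]; simpa using hz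

namespace Frame

variable (F : Frame) {n : ℕ} {v : Fin n → ℂ} {k : Bool × Bool → Fin n}

theorem unit_real_mul {r : ℝ} (hr : 0 < r) (z : ℂ) : F.unit (r * z) = F.unit z := by
  rw [unit, unit, vec_smul]
  simp only [Prod.smul_fst, Prod.smul_snd, smul_eq_mul, abs_mul, abs_of_pos hr, ← mul_add, mul_inv,
    smul_smul]
  congr 1
  field_simp

theorem unit_nrm {z : ℂ} (hz : z ≠ 0) : F.unit (nrm z) = F.unit z := by
  conv_rhs => rw [← norm_mul_nrm hz]
  rw [unit_real_mul _ (norm_pos_iff.2 hz)]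

theorem inward_norm {b : Bool × Bool} {w : ℝ × ℝ} (hw : Inward b w) : |w.1| + |w.2| = 1 := by
  obtain ⟨h1, h2, h3⟩ := hw
  rw [← h3]
  have e1 : |w.1| = -(sg b.1 * w.1) := by
    rw [← abs_of_nonpos h1, abs_mul]
    rcases sg_cases b.1 with e | e <;> simp [e]
  have e2 : |w.2| = -(sg b.2 * w.2) := by
    rw [← abs_of_nonpos h2, abs_mul]
    rcases sg_cases b.2 with e | e <;> simp [e]
  rw [e1, e2]; ring

theorem at_corner_sub {b b' : Bool × Bool} {w : ℝ × ℝ} (hb : corner b' = corner b + (2 : ℝ) • w) :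
    F.vec (F.at_ (corner b') - F.at_ (corner b)) = (2 : ℝ) • w := by
  rw [show F.at_ (corner b') - F.at_ (corner b) =
    (F.at_ (corner b') - F.c) - (F.at_ (corner b) - F.c) by ring, vec_sub]
  change F.co (F.at_ (corner b')) - F.co (F.at_ (corner b)) = _
  rw [co_at, co_at, hb]; abel

/-- The side of the square from `corner b` to `corner b'`. -/
structure IsSide (b b' : Bool × Bool) (w : ℝ × ℝ) : Prop where
  eq : corner b' = corner b + (2 : ℝ) • w
  inw : Inward b w
  inw' : Inward b' (-w)

theorem IsSide.symm {b b' : Bool × Bool} {w : ℝ × ℝ} (h : IsSide b b' w) : IsSide b' b (-w) :=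
  ⟨by rw [h.eq]; simp, h.inw', by simpa using h.inw⟩

variable {F}

theorem IsSide.sub {b b' : Bool × Bool} {w : ℝ × ℝ} (h : IsSide b b' w) :
    F.at_ (corner b') - F.at_ (corner b) ≠ 0 ∧
      F.unit (F.at_ (corner b') - F.at_ (corner b)) = w := by
  have h1 := F.at_corner_sub h.eq
  have h2 := inward_norm h.inw
  constructor
  · intro h0
    rw [h0] at h1
    have : F.vec 0 = 0 := by simpa using F.vec_sub 0 0
    rw [this] at h1
    have h3 : w = 0 := by
      have := (smul_eq_zero.1 h1.symm); simpa using this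
    rw [h3] at h2; simp at h2
  · rw [unit, h1]
    simp only [Prod.smul_fst, Prod.smul_snd, smul_eq_mul, abs_mul]
    rw [← mul_add, h2, smul_smul]
    norm_num

theorem IsSide.ne {b b' : Bool × Bool} {w : ℝ × ℝ} (h : IsSide b b' w) :
    F.at_ (corner b) ≠ F.at_ (corner b') := fun e => (h.sub (F := F)).1 (sub_eq_zero.2 e.symm)

theorem at_combo (b : Bool × Bool) (w : ℝ × ℝ) {b' : Bool × Bool}
    (hb : corner b' = corner b + (2 : ℝ) • w) (Y : ℝ) :
    F.at_ (corner b + (1 + Y) • w) =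
      F.at_ (corner b) + ((1 + Y) / 2 : ℝ) • (F.at_ (corner b') - F.at_ (corner b)) := by
  have e1 := congrArg Prod.fst hb
  have e2 := congrArg Prod.snd hb
  simp only [Prod.fst_add, Prod.snd_add, Prod.smul_fst, Prod.smul_snd, smul_eq_mul] at e1 e2
  simp only [at_, Complex.real_smul, e1, e2, Prod.fst_add, Prod.snd_add, Prod.smul_fst,
    Prod.smul_snd, smul_eq_mul]
  push_cast; ring

theorem co_segment {b b' : Bool × Bool} {w : ℝ × ℝ} (h : IsSide b b' w) {z : ℂ}
    (hz : z ∈ segment ℝ (F.at_ (corner b)) (F.at_ (corner b'))) :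
    ∃ Y : ℝ, |Y| ≤ 1 ∧ z = F.at_ (corner b + (1 + Y) • w) := by
  rw [segment_eq_image'] at hz
  obtain ⟨θ, ⟨h0, h1⟩, rfl⟩ := hz
  refine ⟨2 * θ - 1, abs_le.2 ⟨by linarith, by linarith⟩, ?_⟩
  rw [at_combo b w h.eq]
  congr 2; ring

theorem IsSide.half {b b' : Bool × Bool} {w : ℝ × ℝ} (h : IsSide b b' w) (C : F.Corners v k)
    {x : ℂ × (Fin n → ℂ)}
    (hx : x ∈ blowUp v (segment ℝ (F.at_ (corner b)) (F.at_ (corner b'))))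
    (hbox : x ∈ blowUp v F.box) {Y : ℝ} (h0 : Y ≤ 0)
    (e : x.1 = F.at_ (corner b + (1 + Y) • w)) :
    F.toOct k x = corner b + (1 + Y / 2) • w := by
  have hd := F.dirs C hbox
  have hw : F.unit (x.2 (k b)) = w := by
    rw [blowUp.dir_segment hx (C.eq b), unit_nrm _ (h.sub (F := F)).1, (h.sub (F := F)).2]
  have hc : cdist b (F.co x.1) = 1 + Y := by rw [e, co_at, cdist_add_smul h.inw]
  have := push_near (u := fun b => F.unit (x.2 (k b))) hd.h1 hd.h2 (b := b) (by linarith) (hd.eq b)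
  rw [toOct, this, hw, hc]
  congr 2; ring

theorem IsSide.toOct_eq {b b' : Bool × Bool} {w : ℝ × ℝ} (h : IsSide b b' w) (C : F.Corners v k)
    {x : ℂ × (Fin n → ℂ)}
    (hx : x ∈ blowUp v (segment ℝ (F.at_ (corner b)) (F.at_ (corner b'))))
    (hbox : x ∈ blowUp v F.box) {Y : ℝ}
    (e : x.1 = F.at_ (corner b + (1 + Y) • w)) :
    F.toOct k x = corner b + (1 + Y / 2) • w := by
  rcases le_total Y 0 with h0 | h0
  · exact h.half C hx hbox h0 e
  · have key : ∀ r s : ℝ, r + s = 2 → corner b + r • w = corner b' + s • (-w) := by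
      intro r s hrs
      rw [h.eq, smul_neg, add_assoc, ← sub_eq_add_neg, ← sub_smul]
      congr 2; linarith
    rw [h.symm.half C (segment_symm ℝ (F.at_ (corner b)) _ ▸ hx) hbox (Y := -Y)
      (by linarith) (by rw [e, key _ (1 + -Y) (by ring)]), key _ (1 + -Y / 2) (by ring)]

theorem mem_box_of_dirs {p : ℝ × ℝ} (h : |p.1| ≤ 1 ∧ |p.2| ≤ 1) : F.at_ p ∈ F.box := by
  simpa only [box, Set.mem_ofPred_eq, co_at] using h

theorem convex_box : Convex ℝ F.box := by
  intro x hx y hy s t hs ht hst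
  have e : F.co (s • x + t • y) = s • F.co x + t • F.co y := by
    have e0 : (s • x + t • y : ℂ) - F.c = (s : ℝ) * (x - F.c) + (t : ℝ) * (y - F.c) := by
      simp only [Complex.real_smul]
      have : (s : ℂ) + t = 1 := by exact_mod_cast hst
      linear_combination F.c * this
    rw [co, e0, vec_add, vec_smul, vec_smul]; rfl
  obtain ⟨h1, h2⟩ := hx
  obtain ⟨h3, h4⟩ := hy
  simp only [box, Set.mem_ofPred_eq, e, Prod.fst_add, Prod.snd_add, Prod.smul_fst, Prod.smul_snd,
    smul_eq_mul]
  constructor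
  · calc |s * (F.co x).1 + t * (F.co y).1| ≤ |s * (F.co x).1| + |t * (F.co y).1| := abs_add_le _ _
      _ = s * |(F.co x).1| + t * |(F.co y).1| := by rw [abs_mul, abs_mul, abs_of_nonneg hs, abs_of_nonneg ht]
      _ ≤ s * 1 + t * 1 := by gcongr
      _ = 1 := by linarith
  · calc |s * (F.co x).2 + t * (F.co y).2| ≤ |s * (F.co x).2| + |t * (F.co y).2| := abs_add_le _ _
      _ = s * |(F.co x).2| + t * |(F.co y).2| := by rw [abs_mul, abs_mul, abs_of_nonneg hs, abs_of_nonneg ht]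
      _ ≤ s * 1 + t * 1 := by gcongr
      _ = 1 := by linarith

theorem segment_subset_box (b b' : Bool × Bool) :
    segment ℝ (F.at_ (corner b)) (F.at_ (corner b')) ⊆ F.box := by
  have h : ∀ b, F.at_ (corner b) ∈ F.box := fun b => mem_box_of_dirs (by
    rcases sg_cases b.1 with e1 | e1 <;> rcases sg_cases b.2 with e2 | e2 <;> simp [corner, e1, e2])
  exact F.convex_box.segment_subset (h b) (h b')

/-- A point of the octagon on a side comes from the blown-up side of the parallelogram. -/
theorem IsSide.of_toOct {b b' : Bool × Bool} {w : ℝ × ℝ} (h : IsSide b b' w) (C : F.Corners v k)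
    {x : ℂ × (Fin n → ℂ)} (hbox : x ∈ blowUp v F.box) {Y : ℝ} (hY : |Y| ≤ 1)
    (e : F.toOct k x = corner b + (1 + Y / 2) • w) :
    x ∈ blowUp v (segment ℝ (F.at_ (corner b)) (F.at_ (corner b'))) ∧
      x.1 = F.at_ (corner b + (1 + Y) • w) := by
  have hz : F.at_ (corner b + (1 + Y) • w) ∈
      segment ℝ (F.at_ (corner b)) (F.at_ (corner b')) := by
    rw [segment_eq_image', at_combo b w h.eq]
    rw [abs_le] at hY
    exact ⟨(1 + Y) / 2, ⟨by linarith, by linarith⟩, rfl⟩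
  obtain ⟨y, hy, hy1⟩ := blowUp.exists_segment v h.ne hz
  have hyb : y ∈ blowUp v F.box := blowUp.mono (segment_subset_box b b') hy
  have := h.toOct_eq C hy hyb hy1
  rw [← e] at this
  rw [← (F.toOct_bijOn C).injOn hyb hbox this]
  exact ⟨hy, hy1⟩

end Frame

/-! ### The surface glued from six octagons -/

/-- The octagon across the right side. -/
def right : Fin 6 → Fin 6 := ![5, 3, 4, 1, 2, 0]

/-- The octagon across the upper side. -/
def upper : Fin 6 → Fin 6 := ![3, 2, 1, 0, 5, 4]

/-- The gluings of the six octagons. -/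
def OctGlued (x y : Σ _ : Fin 6, Oct) : Prop :=
  (x.2.1.1 = 1 ∧ y.1 = right x.1 ∧ y.2.1 = (-1, x.2.1.2)) ∨
    (x.2.1.2 = 1 ∧ y.1 = upper x.1 ∧ y.2.1 = (x.2.1.1, -1))

/-- The surface glued from six octagons. -/
def OctSurf : Type := Quot OctGlued

instance : TopologicalSpace OctSurf := inferInstanceAs (TopologicalSpace (Quot OctGlued))


/-- The corners of the six parallelograms. -/
def quad : Fin 6 → Bool × Bool → Fin 14 := fun j b =>
  (![![0, 1, 13, 2], ![2, 3, 11, 4], ![11, 4, 10, 9], ![13, 2, 12, 11], ![4, 5, 9, 6],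
    ![9, 6, 8, 7]] : Fin 6 → Fin 4 → Fin 14) j (cond b.1 1 0 + cond b.2 2 0)

/-- The exact corners of the six parallelograms. -/
def crn (j : Fin 6) (b : Bool × Bool) : Pt := modelD.v (quad j b)

/-- The exact sides of the six parallelograms. -/
def sideE (j : Fin 6) : Pt := (crn j (true, false)).sub (crn j (false, false))

/-- The exact sides of the six parallelograms. -/
def sideF (j : Fin 6) : Pt := (crn j (false, true)).sub (crn j (false, false))

/-- The determinant of two exact vectors. -/
def Pt.det (p q : Pt) : Z3 := (p.x.mul q.y).sub (p.y.mul q.x)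

/-- The forms cutting out the parallelogram. -/
def boxForms (j : Fin 6) : List Form :=
  let P := crn j (false, false)
  let e := sideE j
  let f := sideF j
  let c := (P.y.mul f.x).sub (P.x.mul f.y)
  let d := (e.y.mul P.x).sub (e.x.mul P.y)
  [⟨f.y, f.x.neg, c⟩, ⟨f.y.neg, f.x, (e.det f).sub c⟩,
   ⟨e.y.neg, e.x, d⟩, ⟨e.y, e.x.neg, (e.det f).sub d⟩]

/-- The exact gluing across the right side. -/
def glueRight (j : Fin 6) : GD :=
  ⟨j, right j, crn j (true, false), crn j (true, true),
    (crn (right j) (false, false)).sub (crn j (true, false))⟩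

/-- The exact gluing across the upper side. -/
def glueUpper (j : Fin 6) : GD :=
  ⟨j, upper j, crn j (false, true), crn j (true, true),
    (crn (upper j) (false, false)).sub (crn j (false, true))⟩

theorem model_gl : modelD.gl = [glueRight 0, glueRight 1, glueRight 2, glueRight 3, glueRight 4,
    glueRight 5, glueUpper 0, glueUpper 1, glueUpper 2, glueUpper 3, glueUpper 4, glueUpper 5] := by
  rfl

theorem model_cell : modelD.cell = boxForms := by
  funext j; fin_cases j <;> rfl

/-- A check that the corners are those of parallelograms glued along parallel sides. -/
def quadCheck (j : Fin 6) : Bool :=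
  (crn j (true, true)).eq ((crn j (true, false)).add (sideF j)) &&
  (crn (right j) (false, true)).eq ((crn (right j) (false, false)).add (sideF j)) &&
  (crn (upper j) (true, false)).eq ((crn (upper j) (false, false)).add (sideE j)) &&
  ((sideE j).det (sideF j)).pos &&
  (List.finRange 14).all fun l => outside (boxForms j) (modelD.v l) ||
    decide (l = quad j (false, false) ∨ l = quad j (true, false) ∨ l = quad j (false, true) ∨
      l = quad j (true, true))

theorem quad_check : ∀ j, quadCheck j = true := by decide +kernel

end AY

namespace AY

variable {α : ℝ}

theorem quad_spec (j : Fin 6) : (crn j (true, true) = (crn j (true, false)).add (sideF j)) ∧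
    (crn (right j) (false, true) = (crn (right j) (false, false)).add (sideF j)) ∧
    (crn (upper j) (true, false) = (crn (upper j) (false, false)).add (sideE j)) ∧
    ((sideE j).det (sideF j)).pos = true ∧
    ∀ l, outside (boxForms j) (modelD.v l) = false → ∃ b, l = quad j b := by
  have h := quad_check j
  simp only [quadCheck, Bool.and_eq_true] at h
  obtain ⟨⟨⟨⟨h1, h2⟩, h3⟩, h4⟩, h5⟩ := h
  refine ⟨Pt.eq_of_eq h1, Pt.eq_of_eq h2, Pt.eq_of_eq h3, h4, fun l hl => ?_⟩
  have := List.all_eq_true.1 h5 l (List.mem_finRange l)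
  rw [hl, Bool.false_or, decide_eq_true_eq] at this
  rcases this with e | e | e | e <;> exact ⟨_, e⟩

theorem det_ev (A : IsRoot3 α) (p q : Pt) :
    (p.det q).ev α = 4 * ((p.ev α).re * (q.ev α).im - (p.ev α).im * (q.ev α).re) := by
  simp only [Pt.det, Z3.ev_sub, Z3.ev_mul A, Pt.ev]; ring

/-- The six parallelograms. -/
def frame (A : IsRoot3 α) (j : Fin 6) : Frame where
  c := ((crn j (true, false)).ev α + (crn j (false, true)).ev α) / 2
  e := (sideE j).ev α / 2
  f := (sideF j).ev α / 2
  pos := by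
    have := Z3.ev_pos A (quad_spec j).2.2.2.1
    rw [det_ev A] at this
    have e : ∀ z : ℂ, (z / 2).re = z.re / 2 ∧ (z / 2).im = z.im / 2 := fun z => by
      simp [Complex.div_ofNat_re, Complex.div_ofNat_im]
    rw [(e _).1, (e _).2, (e _).1, (e _).2]
    linarith

variable (A : IsRoot3 α)

theorem frame_corner (j : Fin 6) (b : Bool × Bool) :
    (crn j b).ev α = (frame A j).at_ (corner b) := by
  have h := congrArg (Pt.ev α) (quad_spec j).1
  rw [Pt.ev_add] at h
  simp only [frame, Frame.at_, corner, sideE, sideF, Pt.ev_sub] at h ⊢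
  obtain ⟨b1, b2⟩ := b
  cases b1 <;> cases b2 <;> simp [sg] <;> first | linear_combination h | ring

theorem frame_box (j : Fin 6) : (modelD.real α).cell j = (frame A j).box := by
  have hpos := (frame A j).pos
  ext z
  set p := (frame A j).co z with hp
  have hz : z = (frame A j).at_ p := ((frame A j).at_co z).symm
  have hdet : ((sideE j).det (sideF j)).ev α =
      16 * ((frame A j).e.re * (frame A j).f.im - (frame A j).e.im * (frame A j).f.re) := by
    rw [det_ev A]
    simp only [frame, Complex.div_ofNat_re, Complex.div_ofNat_im]; ring
  set d := (frame A j).e.re * (frame A j).f.im - (frame A j).e.im * (frame A j).f.re with hd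
  have hc : (frame A j).c = (crn j (false, false)).ev α + (frame A j).e + (frame A j).f := by
    rw [frame_corner A]; simp [Frame.at_, corner, sg]; ring
  have he : (frame A j).e = (sideE j).ev α / 2 := rfl
  have hf : (frame A j).f = (sideF j).ev α / 2 := rfl
  have e1 : (sideE j).x.ev α = 4 * (frame A j).e.re := by
    rw [he, Complex.div_ofNat_re]; simp [Pt.ev]; ring
  have e2 : (sideE j).y.ev α = 4 * (frame A j).e.im := by
    rw [he, Complex.div_ofNat_im]; simp [Pt.ev]; ring
  have e3 : (sideF j).x.ev α = 4 * (frame A j).f.re := by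
    rw [hf, Complex.div_ofNat_re]; simp [Pt.ev]; ring
  have e4 : (sideF j).y.ev α = 4 * (frame A j).f.im := by
    rw [hf, Complex.div_ofNat_im]; simp [Pt.ev]; ring
  have ezr : z.re = (crn j (false, false)).x.ev α / 2 + (1 + p.1) * (frame A j).e.re +
      (1 + p.2) * (frame A j).f.re := by
    conv_lhs => rw [hz, Frame.at_, hc]
    simp [Pt.ev]; ring
  have ezi : z.im = (crn j (false, false)).y.ev α / 2 + (1 + p.1) * (frame A j).e.im +
      (1 + p.2) * (frame A j).f.im := by
    conv_lhs => rw [hz, Frame.at_, hc]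
    simp [Pt.ev]; ring
  show (∀ f ∈ modelD.cell j, 0 ≤ f.val α z) ↔ |p.1| ≤ 1 ∧ |p.2| ≤ 1
  rw [model_cell]
  simp only [boxForms, List.mem_cons, List.not_mem_nil, or_false, forall_eq_or_imp, forall_eq]
  have v1 : Form.val α ⟨(sideF j).y, (sideF j).x.neg,
      ((crn j (false, false)).y.mul (sideF j).x).sub ((crn j (false, false)).x.mul (sideF j).y)⟩ z
      = 8 * d * (1 + p.1) := by
    simp only [Form.val, Z3.ev_neg, Z3.ev_sub, Z3.ev_mul A, e3, e4, ezr, ezi, hd]; ring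
  have v2 : Form.val α ⟨(sideF j).y.neg, (sideF j).x, ((sideE j).det (sideF j)).sub
      (((crn j (false, false)).y.mul (sideF j).x).sub
        ((crn j (false, false)).x.mul (sideF j).y))⟩ z = 8 * d * (1 - p.1) := by
    simp only [Form.val, Z3.ev_neg, Z3.ev_sub, Z3.ev_mul A, hdet, e3, e4, ezr, ezi, hd]; ring
  have v3 : Form.val α ⟨(sideE j).y.neg, (sideE j).x,
      ((sideE j).y.mul (crn j (false, false)).x).sub ((sideE j).x.mul (crn j (false, false)).y)⟩ z
      = 8 * d * (1 + p.2) := by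
    simp only [Form.val, Z3.ev_neg, Z3.ev_sub, Z3.ev_mul A, e1, e2, ezr, ezi, hd]; ring
  have v4 : Form.val α ⟨(sideE j).y, (sideE j).x.neg, ((sideE j).det (sideF j)).sub
      (((sideE j).y.mul (crn j (false, false)).x).sub
        ((sideE j).x.mul (crn j (false, false)).y))⟩ z = 8 * d * (1 - p.2) := by
    simp only [Form.val, Z3.ev_neg, Z3.ev_sub, Z3.ev_mul A, hdet, e1, e2, ezr, ezi, hd]; ring
  rw [v1, v2, v3, v4]
  have h8 : 0 < 8 * d := by linarith
  rw [mul_nonneg_iff_of_pos_left h8, mul_nonneg_iff_of_pos_left h8, mul_nonneg_iff_of_pos_left h8,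
    mul_nonneg_iff_of_pos_left h8, abs_le, abs_le]
  constructor
  · rintro ⟨h1, h2, h3, h4⟩
    exact ⟨⟨by linarith, by linarith⟩, by linarith, by linarith⟩
  · rintro ⟨⟨h1, h2⟩, h3, h4⟩
    exact ⟨by linarith, by linarith, by linarith, by linarith⟩

theorem frame_corners (j : Fin 6) : (frame A j).Corners (modelD.real α).v (quad j) where
  inj := (PD.good A modelD_good).inj
  eq b := frame_corner A j b
  only l hl := by
    rw [← frame_box] at hl
    refine (quad_spec j).2.2.2.2 l ?_
    rw [← model_cell]
    exact PD.not_outside A hl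

theorem frame_closed (j : Fin 6) : IsClosed (blowUp (modelD.real α).v (frame A j).box) := by
  rw [← frame_box]
  exact ((PD.good A modelD_good).poly j).isClosed_blowUp

/-- The blown-up parallelograms are octagons. -/
def octChart (j : Fin 6) : blowUp (modelD.real α).v ((modelD.real α).cell j) ≃ₜ Oct :=
  (Homeomorph.setCongr (by rw [frame_box A])).trans
    ((frame A j).octHomeo (frame_corners A j) (frame_closed A j))

theorem octChart_apply (j : Fin 6) (x : blowUp (modelD.real α).v ((modelD.real α).cell j)) :
    (octChart A j x : ℝ × ℝ) = (frame A j).toOct (quad j) x := rfl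

theorem rightSide : Frame.IsSide (true, false) (true, true) (0, 1) := by
  constructor <;> norm_num [corner, sg, Inward]

theorem leftSide : Frame.IsSide (false, false) (false, true) (0, 1) := by
  constructor <;> norm_num [corner, sg, Inward]

theorem upperSide : Frame.IsSide (false, true) (true, true) (1, 0) := by
  constructor <;> norm_num [corner, sg, Inward]

theorem lowerSide : Frame.IsSide (false, false) (true, false) (1, 0) := by
  constructor <;> norm_num [corner, sg, Inward]

/-- The points of two parallel sides correspond by a translation if and only if their images in the
octagons correspond. -/
theorem glued_side {j j' : Fin 6} {b b' c c' : Bool × Bool} {w : ℝ × ℝ}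
    (hb : Frame.IsSide b b' w) (hc : Frame.IsSide c c' w) {t : ℂ}
    (h1 : (crn j' c).ev α = (crn j b).ev α + t) (h2 : (crn j' c').ev α = (crn j b').ev α + t)
    (x : blowUp (modelD.real α).v ((modelD.real α).cell j))
    (y : blowUp (modelD.real α).v ((modelD.real α).cell j')) :
    ((x : ℂ × (Fin 14 → ℂ)) ∈
        blowUp (modelD.real α).v (segment ℝ ((crn j b).ev α) ((crn j b').ev α)) ∧
      (y : ℂ × (Fin 14 → ℂ)) ∈
        blowUp (modelD.real α).v (segment ℝ ((crn j b).ev α + t) ((crn j b').ev α + t)) ∧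
      (y : ℂ × (Fin 14 → ℂ)).1 = (x : ℂ × (Fin 14 → ℂ)).1 + t) ↔
    ∃ Y : ℝ, |Y| ≤ 1 ∧ (octChart A j x : ℝ × ℝ) = corner b + (1 + Y / 2) • w ∧
      (octChart A j' y : ℝ × ℝ) = corner c + (1 + Y / 2) • w := by
  have hx : (x : ℂ × (Fin 14 → ℂ)) ∈ blowUp (modelD.real α).v (frame A j).box := by
    rw [← frame_box]; exact x.2
  have hy : (y : ℂ × (Fin 14 → ℂ)) ∈ blowUp (modelD.real α).v (frame A j').box := by
    rw [← frame_box]; exact y.2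
  have key : ∀ Y : ℝ, (frame A j').at_ (corner c + (1 + Y) • w) =
      (frame A j).at_ (corner b + (1 + Y) • w) + t := by
    intro Y
    rw [Frame.at_combo c w hc.eq, Frame.at_combo b w hb.eq]
    simp only [← frame_corner, h1, h2]
    rw [add_sub_add_right_eq_sub]; ring
  rw [octChart_apply, octChart_apply, ← h1, ← h2]
  simp only [frame_corner A]
  constructor
  · rintro ⟨hx', hy', e⟩
    obtain ⟨Y, hY, eY⟩ := Frame.co_segment hb hx'.1
    refine ⟨Y, hY, hb.toOct_eq (frame_corners A j) hx' hx eY,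
      hc.toOct_eq (frame_corners A j') hy' hy ?_⟩
    rw [e, eY, key]
  · rintro ⟨Y, hY, ex, ey⟩
    obtain ⟨hx', ex'⟩ := hb.of_toOct (frame_corners A j) hx hY ex
    obtain ⟨hy', ey'⟩ := hc.of_toOct (frame_corners A j') hy hY ey
    exact ⟨hx', hy', by rw [ey', ex', key]⟩

theorem abs_le_half {o : Oct} : (|o.1.1| = 1 → |o.1.2| ≤ 1 / 2) ∧ (|o.1.2| = 1 → |o.1.1| ≤ 1 / 2) := by
  obtain ⟨-, -, h⟩ := o.2
  exact ⟨fun e => by linarith, fun e => by linarith⟩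

theorem crn_right (j : Fin 6) : (crn (right j) (false, false)).ev α =
      (crn j (true, false)).ev α + (glueRight j).t.ev α ∧
    (crn (right j) (false, true)).ev α = (crn j (true, true)).ev α + (glueRight j).t.ev α := by
  have h1 := congrArg (Pt.ev α) (quad_spec j).1
  have h2 := congrArg (Pt.ev α) (quad_spec j).2.1
  rw [Pt.ev_add] at h1 h2
  rw [h1, h2, glueRight, Pt.ev_sub]
  constructor <;> ring

theorem crn_upper (j : Fin 6) : (crn (upper j) (false, false)).ev α =
      (crn j (false, true)).ev α + (glueUpper j).t.ev α ∧
    (crn (upper j) (true, false)).ev α = (crn j (true, true)).ev α + (glueUpper j).t.ev α := by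
  have h1 := congrArg (Pt.ev α) (quad_spec j).1
  have h2 := congrArg (Pt.ev α) (quad_spec j).2.2.1
  rw [Pt.ev_add] at h1 h2
  rw [h1, h2, glueUpper, Pt.ev_sub, sideE, sideF, Pt.ev_sub, Pt.ev_sub]
  constructor <;> ring

theorem glued_right (j : Fin 6) (x : blowUp (modelD.real α).v ((modelD.real α).cell j))
    (y : blowUp (modelD.real α).v ((modelD.real α).cell (right j))) :
    ((x : ℂ × (Fin 14 → ℂ)) ∈ blowUp (modelD.real α).v
        (segment ℝ ((glueRight j).p.ev α) ((glueRight j).q.ev α)) ∧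
      (y : ℂ × (Fin 14 → ℂ)) ∈ blowUp (modelD.real α).v
        (segment ℝ ((glueRight j).p.ev α + (glueRight j).t.ev α)
          ((glueRight j).q.ev α + (glueRight j).t.ev α)) ∧
      (y : ℂ × (Fin 14 → ℂ)).1 = (x : ℂ × (Fin 14 → ℂ)).1 + (glueRight j).t.ev α) ↔
    ((octChart A j x).1.1 = 1 ∧
      (octChart A (right j) y : ℝ × ℝ) = (-1, (octChart A j x).1.2)) := by
  refine (glued_side A rightSide leftSide (crn_right j).1 (crn_right j).2 x y).trans ?_
  constructor
  · rintro ⟨Y, -, e1, e2⟩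
    rw [e1, e2]; simp [corner, sg]
  · rintro ⟨e1, e2⟩
    refine ⟨2 * (octChart A j x).1.2, ?_, ?_, ?_⟩
    · rw [abs_mul, abs_two]
      linarith [(abs_le_half (o := octChart A j x)).1 (by rw [e1, abs_one])]
    · apply Prod.ext <;> simp [corner, sg, e1]
    · rw [e2]; apply Prod.ext <;> simp [corner, sg]

theorem glued_upper (j : Fin 6) (x : blowUp (modelD.real α).v ((modelD.real α).cell j))
    (y : blowUp (modelD.real α).v ((modelD.real α).cell (upper j))) :
    ((x : ℂ × (Fin 14 → ℂ)) ∈ blowUp (modelD.real α).v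
        (segment ℝ ((glueUpper j).p.ev α) ((glueUpper j).q.ev α)) ∧
      (y : ℂ × (Fin 14 → ℂ)) ∈ blowUp (modelD.real α).v
        (segment ℝ ((glueUpper j).p.ev α + (glueUpper j).t.ev α)
          ((glueUpper j).q.ev α + (glueUpper j).t.ev α)) ∧
      (y : ℂ × (Fin 14 → ℂ)).1 = (x : ℂ × (Fin 14 → ℂ)).1 + (glueUpper j).t.ev α) ↔
    ((octChart A j x).1.2 = 1 ∧
      (octChart A (upper j) y : ℝ × ℝ) = ((octChart A j x).1.1, -1)) := by
  refine (glued_side A upperSide lowerSide (crn_upper j).1 (crn_upper j).2 x y).trans ?_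
  constructor
  · rintro ⟨Y, -, e1, e2⟩
    rw [e1, e2]; simp [corner, sg]
  · rintro ⟨e1, e2⟩
    refine ⟨2 * (octChart A j x).1.1, ?_, ?_, ?_⟩
    · rw [abs_mul, abs_two]
      linarith [(abs_le_half (o := octChart A j x)).2 (by rw [e1, abs_one])]
    · apply Prod.ext <;> simp [corner, sg, e1]
    · rw [e2]; apply Prod.ext <;> simp [corner, sg]

theorem mem_model_gl {g : Gluing} : g ∈ (modelD.real α).gl ↔
    ∃ j, g = (glueRight j).real α ∨ g = (glueUpper j).real α := by
  show g ∈ modelD.gl.map _ ↔ _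
  rw [model_gl]
  simp only [List.map_cons, List.map_nil, List.mem_cons, List.not_mem_nil, or_false]
  constructor
  · rintro (h | h | h | h | h | h | h | h | h | h | h | h) <;>
      first | exact ⟨_, .inl h⟩ | exact ⟨_, .inr h⟩
  · rintro ⟨j, h | h⟩ <;> fin_cases j <;> simp [h]

/-- The blown-up parallelograms are octagons. -/
def piecesHomeo : (Σ j : Fin 6, blowUp (modelD.real α).v ((modelD.real α).cell j)) ≃ₜ
    Σ _ : Fin 6, Oct where
  toEquiv := Equiv.sigmaCongrRight fun j => (octChart A j).toEquiv
  continuous_toFun := continuous_sigma fun j =>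
    continuous_sigmaMk.comp (octChart A j).continuous
  continuous_invFun := continuous_sigma fun j =>
    continuous_sigmaMk.comp (octChart A j).symm.continuous

theorem glued_iff (x y : Σ j : Fin 6, blowUp (modelD.real α).v ((modelD.real α).cell j)) :
    (modelD.real α).Glued x y ↔ OctGlued (piecesHomeo A x) (piecesHomeo A y) := by
  obtain ⟨j, x⟩ := x
  obtain ⟨j', y⟩ := y
  constructor
  · rintro ⟨g, hg, h1, h2, h3⟩
    obtain ⟨l, rfl | rfl⟩ := mem_model_gl.1 hg
    · obtain rfl : j = l := h1
      obtain rfl : j' = right j := h2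
      have := (glued_right A j x y).1 h3
      exact .inl ⟨this.1, rfl, this.2⟩
    · obtain rfl : j = l := h1
      obtain rfl : j' = upper j := h2
      have := (glued_upper A j x y).1 h3
      exact .inr ⟨this.1, rfl, this.2⟩
  · rintro (⟨h1, h2, h3⟩ | ⟨h1, h2, h3⟩)
    · obtain rfl : j' = right j := h2
      exact ⟨_, mem_model_gl.2 ⟨j, .inl rfl⟩, rfl, rfl, (glued_right A j x y).2 ⟨h1, h3⟩⟩
    · obtain rfl : j' = upper j := h2
      exact ⟨_, mem_model_gl.2 ⟨j, .inr rfl⟩, rfl, rfl, (glued_upper A j x y).2 ⟨h1, h3⟩⟩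

/-- The surface glued from parallelograms is the one glued from octagons. -/
def modelHomeo : (modelD.real α).Space ≃ₜ OctSurf where
  toEquiv := Quot.congr (piecesHomeo A).toEquiv (glued_iff A)
  continuous_toFun := continuous_quot_lift _ (continuous_quot_mk.comp (piecesHomeo A).continuous)
  continuous_invFun := continuous_quot_lift _
    (continuous_quot_mk.comp (piecesHomeo A).symm.continuous)

end AY

namespace AY

/-- A quotient of a compact Hausdorff space by a closed equivalence relation is Hausdorff. -/
theorem t2_of_isQuotientMap {S Y : Type*} [TopologicalSpace S] [TopologicalSpace Y] [CompactSpace S]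
    [T2Space S] {q : S → Y} (hq : IsQuotientMap q) (h : IsClosed {p : S × S | q p.1 = q p.2}) :
    T2Space Y := by
  have hcl : IsClosedMap q := by
    intro C hC
    rw [← hq.isClosed_preimage]
    have : q ⁻¹' (q '' C) = Prod.snd '' ({p : S × S | q p.1 = q p.2} ∩ Prod.fst ⁻¹' C) := by
      ext y
      constructor
      · rintro ⟨x, hx, e⟩
        exact ⟨(x, y), ⟨e, hx⟩, rfl⟩
      · rintro ⟨⟨x, y'⟩, ⟨e, hx⟩, rfl⟩
        exact ⟨x, hx, e⟩
    rw [this]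
    exact ((h.inter (hC.preimage continuous_fst)).isCompact.image continuous_snd).isClosed
  have key : ∀ y : Y, IsClosed (q ⁻¹' {y}) := by
    intro y
    obtain ⟨x, rfl⟩ := hq.surjective y
    rw [← Set.image_singleton]
    exact (hcl _ isClosed_singleton).preimage hq.continuous
  refine ⟨fun y y' hne => ?_⟩
  obtain ⟨U, V, hU, hV, hyU, hyV, hUV⟩ := NormalSpace.normal _ _ (key y) (key y') (Set.disjoint_left.2 fun x hx hx' => hne (hx.symm.trans hx'))
  refine ⟨(q '' Uᶜ)ᶜ, (q '' Vᶜ)ᶜ, (hcl _ hU.isClosed_compl).isOpen_compl,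
    (hcl _ hV.isClosed_compl).isOpen_compl, ?_, ?_, ?_⟩
  · rintro ⟨x, hx, e⟩; exact hx (hyU e)
  · rintro ⟨x, hx, e⟩; exact hx (hyV e)
  · rw [Set.disjoint_left]
    intro z hz hz'
    obtain ⟨x, rfl⟩ := hq.surjective z
    have h1 : x ∈ U := by by_contra hx; exact hz ⟨x, hx, rfl⟩
    have h2 : x ∈ V := by by_contra hx; exact hz' ⟨x, hx, rfl⟩
    exact Set.disjoint_left.1 hUV h1 h2

theorem convex_Oct : Convex ℝ Oct := by
  intro x hx y hy s t hs ht hst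
  have k : ∀ a b : ℝ, |s * a + t * b| ≤ s * |a| + t * |b| := fun a b =>
    (abs_add_le _ _).trans (by rw [abs_mul, abs_mul, abs_of_nonneg hs, abs_of_nonneg ht])
  obtain ⟨h1, h2, h3⟩ := hx
  obtain ⟨h4, h5, h6⟩ := hy
  have k1 := k x.1 y.1
  have k2 := k x.2 y.2
  have e : ∀ c : ℝ, s * c + t * c = c := fun c => by rw [← add_mul, hst, one_mul]
  have := e 1; have := e (3 / 2)
  refine ⟨?_, ?_, ?_⟩ <;>
    simp only [Prod.fst_add, Prod.snd_add, Prod.smul_fst, Prod.smul_snd, smul_eq_mul] <;>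
    nlinarith [mul_le_mul_of_nonneg_left h1 hs, mul_le_mul_of_nonneg_left h2 hs,
      mul_le_mul_of_nonneg_left h3 hs, mul_le_mul_of_nonneg_left h4 ht,
      mul_le_mul_of_nonneg_left h5 ht, mul_le_mul_of_nonneg_left h6 ht]

theorem isCompact_Oct : IsCompact Oct := by
  have h : IsClosed Oct := by
    have h1 : Continuous fun p : ℝ × ℝ => |p.1| := continuous_fst.abs
    have h2 : Continuous fun p : ℝ × ℝ => |p.2| := continuous_snd.abs
    exact (isClosed_le h1 continuous_const).inter ((isClosed_le h2 continuous_const).inter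
      (isClosed_le (h1.add h2) continuous_const))
  refine (isCompact_Icc (a := ((-1, -1) : ℝ × ℝ)) (b := (1, 1))).of_isClosed_subset h ?_
  rintro p ⟨h1, h2, -⟩
  rw [abs_le] at h1 h2
  exact ⟨⟨h1.1, h2.1⟩, h1.2, h2.2⟩

instance : CompactSpace Oct := isCompact_iff_compactSpace.1 isCompact_Oct

/-- Points of the octagons are equal or glued. -/
def OctEq (x y : Σ _ : Fin 6, Oct) : Prop := x = y ∨ OctGlued x y ∨ OctGlued y x

theorem oct_not_corner (o : Oct) (h1 : |o.1.1| = 1) (h2 : |o.1.2| = 1) : False := by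
  have := o.2.2.2
  rw [h1, h2] at this
  norm_num at this

theorem octGlued_right_unique {x y z : Σ _ : Fin 6, Oct} (h : OctGlued x y) (h' : OctGlued x z) :
    y = z := by
  obtain ⟨j, o⟩ := y
  obtain ⟨j', o'⟩ := z
  rcases h with ⟨h1, h2, h3⟩ | ⟨h1, h2, h3⟩ <;> rcases h' with ⟨h4, h5, h6⟩ | ⟨h4, h5, h6⟩
  · obtain rfl : j = j' := h2.trans h5.symm
    obtain rfl : o = o' := Subtype.ext (h3.trans h6.symm)
    rfl
  · exact (oct_not_corner x.2 (by rw [h1, abs_one]) (by rw [h4, abs_one])).elim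
  · exact (oct_not_corner x.2 (by rw [h4, abs_one]) (by rw [h1, abs_one])).elim
  · obtain rfl : j = j' := h2.trans h5.symm
    obtain rfl : o = o' := Subtype.ext (h3.trans h6.symm)
    rfl

theorem right_inj : Function.Injective right := by decide

theorem upper_inj : Function.Injective upper := by decide

theorem octGlued_left_unique {x y z : Σ _ : Fin 6, Oct} (h : OctGlued y x) (h' : OctGlued z x) :
    y = z := by
  obtain ⟨j, o⟩ := y
  obtain ⟨j', o'⟩ := z
  rcases h with ⟨h1, h2, h3⟩ | ⟨h1, h2, h3⟩ <;> rcases h' with ⟨h4, h5, h6⟩ | ⟨h4, h5, h6⟩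
  · obtain rfl : j = j' := right_inj (h2.symm.trans h5)
    obtain rfl : o = o' := Subtype.ext (Prod.ext (h1.trans h4.symm)
      (Prod.ext_iff.1 (h3.symm.trans h6)).2)
    rfl
  · exact (oct_not_corner x.2 (by rw [h3]; simp) (by rw [h6]; simp)).elim
  · exact (oct_not_corner x.2 (by rw [h6]; simp) (by rw [h3]; simp)).elim
  · obtain rfl : j = j' := upper_inj (h2.symm.trans h5)
    obtain rfl : o = o' := Subtype.ext (Prod.ext (Prod.ext_iff.1 (h3.symm.trans h6)).1
      (h1.trans h4.symm))
    rfl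

theorem not_octGlued_octGlued {x y z : Σ _ : Fin 6, Oct} (h : OctGlued x y) (h' : OctGlued y z) :
    False := by
  rcases h with ⟨h1, h2, h3⟩ | ⟨h1, h2, h3⟩ <;> rcases h' with ⟨h4, h5, h6⟩ | ⟨h4, h5, h6⟩
  · rw [h3] at h4; norm_num at h4
  · exact oct_not_corner y.2 (by rw [h3]; simp) (by rw [h4]; simp)
  · exact oct_not_corner y.2 (by rw [h4]; simp) (by rw [h3]; simp)
  · rw [h3] at h4; norm_num at h4

theorem octEq_equivalence : Equivalence OctEq where
  refl _ := .inl rfl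
  symm := by
    rintro x y (h | h | h)
    exacts [.inl h.symm, .inr (.inr h), .inr (.inl h)]
  trans := by
    rintro x y z (rfl | h | h) (rfl | h' | h')
    · exact .inl rfl
    · exact .inr (.inl h')
    · exact .inr (.inr h')
    · exact .inr (.inl h)
    · exact (not_octGlued_octGlued h h').elim
    · exact .inl (octGlued_left_unique h h')
    · exact .inr (.inr h)
    · exact .inl (octGlued_right_unique h h')
    · exact (not_octGlued_octGlued h' h).elim

theorem oct_mk_eq_iff {x y : Σ _ : Fin 6, Oct} :
    (Quot.mk OctGlued x = Quot.mk OctGlued y) ↔ OctEq x y := by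
  constructor
  · intro h
    have := Quot.eqvGen_exact h
    clear h
    induction this with
    | rel _ _ h => exact .inr (.inl h)
    | refl _ => exact .inl rfl
    | symm _ _ _ ih => exact octEq_equivalence.symm ih
    | trans _ _ _ _ _ ih1 ih2 => exact octEq_equivalence.trans ih1 ih2
  · rintro (rfl | h | h)
    exacts [rfl, Quot.sound h, (Quot.sound h).symm]

theorem isClosed_octGlued : IsClosed {p : (Σ _ : Fin 6, Oct) × (Σ _ : Fin 6, Oct) |
    OctGlued p.1 p.2} := by
  have h1 : Continuous fun x : Σ _ : Fin 6, Oct => x.1 := continuous_sigma fun _ => continuous_const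
  have h2 : Continuous fun x : Σ _ : Fin 6, Oct => x.2.1 := continuous_sigma fun _ =>
    continuous_subtype_val
  have hr : Continuous right := continuous_of_discreteTopology
  have hu : Continuous upper := continuous_of_discreteTopology
  refine IsClosed.union ?_ ?_
  · refine IsClosed.inter ?_ (IsClosed.inter ?_ ?_)
    · exact isClosed_eq (continuous_fst.comp (h2.comp continuous_fst)) continuous_const
    · exact isClosed_eq (h1.comp continuous_snd) (hr.comp (h1.comp continuous_fst))
    · exact isClosed_eq (h2.comp continuous_snd)
        (continuous_const.prodMk (continuous_snd.comp (h2.comp continuous_fst)))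
  · refine IsClosed.inter ?_ (IsClosed.inter ?_ ?_)
    · exact isClosed_eq (continuous_snd.comp (h2.comp continuous_fst)) continuous_const
    · exact isClosed_eq (h1.comp continuous_snd) (hu.comp (h1.comp continuous_fst))
    · exact isClosed_eq (h2.comp continuous_snd)
        ((continuous_fst.comp (h2.comp continuous_fst)).prodMk continuous_const)

instance : T2Space OctSurf := by
  refine t2_of_isQuotientMap (q := Quot.mk OctGlued) isQuotientMap_quot_mk ?_
  have h : {p : (Σ _ : Fin 6, Oct) × (Σ _ : Fin 6, Oct) |
      Quot.mk OctGlued p.1 = Quot.mk OctGlued p.2} = {p | OctEq p.1 p.2} :=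
    Set.ext fun p => oct_mk_eq_iff
  refine (congrArg IsClosed h).mpr ?_
  refine (isClosed_eq continuous_fst continuous_snd).union (isClosed_octGlued.union ?_)
  exact isClosed_octGlued.preimage continuous_swap

/-! ### The Arnoux–Yoccoz surface as an exact presentation -/

variable {α : ℝ} (A : IsRoot3 α)

include A in
theorem surf_v : (surfD.real α).v = sing α := by
  have h3 := A.cube
  have h4 := A.fourth
  funext k
  fin_cases k <;> apply Complex.ext <;>
    simp [PD.real, surfD, sing, Pt.ev, Z3.ev, slit1, slit2, slit3, tip1, tip2, tip3] <;> linarith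

include A in
theorem surf_cell : (surfD.real α).cell = cell α := by
  have h3 := A.cube
  have h4 := A.fourth
  funext i
  ext z
  have key : ∀ a b c d : Form, (∀ f ∈ [a, b, c, d], 0 ≤ f.val α z) ↔
      0 ≤ a.val α z ∧ 0 ≤ b.val α z ∧ 0 ≤ c.val α z ∧ 0 ≤ d.val α z := by simp
  fin_cases i <;> refine (key _ _ _ _).trans
      (and_congr ?_ (and_congr ?_ (and_congr ?_ ?_))) <;> constructor <;> intro h <;>
    simp [cellLeft, cellRight, cellTop, slit1, slit2, slit3, Z3.ev, Form.val] at h ⊢ <;> linarith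

theorem gluing_eq {g g' : Gluing} (h1 : g.src = g'.src) (h2 : g.tgt = g'.tgt)
    (h3 : g.p.re = g'.p.re) (h4 : g.p.im = g'.p.im) (h5 : g.q.re = g'.q.re)
    (h6 : g.q.im = g'.q.im) (h7 : g.t.re = g'.t.re) (h8 : g.t.im = g'.t.im) : g = g' := by
  obtain ⟨a, b, p, q, t⟩ := g
  obtain ⟨a', b', p', q', t'⟩ := g'
  obtain rfl : a = a' := h1
  obtain rfl : b = b' := h2
  obtain rfl : p = p' := Complex.ext h3 h4
  obtain rfl : q = q' := Complex.ext h5 h6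
  obtain rfl : t = t' := Complex.ext h7 h8
  rfl

include A in
theorem surf_gl : (surfD.real α).gl = gluings α := by
  have h3 := A.cube
  have h4 := A.fourth
  show surfD.gl.map (GD.real α) = gluings α
  simp only [surfD, gluings, List.map_cons, List.map_nil]
  repeat' refine congrArg₂ List.cons ?_ ?_
  all_goals first | rfl | refine gluing_eq rfl rfl ?_ ?_ ?_ ?_ ?_ ?_
  all_goals
    simp only [GD.real, Pt.ev, Z3.ev, slit1, slit2, slit3, tip1, tip2, tip3, Complex.zero_re,
      Complex.zero_im]
    push_cast
    linarith

end AY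

namespace AY

/-- The point of the blow-up over `z`, for `z` not among the blown-up points. -/
def hatPt {n : ℕ} (v : Fin n → ℂ) (z : ℂ) : ℂ × (Fin n → ℂ) := (z, fun k => nrm (z - v k))

theorem hatPt_mem {n : ℕ} {v : Fin n → ℂ} {S : Set ℂ} {z : ℂ} (hz : z ∈ S) (hv : z ∉ Set.range v) :
    hatPt v z ∈ blowUp v S := by
  refine ⟨hz, fun l => ?_⟩
  have hne : z - v l ≠ 0 := sub_ne_zero.2 fun h => hv ⟨l, h.symm⟩
  refine ⟨norm_nrm hne, ?_, ‖z - v l‖, norm_pos_iff.2 hne, ?_⟩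
  · show z = v l + ‖z - v l‖ * nrm (z - v l)
    rw [norm_mul_nrm hne]; ring
  · show v l + ‖z - v l‖ * nrm (z - v l) ∈ S
    rw [norm_mul_nrm hne]; simpa using hz

theorem blowUp.eq_hatPt {n : ℕ} {v : Fin n → ℂ} {S : Set ℂ} {x : ℂ × (Fin n → ℂ)}
    (hx : x ∈ blowUp v S) (hv : x.1 ∉ Set.range v) : x = hatPt v x.1 :=
  blowUp.ext hx (hatPt_mem (S := S) hx.1 hv) rfl fun k hk => absurd ⟨k, hk.symm⟩ hv

theorem continuousOn_hatPt {n : ℕ} (v : Fin n → ℂ) : ContinuousOn (hatPt v) (Set.range v)ᶜ := by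
  refine continuousOn_id.prodMk (continuousOn_pi.2 fun l => ?_)
  have h : Continuous fun z => z - v l := by fun_prop
  exact h.continuousOn.div (Complex.continuous_ofReal.comp h.norm).continuousOn fun z hz => by
    simp only [ne_eq, Complex.ofReal_eq_zero, norm_eq_zero, sub_eq_zero]
    exact fun e => hz ⟨l, e.symm⟩

namespace Pres

variable {n n' : ℕ} {P : Pres n} {P' : Pres n'} {s : ℂ}

/-- `x` is the point of the surface represented by the point `z` of the `i`-th polygon, which is
not among the blown-up points. -/
def Over (P : Pres n) (i : Fin 6) (z : ℂ) (x : P.Space) : Prop :=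
  z ∉ Set.range P.v ∧ ∃ h : hatPt P.v z ∈ blowUp P.v (P.cell i), x = P.pt i (hatPt P.v z) h

theorem exists_over {i : Fin 6} {z : ℂ} (hz : z ∈ P.cell i) (hv : z ∉ Set.range P.v) :
    ∃ x, P.Over i z x := ⟨_, hv, hatPt_mem hz hv, rfl⟩

theorem Over.mem {i : Fin 6} {z : ℂ} {x : P.Space} (h : P.Over i z x) : z ∈ P.cell i := h.2.1.1

theorem Over.unique {i : Fin 6} {z : ℂ} {x y : P.Space} (h : P.Over i z x) (h' : P.Over i z y) :
    x = y := by
  obtain ⟨_, _, rfl⟩ := h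
  obtain ⟨_, _, rfl⟩ := h'
  rfl

theorem Over.glue (hP : P.Good) {g : Gluing} (hg : g ∈ P.gl) {z : ℂ} {x : P.Space}
    (h : P.Over g.src z x) (hs : z ∈ segment ℝ g.p g.q) (ht : z + g.t ∈ P.cell g.tgt) :
    P.Over g.tgt (z + g.t) x := by
  have hv : z + g.t ∉ Set.range P.v := fun hv => h.1 ((hP.sing g hg z hs).2 hv)
  obtain ⟨hz, h1, rfl⟩ := h
  refine ⟨hv, hatPt_mem ht hv, Quot.sound ⟨g, hg, rfl, rfl, hatPt_mem hs hz, hatPt_mem ?_ hv, rfl⟩⟩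
  rw [segment_eq_image'] at hs ⊢
  obtain ⟨θ, hθ, rfl⟩ := hs
  exact ⟨θ, hθ, by simp only [add_sub_add_right_eq_sub]; ring⟩

theorem Over.unglue (hP : P.Good) {g : Gluing} (hg : g ∈ P.gl) {z : ℂ} {x : P.Space}
    (h : P.Over g.tgt (z + g.t) x) (hs : z ∈ segment ℝ g.p g.q) (ht : z ∈ P.cell g.src) :
    P.Over g.src z x := by
  have hv : z ∉ Set.range P.v := fun hv => h.1 ((hP.sing g hg z hs).1 hv)
  obtain ⟨y, hy⟩ := exists_over ht hv
  rwa [h.unique (hy.glue hP hg hs h.mem)]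

theorem Over.map {L : List Part} (H : Compat P P' s L) {p : Part} (hp : p ∈ L) {z : ℂ} {x : P.Space}
    (h : P.Over p.i z x) (hz : p.map s z ∈ P'.cell p.j) : P'.Over p.j (p.map s z) (H.fwd x) := by
  obtain ⟨hv, h1, rfl⟩ := h
  have hd : z ∈ P.dom P' s p := ⟨h1.1, hz⟩
  have hv' : p.map s z ∉ Set.range P'.v := fun hv' => hv ((H.sing p hp z hd).2 hv')
  refine ⟨hv', hatPt_mem hz hv', ?_⟩
  have hd' := hatPt_mem hd hv
  rw [H.fwd_pt hp rfl hd' h1]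
  exact pt_eq rfl (blowUp.eq_hatPt (H.liftPart_mem_cell hp hd') hv') _ _

/-- Curves in the polygons avoiding the blown-up points lift. -/
theorem exists_continuous_over {T : Type*} [TopologicalSpace T] {c : T → ℂ} (hc : Continuous c)
    {i : Fin 6} (h : ∀ t, c t ∈ P.cell i) (hv : ∀ t, c t ∉ Set.range P.v) :
    ∃ γ : T → P.Space, Continuous γ ∧ ∀ t, P.Over i (c t) (γ t) := by
  refine ⟨fun t => P.pt i (hatPt P.v (c t)) (hatPt_mem (h t) (hv t)), ?_,
    fun t => ⟨hv t, hatPt_mem (h t) (hv t), rfl⟩⟩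
  have h1 : Continuous fun t => hatPt P.v (c t) :=
    (continuousOn_hatPt P.v).comp_continuous hc hv
  exact continuous_quot_mk.comp (continuous_sigmaMk.comp (h1.subtype_mk _))

end Pres

/-! ### The Arnoux–Yoccoz map on the surfaces -/

/-- The presentation of the blown-up surface. -/
abbrev surf (α : ℝ) : Pres 9 := ⟨sing α, cell α, gluings α⟩

/-- The presentation of the surface. -/
abbrev surf₀ (α : ℝ) : Pres 0 := ⟨![], cell α, gluings α⟩

variable {α : ℝ} (A : IsRoot3 α)

include A in
theorem surf_real : surfD.real α = surf α := by
  have h : surfD.real α = ⟨(surfD.real α).v, (surfD.real α).cell, (surfD.real α).gl⟩ := rfl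
  rw [h, surf_v A, surf_cell A, surf_gl A]

include A in
theorem surf₀_real : surfD₀.real α = surf₀ α := by
  have h : surfD₀.real α = ⟨![], (surfD.real α).cell, (surfD.real α).gl⟩ := by
    have : (surfD₀.real α).v = ![] := Subsingleton.elim _ _
    rw [← this]; rfl
  rw [h, surf_cell A, surf_gl A]

include A in
theorem surf_good : (surf α).Good := surf_real A ▸ PD.good A surfD_good

/-- The parts of the Arnoux–Yoccoz map. -/
abbrev ayParts (α : ℝ) : List Part := mapParts.map (PartD.real α)

include A in
theorem map_compat : Pres.Compat (surf α) (surf α) (stretch.scale α) (ayParts α) := by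
  have := PD.compat A surfD_good surfD_good map_check
  rwa [surf_real A] at this

include A in
theorem map_compat₀ : Pres.Compat (surf₀ α) (surf₀ α) (stretch.scale α) (ayParts α) := by
  have := PD.compat A surfD₀_good surfD₀_good map_check₀
  rwa [surf₀_real A] at this

include A in
theorem map_compat_inv : Pres.Compat (surf α) (surf α)
    ⟨(stretch.scale α).re⁻¹, (stretch.scale α).im⁻¹⟩
    ((ayParts α).map fun p => p.inv (stretch.scale α)) := by
  have hl : PD.linCheck stretch shrink = true := by decide
  have := PD.compat A surfD_good surfD_good map_check_inv
  rwa [surf_real A, PD.inv_scale A hl, PD.map_inv A hl] at this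

include A in
theorem map_compat_inv₀ : Pres.Compat (surf₀ α) (surf₀ α)
    ⟨(stretch.scale α).re⁻¹, (stretch.scale α).im⁻¹⟩
    ((ayParts α).map fun p => p.inv (stretch.scale α)) := by
  have hl : PD.linCheck stretch shrink = true := by decide
  have := PD.compat A surfD₀_good surfD₀_good map_check_inv₀
  rwa [surf₀_real A, PD.inv_scale A hl, PD.map_inv A hl] at this

/-- The Arnoux–Yoccoz map on the blown-up surface. -/
def hatMap : Xhat α ≃ₜ Xhat α := (map_compat A).homeo (map_compat_inv A)

theorem continuous_base {n : ℕ} {v : Fin n → ℂ} {S : Set ℂ} :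
    Continuous fun x : blowUp v S => (⟨x.1.1, x.2.1⟩ : S) :=
  Continuous.subtype_mk (continuous_fst.comp continuous_subtype_val) fun x => x.2.1

/-- The polygons with no points blown up. -/
def noHat (i : Fin 6) (z : cell α i) : blowUp (surf₀ α).v ((surf₀ α).cell i) :=
  ⟨hatPt (surf₀ α).v z, hatPt_mem z.2 fun ⟨k, _⟩ => k.elim0⟩

theorem continuous_noHat (i : Fin 6) : Continuous (noHat (α := α) i) :=
  ((continuousOn_hatPt (surf₀ α).v).comp_continuous continuous_subtype_val
    fun _ ⟨k, _⟩ => k.elim0).subtype_mk _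

/-- The surface as a surface with no points blown up. -/
def surfHomeo (α : ℝ) : X α ≃ₜ (surf₀ α).Space where
  toFun := Quot.map (fun x => ⟨x.1, noHat x.1 x.2⟩) (by
    rintro x y ⟨g, hg, h1, h2, h3, h4⟩
    refine ⟨g, hg, h1, h2, ⟨h3, fun k => k.elim0⟩, ⟨?_, fun k => k.elim0⟩, h4⟩
    show (y.2 : ℂ) ∈ _
    rw [h4]
    rw [segment_eq_image'] at h3 ⊢
    obtain ⟨θ, hθ, h⟩ := h3
    exact ⟨θ, hθ, by simp only [add_sub_add_right_eq_sub, ← h]; ring⟩)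
  invFun := Quot.map (fun x => ⟨x.1, x.2.1.1, x.2.2.1⟩)
    (fun _ _ ⟨g, hg, h1, h2, h3, _, h5⟩ => ⟨g, hg, h1, h2, h3.1, h5⟩)
  left_inv x := by
    induction x using Quot.ind
    rfl
  right_inv x := by
    induction x using Quot.ind with | mk x => ?_
    obtain ⟨i, ⟨z, u⟩, h⟩ := x
    obtain rfl : u = (hatPt (surf₀ α).v z).2 := Subsingleton.elim _ _
    rfl
  continuous_toFun := continuous_coinduced_dom.2 (continuous_sigma fun i =>
    continuous_quot_mk.comp (continuous_sigmaMk.comp (continuous_noHat i)))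
  continuous_invFun := continuous_coinduced_dom.2 (continuous_sigma fun _ => continuous_quot_mk.comp
    (continuous_sigmaMk.comp continuous_base))

/-- The Arnoux–Yoccoz map. -/
def ayMap : X α ≃ₜ X α :=
  ((surfHomeo α).trans ((map_compat₀ A).homeo (map_compat_inv₀ A))).trans (surfHomeo α).symm

theorem over_surf₀ {i : Fin 6} {z : ℂ} (hz : z ∈ cell α i) :
    (surf₀ α).Over i z (surfHomeo α (Quot.mk _ ⟨i, z, hz⟩)) := by
  have hv : z ∉ Set.range (surf₀ α).v := fun ⟨k, _⟩ => k.elim0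
  exact ⟨hv, hatPt_mem hz hv, rfl⟩

theorem at_iff_over₀ {i : Fin 6} {z : ℂ} {x : X α} :
    At α i z x ↔ (surf₀ α).Over i z (surfHomeo α x) := by
  constructor
  · rintro ⟨hz, rfl⟩
    exact over_surf₀ hz
  · intro h
    exact ⟨h.mem, (surfHomeo α).injective (h.unique (over_surf₀ h.mem))⟩

theorem At.map {p : Part} (hp : p ∈ ayParts α) {z : ℂ} {x : X α} (h : At α p.i z x)
    (hz : p.map (stretch.scale α) z ∈ cell α p.j) :
    At α p.j (p.map (stretch.scale α) z) (ayMap A x) := by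
  rw [at_iff_over₀] at h ⊢
  have e : surfHomeo α (ayMap A x) = (map_compat₀ A).fwd (surfHomeo α x) :=
    (surfHomeo α).apply_symm_apply _
  rw [e]
  exact h.map (map_compat₀ A) hp hz

theorem collapse_hatMap (x : Xhat α) : collapse α (hatMap A x) = ayMap A (collapse α x) := by
  induction x using Quot.ind with | mk x => ?_
  obtain ⟨i, x, hx⟩ := x
  obtain ⟨p, hp, rfl, hxp⟩ := (map_compat A).exists_part hx
  have h1 : hatMap A (Quot.mk _ ⟨p.i, x, hx⟩) = _ := (map_compat A).fwd_pt hp rfl hxp hx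
  have h2 : At α p.i x.1 (collapse α (Quot.mk _ ⟨p.i, x, hx⟩)) := ⟨hx.1, rfl⟩
  obtain ⟨h3, h4⟩ := h2.map A hp hxp.1.2
  rw [h1, h4]
  rfl

/-- Nonsingular points of the blown-up surface are determined by their images in the surface. -/
def unCollapse : X α → Option (Xhat α) :=
  open Classical in
  Quot.lift (fun x : Pieces α => if h : (x.2 : ℂ) ∉ Set.range (sing α) then
    some ((surf α).pt x.1 (hatPt (sing α) x.2) (hatPt_mem x.2.2 h)) else none) (by
    rintro ⟨i, z, hz⟩ ⟨i', z', hz'⟩ ⟨g, hg, h1, h2, h3, h4⟩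
    obtain rfl : i = g.src := h1
    obtain rfl : i' = g.tgt := h2
    obtain rfl : z' = z + g.t := h4
    have hs := (surf_good A).sing g hg z h3
    by_cases hv : z ∈ Set.range (sing α)
    · have hv' : z + g.t ∈ Set.range (sing α) := hs.1 hv
      simp only [hv, hv', not_true_eq_false, dite_false]
    · have hv' : z + g.t ∉ Set.range (sing α) := fun h => hv (hs.2 h)
      have h5 : (surf α).Over g.src z ((surf α).pt g.src (hatPt (sing α) z) (hatPt_mem hz hv)) :=
        ⟨hv, _, rfl⟩
      have h6 := h5.glue (surf_good A) hg h3 hz'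
      simp only [hv, hv', not_false_eq_true, dite_true]
      exact congrArg some (h6.unique ⟨hv', _, rfl⟩))

include A in
theorem at_collapse_iff {i : Fin 6} {z : ℂ} (hv : z ∉ Set.range (sing α)) {x : Xhat α} :
    At α i z (collapse α x) ↔ (surf α).Over i z x := by
  constructor
  · rintro ⟨hz, h⟩
    induction x using Quot.ind with | mk x => ?_
    obtain ⟨j, x, hx⟩ := x
    have h1 : unCollapse A (collapse α (Quot.mk _ ⟨j, x, hx⟩)) =
      unCollapse A (Quot.mk _ ⟨i, z, hz⟩) := congrArg _ h
    have h2 : unCollapse A (Quot.mk _ ⟨i, z, hz⟩) =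
        some ((surf α).pt i (hatPt (sing α) z) (hatPt_mem hz hv)) := dif_pos hv
    by_cases hx1 : x.1 ∈ Set.range (sing α)
    · have h3 : unCollapse A (collapse α (Quot.mk _ ⟨j, x, hx⟩)) = none :=
        dif_neg (not_not.2 hx1)
      rw [h2, h3] at h1
      simp at h1
    · have h3 : unCollapse A (collapse α (Quot.mk _ ⟨j, x, hx⟩)) =
        some ((surf α).pt j (hatPt (sing α) x.1) (hatPt_mem hx.1 hx1)) := dif_pos hx1
      rw [h2, h3] at h1
      replace h1 := Option.some.inj h1
      refine ⟨hv, hatPt_mem hz hv, ?_⟩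
      rw [← h1]
      exact Pres.pt_eq (P := surf α) rfl (blowUp.eq_hatPt hx hx1) _ _
  · rintro ⟨-, h, rfl⟩
    exact ⟨h.1, rfl⟩

/-- The congruence of the blown-up surface with the model glued from parallelograms. -/
abbrev parParts (α : ℝ) : List Part := modelParts.map (PartD.real α)

include A in
theorem model_compat : Pres.Compat (surf α) (modelD.real α) (onePt.scale α) (parParts α) := by
  have := PD.compat A surfD_good modelD_good model_check
  rwa [surf_real A] at this

include A in
theorem model_compat_inv : Pres.Compat (modelD.real α) (surf α)
    ⟨(onePt.scale α).re⁻¹, (onePt.scale α).im⁻¹⟩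
    ((parParts α).map fun p => p.inv (onePt.scale α)) := by
  have hl : PD.linCheck onePt onePt = true := by decide
  have := PD.compat A modelD_good surfD_good model_check_inv
  rwa [surf_real A, PD.inv_scale A hl, PD.map_inv A hl] at this

/-- The blown-up surface is glued from six parallelograms. -/
def parHomeo : Xhat α ≃ₜ (modelD.real α).Space := (model_compat A).homeo (model_compat_inv A)

/-- The blown-up surface is glued from six octagons. -/
def octSurfHomeo : Xhat α ≃ₜ OctSurf := (parHomeo A).trans (modelHomeo A)

include A in
theorem t2_Xhat : T2Space (Xhat α) := (octSurfHomeo A).symm.t2Space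

end AY

namespace AY

variable {α : ℝ} (A : IsRoot3 α)

theorem interior_cell (i : Fin 6) : interior (cell α i) = {z | cellLeft α i < z.re ∧
    z.re < cellRight α i ∧ 0 < z.im ∧ z.im < cellTop α i} := by
  have h : cell α i = Set.Icc (cellLeft α i) (cellRight α i) ×ℂ Set.Icc 0 (cellTop α i) := by
    ext z
    simp only [cell, Set.mem_ofPred_eq, Complex.mem_reProdIm, Set.mem_Icc, and_assoc]
  rw [h, Complex.interior_reProdIm, interior_Icc, interior_Icc]
  ext z
  simp only [Set.mem_ofPred_eq, Complex.mem_reProdIm, Set.mem_Ioo, and_assoc]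

include A in
theorem eq_of_mem_interior_cell {i j : Fin 6} {z : ℂ} (h : z ∈ interior (cell α i))
    (h' : z ∈ cell α j) : i = j := by
  rw [interior_cell] at h
  obtain ⟨h1, h2, -, -⟩ := h
  obtain ⟨h3, h4, -, -⟩ := h'
  have k1 := A.lo; have k2 := A.hi; have k3 := A.lo2; have k4 := A.hi2
  have k5 := A.fourth
  fin_cases i <;> fin_cases j <;> first | rfl | (
    exfalso
    simp [cellLeft, cellRight, slit1, slit2, slit3] at h1 h2 h3 h4
    linarith)

include A in
theorem stretch_scale : stretch.scale α = ⟨α, α⁻¹⟩ := by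
  rw [A.inv]
  apply Complex.ext <;> simp [stretch, Pt.scale, Z3.ev]

include A in
theorem cellTop_le (j : Fin 6) : cellTop α j ≤ 1 := by
  have k1 := A.lo; have k2 := A.hi; have k3 := A.lo2; have k4 := A.hi2
  fin_cases j <;> simp [cellTop] <;> linarith

include A in
theorem ayFormula_eq {p : Part} (hp : p ∈ ayParts α) {z : ℂ} (hz : z ∈ cell α p.i)
    (hz' : p.map (stretch.scale α) z ∈ cell α p.j) (hx : z.re ≠ slit2 α) (hy : z.im ≠ α) :
    ayFormula α z = p.map (stretch.scale α) z := by
  have hpos := A.pos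
  have hi := inv_pos.2 hpos
  have h4 := A.fourth
  have k1 := A.lo; have k2 := A.hi; have k3 := A.lo2; have k4 := A.hi2
  have ht := hz'.2.2.2.trans (cellTop_le A _)
  have hb := hz'.2.2.1
  have hl := hz.1
  have hr := hz.2.1
  clear hz hz'
  rw [stretch_scale A] at *
  have up : 0 ≤ α⁻¹ * z.im - 1 → α < z.im := fun h => by
    refine lt_of_le_of_ne ?_ hy.symm
    have := mul_le_mul_of_nonneg_left (by linarith : 1 ≤ α⁻¹ * z.im) hpos.le
    rwa [mul_one, mul_inv_cancel_left₀ hpos.ne'] at this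
  have dn : α⁻¹ * z.im ≤ 1 → z.im ≤ α := fun h => by
    have := mul_le_mul_of_nonneg_left h hpos.le
    rwa [mul_one, mul_inv_cancel_left₀ hpos.ne'] at this
  simp only [ayParts, mapParts, List.map_cons, List.map_nil, List.mem_cons, List.not_mem_nil,
    or_false] at hp
  rcases hp with rfl | rfl | rfl | rfl | rfl | rfl | rfl | rfl | rfl | rfl | rfl
  iterate 5
    simp [Part.map, PartD.real, Pt.ev, Z3.ev, diag] at hb ht ⊢
    have := up (by linarith)
    rw [ayFormula, if_neg (not_le.2 this), if_pos this, ite_self]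
    apply Complex.ext <;> simp; ring
  iterate 2
    simp [Part.map, PartD.real, Pt.ev, Z3.ev, diag, cellRight, slit1, slit2] at hb ht hr ⊢
    have := dn (by linarith)
    rw [ayFormula, if_neg, if_neg (not_lt.2 this)]
    · apply Complex.ext <;> simp [h4]; ring
    · rw [slit2]; linarith
  iterate 4
    simp [Part.map, PartD.real, Pt.ev, Z3.ev, diag, cellLeft, slit2, slit3] at hb ht hl hx ⊢
    have := dn (by linarith)
    rw [ayFormula, if_pos, if_pos this]
    · apply Complex.ext <;> simp [h4]; ring
    · rw [slit2]
      refine lt_of_le_of_ne ?_ (fun e => hx e.symm)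
      linarith

include A in
theorem re_ne_slit2 {i : Fin 6} {z : ℂ} (h : z ∈ interior (cell α i)) : z.re ≠ slit2 α := by
  rw [interior_cell] at h
  obtain ⟨h1, h2, -, -⟩ := h
  have k1 := A.lo; have k2 := A.hi; have k3 := A.lo2; have k4 := A.hi2
  have k5 := A.fourth
  intro e
  rw [e] at h1 h2
  fin_cases i <;> simp [cellLeft, cellRight, slit1, slit2, slit3] at h1 h2 <;> linarith

theorem isAYMap_ayMap : IsAYMap α (ayMap A) := by
  rintro i j z x hi hj hx
  obtain ⟨hz, rfl⟩ := hx
  obtain ⟨p, hp, rfl, hxp⟩ := (map_compat₀ A).exists_part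
    (hatPt_mem (v := (surf₀ α).v) hz fun ⟨k, _⟩ => k.elim0)
  have hd := hxp.1
  have hy : z.im ≠ α := by
    intro e
    rw [interior_cell] at hj
    have h1 := hj.2.2.2.trans_le (cellTop_le A j)
    have h2 : (ayFormula α z).im = 1 := by
      unfold ayFormula
      rw [e]
      split_ifs with h1 h2 h3
      · exact inv_mul_cancel₀ A.pos.ne'
      · exact absurd le_rfl h2
      · exact absurd h3 (lt_irrefl _)
      · exact inv_mul_cancel₀ A.pos.ne'
    linarith
  have e := ayFormula_eq A hp hz hd.2 (re_ne_slit2 A hi) hy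
  have hpj : j = p.j := eq_of_mem_interior_cell A hj (e ▸ hd.2)
  subst hpj
  rw [e]
  exact At.map A hp ⟨hz, rfl⟩ hd.2

/-- An interior point of the domain of each part of the Arnoux–Yoccoz map. -/
def midPts : List Pt := [
  ⟨⟨0, 0, 1⟩, ⟨1, 0, 1⟩⟩, ⟨⟨0, 1, 0⟩, ⟨1, 0, 1⟩⟩,
  ⟨⟨1, 0, 0⟩, ⟨1, 0, 1⟩⟩, ⟨⟨1, 0, 1⟩, ⟨1, 0, 1⟩⟩,
  ⟨⟨1, 0, 2⟩, ⟨1, 0, 1⟩⟩, ⟨⟨0, 0, 1⟩, ⟨0, 0, 1⟩⟩,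
  ⟨⟨0, 1, 0⟩, ⟨0, 0, 1⟩⟩, ⟨⟨1, 0, 0⟩, ⟨0, 0, 1⟩⟩,
  ⟨⟨1, 0, 1⟩, ⟨0, 0, 1⟩⟩, ⟨⟨1, 0, 2⟩, ⟨0, 0, 1⟩⟩,
  ⟨⟨1, 1, 1⟩, ⟨0, 0, 1⟩⟩]

/-- A check that the point is interior to the domain of a part. -/
def midCheck (p : PartD) (c : Pt) : Bool :=
  (PD.domForms surfD surfD stretch p).all fun f => (f.evalAt c).pos

theorem mid_check : (List.zip mapParts midPts).all (fun x => midCheck x.1 x.2) = true := by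
  decide +kernel

theorem exists_mid {p : PartD} (hp : p ∈ mapParts) : ∃ c, midCheck p c = true := by
  obtain ⟨k, hk, rfl⟩ := List.getElem_of_mem hp
  have hl : (List.zip mapParts midPts).length = mapParts.length := by decide
  have hk' : k < (List.zip mapParts midPts).length := by rw [hl]; exact hk
  have := List.all_eq_true.1 mid_check _ (List.getElem_mem hk')
  rw [List.getElem_zip] at this
  exact ⟨_, this⟩

/-- A check that the singular points are not interior to the cells. -/
theorem sing_check : ((List.finRange 6).all fun i => (List.finRange 9).all fun k =>
    (surfD.cell i).any fun f => (f.evalAt (surfD.v k)).neg.nonneg) = true := by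
  decide +kernel

theorem continuous_val (f : Form) : Continuous (f.val α) := by
  unfold Form.val
  exact (continuous_const.mul (continuous_const.mul Complex.continuous_re)).add
    (continuous_const.mul (continuous_const.mul Complex.continuous_im)) |>.add continuous_const

theorem val_lineMap (f : Form) (z c : ℂ) (t : ℝ) :
    f.val α (z + t * (c - z)) = (1 - t) * f.val α z + t * f.val α c := by
  simp [Form.val]; ring

include A in
theorem mem_interior_cell {i : Fin 6} {z : ℂ} (h : ∀ f ∈ surfD.cell i, 0 < f.val α z) :
    z ∈ interior (cell α i) ∧ z ∉ Set.range (sing α) := by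
  constructor
  · refine mem_interior.2 ⟨{w | ∀ f ∈ surfD.cell i, 0 < f.val α w}, fun w hw => ?_, ?_, h⟩
    · rw [← surf_cell A]
      exact fun f hf => (hw f hf).le
    · have : {w | ∀ f ∈ surfD.cell i, 0 < f.val α w} =
          ⋂ f ∈ {f | f ∈ surfD.cell i}, {w | 0 < f.val α w} := by
        ext w; simp
      rw [this]
      exact (List.finite_toSet _).isOpen_biInter fun f _ =>
        isOpen_lt continuous_const (continuous_val f)
  · rintro ⟨k, rfl⟩
    have h1 := List.all_eq_true.1 (List.all_eq_true.1 sing_check i (List.mem_finRange i)) k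
      (List.mem_finRange k)
    obtain ⟨f, hf, h2⟩ := List.any_eq_true.1 h1
    have h3 := Z3.ev_nonneg A h2
    rw [Z3.ev_neg, Form.ev_evalAt A] at h3
    have h4 := h f hf
    rw [← surf_v A] at h4
    exact absurd (neg_nonneg.1 h3) (not_le.2 h4)

theorem Data.hhat_eq (D : Data α) {i : Fin 6} {z : ℂ} {x : Xhat α} (h : (surf α).Over i z x) :
    D.hhat x = hatMap A x := by
  have := t2_Xhat A
  obtain ⟨p, hp, rfl, hxp⟩ := (map_compat A).exists_part h.2.1
  have hd : z ∈ (surf α).dom (surf α) (stretch.scale α) p := hxp.1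
  obtain ⟨q, hq, rfl⟩ := List.mem_map.1 hp
  obtain ⟨c, hc⟩ := exists_mid hq
  set w : I → ℂ := fun t => z + (t : ℝ) * (c.ev α - z) with hw
  have hval : ∀ f ∈ PD.domForms surfD surfD stretch q, 0 ≤ f.val α z ∧ 0 < f.val α (c.ev α) := by
    intro f hf
    constructor
    · have h1 := (PD.domForms_iff (P := surfD) (Q := surfD) (s := stretch) A q z).2
      rw [surf_real A] at h1
      exact h1 hd f hf
    · rw [← Form.ev_evalAt A]
      exact Z3.ev_pos A (List.all_eq_true.1 hc f hf)
  have hpos : ∀ t : I, t ≠ 0 → ∀ f ∈ PD.domForms surfD surfD stretch q, 0 < f.val α (w t) := by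
    intro t ht f hf
    have ht0 : (0 : ℝ) < t := lt_of_le_of_ne t.2.1 fun e => ht (Subtype.ext e.symm)
    rw [hw, val_lineMap]
    have h1 := mul_nonneg (sub_nonneg.2 t.2.2) (hval f hf).1
    have h2 := mul_pos ht0 (hval f hf).2
    linarith
  have hsrc : ∀ t : I, t ≠ 0 → w t ∈ interior (cell α q.i) ∧ w t ∉ Set.range (sing α) :=
    fun t ht => mem_interior_cell A fun f hf => hpos t ht f (List.mem_append_left _ hf)
  have htgt : ∀ t : I, t ≠ 0 → (q.real α).map (stretch.scale α) (w t) ∈ interior (cell α q.j) ∧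
      (q.real α).map (stretch.scale α) (w t) ∉ Set.range (sing α) := by
    intro t ht
    refine mem_interior_cell A fun f hf => ?_
    have := hpos t ht _ (List.mem_append_right _ (List.mem_map_of_mem hf))
    rwa [Form.val_pull A] at this
  have hw0 : w 0 = z := by simp [hw]
  obtain ⟨γ, hγ, hγo⟩ := Pres.exists_continuous_over (P := surf α) (c := w) (by fun_prop)
    (i := q.i) (fun t => by
      by_cases ht : t = 0
      · rw [ht, hw0]; exact h.mem
      · exact interior_subset (hsrc t ht).1)
    (fun t => by
      by_cases ht : t = 0
      · rw [ht, hw0]; exact h.1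
      · exact (hsrc t ht).2)
  have key : ∀ t : I, t ≠ 0 → D.hhat (γ t) = hatMap A (γ t) := by
    intro t ht
    have h1 := interior_subset (htgt t ht).1
    have h2 := (hγo t).map (map_compat A) hp h1
    have h3 : ayFormula α (w t) = (q.real α).map (stretch.scale α) (w t) := by
      refine ayFormula_eq A hp (hγo t).mem h1 (re_ne_slit2 A (hsrc t ht).1) ?_
      intro e
      have h4 := (htgt t ht).1
      rw [interior_cell, stretch_scale A] at h4
      obtain ⟨-, -, h5, h6⟩ := h4
      replace h6 := h6.trans_le (cellTop_le A _)
      simp only [Part.map, diag, e, inv_mul_cancel₀ A.pos.ne', Complex.add_im] at h5 h6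
      have h7 : ((q.real α).w).im = 0 ∨ ((q.real α).w).im = -1 := by
        clear * - hq
        simp only [mapParts, List.mem_cons, List.not_mem_nil, or_false] at hq
        rcases hq with rfl | rfl | rfl | rfl | rfl | rfl | rfl | rfl | rfl | rfl | rfl <;>
          simp [PartD.real, Pt.ev, Z3.ev]
      rcases h7 with h7 | h7 <;> rw [h7] at h5 h6 <;> linarith
    have h4 := D.isAYMap q.i q.j (w t) (collapse α (γ t)) (hsrc t ht).1 (h3 ▸ (htgt t ht).1)
      ((at_collapse_iff A (hsrc t ht).2).2 (hγo t))
    replace h4 : At α q.j (ayFormula α (w t)) (collapse α (D.hhat (γ t))) :=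
      (D.collapse_hhat (γ t)).symm ▸ h4
    rw [h3] at h4
    exact ((at_collapse_iff A (htgt t ht).2).1 h4).unique h2
  have h5 : (fun t => D.hhat (γ t)) = fun t => hatMap A (γ t) :=
    Continuous.ext_on (dense_compl_singleton (0 : I)) (D.hhat.continuous.comp hγ)
      ((hatMap A).continuous.comp hγ) fun t ht => key t ht
  have h6 : γ 0 = x := Pres.Over.unique (hγo 0) (by rw [hw0]; exact h)
  rw [← h6]
  exact congrFun h5 0

end AY

namespace AY

/-! ### Homotopy classes of paths from a base point -/

section Tails

variable {Y : Type*} [TopologicalSpace Y] {x₀ : Y}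

/-- Homotopy classes of loops at `x₀`, composed from left to right. -/
def LoopGrp (x₀ : Y) : Type _ := Path.Homotopic.Quotient x₀ x₀

/-- The class of a loop. -/
def LoopGrp.mk (p : Path x₀ x₀) : LoopGrp x₀ := Path.Homotopic.Quotient.mk p

instance : Group (LoopGrp x₀) where
  mul := Path.Homotopic.Quotient.trans
  one := Path.Homotopic.Quotient.refl x₀
  inv := Path.Homotopic.Quotient.symm
  mul_assoc := Path.Homotopic.Quotient.trans_assoc
  one_mul := Path.Homotopic.Quotient.refl_trans
  mul_one := Path.Homotopic.Quotient.trans_refl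
  inv_mul_cancel := Path.Homotopic.Quotient.symm_trans

theorem LoopGrp.one_def : (1 : LoopGrp x₀) = Path.Homotopic.Quotient.refl x₀ := rfl

/-- A homotopy class of paths starting at `x₀`. -/
structure Tail (x₀ : Y) where
  /-- The end point. -/
  pt : Y
  /-- The class. -/
  cls : Path.Homotopic.Quotient x₀ pt

instance : MulAction (LoopGrp x₀) (Tail x₀) where
  smul w τ := ⟨τ.pt, Path.Homotopic.Quotient.trans w τ.cls⟩
  one_smul τ := by
    cases τ
    exact congrArg (Tail.mk _) (Path.Homotopic.Quotient.refl_trans _)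
  mul_smul a b τ := by
    cases τ
    exact congrArg (Tail.mk _) (Path.Homotopic.Quotient.trans_assoc a b _)

theorem Tail.exists_smul {τ τ' : Tail x₀} (h : τ.pt = τ'.pt) : ∃ w : LoopGrp x₀, τ = w • τ' := by
  obtain ⟨x, c⟩ := τ
  obtain ⟨y, c'⟩ := τ'
  dsimp only at h
  subst h
  refine ⟨Path.Homotopic.Quotient.trans c c'.symm, congrArg (Tail.mk _) ?_⟩
  rw [Path.Homotopic.Quotient.trans_assoc, Path.Homotopic.Quotient.symm_trans,
    Path.Homotopic.Quotient.trans_refl]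

/-- The class `τ` continued along `γ` from time `a` to time `b` is `τ'`. -/
def Carries (γ : ℝ → Y) (a b : ℝ) (τ τ' : Tail x₀) : Prop :=
  ∃ p : Path τ.pt τ'.pt, (∀ t : I, p t = γ (a + t * (b - a))) ∧
    τ.cls.trans (Path.Homotopic.Quotient.mk p) = τ'.cls

theorem mk_trans_eq_of_line {γ : ℝ → Y} (hγ : Continuous γ) {a b c : ℝ} {x y z : Y} (p : Path x y)
    (q : Path y z) (r : Path x z) (hp : ∀ t : I, p t = γ (a + t * (b - a)))
    (hq : ∀ t : I, q t = γ (b + t * (c - b))) (hr : ∀ t : I, r t = γ (a + t * (c - a))) :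
    (Path.Homotopic.Quotient.mk p).trans (Path.Homotopic.Quotient.mk q) =
      Path.Homotopic.Quotient.mk r := by
  have hx : x = γ a := by rw [← p.source, hp]; simp
  have hy : y = γ b := by rw [← p.target, hp]; simp
  have hz : z = γ c := by rw [← q.target, hq]; simp
  subst hx hy hz
  let g : C(ℝ, Y) := ⟨γ, hγ⟩
  let l : ∀ u v : ℝ, Path u v := fun u v =>
    { toFun := fun t => u + t * (v - u)
      source' := by simp
      target' := by simp }
  have e : ∀ {u v : ℝ} (p : Path (γ u) (γ v)), (∀ t : I, p t = γ (u + t * (v - u))) →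
      p = (l u v).map g.continuous := fun p hp => Path.ext (funext fun t => hp t)
  rw [e p hp, e q hq, e r hr, ← Path.Homotopic.Quotient.mk_trans, ← Path.map_trans]
  exact Path.Homotopic.Quotient.eq.2
    ((SimplyConnectedSpace.paths_homotopic ((l a b).trans (l b c)) (l a c)).map g)

theorem Carries.trans {γ : ℝ → Y} (hγ : Continuous γ) {a b c : ℝ} {τ τ' τ'' : Tail x₀}
    (h : Carries γ a b τ τ') (h' : Carries γ b c τ' τ'') : Carries γ a c τ τ'' := by
  obtain ⟨p, hp, e⟩ := h
  obtain ⟨q, hq, e'⟩ := h'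
  let r : Path τ.pt τ''.pt :=
    { toFun := fun t => γ (a + t * (c - a))
      continuous_toFun := by fun_prop
      source' := by rw [← p.source, hp]; simp
      target' := by rw [← q.target, hq]; simp }
  refine ⟨r, fun _ => rfl, ?_⟩
  rw [← e', ← e, Path.Homotopic.Quotient.trans_assoc,
    mk_trans_eq_of_line hγ p q r hp hq fun _ => rfl]

theorem Carries.unique {γ : ℝ → Y} {a b : ℝ} {τ τ' τ'' : Tail x₀} (h : Carries γ a b τ τ')
    (h' : Carries γ a b τ τ'') : τ' = τ'' := by
  obtain ⟨p, hp, e⟩ := h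
  obtain ⟨q, hq, e'⟩ := h'
  obtain ⟨x, c⟩ := τ'
  obtain ⟨y, c'⟩ := τ''
  have : x = y := p.target.symm.trans (((hp 1).trans (hq 1).symm).trans q.target)
  subst this
  congr
  dsimp only at e e'
  rw [← e, ← e', Path.ext (funext fun t => (hp t).trans (hq t).symm)]

theorem Carries.smul (w : LoopGrp x₀) {γ : ℝ → Y} {a b : ℝ} {τ τ' : Tail x₀}
    (h : Carries γ a b τ τ') : Carries γ a b (w • τ) (w • τ') := by
  obtain ⟨p, hp, e⟩ := h
  refine ⟨p, hp, ?_⟩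
  exact (Path.Homotopic.Quotient.trans_assoc _ _ _).trans
    (congrArg (Path.Homotopic.Quotient.trans w) e)

theorem Carries.of_eqOn {γ γ' : ℝ → Y} {a b : ℝ} {τ τ' : Tail x₀} (h : Carries γ a b τ τ')
    (e : ∀ t : I, γ (a + t * (b - a)) = γ' (a + t * (b - a))) : Carries γ' a b τ τ' :=
  let ⟨p, hp, h⟩ := h
  ⟨p, fun t => (hp t).trans (e t), h⟩

theorem Carries.path {x y : Y} {c : Path.Homotopic.Quotient x₀ x} {c' : Path.Homotopic.Quotient x₀ y}
    {p : Path x y} (h : Carries p.extend 0 1 ⟨x, c⟩ ⟨y, c'⟩) :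
    c.trans (Path.Homotopic.Quotient.mk p) = c' := by
  obtain ⟨q, hq, e⟩ := h
  have : p = q := by
    ext t
    refine Eq.trans ?_ (hq t).symm
    simp
  subst this
  exact e

/-- The class `τ` continued inside the image of a simply connected space `O`. -/
def Tail.chart {O : Type*} [TopologicalSpace O] [SimplyConnectedSpace O] (f : C(O, Y)) (o₁ : O)
    (c : Path.Homotopic.Quotient x₀ (f o₁)) (o : O) : Tail x₀ :=
  ⟨f o, c.trans (Path.Homotopic.Quotient.map
    (Path.Homotopic.Quotient.mk (PathConnectedSpace.somePath o₁ o)) f)⟩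

theorem Tail.chart_self {O : Type*} [TopologicalSpace O] [SimplyConnectedSpace O] (f : C(O, Y))
    (o₁ : O) (c : Path.Homotopic.Quotient x₀ (f o₁)) : Tail.chart f o₁ c o₁ = ⟨f o₁, c⟩ := by
  refine congrArg (Tail.mk _) ?_
  rw [Subsingleton.elim (Path.Homotopic.Quotient.mk _) (Path.Homotopic.Quotient.refl o₁)]
  exact Path.Homotopic.Quotient.trans_refl c

theorem Tail.carries_chart {O : Type*} [TopologicalSpace O] [SimplyConnectedSpace O] (f : C(O, Y))
    (o₁ : O) (c : Path.Homotopic.Quotient x₀ (f o₁)) {γ : ℝ → Y} {a b : ℝ} {o o' : O}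
    (δ : Path o o') (h : ∀ t : I, γ (a + t * (b - a)) = f (δ t)) :
    Carries γ a b (Tail.chart f o₁ c o) (Tail.chart f o₁ c o') := by
  refine ⟨δ.map f.continuous, fun t => (h t).symm, ?_⟩
  refine (Path.Homotopic.Quotient.trans_assoc c _ _).trans (congrArg c.trans ?_)
  rw [← Subsingleton.elim (Path.Homotopic.Quotient.mk
    ((PathConnectedSpace.somePath o₁ o).trans δ)) (Path.Homotopic.Quotient.mk _),
    ← Path.Homotopic.Quotient.mk_map, ← Path.Homotopic.Quotient.mk_map, Path.map_trans,
    Path.Homotopic.Quotient.mk_trans]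
  rfl

end Tails

/-! ### Sheets over the octagons -/

instance : SimplyConnectedSpace Oct :=
  have : ContractibleSpace Oct := convex_Oct.contractibleSpace ⟨0, by norm_num [Oct]⟩
  inferInstance

/-- The letter of the right side of an octagon; the sides without letter form, together with those
of `letterU`, a spanning tree. -/
def letterR : Fin 6 → Option (Fin 7) := ![some 0, some 1, none, none, some 2, none]

/-- The letter of the upper side of an octagon. -/
def letterU : Fin 6 → Option (Fin 7) := ![none, none, some 3, some 4, some 5, some 6]

/-- The value of a letter, the missing letter having value `1`. -/
def letterVal {G : Type*} [Group G] (W : Fin 7 → G) (l : Option (Fin 7)) : G := l.elim 1 W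

/-- The midpoints of the four sides. -/
def midR : Oct := ⟨(1, 0), by norm_num [Oct]⟩
def midL : Oct := ⟨(-1, 0), by norm_num [Oct]⟩
def midU : Oct := ⟨(0, 1), by norm_num [Oct]⟩
def midD : Oct := ⟨(0, -1), by norm_num [Oct]⟩

variable {Y : Type*} [TopologicalSpace Y] {x₀ : Y}

/-- Choices, for a space `Y` to which six octagons are mapped compatibly with the gluings, of
classes of paths from `x₀` to the points of the octagons. -/
structure Sheets (oc : Fin 6 → C(Oct, Y)) (o₀ : Oct) (h₀ : oc 5 o₀ = x₀) where
  /-- The classes. -/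
  T : Fin 6 → Oct → Tail x₀
  /-- The values of the letters. -/
  W : Fin 7 → LoopGrp x₀
  pt : ∀ j o, (T j o).pt = oc j o
  start : T 5 o₀ = ⟨x₀, Path.Homotopic.Quotient.refl x₀⟩
  carries : ∀ (j : Fin 6) (γ : ℝ → Y) (a b : ℝ) (o o' : Oct) (δ : Path o o'),
    (∀ t : I, γ (a + t * (b - a)) = oc j (δ t)) → Carries γ a b (T j o) (T j o')
  right : ∀ (j : Fin 6) (x y : Oct), x.1.1 = 1 → (y : ℝ × ℝ) = (-1, x.1.2) →
    T j x = letterVal W (letterR j) • T (right j) y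
  upper : ∀ (j : Fin 6) (x y : Oct), x.1.2 = 1 → (y : ℝ × ℝ) = (x.1.1, -1) →
    T j x = letterVal W (letterU j) • T (upper j) y

/-- The segment joining two points of the octagon. -/
def octLine (o o' : Oct) : Path o o' where
  toFun t := ⟨AffineMap.lineMap (o : ℝ × ℝ) o' (t : ℝ), convex_Oct.lineMap_mem o.2 o'.2 t.2⟩
  continuous_toFun := by
    refine Continuous.subtype_mk ?_ _
    simp only [AffineMap.lineMap_apply]
    fun_prop
  source' := by simp
  target' := by simp

theorem octLine_apply (o o' : Oct) (t : I) :
    ((octLine o o' t : Oct) : ℝ × ℝ) = AffineMap.lineMap (o : ℝ × ℝ) o' (t : ℝ) := rfl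

theorem exists_sheets (oc : Fin 6 → C(Oct, Y)) (o₀ : Oct) (h₀ : oc 5 o₀ = x₀)
    (hr : ∀ (j : Fin 6) (x y : Oct), x.1.1 = 1 → (y : ℝ × ℝ) = (-1, x.1.2) →
      oc j x = oc (right j) y)
    (hu : ∀ (j : Fin 6) (x y : Oct), x.1.2 = 1 → (y : ℝ × ℝ) = (x.1.1, -1) →
      oc j x = oc (upper j) y) : Nonempty (Sheets oc o₀ h₀) := by
  -- continue a class from one octagon to the next
  have next : ∀ (k : Fin 6) (τ : Tail x₀) (o : Oct), τ.pt = oc k o →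
      ∃ c : Path.Homotopic.Quotient x₀ (oc k o), τ = ⟨oc k o, c⟩ := by
    rintro k ⟨x, c⟩ o h
    dsimp only at h
    subst h
    exact ⟨c, rfl⟩
  have hR : ∀ j, oc j midR = oc (right j) midL := fun j => hr j _ _ rfl rfl
  have hU : ∀ j, oc j midU = oc (upper j) midD := fun j => hu j _ _ rfl rfl
  obtain ⟨c5, e5⟩ := next 5 ⟨x₀, Path.Homotopic.Quotient.refl x₀⟩ o₀ h₀.symm
  obtain ⟨c0, e0⟩ := next 0 (Tail.chart (oc 5) o₀ c5 midR) midL (hR 5)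
  obtain ⟨c3, e3⟩ := next 3 (Tail.chart (oc 0) midL c0 midU) midD (hU 0)
  obtain ⟨c1, e1⟩ := next 1 (Tail.chart (oc 3) midD c3 midR) midL (hR 3)
  obtain ⟨c2, e2⟩ := next 2 (Tail.chart (oc 1) midL c1 midU) midD (hU 1)
  obtain ⟨c4, e4⟩ := next 4 (Tail.chart (oc 2) midD c2 midR) midL (hR 2)
  let T : Fin 6 → Oct → Tail x₀ := ![Tail.chart (oc 0) midL c0, Tail.chart (oc 1) midL c1,
    Tail.chart (oc 2) midD c2, Tail.chart (oc 3) midD c3, Tail.chart (oc 4) midL c4,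
    Tail.chart (oc 5) o₀ c5]
  have hpt : ∀ j o, (T j o).pt = oc j o := by
    intro j o
    fin_cases j <;> rfl
  have hT : ∀ (j : Fin 6) (γ : ℝ → Y) (a b : ℝ) (o o' : Oct) (δ : Path o o'),
      (∀ t : I, γ (a + t * (b - a)) = oc j (δ t)) → Carries γ a b (T j o) (T j o') := by
    intro j γ a b o o' δ h
    fin_cases j <;> exact Tail.carries_chart _ _ _ δ h
  -- a relation at one pair of points extends along a side
  have extend : ∀ (j k : Fin 6) (w : LoopGrp x₀) (x x' y y' : Oct), T j x = w • T k y →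
      (∀ t, oc j (octLine x x' t) = oc k (octLine y y' t)) → T j x' = w • T k y' := by
    intro j k w x x' y y' h e
    have h1 := hT j (oc j ∘ (octLine x x').extend) 0 1 x x' (octLine x x') (fun t => by simp)
    have h2 := (hT k (oc j ∘ (octLine x x').extend) 0 1 y y' (octLine y y')
      (fun t => by simp [e])).smul w
    rw [← h] at h2
    exact h1.unique h2
  have cR : ∀ j, ∃ w : LoopGrp x₀, T j midR = w • T (right j) midL := fun j =>
    Tail.exists_smul (by rw [hpt, hpt, hR])
  have cU : ∀ j, ∃ w : LoopGrp x₀, T j midU = w • T (upper j) midD := fun j =>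
    Tail.exists_smul (by rw [hpt, hpt, hU])
  choose wR hwR using cR
  choose wU hwU using cU
  let W : Fin 7 → LoopGrp x₀ := ![wR 0, wR 1, wR 4, wU 2, wU 3, wU 4, wU 5]
  have tree : ∀ {f g : C(Oct, Y)} {o o' m : Oct} {c : Path.Homotopic.Quotient x₀ (f o)}
      {c' : Path.Homotopic.Quotient x₀ (g m)}, Tail.chart f o c o' = ⟨g m, c'⟩ →
      Tail.chart f o c o' = (1 : LoopGrp x₀) • Tail.chart g m c' m := by
    intro f g o o' m c c' h
    rw [h, one_smul, Tail.chart_self]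
  refine ⟨⟨T, W, hpt, ?_, hT, ?_, ?_⟩⟩
  · rw [e5]
    exact Tail.chart_self _ _ _
  · intro j x y hx hy
    have key : T j midR = letterVal W (letterR j) • T (AY.right j) midL := by
      fin_cases j
      · exact hwR 0
      · exact hwR 1
      · exact tree e4
      · exact tree e1
      · exact hwR 4
      · exact tree e0
    refine extend j _ _ _ _ _ _ key fun t => hr j _ _ ?_ ?_
    · rw [octLine_apply]
      simp [AffineMap.lineMap_apply, midR, hx]
    · rw [octLine_apply, octLine_apply]
      simp [AffineMap.lineMap_apply, midR, midL, hy]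
  · intro j x y hx hy
    have key : T j midU = letterVal W (letterU j) • T (AY.upper j) midD := by
      fin_cases j
      · exact tree e3
      · exact tree e2
      · exact hwU 2
      · exact hwU 3
      · exact hwU 4
      · exact hwU 5
    refine extend j _ _ _ _ _ _ key fun t => hu j _ _ ?_ ?_
    · rw [octLine_apply]
      simp [AffineMap.lineMap_apply, midU, hx]
    · rw [octLine_apply, octLine_apply]
      simp [AffineMap.lineMap_apply, midU, midD, hy]

end AY

namespace AY

/-! ### Checking the class of a polygonal curve -/

/-- The integer as an exact number. -/
def Z3.ofInt (n : ℤ) : Z3 := ⟨n, 0, 0⟩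

theorem Z3.ev_ofInt (α : ℝ) (n : ℤ) : (Z3.ofInt n).ev α = n := by simp [Z3.ofInt, Z3.ev]

/-- The multiple of a point. -/
def Pt.smul (u : Z3) (p : Pt) : Pt := ⟨u.mul p.x, u.mul p.y⟩

/-- The point `p / H`. -/
def Pt.over (α : ℝ) (H : ℤ) (p : Pt) : ℂ := p.ev α / (H : ℂ)

/-- The form in coordinates multiplied by `H`. -/
def Form.dil (H : ℤ) (f : Form) : Form := ⟨f.a, f.b, (Z3.ofInt H).mul f.c⟩

/-- The value of a word. -/
def wordVal {G : Type*} [Group G] (W : Fin 7 → G) (L : List (Fin 7 × Bool)) : G :=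
  FreeGroup.lift W (FreeGroup.mk L)

theorem wordVal_append {G : Type*} [Group G] (W : Fin 7 → G) (L L' : List (Fin 7 × Bool)) :
    wordVal W (L ++ L') = wordVal W L * wordVal W L' := by
  rw [wordVal, ← FreeGroup.mul_mk, map_mul]; rfl

theorem wordVal_nil {G : Type*} [Group G] (W : Fin 7 → G) : wordVal W [] = 1 := by
  simp [wordVal]

section Exact

variable {α : ℝ}

theorem Pt.ev_smul (A : IsRoot3 α) (u : Z3) (p : Pt) : (p.smul u).ev α = (u.ev α : ℂ) * p.ev α := by
  apply Complex.ext <;> simp [Pt.ev, Pt.smul, Z3.ev_mul A] <;> ring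

theorem Pt.over_re (H : ℤ) (p : Pt) : (p.over α H).re = (p.ev α).re / H := by
  rw [Pt.over, ← Complex.ofReal_intCast, Complex.div_ofReal_re]

theorem Pt.over_im (H : ℤ) (p : Pt) : (p.over α H).im = (p.ev α).im / H := by
  rw [Pt.over, ← Complex.ofReal_intCast, Complex.div_ofReal_im]

theorem Form.ev_dil (A : IsRoot3 α) {H : ℤ} (hH : 0 < H) (f : Form) (p : Pt) :
    ((f.dil H).evalAt p).ev α = H * f.val α (p.over α H) := by
  have : (H : ℝ) ≠ 0 := by exact_mod_cast hH.ne'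
  rw [Form.ev_evalAt A, Form.val, Form.val, Pt.over_re, Pt.over_im, Form.dil, Z3.ev_mul A,
    Z3.ev_ofInt]
  field_simp

/-- The point `p / H` satisfies all the inequalities. -/
def inside (H : ℤ) (L : List Form) (p : Pt) : Bool := L.all fun f => ((f.dil H).evalAt p).nonneg

theorem inside_spec (A : IsRoot3 α) {H : ℤ} (hH : 0 < H) {L : List Form} {p : Pt}
    (h : inside H L p = true) : ∀ f ∈ L, 0 ≤ f.val α (p.over α H) := by
  intro f hf
  have h1 := Z3.ev_nonneg A (List.all_eq_true.1 h f hf)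
  rw [Form.ev_dil A hH] at h1
  have : (0 : ℝ) < H := by exact_mod_cast hH
  exact nonneg_of_mul_nonneg_right h1 this

theorem Form.val_lineMap (f : Form) (z z' : ℂ) (t : ℝ) :
    f.val α (AffineMap.lineMap z z' t) = AffineMap.lineMap (f.val α z) (f.val α z') t := by
  simp only [Form.val, AffineMap.lineMap_apply, vsub_eq_sub, vadd_eq_add, Complex.add_re,
    Complex.add_im, Complex.real_smul, Complex.mul_re, Complex.mul_im, Complex.ofReal_re,
    Complex.ofReal_im, Complex.sub_re, Complex.sub_im, smul_eq_mul]
  ring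

theorem forms_lineMap {L : List Form} {z z' : ℂ} (h : ∀ f ∈ L, 0 ≤ f.val α z)
    (h' : ∀ f ∈ L, 0 ≤ f.val α z') {t : ℝ} (ht : t ∈ I) :
    ∀ f ∈ L, 0 ≤ f.val α (AffineMap.lineMap z z' t) := by
  intro f hf
  rw [Form.val_lineMap]
  exact (convex_Ici (0 : ℝ)).lineMap_mem (h f hf) (h' f hf) ht

theorem over_mem_segment (A : IsRoot3 α) {H : ℤ} (hH : 0 < H) {p q z : Pt} (hn : p.ne q = true)
    (h : inside H (Form.segment p q) z = true) :
    z.over α H ∈ segment ℝ (p.ev α) (q.ev α) :=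
  (Form.segment_iff A hn _).1 (inside_spec A hH h)

theorem over_mem_segment_over {H : ℤ} (hH : 0 < H) {p q : Pt} {z : ℂ}
    (h : z ∈ segment ℝ (p.over α H) (q.over α H)) : (H : ℂ) * z ∈ segment ℝ (p.ev α) (q.ev α) := by
  have hc : (H : ℂ) ≠ 0 := by exact_mod_cast hH.ne'
  obtain ⟨a, b, ha, hb, hab, rfl⟩ := h
  refine ⟨a, b, ha, hb, hab, ?_⟩
  simp only [Pt.over, Complex.real_smul]
  field_simp

/-- The image of `p / H` under a part, times `H`. -/
def PartD.img (H : ℤ) (s : Pt) (k : PartD) (p : Pt) : Pt :=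
  (Pt.diag s p).add (k.w.smul (Z3.ofInt H))

theorem PartD.over_img (A : IsRoot3 α) {H : ℤ} (hH : 0 < H) (s : Pt) (k : PartD) (p : Pt) :
    (k.img H s p).over α H = (k.real α).map (s.scale α) (p.over α H) := by
  have hc : (H : ℝ) ≠ 0 := by exact_mod_cast hH.ne'
  have h1 : (k.img H s p).ev α = AY.diag (s.scale α) (p.ev α) + H * k.w.ev α := by
    rw [PartD.img, Pt.ev_add, Pt.ev_diag A, Pt.ev_smul A, Z3.ev_ofInt]
    simp
  have h2 : (k.real α).map (s.scale α) (p.over α H) =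
      AY.diag (s.scale α) (p.over α H) + k.w.ev α := rfl
  rw [h2]
  apply Complex.ext
  · rw [Pt.over_re, h1]
    simp only [AY.diag, Complex.add_re, Pt.over_re, Complex.mul_re, Complex.intCast_re,
      Complex.intCast_im]
    field_simp
    ring
  · rw [Pt.over_im, h1]
    simp only [AY.diag, Complex.add_im, Pt.over_im, Complex.mul_im, Complex.intCast_re,
      Complex.intCast_im]
    field_simp
    ring

theorem Part.map_lineMap (p : Part) (s z z' : ℂ) (t : ℝ) :
    p.map s (AffineMap.lineMap z z' t) = AffineMap.lineMap (p.map s z) (p.map s z') t := by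
  have h : ∀ z, p.map s z = AY.diag s z + p.w := fun _ => rfl
  rw [h, h, h]
  apply Complex.ext <;> simp [AY.diag, AffineMap.lineMap_apply] <;> ring

end Exact

/-! ### The curves in the octagons -/

section Model

variable {α : ℝ} (A : IsRoot3 α)

/-- The octagons mapped to the surface. -/
def octMap (j : Fin 6) : C(Oct, Xhat α) :=
  ⟨fun o => (octSurfHomeo A).symm (Quot.mk _ ⟨j, o⟩),
    (octSurfHomeo A).symm.continuous.comp (continuous_quot_mk.comp continuous_sigmaMk)⟩

/-- The point of an octagon corresponding to a point of a parallelogram. -/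
def octPt (j : Fin 6) {z : ℂ} (h : z ∈ (modelD.real α).cell j) (hv : z ∉ Set.range (modelD.real α).v) :
    Oct := octChart A j ⟨_, hatPt_mem h hv⟩

theorem octMap_eq {j : Fin 6} {z : ℂ} {x : Xhat α} (h : (modelD.real α).Over j z (parHomeo A x)) :
    octMap A j (octPt A j h.mem h.1) = x := by
  have h1 : octSurfHomeo A x = modelHomeo A ((modelD.real α).pt j _ (hatPt_mem h.mem h.1)) := by
    obtain ⟨-, -, hx⟩ := h
    exact congrArg (modelHomeo A) hx
  exact (octSurfHomeo A).symm_apply_eq.2 h1.symm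

/-- The octagon across the right or the upper side. -/
def across (up : Bool) (j : Fin 6) : Fin 6 := cond up (upper j) (right j)

/-- The gluing along the right or the upper side. -/
def glueSide (up : Bool) (j : Fin 6) : GD := cond up (glueUpper j) (glueRight j)

/-- The letter of the right or the upper side. -/
def letterSide (up : Bool) (j : Fin 6) : Option (Fin 7) := cond up (letterU j) (letterR j)

theorem octMap_right (j : Fin 6) (x y : Oct) (hx : x.1.1 = 1) (hy : (y : ℝ × ℝ) = (-1, x.1.2)) :
    octMap A j x = octMap A (right j) y :=
  congrArg (octSurfHomeo A).symm (Quot.sound (Or.inl ⟨hx, rfl, hy⟩))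

theorem octMap_upper (j : Fin 6) (x y : Oct) (hx : x.1.2 = 1) (hy : (y : ℝ × ℝ) = (x.1.1, -1)) :
    octMap A j x = octMap A (upper j) y :=
  congrArg (octSurfHomeo A).symm (Quot.sound (Or.inr ⟨hx, rfl, hy⟩))

variable {x₀ : Xhat α} {o₀ : Oct} {h₀ : octMap A 5 o₀ = x₀} (S : Sheets (octMap A) o₀ h₀)

open Classical in
/-- The class attached to a point of a parallelogram (with a default value outside). -/
def Sheets.at_ (j : Fin 6) (z : ℂ) : Tail x₀ :=
  if h : z ∈ (modelD.real α).cell j ∧ z ∉ Set.range (modelD.real α).v then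
    S.T j (octPt A j h.1 h.2) else S.T j midR

theorem Sheets.at_eq {j : Fin 6} {z : ℂ} (h : z ∈ (modelD.real α).cell j)
    (hv : z ∉ Set.range (modelD.real α).v) : S.at_ A j z = S.T j (octPt A j h hv) :=
  dif_pos ⟨h, hv⟩

theorem Sheets.at_carries {γ : ℝ → Xhat α} {j : Fin 6} {z z' : ℂ} {a b : ℝ}
    (h : ∀ t : I, (modelD.real α).Over j (AffineMap.lineMap z z' (t : ℝ))
      (parHomeo A (γ (a + t * (b - a))))) :
    Carries γ a b (S.at_ A j z) (S.at_ A j z') := by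
  have hc : Continuous fun t : I => AffineMap.lineMap z z' (t : ℝ) := by
    simp only [AffineMap.lineMap_apply]
    fun_prop
  have h0 := h 0
  have h1 := h 1
  simp only [Set.Icc.coe_zero, AffineMap.lineMap_apply_zero, Set.Icc.coe_one,
    AffineMap.lineMap_apply_one] at h0 h1
  rw [S.at_eq A h0.mem h0.1, S.at_eq A h1.mem h1.1]
  let δ : Path (octPt A j h0.mem h0.1) (octPt A j h1.mem h1.1) :=
    { toFun := fun t => octPt A j (h t).mem (h t).1
      continuous_toFun := (octChart A j).continuous.comp
        (((continuousOn_hatPt _).comp_continuous hc fun t => (h t).1).subtype_mk _)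
      source' := by congr 2; simp
      target' := by congr 2; simp }
  exact S.carries j γ a b _ _ δ fun t => (octMap_eq A (h t)).symm

theorem Sheets.at_cross (up : Bool) {j : Fin 6} {z z' : ℂ}
    (hs : z ∈ segment ℝ ((glueSide up j).p.ev α) ((glueSide up j).q.ev α))
    (hz' : z' = z + (glueSide up j).t.ev α) (h : z ∈ (modelD.real α).cell j)
    (hv : z ∉ Set.range (modelD.real α).v) (h' : z' ∈ (modelD.real α).cell (across up j))
    (hv' : z' ∉ Set.range (modelD.real α).v) :
    S.at_ A j z = letterVal S.W (letterSide up j) • S.at_ A (across up j) z' := by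
  rw [S.at_eq A h hv, S.at_eq A h' hv']
  have hs' : z' ∈ segment ℝ ((glueSide up j).p.ev α + (glueSide up j).t.ev α)
      ((glueSide up j).q.ev α + (glueSide up j).t.ev α) := by
    rw [hz', add_comm z, add_comm _ ((glueSide up j).t.ev α), add_comm _ ((glueSide up j).t.ev α)]
    exact (mem_segment_translate ℝ _).2 hs
  cases up
  · obtain ⟨h1, h2⟩ := (glued_right A j ⟨_, hatPt_mem h hv⟩ ⟨_, hatPt_mem h' hv'⟩).1
      ⟨hatPt_mem hs hv, hatPt_mem hs' hv', hz'⟩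
    exact S.right j _ _ h1 h2
  · obtain ⟨h1, h2⟩ := (glued_upper A j ⟨_, hatPt_mem h hv⟩ ⟨_, hatPt_mem h' hv'⟩).1
      ⟨hatPt_mem hs hv, hatPt_mem hs' hv', hz'⟩
    exact S.upper j _ _ h1 h2

end Model

/-! ### Tracks -/

/-- A leg with exact ends, in coordinates multiplied by `2`. -/
structure LegD where
  i : Fin 6
  p : Pt
  q : Pt

/-- The leg given by exact data. -/
def LegD.real (α : ℝ) (l : LegD) : Leg := ⟨l.i, l.p.over α 2, l.q.over α 2⟩

/-- A part of a leg, or its image, inside an octagon; coordinates and times are multiplied by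
a common integer. -/
structure Run where
  /-- The index of the leg. -/
  leg : ℕ
  /-- The initial time. -/
  s : Z3
  /-- The final time. -/
  s' : Z3
  /-- The initial point. -/
  a : Pt
  /-- The final point. -/
  b : Pt
  /-- The index of the part of the Arnoux–Yoccoz map, for images. -/
  h : ℕ
  /-- The index of the part of the congruence with the octagons. -/
  m : ℕ
  /-- The side crossed at the end: whether it is an upper side, its octagon, and the direction. -/
  step : Option (Bool × Fin 6 × Bool)

/-- A part of the Arnoux–Yoccoz map. -/
def mapPart (k : ℕ) : PartD := mapParts.getD k ⟨0, 0, onePt⟩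

/-- A part of the congruence with the octagons. -/
def modelPart (k : ℕ) : PartD := modelParts.getD k ⟨0, 0, onePt⟩

namespace Run

variable (img : Bool) (H : ℤ) (r : Run)

/-- The cell. -/
def cell (l : LegD) : Fin 6 := cond img (mapPart r.h).j l.i

/-- The point in the cell. -/
def src (p : Pt) : Pt := cond img ((mapPart r.h).img H stretch p) p

/-- The octagon. -/
def piece : Fin 6 := (modelPart r.m).j

/-- The point in the parallelogram. -/
def dst (p : Pt) : Pt := (modelPart r.m).img H onePt (r.src img H p)

/-- The letters read off when crossing the side. -/
def letters : List (Fin 7 × Bool) :=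
  match r.step with
  | none => []
  | some (up, k, fwd) => ((letterSide up k).map fun c => (c, fwd)).toList

/-- A check that the leg runs as indicated. -/
def check (l : LegD) : Bool :=
  (r.s.nonneg && ((Z3.ofInt H).sub r.s).nonneg) &&
  ((r.s'.nonneg && ((Z3.ofInt H).sub r.s').nonneg) &&
  ((((r.a.smul ⟨2, 0, 0⟩).sub (l.p.smul (Z3.ofInt H))).eq ((l.q.sub l.p).smul r.s) &&
    ((r.b.smul ⟨2, 0, 0⟩).sub (l.p.smul (Z3.ofInt H))).eq ((l.q.sub l.p).smul r.s')) &&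
  ((r.a.ne r.b && (List.finRange 9).all fun k =>
      outside (Form.segment r.a r.b) ((surfD.v k).smul (Z3.ofInt H))) &&
  ((!img || (decide (r.h < mapParts.length ∧ (mapPart r.h).i = l.i) &&
    (inside H (PD.domForms surfD surfD stretch (mapPart r.h)) r.a &&
      inside H (PD.domForms surfD surfD stretch (mapPart r.h)) r.b))) &&
  (decide (r.m < modelParts.length ∧ (modelPart r.m).i = r.cell img l) &&
    (inside H (PD.domForms surfD modelD onePt (modelPart r.m)) (r.src img H r.a) &&
      inside H (PD.domForms surfD modelD onePt (modelPart r.m)) (r.src img H r.b)))))))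

/-- A check of the crossing at the end. -/
def linkCheck (j : Fin 6) (z : Pt) : Bool :=
  match r.step with
  | none => decide (r.piece = j) && (r.dst img H r.b).eq z
  | some (up, k, true) => (glueSide up k).p.ne (glueSide up k).q &&
      (decide (r.piece = k ∧ j = across up k) &&
      (z.eq ((r.dst img H r.b).add ((glueSide up k).t.smul (Z3.ofInt H))) &&
        inside H (Form.segment (glueSide up k).p (glueSide up k).q) (r.dst img H r.b)))
  | some (up, k, false) => (glueSide up k).p.ne (glueSide up k).q &&
      (decide (j = k ∧ r.piece = across up k) &&
      ((r.dst img H r.b).eq (z.add ((glueSide up k).t.smul (Z3.ofInt H))) &&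
        inside H (Form.segment (glueSide up k).p (glueSide up k).q) z))

/-- The absolute initial time. -/
def start : Z3 := (Z3.ofInt (H * r.leg)).add r.s

/-- The absolute final time. -/
def stop_ : Z3 := (Z3.ofInt (H * r.leg)).add r.s'

end Run

/-- A check of a curve ending at time `n` at the point `z` of the `j`-th octagon. -/
def trackCheck (img : Bool) (H : ℤ) (legs : List LegD) (n : ℕ) (j : Fin 6) (z : Pt) :
    List Run → Bool
  | [] => false
  | [r] => (legs[r.leg]?).any (r.check img H) &&
      ((r.stop_ H).eq (Z3.ofInt (H * n)) && r.linkCheck img H j z)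
  | r :: r' :: L => (legs[r.leg]?).any (r.check img H) && ((r.stop_ H).eq (r'.start H) &&
      (r.linkCheck img H r'.piece (r'.dst img H r'.a) && trackCheck img H legs n j z (r' :: L)))

/-- The word read off along a curve. -/
def trackWord (L : List Run) : List (Fin 7 × Bool) := L.flatMap Run.letters

end AY

namespace AY

section Soundness

variable {α : ℝ} (A : IsRoot3 α)

/-- The Arnoux–Yoccoz map, or the identity. -/
def imgMap (img : Bool) (x : Xhat α) : Xhat α := cond img (hatMap A x) x

theorem mapPart_mem {k : ℕ} (h : k < mapParts.length) : (mapPart k).real α ∈ ayParts α :=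
  List.mem_map_of_mem (by rw [mapPart, List.getD_eq_getElem _ _ h]; exact List.getElem_mem h)

theorem modelPart_mem {k : ℕ} (h : k < modelParts.length) : (modelPart k).real α ∈ parParts α :=
  List.mem_map_of_mem (by rw [modelPart, List.getD_eq_getElem _ _ h]; exact List.getElem_mem h)

variable {A}

theorem Pt.smul_eq_over {H : ℤ} (hH : 0 < H) {a p q : Pt} {s : Z3}
    (h : ((a.smul ⟨2, 0, 0⟩).sub (p.smul (Z3.ofInt H))).eq ((q.sub p).smul s) = true)
    (A : IsRoot3 α) :
    a.over α H = AffineMap.lineMap (p.over α 2) (q.over α 2) (s.ev α / H) := by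
  have hc : (H : ℂ) ≠ 0 := by exact_mod_cast hH.ne'
  have h1 := congrArg (Pt.ev α) (Pt.eq_of_eq h)
  rw [Pt.ev_sub, Pt.ev_smul A, Pt.ev_smul A, Pt.ev_smul A, Pt.ev_sub, Z3.ev_ofInt] at h1
  have h2 : ((Z3.ev α ⟨2, 0, 0⟩ : ℝ) : ℂ) = 2 := by simp [Z3.ev]
  rw [h2] at h1
  simp only [Pt.over, AffineMap.lineMap_apply, vsub_eq_sub, vadd_eq_add, Complex.real_smul]
  push_cast at h1 ⊢
  field_simp
  linear_combination h1

theorem Run.unit_time {H : ℤ} (hH : 0 < H) {s : Z3}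
    (h : (s.nonneg && ((Z3.ofInt H).sub s).nonneg) = true) (A : IsRoot3 α) : s.ev α / H ∈ I := by
  rw [Bool.and_eq_true] at h
  have h1 := Z3.ev_nonneg A h.1
  have h2 := Z3.ev_nonneg A h.2
  rw [Z3.ev_sub, Z3.ev_ofInt] at h2
  have h3 : (0 : ℝ) < H := by exact_mod_cast hH
  exact ⟨by positivity, (div_le_one h3).2 (by linarith)⟩

theorem inside_dom {H : ℤ} (hH : 0 < H) {n n' : ℕ} {P : PD n} {Q : PD n'} {s : Pt} {k : PartD}
    {a b : Pt} (h : (inside H (PD.domForms P Q s k) a && inside H (PD.domForms P Q s k) b) = true)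
    (A : IsRoot3 α) (t : I) : (k.real α).map (s.scale α)
      (AffineMap.lineMap (a.over α H) (b.over α H) (t : ℝ)) ∈ (Q.real α).cell k.j := by
  rw [Bool.and_eq_true] at h
  have h1 := forms_lineMap (inside_spec A hH h.1) (inside_spec A hH h.2) t.2
  exact ((PD.domForms_iff (P := P) (Q := Q) (s := s) A k _).1 h1).2

theorem avoid {H : ℤ} (hH : 0 < H) {a b : Pt} (hne : a.ne b = true)
    (h : ((List.finRange 9).all fun k =>
      outside (Form.segment a b) ((surfD.v k).smul (Z3.ofInt H))) = true) (A : IsRoot3 α) (t : I) :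
    AffineMap.lineMap (a.over α H) (b.over α H) (t : ℝ) ∉ Set.range (sing α) := by
  rintro ⟨k, hk⟩
  have h1 : outside (Form.segment a b) ((surfD.v k).smul (Z3.ofInt H)) = true :=
    List.all_eq_true.1 h k (List.mem_finRange k)
  have h2 : sing α k = (surfD.v k).ev α := (congrFun (surf_v A) k).symm
  have h3 : sing α k ∈ segment ℝ (a.over α H) (b.over α H) := by
    rw [hk, segment_eq_image_lineMap]
    exact Set.mem_image_of_mem _ t.2
  rw [h2] at h3
  have h4 := over_mem_segment_over hH h3
  have h5 : (H : ℂ) * (surfD.v k).ev α = ((surfD.v k).smul (Z3.ofInt H)).ev α := by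
    rw [Pt.ev_smul A, Z3.ev_ofInt]; norm_cast
  rw [h5] at h4
  exact absurd h1 (by rw [PD.not_outside A ((Form.segment_iff A hne _).2 h4)]; decide)

/-- A run lies over a segment in a parallelogram. -/
theorem Run.over {img : Bool} {H : ℤ} (hH : 0 < H) {r : Run} {l : LegD}
    (h : r.check img H l = true) {γ : ℝ → Xhat α} (hγ : ∀ s : ℝ, 0 ≤ s → s ≤ 1 →
      At α l.i (AffineMap.lineMap (l.p.over α 2) (l.q.over α 2) s) (collapse α (γ (r.leg + s))))
    {m : Xhat α → Xhat α} (hm : ∀ i z x, (surf α).Over i z x → m x = imgMap A img x)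
    (t : I) : (modelD.real α).Over r.piece
      (AffineMap.lineMap ((r.dst img H r.a).over α H) ((r.dst img H r.b).over α H) (t : ℝ))
      (parHomeo A (m (γ ((r.start H).ev α / H +
        t * ((r.stop_ H).ev α / H - (r.start H).ev α / H))))) := by
  rw [check, Bool.and_eq_true] at h
  obtain ⟨hs, h⟩ := h
  rw [Bool.and_eq_true] at h
  obtain ⟨hs', h⟩ := h
  rw [Bool.and_eq_true, Bool.and_eq_true] at h
  obtain ⟨⟨ha, hb⟩, h⟩ := h
  rw [Bool.and_eq_true, Bool.and_eq_true] at h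
  obtain ⟨⟨hne, hv⟩, h⟩ := h
  rw [Bool.and_eq_true] at h
  obtain ⟨hi, h⟩ := h
  rw [Bool.and_eq_true, decide_eq_true_eq] at h
  obtain ⟨⟨hlt, hmi⟩, hd⟩ := h
  have hc : (H : ℝ) ≠ 0 := by exact_mod_cast hH.ne'
  have u1 := Run.unit_time hH hs A
  have u2 := Run.unit_time hH hs' A
  have e1 := Pt.smul_eq_over hH ha A
  have e2 := Pt.smul_eq_over hH hb A
  -- the point on the surface
  have h0 : (surf α).Over l.i (AffineMap.lineMap (r.a.over α H) (r.b.over α H) (t : ℝ))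
      (γ ((r.start H).ev α / H + t * ((r.stop_ H).ev α / H - (r.start H).ev α / H))) := by
    refine (at_collapse_iff A (avoid hH hne hv A t)).1 ?_
    have u3 := (convex_Icc (0 : ℝ) 1).lineMap_mem u1 u2 t.2
    have e3 : AffineMap.lineMap (r.a.over α H) (r.b.over α H) (t : ℝ) =
        AffineMap.lineMap (l.p.over α 2) (l.q.over α 2)
          (AffineMap.lineMap (r.s.ev α / H) (r.s'.ev α / H) (t : ℝ) : ℝ) := by
      rw [e1, e2]
      simp only [AffineMap.lineMap_apply, vsub_eq_sub, vadd_eq_add, Complex.real_smul, smul_eq_mul]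
      push_cast
      ring
    have e4 : (r.start H).ev α / H + t * ((r.stop_ H).ev α / H - (r.start H).ev α / H) =
        r.leg + (AffineMap.lineMap (r.s.ev α / H) (r.s'.ev α / H) (t : ℝ) : ℝ) := by
      simp only [start, stop_, Z3.ev_add, Z3.ev_ofInt, AffineMap.lineMap_apply, vsub_eq_sub,
        vadd_eq_add, smul_eq_mul]
      push_cast
      field_simp
      ring
    rw [e3, e4]
    exact hγ _ u3.1 u3.2
  rw [hm _ _ _ h0]
  -- the point in the cell after the map
  have h1 : (surf α).Over (r.cell img l)
      (AffineMap.lineMap ((r.src img H r.a).over α H) ((r.src img H r.b).over α H) (t : ℝ))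
      (imgMap A img (γ ((r.start H).ev α / H +
        t * ((r.stop_ H).ev α / H - (r.start H).ev α / H)))) := by
    cases img
    · exact h0
    · rw [Bool.not_true, Bool.false_or, Bool.and_eq_true, decide_eq_true_eq] at hi
      obtain ⟨⟨hh, hhi⟩, hd'⟩ := hi
      have h2 := inside_dom hH hd' A t
      rw [surf_cell A] at h2
      have h3 := Pres.Over.map (map_compat A) (mapPart_mem hh) (p := (mapPart r.h).real α)
        (z := AffineMap.lineMap (r.a.over α H) (r.b.over α H) (t : ℝ))
        (by rw [← hhi] at h0; exact h0) h2
      rw [Part.map_lineMap, ← PartD.over_img A hH, ← PartD.over_img A hH] at h3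
      exact h3
  have h2 := inside_dom hH hd A t
  have h3 := Pres.Over.map (model_compat A) (modelPart_mem hlt) (p := (modelPart r.m).real α)
    (by rw [← hmi] at h1; exact h1) h2
  rw [Part.map_lineMap, ← PartD.over_img A hH, ← PartD.over_img A hH] at h3
  exact h3

variable {x₀ : Xhat α} {o₀ : Oct} {h₀ : octMap A 5 o₀ = x₀} (S : Sheets (octMap A) o₀ h₀)

theorem Run.link {H : ℤ} (hH : 0 < H) {img : Bool} {r : Run} {j : Fin 6} {z : Pt}
    (h : r.linkCheck img H j z = true)
    (h1 : (r.dst img H r.b).over α H ∈ (modelD.real α).cell r.piece)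
    (hv1 : (r.dst img H r.b).over α H ∉ Set.range (modelD.real α).v)
    (h2 : z.over α H ∈ (modelD.real α).cell j) (hv2 : z.over α H ∉ Set.range (modelD.real α).v) :
    S.at_ A r.piece ((r.dst img H r.b).over α H) =
      wordVal S.W r.letters • S.at_ A j (z.over α H) := by
  have hc : (H : ℂ) ≠ 0 := by exact_mod_cast hH.ne'
  have tr : ∀ p t : Pt, (p.add (t.smul (Z3.ofInt H))).over α H = p.over α H + t.ev α := by
    intro p t
    rw [Pt.over, Pt.ev_add, Pt.ev_smul A, Z3.ev_ofInt, Pt.over]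
    push_cast
    field_simp
  rw [linkCheck] at h
  rw [letters]
  rcases hs : r.step with _ | ⟨up, k, _ | _⟩
  · simp only [hs, Bool.and_eq_true, decide_eq_true_eq] at h ⊢
    rw [wordVal_nil, one_smul, Pt.eq_of_eq h.2, h.1]
  · simp only [hs, Bool.and_eq_true, decide_eq_true_eq] at h ⊢
    obtain ⟨hn, ⟨hj, hp⟩, he, hin⟩ := h
    have e : (r.dst img H r.b).over α H = z.over α H + (glueSide up k).t.ev α := by
      rw [Pt.eq_of_eq he, tr]
    rw [hp] at h1 ⊢
    rw [hj] at h2 ⊢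
    rw [S.at_cross A up (over_mem_segment A hH hn hin) e h2 hv2 h1 hv1, smul_smul]
    cases letterSide up k <;> simp [letterVal, wordVal]
  · simp only [hs, Bool.and_eq_true, decide_eq_true_eq] at h ⊢
    obtain ⟨hn, ⟨hp, hj⟩, he, hin⟩ := h
    have e : z.over α H = (r.dst img H r.b).over α H + (glueSide up k).t.ev α := by
      rw [Pt.eq_of_eq he, tr]
    rw [hp] at h1 ⊢
    rw [hj] at h2 ⊢
    rw [S.at_cross A up (over_mem_segment A hH hn hin) e h1 hv1 h2 hv2]
    cases letterSide up k <;> simp [letterVal, wordVal]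

/-- A track gives the class of a curve. -/
theorem track {img : Bool} {H : ℤ} (hH : 0 < H) {legs : List LegD} {n : ℕ} {j : Fin 6} {z : Pt}
    {γ : ℝ → Xhat α} (hc : Continuous γ) {m : Xhat α → Xhat α} (hmc : Continuous m)
    (hm : ∀ i z x, (surf α).Over i z x → m x = imgMap A img x) (hγ : ∀ (k : ℕ) (l : LegD), legs[k]? = some l →
      ∀ s : ℝ, 0 ≤ s → s ≤ 1 →
      At α l.i (AffineMap.lineMap (l.p.over α 2) (l.q.over α 2) s) (collapse α (γ (k + s))))
    (hz : z.over α H ∈ (modelD.real α).cell j) (hv : z.over α H ∉ Set.range (modelD.real α).v) :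
    ∀ {r : Run} {L : List Run}, trackCheck img H legs n j z (r :: L) = true →
      Carries (fun t => m (γ t)) ((r.start H).ev α / H) n
        (S.at_ A r.piece ((r.dst img H r.a).over α H))
        (wordVal S.W (trackWord (r :: L)) • S.at_ A j (z.over α H)) ∧
      (r.dst img H r.a).over α H ∈ (modelD.real α).cell r.piece ∧
      (r.dst img H r.a).over α H ∉ Set.range (modelD.real α).v := by
  have hR : (H : ℝ) ≠ 0 := by exact_mod_cast hH.ne'
  have hc' : Continuous fun t => m (γ t) := hmc.comp hc
  have one : ∀ {r : Run}, (legs[r.leg]?).any (r.check img H) = true → ∀ t : I,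
      (modelD.real α).Over r.piece
      (AffineMap.lineMap ((r.dst img H r.a).over α H) ((r.dst img H r.b).over α H) (t : ℝ))
      (parHomeo A (m (γ ((r.start H).ev α / H +
        t * ((r.stop_ H).ev α / H - (r.start H).ev α / H))))) := by
    intro r h
    obtain ⟨l, hl, h⟩ := Option.any_eq_true _ _ |>.1 h
    exact Run.over hH h (hγ _ l hl) hm
  intro r L
  induction L generalizing r with
  | nil =>
    intro h
    simp only [trackCheck, Bool.and_eq_true] at h
    obtain ⟨h1, h2, h3⟩ := h
    have k := one h1
    have ka := k 0
    have kb := k 1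
    simp only [Set.Icc.coe_zero, AffineMap.lineMap_apply_zero, Set.Icc.coe_one,
      AffineMap.lineMap_apply_one] at ka kb
    refine ⟨?_, ka.mem, ka.1⟩
    have c := S.at_carries A (γ := fun t => m (γ t)) (a := (r.start H).ev α / H)
      (b := (r.stop_ H).ev α / H) k
    rw [r.link S hH h3 kb.mem kb.1 hz hv, Z3.eq_of_eq h2, Z3.ev_ofInt] at c
    have e : ((H * n : ℤ) : ℝ) / H = n := by push_cast; field_simp
    rw [e] at c
    simpa [trackWord] using c
  | cons r' L ih =>
    intro h
    simp only [trackCheck, Bool.and_eq_true] at h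
    obtain ⟨h1, h2, h3, h4⟩ := h
    obtain ⟨i1, i2, i3⟩ := ih h4
    have k := one h1
    have ka := k 0
    have kb := k 1
    simp only [Set.Icc.coe_zero, AffineMap.lineMap_apply_zero, Set.Icc.coe_one,
      AffineMap.lineMap_apply_one] at ka kb
    refine ⟨?_, ka.mem, ka.1⟩
    have c := S.at_carries A (γ := fun t => m (γ t)) (a := (r.start H).ev α / H)
      (b := (r.stop_ H).ev α / H) k
    rw [r.link S hH h3 kb.mem kb.1 i2 i3, Z3.eq_of_eq h2] at c
    have c2 := c.trans hc' (i1.smul _)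
    rw [smul_smul, ← wordVal_append] at c2
    exact c2

/-- A track: an integer such that coordinates and times multiplied by twice this integer are
integral, and, for each run, its final time (unless it is the end of the leg), the indices of the
parts and the crossing. -/
structure TrackD where
  h : ℤ
  cuts : List (Option Z3 × ℕ × ℕ × Option (Bool × Fin 6 × Bool))

/-- The point of the leg at a given time. -/
def LegD.pos (h : ℤ) (l : LegD) (s : Z3) : Pt :=
  let c := (l.p.smul (Z3.ofInt (2 * h))).add ((l.q.sub l.p).smul s)
  ⟨⟨c.x.a / 2, c.x.b / 2, c.x.c / 2⟩, ⟨c.y.a / 2, c.y.b / 2, c.y.c / 2⟩⟩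

/-- The runs from time `s` of the `k`-th leg on. -/
def runsFrom (h : ℤ) (legs : List LegD) : ℕ → Z3 →
    List (Option Z3 × ℕ × ℕ × Option (Bool × Fin 6 × Bool)) → List Run
  | _, _, [] => []
  | k, s, (s', i, m, c) :: L =>
    let l := legs.getD k ⟨0, onePt, onePt⟩
    let e := s'.getD (Z3.ofInt (2 * h))
    ⟨k, s, e, l.pos h s, l.pos h e, i, m, c⟩ :: match s' with
      | none => runsFrom h legs (k + 1) ⟨0, 0, 0⟩ L
      | some s' => runsFrom h legs k s' L

/-- The runs of a track. -/
def TrackD.runs (T : TrackD) (legs : List LegD) : List Run := runsFrom T.h legs 0 ⟨0, 0, 0⟩ T.cuts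

/-- A check that a point lies in a parallelogram and is not blown up. -/
def freeCheck (j : Fin 6) (z : Pt) : Bool :=
  inside 2 (modelD.cell j) z &&
    (List.finRange 14).all fun k => z.ne ((modelD.v k).smul (Z3.ofInt 2))

/-- A check of a curve from the point `z` of the octagon `j` to the point `z'` of `j'`. -/
def TrackD.check (T : TrackD) (img : Bool) (legs : List LegD) (j : Fin 6) (z : Pt) (j' : Fin 6)
    (z' : Pt) : Bool :=
  decide (0 < T.h) && (((T.runs legs).head?.any fun r => decide (r.piece = j) &&
    ((r.start (2 * T.h)).eq ⟨0, 0, 0⟩ && (r.dst img (2 * T.h) r.a).eq (z.smul (Z3.ofInt T.h)))) &&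
  (freeCheck j' z' &&
    trackCheck img (2 * T.h) legs legs.length j' (z'.smul (Z3.ofInt T.h)) (T.runs legs)))

theorem freeCheck_spec (A : IsRoot3 α) {j : Fin 6} {z : Pt} (h : freeCheck j z = true) :
    z.over α 2 ∈ (modelD.real α).cell j ∧ z.over α 2 ∉ Set.range (modelD.real α).v := by
  rw [freeCheck, Bool.and_eq_true] at h
  refine ⟨inside_spec A two_pos h.1, ?_⟩
  rintro ⟨k, hk⟩
  have h1 := Pt.ne_of_ne A (List.all_eq_true.1 h.2 k (List.mem_finRange k))
  refine h1 ?_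
  rw [Pt.ev_smul A, Z3.ev_ofInt]
  change (modelD.v k).ev α = _ at hk
  rw [hk, Pt.over]
  push_cast
  field_simp

theorem Pt.smul_over (A : IsRoot3 α) {h : ℤ} (hh : 0 < h) (z : Pt) :
    (z.smul (Z3.ofInt h)).over α (2 * h) = z.over α 2 := by
  have : (h : ℂ) ≠ 0 := by exact_mod_cast hh.ne'
  rw [Pt.over, Pt.ev_smul A, Z3.ev_ofInt, Pt.over]
  push_cast
  field_simp

theorem TrackD.carries {T : TrackD} {img : Bool} {legs : List LegD} {j j' : Fin 6} {z z' : Pt}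
    (h : T.check img legs j z j' z' = true) {γ : ℝ → Xhat α} (hc : Continuous γ)
    {m : Xhat α → Xhat α} (hmc : Continuous m)
    (hm : ∀ i z x, (surf α).Over i z x → m x = imgMap A img x)
    (hγ : ∀ (k : ℕ) (l : LegD), legs[k]? = some l → ∀ s : ℝ, 0 ≤ s → s ≤ 1 →
      At α l.i (AffineMap.lineMap (l.p.over α 2) (l.q.over α 2) s) (collapse α (γ (k + s)))) :
    Carries (fun t => m (γ t)) 0 legs.length (S.at_ A j (z.over α 2))
      (wordVal S.W (trackWord (T.runs legs)) • S.at_ A j' (z'.over α 2)) := by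
  rw [check, Bool.and_eq_true, Bool.and_eq_true, Bool.and_eq_true, decide_eq_true_eq] at h
  obtain ⟨hh, h1, h2, h3⟩ := h
  obtain ⟨hz, hv⟩ := freeCheck_spec A h2
  cases hr : T.runs legs with
  | nil => simp [hr] at h1
  | cons r L =>
    rw [hr] at h1 h3
    simp only [List.head?_cons, Option.any_some, Bool.and_eq_true, decide_eq_true_eq] at h1
    obtain ⟨hp, hs, hd⟩ := h1
    rw [← Pt.smul_over A hh] at hz hv
    have := (track S (mul_pos two_pos hh) hc hmc hm hγ hz hv h3).1
    rw [Z3.eq_of_eq hs, hp, Pt.eq_of_eq hd, Pt.smul_over A hh, Pt.smul_over A hh] at this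
    simpa [Z3.ev] using this

theorem Carries.rescale {Y : Type*} [TopologicalSpace Y] {x₀ : Y} {g : ℝ → Y} {n : ℝ} (hn : n ≠ 0)
    {τ τ' : Tail x₀} (h : Carries (fun t => g (t / n)) 0 n τ τ') : Carries g 0 1 τ τ' := by
  obtain ⟨p, hp, e⟩ := h
  refine ⟨p, fun t => (hp t).trans (congrArg g ?_), e⟩
  field_simp
  ring

end Soundness

/-! ### Existence of curves -/

section Curves

variable {α : ℝ} (A : IsRoot3 α)

/-- A check that the end of the leg is glued to the point `p` of the cell `i`. -/
def joinCheck (l : LegD) (i : Fin 6) (p : Pt) : Option (ℕ × Bool) → Bool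
  | none => decide (l.i = i) && l.q.eq p
  | some (k, fwd) => (surfD.gl[k]?).any fun g => g.p.ne g.q && cond fwd
      (decide (l.i = g.src ∧ i = g.tgt) && (p.eq (l.q.add (g.t.smul (Z3.ofInt 2))) &&
        inside 2 (Form.segment g.p g.q) l.q))
      (decide (i = g.src ∧ l.i = g.tgt) && (l.q.eq (p.add (g.t.smul (Z3.ofInt 2))) &&
        inside 2 (Form.segment g.p g.q) p))

/-- A check that a leg lies in its cell and avoids the singularities. -/
def LegD.check (l : LegD) : Bool :=
  l.p.ne l.q && (((List.finRange 9).all fun k =>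
      outside (Form.segment l.p l.q) ((surfD.v k).smul (Z3.ofInt 2))) &&
    (inside 2 (surfD.cell l.i) l.p && inside 2 (surfD.cell l.i) l.q))

/-- A check that a list of legs is a curve. -/
def legsCheck : List LegD → List (Option (ℕ × Bool)) → Bool
  | [], _ => false
  | [l], _ => l.check
  | _ :: _ :: _, [] => false
  | l :: l' :: L, o :: J => l.check && (joinCheck l l'.i l'.p o && legsCheck (l' :: L) J)

include A in
theorem LegD.over {l : LegD} (h : l.check = true) (t : I) :
    AffineMap.lineMap (l.p.over α 2) (l.q.over α 2) (t : ℝ) ∈ cell α l.i ∧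
    AffineMap.lineMap (l.p.over α 2) (l.q.over α 2) (t : ℝ) ∉ Set.range (sing α) := by
  rw [check, Bool.and_eq_true, Bool.and_eq_true, Bool.and_eq_true] at h
  obtain ⟨h1, h2, h3, h4⟩ := h
  refine ⟨?_, avoid two_pos h1 h2 A t⟩
  have := forms_lineMap (inside_spec A two_pos h3) (inside_spec A two_pos h4) t.2
  have e : cell α l.i = (surfD.real α).cell l.i := by rw [surf_cell A]
  rw [e]
  exact this

include A in
theorem over_join {l : LegD} {i : Fin 6} {p : Pt} {o : Option (ℕ × Bool)}
    (h : joinCheck l i p o = true) {x : Xhat α} (hx : (surf α).Over l.i (l.q.over α 2) x)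
    (hp : p.over α 2 ∈ cell α i) : (surf α).Over i (p.over α 2) x := by
  have tr : ∀ p t : Pt, (p.add (t.smul (Z3.ofInt 2))).over α 2 = p.over α 2 + t.ev α := by
    intro p t
    rw [Pt.over, Pt.ev_add, Pt.ev_smul A, Z3.ev_ofInt, Pt.over]
    push_cast
    field_simp
  match o with
  | none =>
    simp only [joinCheck, Bool.and_eq_true, decide_eq_true_eq] at h
    rw [← h.1, ← Pt.eq_of_eq h.2]
    exact hx
  | some (k, fwd) =>
    obtain ⟨g, hg, h⟩ := Option.any_eq_true _ _ |>.1 h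
    have hg' : g.real α ∈ (surf α).gl := by
      rw [← surf_real A]
      exact List.mem_map_of_mem (List.mem_of_getElem? hg)
    cases fwd
    · simp only [cond_false, Bool.and_eq_true, decide_eq_true_eq] at h
      obtain ⟨hn, ⟨h1, h2⟩, h3, h4⟩ := h
      rw [h2, Pt.eq_of_eq h3, tr] at hx
      rw [h1] at hp ⊢
      exact Pres.Over.unglue (surf_good A) hg' hx (over_mem_segment A two_pos hn h4) hp
    · simp only [cond_true, Bool.and_eq_true, decide_eq_true_eq] at h
      obtain ⟨hn, ⟨h1, h2⟩, h3, h4⟩ := h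
      rw [h1] at hx
      rw [h2, Pt.eq_of_eq h3, tr] at hp ⊢
      exact Pres.Over.glue (surf_good A) hg' hx (over_mem_segment A two_pos hn h4) hp

include A in
theorem exists_curve : ∀ {L : List LegD} {J : List (Option (ℕ × Bool))}, legsCheck L J = true →
    ∃ γ : ℝ → Xhat α, Continuous γ ∧ ∀ (k : ℕ) (l : LegD), L[k]? = some l → ∀ s : I,
      (surf α).Over l.i (AffineMap.lineMap (l.p.over α 2) (l.q.over α 2) (s : ℝ)) (γ (k + s)) := by
  have one : ∀ {l : LegD}, l.check = true → ∃ γ : ℝ → Xhat α, Continuous γ ∧ ∀ s : I,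
      (surf α).Over l.i (AffineMap.lineMap (l.p.over α 2) (l.q.over α 2) (s : ℝ)) (γ s) := by
    intro l h
    have hc : Continuous fun t : I => AffineMap.lineMap (l.p.over α 2) (l.q.over α 2) (t : ℝ) := by
      simp only [AffineMap.lineMap_apply]
      fun_prop
    obtain ⟨γ, h1, h2⟩ := Pres.exists_continuous_over (P := surf α) hc
      (fun t => (LegD.over A h t).1) fun t => (LegD.over A h t).2
    refine ⟨Set.IccExtend zero_le_one γ, h1.Icc_extend', fun s => ?_⟩
    have e : Set.IccExtend (zero_le_one (α := ℝ)) γ s = γ s := Set.IccExtend_val _ _ s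
    exact e ▸ h2 s
  intro L
  induction L with
  | nil => intro J h; simp [legsCheck] at h
  | cons l L ih =>
    intro J h
    cases L with
    | nil =>
      obtain ⟨γ, h1, h2⟩ := one (l := l) (by simpa [legsCheck] using h)
      refine ⟨γ, h1, fun k l' hk s => ?_⟩
      obtain ⟨rfl, rfl⟩ : k = 0 ∧ l = l' := by
        cases k <;> simp_all
      simpa using h2 s
    | cons l' L =>
      rcases J with _ | ⟨o, J⟩
      · simp [legsCheck] at h
      simp only [legsCheck, Bool.and_eq_true] at h
      obtain ⟨ha, hb, hc⟩ := h
      obtain ⟨γ, h1, h2⟩ := one ha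
      obtain ⟨γ', h1', h2'⟩ := ih hc
      have k1 := h2 1
      have k2 := h2' 0 l' rfl 0
      simp only [Set.Icc.coe_zero, Set.Icc.coe_one, AffineMap.lineMap_apply_zero,
        AffineMap.lineMap_apply_one, Nat.cast_zero, add_zero] at k1 k2
      have e : γ 1 = γ' 0 := (over_join A hb k1 k2.mem).unique k2
      refine ⟨fun t => if t ≤ 1 then γ t else γ' (t - 1),
        Continuous.if_le h1 (h1'.comp (by fun_prop)) continuous_id continuous_const
          fun t ht => by rw [show t = 1 from ht, sub_self, e], fun k l'' hk s => ?_⟩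
      cases k with
      | zero =>
        obtain rfl : l = l'' := by simpa using hk
        simp only [Nat.cast_zero, zero_add]
        rw [if_pos s.2.2]
        exact h2 s
      | succ k =>
        have := h2' k l'' (by simpa using hk) s
        push_cast
        split_ifs with hle
        · have h3 := s.2.1
          have h4 : (0 : ℝ) ≤ k := k.cast_nonneg
          have h5 : (s : ℝ) = 0 := by linarith
          have h6 : (k : ℝ) = 0 := by linarith
          rw [h5, h6] at this ⊢
          simp only [zero_add, add_zero] at this ⊢
          rwa [e]
        · rwa [show (k : ℝ) + 1 + s - 1 = k + s by ring]

end Curves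

end AY

namespace AY

/-! ### Exact data for the curves -/

/-- The loops. -/
def loopD : Fin 7 → List LegD :=
  let la : LegD := ⟨0, ⟨⟨-1, 2, 1⟩, 2, 2, 0⟩, ⟨-2, 4, 2⟩, 2, 2, 0⟩
  let lb : LegD := ⟨0, ⟨⟨-2, 4, 2⟩, 2, 2, 0⟩, ⟨-1, 2, 1⟩, 2, 2, 0⟩
  let lc : LegD := ⟨1, ⟨⟨-2, 4, 2⟩, 2, 2, 0⟩, ⟨0, 2, 2⟩, 2, 2, 0⟩
  let ld : LegD := ⟨2, ⟨⟨0, 4, 0⟩, 2, 2, 0⟩, ⟨0, 2, 2⟩, 2, 2, 0⟩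
  let le : LegD := ⟨1, ⟨⟨0, 2, 2⟩, 2, 2, 0⟩, ⟨-2, 4, 2⟩, 2, 2, 0⟩
  let lf : LegD := ⟨2, ⟨⟨0, 2, 2⟩, 2, 2, 0⟩, ⟨0, 4, 0⟩, 2, 2, 0⟩
  ![[⟨0, ⟨⟨-1, 2, 1⟩, 2, 2, 0⟩, ⟨-1, 2, 0⟩, 0, 0, 0⟩,
      ⟨1, ⟨⟨1, 0, 0⟩, 4, 0, 0⟩, ⟨-2, 4, 2⟩, 2, 2, 0⟩, lb],
    [⟨0, ⟨⟨-1, 2, 1⟩, 2, 2, 0⟩, ⟨-2, 4, 1⟩, 0, 0, 0⟩,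
      ⟨3, ⟨⟨0, 4, 3⟩, 0, 4, 4⟩, ⟨0, 4, 0⟩, 2, 2, 0⟩, ld, le, lb],
    [la, ⟨1, ⟨⟨-2, 4, 2⟩, 2, 2, 0⟩, ⟨-2, 4, 3⟩, 0, 0, 0⟩,
      ⟨3, ⟨⟨0, 4, 1⟩, 0, 4, 4⟩, ⟨0, 4, 0⟩, 2, 2, 0⟩, ld, le, lb],
    [la, ⟨1, ⟨⟨-2, 4, 2⟩, 2, 2, 0⟩, ⟨-1, 3, 3⟩, 0, 0, 0⟩,
      ⟨5, ⟨⟨3, 1, 1⟩, 0, 4, 0⟩, ⟨3, 1, 1⟩, 0, 0, 0⟩,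
      ⟨0, ⟨⟨1, -1, 1⟩, 4, 0, 0⟩, ⟨-1, 2, 1⟩, 2, 2, 0⟩],
    [la, lc, ⟨2, ⟨⟨0, 2, 2⟩, 2, 2, 0⟩, ⟨1, 1, 1⟩, 0, 0, 0⟩,
      ⟨5, ⟨⟨1, 3, 3⟩, 0, 4, 0⟩, ⟨1, 3, 3⟩, 0, 0, 0⟩,
      ⟨0, ⟨⟨-1, 1, 3⟩, 4, 0, 0⟩, ⟨-1, 2, 1⟩, 2, 2, 0⟩],
    [la, lc, lf, ⟨3, ⟨⟨0, 4, 0⟩, 2, 2, 0⟩, ⟨2, 1, 0⟩, 0, 0, 0⟩,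
      ⟨1, ⟨⟨0, 3, 0⟩, 4, 0, 0⟩, ⟨-2, 4, 2⟩, 2, 2, 0⟩, lb],
    [la, lc, lf, ⟨3, ⟨⟨0, 4, 0⟩, 2, 2, 0⟩, ⟨2, 2, 0⟩, 2, 2, 0⟩,
      ⟨4, ⟨⟨2, 2, 0⟩, 2, 2, 0⟩, ⟨0, 6, 0⟩, 0, 0, 0⟩,
      ⟨0, ⟨⟨-2, 4, 0⟩, 4, 0, 0⟩, ⟨-1, 2, 1⟩, 2, 2, 0⟩]]

/-- The joints of the loops. -/
def loopJoins : Fin 7 → List (Option (ℕ × Bool)) := ![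
    [some (15, false), some (0, false)],
    [some (20, false), some (2, false), some (1, false), some (0, false)],
    [some (0, true), some (19, false), some (2, false), some (1, false), some (0, false)],
    [some (0, true), some (23, false), some (13, false)],
    [some (0, true), some (1, true), some (22, false), some (13, false)],
    [some (0, true), some (1, true), some (2, true), some (17, false), some (0, false)],
    [some (0, true), some (1, true), some (2, true), some (3, true), some (12, false)]]

/-- The path from the base point to its image. -/
def epsD : List LegD := [
      ⟨0, ⟨⟨-1, 2, 1⟩, 2, 2, 0⟩, ⟨-2, 4, 2⟩, 2, 2, 0⟩,
      ⟨1, ⟨⟨-2, 4, 2⟩, 2, 2, 0⟩, ⟨0, 2, 2⟩, 2, 2, 0⟩,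
      ⟨2, ⟨⟨0, 2, 2⟩, 2, 2, 0⟩, ⟨0, 4, 0⟩, 2, 2, 0⟩,
      ⟨3, ⟨⟨0, 4, 0⟩, 2, 2, 0⟩, ⟨1, 2, 1⟩, 2, 2, 0⟩,
      ⟨3, ⟨⟨1, 2, 1⟩, 2, 2, 0⟩, ⟨1, 2, 1⟩, 0, 2, 2⟩]

/-- Its joints. -/
def epsJoins : List (Option (ℕ × Bool)) := [some (0, true), some (1, true), some (2, true), none]

/-- A run up to the end of a leg. -/
def lastRun (i j : ℕ) : Option Z3 × ℕ × ℕ × Option (Bool × Fin 6 × Bool) := (none, i, j, none)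

/-- A run ending in a crossing before the end of a leg. -/
def crossRun (t : Z3) (i j : ℕ) (c : Bool × Fin 6 × Bool) :
    Option Z3 × ℕ × ℕ × Option (Bool × Fin 6 × Bool) := (some t, i, j, some c)

/-- Tracks of the loops. -/
def loopTrack : Fin 7 → TrackD :=
  let n := lastRun; let c := crossRun
  ![⟨7, [c ⟨4, 8, -8⟩ 0 0 (true, 4, false), c ⟨24, -8, -20⟩ 0 2 (true, 5, false), n 0 1, n 0 7,
    n 0 0]⟩,
    ⟨1400987, [c ⟨1286152, 183736, -275604⟩ 0 0 (true, 4, false), c ⟨2401692, -800564, 800564⟩ 0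
    2 (false, 4, true), n 0 3, c ⟨667828, 261324, 304878⟩ 0 15 (true, 1, false), c ⟨1318576,
    329644, 494466⟩ 0 14 (false, 3, false), n 0 13, n 0 11, c ⟨1400987, -1400987, 0⟩ 0 8 (true,
    0, false), c ⟨1400987, 1400987, 0⟩ 0 4 (false, 5, false), n 0 7, n 0 0]⟩,
    ⟨11, [n 0 0, c ⟨2, 12, -6⟩ 0 7 (false, 5, true), c ⟨22, 0, -22⟩ 0 4 (true, 3, false), n 0 5,
    n 0 13, n 0 11, c ⟨11, -11, 0⟩ 0 8 (true, 0, false), c ⟨11, 11, 0⟩ 0 4 (false, 5, false), n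
    0 7, n 0 0]⟩,
    ⟨22, [n 0 0, c ⟨12, 8, -28⟩ 0 7 (false, 5, true), c ⟨52, -24, -4⟩ 0 4 (false, 0, true), n 0
    6, c ⟨11, -22, 11⟩ 0 22 (true, 4, false), c ⟨11, 22, 55⟩ 0 21 (true, 5, false), n 0 23, n 0
    0]⟩,
    ⟨742, [n 0 0, c ⟨742, -742, 0⟩ 0 7 (false, 5, true), c ⟨742, 742, 0⟩ 0 4 (true, 0, true), n
    0 8, c ⟨476, -224, -420⟩ 0 11 (false, 3, true), c ⟨1060, -848, -636⟩ 0 10 (true, 2, false),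
    n 0 9, c ⟨371, 0, -371⟩ 0 20 (false, 2, true), c ⟨-371, 2226, 1113⟩ 0 21 (true, 5, false), n
    0 23, n 0 0]⟩,
    ⟨12551, [n 0 0, c ⟨12551, -12551, 0⟩ 0 7 (false, 5, true), c ⟨12551, 12551, 0⟩ 0 4 (true, 0,
    true), n 0 8, n 0 11, c ⟨6930, -10472, -462⟩ 0 13 (false, 3, true), c ⟨25410, -4928, -1694⟩
    0 14 (false, 1, true), n 0 16, c ⟨9128, 4564, -2282⟩ 0 8 (true, 0, false), c ⟨7172, 14344,
    10758⟩ 0 4 (false, 5, false), n 0 7, n 0 0]⟩,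
    ⟨583, [n 0 0, c ⟨583, -583, 0⟩ 0 7 (false, 5, true), c ⟨583, 583, 0⟩ 0 4 (true, 0, true), n
    0 8, n 0 11, c ⟨583, -583, 0⟩ 0 13 (false, 3, true), c ⟨1749, -1749, 0⟩ 0 14 (true, 1,
    true), n 0 15, c ⟨636, 424, -318⟩ 0 17 (false, 2, true), c ⟨748, 220, 154⟩ 0 18 (true, 5,
    false), n 0 19, n 0 0]⟩]

/-- Tracks of the images of the loops. -/
def imageTrack : Fin 7 → TrackD :=
  let n := lastRun; let c := crossRun
  ![⟨1281, [c ⟨-252, 1428, 420⟩ 0 14 (false, 1, true), (some ⟨0, 0, 2562⟩, 0, 16, none), c ⟨732,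
    1464, -1464⟩ 5 8 (true, 0, false), c ⟨4392, -1464, -3660⟩ 5 4 (true, 3, false), n 5 5, c
    ⟨488, -732, -122⟩ 1 13 (false, 3, true), n 1 14, n 0 14]⟩,
    ⟨179609437, [c ⟨44308936, 91782796, -18989544⟩ 0 14 (false, 1, true), (some ⟨0, 0,
    359218874⟩, 0, 16, none), c ⟨164887352, 23555336, -35333004⟩ 5 8 (true, 0, false), c
    ⟨307901892, -102633964, 102633964⟩ 5 4 (false, 0, true), n 5 6, c ⟨65911720, -26364688,
    -9886758⟩ 3 22 (true, 4, false), c ⟨169044176, 42261044, 63391566⟩ 3 21 (false, 2, false), n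
    3 20, n 2 17, c ⟨179609437, -179609437, 0⟩ 1 15 (true, 1, false), n 1 14, n 0 14]⟩,
    ⟨47, [n 0 14, c ⟨6, 56, -54⟩ 1 14 (false, 1, true), (some ⟨0, 0, 94⟩, 1, 16, none), c ⟨42,
    16, -2⟩ 6 11 (false, 3, true), c ⟨94, 0, -94⟩ 6 10 (true, 2, false), n 6 9, n 3 20, n 2 17,
    c ⟨47, -47, 0⟩ 1 15 (true, 1, false), n 1 14, n 0 14]⟩,
    ⟨23326, [n 0 14, c ⟨20492, -6976, -23108⟩ 1 14 (false, 1, true), (some ⟨0, 0, 46652⟩, 1, 16,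
    none), c ⟨19620, 5232, 5668⟩ 6 11 (false, 3, true), c ⟨47524, -12208, 17876⟩ 6 10 (false, 1,
    true), n 6 12, c ⟨11663, -23326, 11663⟩ 10 8 (true, 0, false), c ⟨11663, 23326, 58315⟩ 10 4
    (true, 3, false), n 10 5, c ⟨21828, -27392, -10272⟩ 0 13 (false, 3, true), n 0 14]⟩,
    ⟨12614, [n 0 14, c ⟨12614, 12614, 0⟩ 1 14 (true, 1, true), n 1 15, c ⟨8092, -3808, -7140⟩ 2
    17 (false, 2, true), c ⟨6572, -4664, 212⟩ 2 18 (true, 5, false), (some ⟨0, 0, 25228⟩, 2, 19,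
    none), c ⟨20140, -1272, -9116⟩ 7 0 (true, 4, false), c ⟨33284, -10600, -8692⟩ 7 2 (true, 5,
    false), n 7 1, c ⟨6307, 0, -6307⟩ 10 7 (false, 5, true), c ⟨-6307, 37842, 18921⟩ 10 4 (true,
    3, false), n 10 5, c ⟨14628, -15264, -8480⟩ 0 13 (false, 3, true), n 0 14]⟩,
    ⟨84271, [n 0 14, c ⟨84271, 84271, 0⟩ 1 14 (true, 1, true), n 1 15, n 2 17, c ⟨46530, -70312,
    -3102⟩ 3 20 (false, 2, true), c ⟨77914, -86716, 9454⟩ 3 21 (true, 5, false), (some ⟨0, 0,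
    168542⟩, 3, 23, none), c ⟨126162, -16300, 6846⟩ 8 0 (true, 4, false), c ⟨170610, -33088,
    -11374⟩ 8 2 (false, 4, true), n 8 3, c ⟨61288, 30644, -15322⟩ 1 15 (true, 1, false), n 1 14,
    n 0 14]⟩,
    ⟨7579, [n 0 14, c ⟨7579, 7579, 0⟩ 1 14 (true, 1, true), n 1 15, n 2 17, c ⟨7579, -7579, 0⟩ 3
    20 (false, 2, true), n 3 21, c ⟨1060, 6360, -2014⟩ 4 21 (true, 5, false), (some ⟨0, 0,
    15158⟩, 4, 23, none), c ⟨8268, 5512, -4134⟩ 9 7 (false, 5, true), c ⟨9724, 2860, 2002⟩ 9 4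
    (true, 3, false), n 9 5, c ⟨6890, -4134, -5512⟩ 0 13 (false, 3, true), n 0 14]⟩]

/-- The track of the path from the base point to its image. -/
def epsTrack : TrackD :=
  let n := lastRun; let c := crossRun
  ⟨1, [n 0 0, c ⟨1, -1, 0⟩ 0 7 (false, 5, true), c ⟨1, 1, 0⟩ 0 4 (true, 0, true), n 0 8, n 0 11,
    (none, 0, 13, some (false, 3, true)), n 0 14]⟩

/-- The track of the image of this path. -/
def epsImageTrack : TrackD :=
  let n := lastRun; let c := crossRun
  ⟨1, [n 0 14, c ⟨1, 1, 0⟩ 1 14 (true, 1, true), n 1 15, n 2 17, (none, 3, 20, some (false, 2,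
    true)), c ⟨2, -2, 0⟩ 3 21 (true, 5, false), (some ⟨1, 0, 1⟩, 3, 23, none), n 8 0]⟩

/-- The base point in the octagons. -/
def baseD : Pt := ⟨⟨3, 2, 1⟩, 2, 2, 0⟩

/-- The octagon containing the image of the base point. -/
def imageOct : Fin 6 := 1

/-- The image of the base point in the octagons. -/
def imageD : Pt := ⟨⟨1, 2, 1⟩, 0, 2, 2⟩

theorem loopTrack_check (k : Fin 7) :
    (loopTrack k).check false (loopD k) 5 baseD 5 baseD = true := by
  revert k; decide +kernel

theorem imageTrack_check (k : Fin 7) :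
    (imageTrack k).check true (loopD k) imageOct imageD imageOct imageD = true := by
  revert k; decide +kernel

theorem epsTrack_check : epsTrack.check false epsD 5 baseD imageOct imageD = true := by
  decide +kernel

theorem epsImageTrack_check : epsImageTrack.check true epsD imageOct imageD 5 baseD = true := by
  decide +kernel

theorem loopD_check (k : Fin 7) : legsCheck (loopD k) (loopJoins k) = true := by
  revert k; decide +kernel

theorem epsD_check : legsCheck epsD epsJoins = true := by
  decide +kernel

/-- The words of the loops. -/
def loopWord (k : Fin 7) : List (Fin 7 × Bool) := trackWord ((loopTrack k).runs (loopD k))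

/-- The words of their images. -/
def imageWord (k : Fin 7) : List (Fin 7 × Bool) := trackWord ((imageTrack k).runs (loopD k))

theorem epsTrack_word : trackWord (epsTrack.runs epsD) = [] := by decide +kernel

theorem epsImageTrack_word : trackWord (epsImageTrack.runs epsD) = [(6, false)] := by decide +kernel

end AY

namespace AY

variable {α : ℝ} (A : IsRoot3 α)

/-! ### The curves of the statement in exact form -/

theorem Pt.over_two (p : Pt) : p.over α 2 = ⟨p.x.ev α / 4, p.y.ev α / 4⟩ := by
  apply Complex.ext
  · rw [Pt.over_re, Pt.ev]; push_cast; ring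
  · rw [Pt.over_im, Pt.ev]; push_cast; ring

include A in
theorem base_eq : base α = ⟨(-1 + 2 * α + α ^ 2) / 4, (1 + α) / 2⟩ := by
  have h1 := A.cube
  have h2 := A.fourth
  have hi : α⁻¹ - α ≠ 0 := by
    rw [A.inv]
    have := sq_nonneg α
    intro h
    nlinarith
  have hq : (1 : ℝ) + α ^ 2 ≠ 0 := by positivity
  apply Complex.ext
  · simp only [base]
    field_simp
    linear_combination -2 * h2 - 4 * h1
  · simp only [base]
    rw [div_eq_iff hi, A.inv]
    linear_combination (-1 / 2 : ℝ) * h1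

include A in
theorem ay_base : ayFormula α (base α) = ⟨(1 + 2 * α + α ^ 2) / 4, (α + α ^ 2) / 2⟩ := by
  have h1 := A.cube
  have h2 := A.fourth
  have k1 := A.lo; have k2 := A.hi; have k3 := A.lo2; have k4 := A.hi2
  rw [base_eq A, ayFormula, if_neg (by simp only [slit2]; linarith), if_pos (by dsimp only; linarith),
    A.inv]
  congr 1
  · linear_combination h1 / 4
  · linear_combination h1 / 2

include A in
theorem loopLegs_eq (k : Fin 7) : loopLegs α k = (loopD k).map (LegD.real α) := by
  have h1 := A.cube
  have h2 := A.fourth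
  have hb := base_eq A
  fin_cases k <;> simp [loopLegs, loopD, LegD.real, level, hb, Pt.over_two, Z3.ev, slit1, slit2,
    slit3, h1, h2] <;> ring_nf <;> simp

include A in
theorem epsLegs_eq : epsLegs α = epsD.map (LegD.real α) := by
  have h1 := A.cube
  have h2 := A.fourth
  have hb := base_eq A
  have hi := ay_base A
  rw [epsLegs, hi]
  simp [epsD, LegD.real, level, hb, Pt.over_two, Z3.ev, slit1, slit2, h2]
  ring_nf
  simp

/-- A path following the legs, as a curve parametrized by the legs. -/
theorem Follows.curve {x y : Xhat α} {γ : Path x y} {L : List LegD}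
    (h : Follows α γ (L.map (LegD.real α))) (k : ℕ) (l : LegD) (hk : L[k]? = some l) (s : ℝ)
    (h0 : 0 ≤ s) (h1 : s ≤ 1) : At α l.i (AffineMap.lineMap (l.p.over α 2) (l.q.over α 2) s)
      (collapse α (γ.extend ((k + s) / (L.length : ℕ)))) := by
  obtain ⟨hk', rfl⟩ := List.getElem?_eq_some_iff.1 hk
  have := h ⟨k, by simpa using hk'⟩ s h0 h1
  simpa [LegD.real] using this

include A in
theorem exists_path {L : List LegD} {J : List (Option (ℕ × Bool))} (hL : legsCheck L J = true)
    {l : LegD} (hl : L[0]? = some l) {l' : LegD} (hl' : L[L.length - 1]? = some l') {x y : Xhat α}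
    (hx : (surf α).Over l.i (l.p.over α 2) x) (hy : (surf α).Over l'.i (l'.q.over α 2) y) :
    ∃ γ : Path x y, Follows α γ (L.map (LegD.real α)) := by
  obtain ⟨γ, hc, hγ⟩ := exists_curve A hL
  have hn : L.length ≠ 0 := by rintro h; simp [List.length_eq_zero_iff.1 h] at hl
  have hn' : ((L.length : ℕ) : ℝ) ≠ 0 := by exact_mod_cast hn
  refine ⟨{ toFun := fun t => γ (L.length * t), continuous_toFun := by fun_prop, source' := ?_,
            target' := ?_ }, ?_⟩
  · have := hγ 0 l hl 0
    simp only [Nat.cast_zero, Set.Icc.coe_zero, add_zero, AffineMap.lineMap_apply_zero] at this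
    rw [Set.Icc.coe_zero, mul_zero]
    exact this.unique hx
  · have := hγ _ l' hl' 1
    simp only [Set.Icc.coe_one, AffineMap.lineMap_apply_one] at this
    rw [Nat.cast_sub (Nat.one_le_iff_ne_zero.2 hn), Nat.cast_one, sub_add_cancel] at this
    rw [Set.Icc.coe_one, mul_one]
    exact this.unique hy
  · rintro ⟨k, hk⟩ s h0 h1
    simp only [List.length_map] at hk
    have h2 := hγ k _ (List.getElem?_eq_getElem hk) ⟨s, h0, h1⟩
    have hk' : (k : ℝ) + 1 ≤ L.length := by exact_mod_cast hk
    have hu : ((k : ℝ) + s) / ((L.map (LegD.real α)).length : ℕ) ∈ I := by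
      rw [List.length_map]
      exact ⟨by positivity, (div_le_one (by positivity)).2 (by linarith)⟩
    dsimp only
    rw [Path.extend_apply _ hu]
    have e : (L.length : ℝ) * (((k : ℝ) + s) / ((L.map (LegD.real α)).length : ℕ)) = k + s := by
      rw [List.length_map]; field_simp
    change At α _ _ (collapse α (γ (L.length * (((k : ℝ) + s) / ((L.map (LegD.real α)).length : ℕ)))))
    rw [e]
    simpa [LegD.real] using (at_collapse_iff A h2.1).2 h2

/-- The base point, in exact form. -/
def baseQ : Pt := ⟨⟨-1, 2, 1⟩, ⟨2, 2, 0⟩⟩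

/-- The image of the base point, in exact form. -/
def imageQ : Pt := ⟨⟨1, 2, 1⟩, ⟨0, 2, 2⟩⟩

include A in
theorem baseQ_over : baseQ.over α 2 = base α := by
  rw [base_eq A, Pt.over_two]
  apply Complex.ext <;> simp [baseQ, Z3.ev]
  all_goals ring

/-- A check that a part sends an exact point to another. -/
def moveCheck {n n' : ℕ} (P : PD n) (Q : PD n') (s : Pt) (k : PartD) (i j : Fin 6) (p q : Pt) :
    Bool :=
  decide (k.i = i ∧ k.j = j) && (inside 2 (PD.domForms P Q s k) p && q.eq (k.img 2 s p))

theorem moveCheck_spec (A : IsRoot3 α) {n n' : ℕ} {P : PD n} {Q : PD n'} {s : Pt} {k : PartD}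
    {i j : Fin 6} {p q : Pt} (h : moveCheck P Q s k i j p q = true) : k.i = i ∧ k.j = j ∧
      q.over α 2 = (k.real α).map (s.scale α) (p.over α 2) ∧
      (k.real α).map (s.scale α) (p.over α 2) ∈ (Q.real α).cell k.j := by
  rw [moveCheck, Bool.and_eq_true, Bool.and_eq_true, decide_eq_true_eq] at h
  obtain ⟨⟨h3, h4⟩, h1, h2⟩ := h
  refine ⟨h3, h4, ?_, ((PD.domForms_iff (P := P) (Q := Q) (s := s) A k _).1
    (inside_spec A two_pos h1)).2⟩
  rw [Pt.eq_of_eq h2, PartD.over_img A two_pos]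

theorem over_hat {k : ℕ} {i j : Fin 6} {p q : Pt}
    (h : moveCheck surfD surfD stretch (mapPart k) i j p q = true) (hk : k < mapParts.length)
    {x : Xhat α} (hx : (surf α).Over i (p.over α 2) x) :
    (surf α).Over j (q.over α 2) (hatMap A x) := by
  obtain ⟨rfl, rfl, h1, h2⟩ := moveCheck_spec A h
  rw [surf_cell A] at h2
  rw [h1]
  exact Pres.Over.map (map_compat A) (mapPart_mem hk) (p := (mapPart k).real α) hx h2

theorem over_par {k : ℕ} {i j : Fin 6} {p q : Pt}
    (h : moveCheck surfD modelD onePt (modelPart k) i j p q = true) (hk : k < modelParts.length)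
    {x : Xhat α} (hx : (surf α).Over i (p.over α 2) x) :
    (modelD.real α).Over j (q.over α 2) (parHomeo A x) := by
  obtain ⟨rfl, rfl, h1, h2⟩ := moveCheck_spec A h
  rw [h1]
  exact Pres.Over.map (model_compat A) (modelPart_mem hk) (p := (modelPart k).real α) hx h2

theorem over_base_image {x : Xhat α} (hx : (surf α).Over 0 (baseQ.over α 2) x) :
    (surf α).Over 3 (imageQ.over α 2) (hatMap A x) :=
  over_hat A (k := 0) (by decide +kernel) (by decide) hx

theorem over_image_base {x : Xhat α} (hx : (surf α).Over 3 (imageQ.over α 2) x) :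
    (surf α).Over 0 (baseQ.over α 2) (hatMap A x) :=
  over_hat A (k := 8) (by decide +kernel) (by decide) hx

theorem base_par {x : Xhat α} (hx : (surf α).Over 0 (baseQ.over α 2) x) :
    (modelD.real α).Over 5 (baseD.over α 2) (parHomeo A x) :=
  over_par A (k := 0) (by decide +kernel) (by decide) hx

theorem image_par {x : Xhat α} (hx : (surf α).Over 3 (imageQ.over α 2) x) :
    (modelD.real α).Over imageOct (imageD.over α 2) (parHomeo A x) :=
  over_par A (k := 14) (by decide +kernel) (by decide) hx

include A in
theorem base_free : base α ∈ cell α 0 ∧ base α ∉ Set.range (sing α) := by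
  have h := LegD.over A (l := (loopD 0).head (by decide)) (by decide +kernel) 0
  rw [← baseQ_over A]
  simpa [loopD, baseQ] using h

theorem loopD_ends (k : Fin 7) : ∃ l l' : LegD, (loopD k)[0]? = some l ∧
    (loopD k)[(loopD k).length - 1]? = some l' ∧ l.i = 0 ∧ l.p = baseQ ∧ l'.i = 0 ∧
      l'.q = baseQ := by
  fin_cases k <;> exact ⟨_, _, rfl, rfl, rfl, rfl, rfl, rfl⟩

theorem epsD_ends : ∃ l l' : LegD, epsD[0]? = some l ∧ epsD[epsD.length - 1]? = some l' ∧
    l.i = 0 ∧ l.p = baseQ ∧ l'.i = 3 ∧ l'.q = imageQ :=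
  ⟨_, _, rfl, rfl, rfl, rfl, rfl, rfl⟩

include A in
theorem nonempty_data : Nonempty (Data α) := by
  obtain ⟨hz, hv⟩ := base_free A
  obtain ⟨x₀, hx⟩ := Pres.exists_over (P := surf α) hz hv
  have hb := hx
  rw [← baseQ_over A] at hx
  have hi := over_base_image A hx
  have hl : ∀ k, ∃ γ : Path x₀ x₀, Follows α γ (loopLegs α k) := by
    intro k
    rw [loopLegs_eq A]
    obtain ⟨l, l', h1, h2, h3, h4, h5, h6⟩ := loopD_ends k
    exact exists_path A (loopD_check k) h1 h2 (by rw [h3, h4]; exact hx) (by rw [h5, h6]; exact hx)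
  choose loop hloop using hl
  obtain ⟨l, l', h1, h2, h3, h4, h5, h6⟩ := epsD_ends
  obtain ⟨eps, heps⟩ := exists_path A epsD_check h1 h2 (x := x₀) (y := hatMap A x₀)
    (by rw [h3, h4]; exact hx) (by rw [h5, h6]; exact hi)
  exact ⟨{ h := ayMap A, isAYMap := isAYMap_ayMap A, hhat := hatMap A
           collapse_hhat := collapse_hatMap A, x₀ := x₀
           at_x₀ := (at_collapse_iff A hv).2 hb
           loop := loop, follows_loop := hloop, eps := eps
           follows_eps := by rw [epsLegs_eq A]; exact heps }⟩

/-! ### The classes of the curves -/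

namespace Data

variable (D : Data α)

include A in
theorem over_x₀ : (surf α).Over 0 (baseQ.over α 2) D.x₀ := by
  rw [baseQ_over A]
  exact (at_collapse_iff A (base_free A).2).1 D.at_x₀

/-- The point of the octagon over the base point. -/
def o₀ : Oct := octPt A 5 (base_par A (over_x₀ A D)).mem (base_par A (over_x₀ A D)).1

theorem octMap_o₀ : octMap A 5 (D.o₀ A) = D.x₀ := octMap_eq A (base_par A (over_x₀ A D))

theorem nonempty_sheets : Nonempty (Sheets (octMap A) (D.o₀ A) (D.octMap_o₀ A)) :=
  exists_sheets _ _ _ (octMap_right A) (octMap_upper A)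

include A in
theorem over_hhat : (surf α).Over 3 (imageQ.over α 2) (D.hhat D.x₀) := by
  rw [D.hhat_eq A (over_x₀ A D)]
  exact over_base_image A (over_x₀ A D)

include A in
theorem hhat_hhat : D.x₀ = D.hhat (D.hhat D.x₀) := by
  have h := over_image_base A (over_hhat A D)
  rw [← D.hhat_eq A (over_hhat A D)] at h
  exact (over_x₀ A D).unique h

variable {A} {D} (S : Sheets (octMap A) (D.o₀ A) (D.octMap_o₀ A))

theorem at_base : S.at_ A 5 (baseD.over α 2) = ⟨D.x₀, Path.Homotopic.Quotient.refl D.x₀⟩ := by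
  have h := base_par A (over_x₀ A D)
  rw [S.at_eq A h.mem h.1]
  exact S.start

theorem at_image : ∃ c, S.at_ A imageOct (imageD.over α 2) = ⟨D.hhat D.x₀, c⟩ := by
  have h := image_par A (over_hhat A D)
  have hp : (S.at_ A imageOct (imageD.over α 2)).pt = D.hhat D.x₀ := by
    rw [S.at_eq A h.mem h.1, S.pt, octMap_eq A h]
  revert hp
  generalize S.at_ A imageOct (imageD.over α 2) = τ
  obtain ⟨y, c⟩ := τ
  intro hp
  dsimp only at hp
  subst hp
  exact ⟨c, rfl⟩

theorem carries_path {x y : Xhat α} {γ : Path x y} {L : List LegD}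
    (hγ : Follows α γ (L.map (LegD.real α))) {T : TrackD} {img : Bool} {j j' : Fin 6} {z z' : Pt}
    (h : T.check img L j z j' z' = true) {m : Xhat α → Xhat α} (hmc : Continuous m)
    (hm : ∀ i z x, (surf α).Over i z x → m x = imgMap A img x) (hL : L.length ≠ 0) :
    Carries (fun t => m (γ.extend t)) 0 1 (S.at_ A j (z.over α 2))
      (wordVal S.W (trackWord (T.runs L)) • S.at_ A j' (z'.over α 2)) := by
  have hn : ((L.length : ℕ) : ℝ) ≠ 0 := by exact_mod_cast hL
  have hc : Continuous fun t : ℝ => γ.extend (t / (L.length : ℕ)) := by fun_prop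
  exact Carries.rescale hn (g := fun t => m (γ.extend t)) (TrackD.carries S h hc hmc hm hγ.curve)

theorem wordVal_smul_mk {Y : Type*} [TopologicalSpace Y] {x₀ y : Y} (w : LoopGrp x₀)
    (c : Path.Homotopic.Quotient x₀ y) :
    w • (⟨y, c⟩ : Tail x₀) = ⟨y, Path.Homotopic.Quotient.trans w c⟩ := rfl

/-- The classes of the loops in terms of the letters of the octagons. -/
theorem loop_class (k : Fin 7) : LoopGrp.mk (D.loop k) = wordVal S.W (loopWord k) := by
  have h := D.follows_loop k
  rw [loopLegs_eq A] at h
  have c := carries_path S h (loopTrack_check k) (m := id) continuous_id (fun _ _ _ _ => rfl)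
    (by clear h; revert k; decide)
  rw [at_base, wordVal_smul_mk] at c
  have := c.path
  rw [Path.Homotopic.Quotient.refl_trans] at this
  exact this.trans (Path.Homotopic.Quotient.trans_refl _)

theorem hhat_imgMap (i : Fin 6) (z : ℂ) (x : Xhat α) (h : (surf α).Over i z x) :
    D.hhat x = imgMap A true x := D.hhat_eq A h

theorem eps_class : S.at_ A imageOct (imageD.over α 2) =
    ⟨D.hhat D.x₀, Path.Homotopic.Quotient.mk D.eps⟩ := by
  obtain ⟨c, hc⟩ := at_image S
  have h := D.follows_eps
  rw [epsLegs_eq A] at h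
  have k := carries_path S h epsTrack_check (m := id) continuous_id (fun _ _ _ _ => rfl)
    (by decide)
  rw [epsTrack_word, wordVal_nil, one_smul, at_base, hc] at k
  have e := k.path
  rw [Path.Homotopic.Quotient.refl_trans] at e
  rw [hc, e]

/-- The classes of the images of the loops. -/
theorem imageLoop_homotopic (k : Fin 7) (F : Path D.x₀ D.x₀)
    (hF : LoopGrp.mk F = wordVal S.W (imageWord k)) : (D.imageLoop k).Homotopic (D.conj F) := by
  have h := D.follows_loop k
  rw [loopLegs_eq A] at h
  have c := carries_path S h (imageTrack_check k) D.hhat.continuous hhat_imgMap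
    (by clear h hF; revert k; decide)
  rw [eps_class, ← imageWord, ← hF, wordVal_smul_mk] at c
  have e := (c.of_eqOn (γ' := (D.imageLoop k).extend) fun t => by simp [imageLoop]).path
  refine Path.Homotopic.Quotient.eq.1 ?_
  rw [conj, Path.Homotopic.Quotient.mk_trans, Path.Homotopic.Quotient.mk_trans,
    Path.Homotopic.Quotient.trans_assoc, Path.Homotopic.Quotient.mk_symm]
  refine Eq.trans ?_ (congrArg _ e)
  rw [← Path.Homotopic.Quotient.trans_assoc, Path.Homotopic.Quotient.symm_trans,
    Path.Homotopic.Quotient.refl_trans]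

/-- The class of the path followed by its image. -/
theorem eps_eps_homotopic (hx : D.x₀ = D.hhat (D.hhat D.x₀)) (F : Path D.x₀ D.x₀)
    (hF : LoopGrp.mk F = wordVal S.W [(6, false)]) :
    ((D.eps.trans (D.eps.map D.hhat.continuous)).cast rfl hx).Homotopic F := by
  have h := D.follows_eps
  rw [epsLegs_eq A] at h
  have c := carries_path S h epsImageTrack_check D.hhat.continuous hhat_imgMap (by decide)
  rw [eps_class, at_base, epsImageTrack_word, ← hF, wordVal_smul_mk] at c
  have e := (c.of_eqOn (γ' := ((D.eps.map D.hhat.continuous).cast rfl hx).extend)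
    fun t => by simp).path
  refine Path.Homotopic.Quotient.eq.1 ?_
  have e2 : (D.eps.trans (D.eps.map D.hhat.continuous)).cast rfl hx =
      D.eps.trans ((D.eps.map D.hhat.continuous).cast rfl hx) := rfl
  rw [e2, Path.Homotopic.Quotient.mk_trans, e]
  exact Path.Homotopic.Quotient.trans_refl _

end Data

end AY

namespace AY

/-! ### Homotopies of maps from graphs -/

section Square

variable {Y : Type*} [TopologicalSpace Y]

theorem trans_extend_of_half_le {x y z : Y} (p : Path x y) (q : Path y z) {r : ℝ} (h : 1 / 2 ≤ r) :
    (p.trans q).extend r = q.extend (2 * r - 1) := by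
  rw [Path.extend_trans_of_half_le _ _ h]

theorem trans_extend_of_le_half {x y z : Y} (p : Path x y) (q : Path y z) {r : ℝ} (h : r ≤ 1 / 2) :
    (p.trans q).extend r = p.extend (2 * r) := by
  rw [Path.extend_trans_of_le_half _ _ h]

/-- A commutative square of homotopy classes of paths can be filled. -/
theorem exists_square {x y x' y' : Y} (p : Path x y) (p' : Path x' y') (η : Path x x')
    (η' : Path y y') (h : (p.trans η').Homotopic (η.trans p')) :
    ∃ K : C(I × I, Y), (∀ r, K (r, 0) = p r) ∧ (∀ r, K (r, 1) = p' r) ∧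
      (∀ u, K (0, u) = (Path.refl x).trans η u) ∧ ∀ u, K (1, u) = (Path.refl y).trans η' u := by
  let l : Path x y := (η.trans p').trans η'.symm
  have hl : p.Homotopic l := by
    rw [← Path.Homotopic.Quotient.eq] at h ⊢
    simp only [l, Path.Homotopic.Quotient.mk_trans, Path.Homotopic.Quotient.mk_symm] at h ⊢
    rw [← h, Path.Homotopic.Quotient.trans_assoc, Path.Homotopic.Quotient.trans_symm,
      Path.Homotopic.Quotient.trans_refl]
  obtain ⟨Φ⟩ := hl
  have e1 : ∀ r : ℝ, r ≤ 1 → l.extend (r / 4) = η.extend r := by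
    intro r hr
    rw [trans_extend_of_le_half _ _ (by linarith), trans_extend_of_le_half _ _ (by linarith)]
    ring_nf
  have e2 : ∀ r : ℝ, 0 ≤ r → r ≤ 1 → l.extend (1 / 4 + r / 4) = p'.extend r := by
    intro r h0 hr
    rw [trans_extend_of_le_half _ _ (by linarith), trans_extend_of_half_le _ _ (by linarith)]
    ring_nf
  have e3 : ∀ r : ℝ, r ≤ 1 → l.extend (1 - r / 2) = η'.extend r := by
    intro r hr
    rw [trans_extend_of_half_le _ _ (by linarith), Path.extend_symm]
    ring_nf
  let Ψ : ContinuousMap.Homotopy (l : C(I, Y)) (p' : C(I, Y)) :=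
    { toFun := fun w => l.extend ((w.1 : ℝ) / 4 + (w.2 : ℝ) * (1 - 3 / 4 * (w.1 : ℝ)))
      continuous_toFun := by fun_prop
      map_zero_left := fun r => by simp
      map_one_left := fun r => by
        have := (e2 r r.2.1 r.2.2).trans (Path.extend_apply p' r.2)
        refine Eq.trans ?_ this
        congr 1
        simp only [Set.Icc.coe_one]
        ring }
  let H := Φ.toHomotopy.trans Ψ
  refine ⟨⟨fun w => H (w.2, w.1), by fun_prop⟩, fun r => H.apply_zero r, fun r => H.apply_one r,
    fun u => ?_, fun u => ?_⟩
  · change H (u, 0) = _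
    rw [ContinuousMap.Homotopy.trans_apply, Path.trans_apply]
    split_ifs with hu
    · exact Φ.source _
    · change l.extend _ = _
      have := e1 (2 * u - 1) (by linarith [u.2.2])
      simp only [Set.Icc.coe_zero, zero_mul, add_zero]
      rw [this]
      exact Path.extend_apply _ _
  · change H (u, 1) = _
    rw [ContinuousMap.Homotopy.trans_apply, Path.trans_apply]
    split_ifs with hu
    · exact Φ.target _
    · change l.extend _ = _
      have := e3 (2 * u - 1) (by linarith [u.2.2])
      rw [← Path.extend_apply, ← this]
      congr 1
      simp only [Set.Icc.coe_one]
      ring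

end Square

section Gr

variable {V E : Type} (s t : E → V)

/-- `v` is the initial vertex (at time `0`) or the final vertex (at time `1`) of an edge. -/
def Gr.IsEnd (x : Σ _ : E, I) (v : V) : Prop := (x.2 = 0 ∧ v = s x.1) ∨ (x.2 = 1 ∧ v = t x.1)

/-- The graph with edges `e : E` from `s e` to `t e`. -/
def Gr : Type := Quot fun x y : (Σ _ : E, I) => ∃ v, Gr.IsEnd s t x v ∧ Gr.IsEnd s t y v

instance : TopologicalSpace (Gr s t) := inferInstanceAs (TopologicalSpace (Quot _))

namespace Gr

/-- The point at time `u` of the edge `e`. -/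
def pt (e : E) (u : I) : Gr s t := Quot.mk _ ⟨e, u⟩

theorem continuous_pt (e : E) : Continuous (pt s t e) :=
  continuous_quot_mk.comp continuous_sigmaMk

variable {s t}

theorem pt_eq {e e' : E} {u u' : I} {v : V} (h : IsEnd s t ⟨e, u⟩ v) (h' : IsEnd s t ⟨e', u'⟩ v) :
    pt s t e u = pt s t e' u' := Quot.sound ⟨v, h, h'⟩

variable {Y : Type*} [TopologicalSpace Y]

/-- The map that sends the edges to given paths. -/
def lift (a : V → Y) (P : ∀ e, Path (a (s e)) (a (t e))) : C(Gr s t, Y) where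
  toFun := Quot.lift (fun x => P x.1 x.2) (by
    have key : ∀ (x : Σ _ : E, I) (v : V), IsEnd s t x v → P x.1 x.2 = a v := by
      rintro ⟨e, u⟩ v (h | h)
      · obtain ⟨h1, rfl⟩ := h
        dsimp only at h1 ⊢
        rw [h1]; exact (P e).source
      · obtain ⟨h1, rfl⟩ := h
        dsimp only at h1 ⊢
        rw [h1]; exact (P e).target
    rintro x y ⟨v, hx, hy⟩
    exact (key x v hx).trans (key y v hy).symm)
  continuous_toFun := continuous_coinduced_dom.2 (continuous_sigma fun e => (P e).continuous)

theorem homotopy_of_squares (F G : C(Gr s t, Y)) (k : V → C(I, Y)) (K : E → C(I × I, Y))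
    (h0 : ∀ e u, K e (0, u) = k (s e) u) (h1 : ∀ e u, K e (1, u) = k (t e) u)
    (hF : ∀ e r, K e (r, 0) = F (pt s t e r)) (hG : ∀ e r, K e (r, 1) = G (pt s t e r)) :
    ∃ H : F.Homotopy G, ∀ e r u, H (u, pt s t e r) = K e (r, u) := by
  let Φ : C(Gr s t, C(I, Y)) := lift k fun e =>
    { toFun := (K e).curry
      continuous_toFun := (K e).curry.continuous
      source' := ContinuousMap.ext (h0 e)
      target' := ContinuousMap.ext (h1 e) }
  refine ⟨{ toFun := fun w => Φ.uncurry (w.2, w.1)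
            continuous_toFun := by fun_prop
            map_zero_left := ?_
            map_one_left := ?_ }, fun e r u => rfl⟩
  · rintro ⟨e, r⟩
    exact hF e r
  · rintro ⟨e, r⟩
    exact hG e r

/-- Two maps from a graph are homotopic if paths that join the images of the vertices transform the
images of the edges into each other. -/
theorem exists_homotopy (F G : C(Gr s t, Y)) {a b : V → Y} (P : ∀ e, Path (a (s e)) (a (t e)))
    (P' : ∀ e, Path (b (s e)) (b (t e))) (hF : ∀ e r, F (pt s t e r) = P e r)
    (hG : ∀ e r, G (pt s t e r) = P' e r) (η : ∀ v, Path (a v) (b v))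
    (h : ∀ e, ((P e).trans (η (t e))).Homotopic ((η (s e)).trans (P' e))) :
    ∃ H : F.Homotopy G, ∀ e u, H (u, pt s t e 0) = (Path.refl _).trans (η (s e)) u := by
  choose K hK using fun e => exists_square _ _ _ _ (h e)
  obtain ⟨H, hH⟩ := homotopy_of_squares F G (fun v => ((Path.refl _).trans (η v) : C(I, Y))) K
    (fun e u => (hK e).2.2.1 u) (fun e u => (hK e).2.2.2 u)
    (fun e r => ((hK e).1 r).trans (hF e r).symm) (fun e r => ((hK e).2.1 r).trans (hG e r).symm)
  exact ⟨H, fun e u => (hH e 0 u).trans ((hK e).2.2.1 u)⟩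

end Gr

end Gr

end AY

namespace AY

/-! ### Cayley graphs as covers of the wedge of circles -/

namespace Gr

variable {V E : Type} {s t : E → V}

open Classical in
/-- A bump function of an edge, and the same multiplied by the time. -/
def edgeBump (e : E) : C(Gr s t, ℝ × ℝ) :=
  lift (fun _ => (0, 0)) fun e' =>
    { toFun := fun u => if e' = e then ((u : ℝ) * (1 - u), (u : ℝ) ^ 2 * (1 - u)) else (0, 0)
      continuous_toFun := by split_ifs <;> fun_prop
      source' := by simp
      target' := by simp }

open Classical in
theorem edgeBump_pt (e e' : E) (u : I) : edgeBump e (pt s t e' u) =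
    if e' = e then ((u : ℝ) * (1 - u), (u : ℝ) ^ 2 * (1 - u)) else (0, 0) := rfl

theorem bump_pos {u : I} (h0 : u ≠ 0) (h1 : u ≠ 1) : 0 < (u : ℝ) * (1 - u) :=
  mul_pos (unitInterval.pos_iff_ne_zero.2 h0) (sub_pos.2 (unitInterval.lt_one_iff_ne_one.2 h1))

theorem pt_inj {e e' : E} {u u' : I} (h : pt s t e u = pt s t e' u') (h0 : u ≠ 0) (h1 : u ≠ 1) :
    e = e' ∧ u = u' := by
  have hb := bump_pos h0 h1
  have k := congrArg (edgeBump e) h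
  rw [edgeBump_pt, edgeBump_pt, if_pos rfl] at k
  split_ifs at k with he
  · have k1 : (u : ℝ) * (1 - u) = (u' : ℝ) * (1 - u') := congrArg Prod.fst k
    have k2 : (u : ℝ) ^ 2 * (1 - u) = (u' : ℝ) ^ 2 * (1 - u') := congrArg Prod.snd k
    refine ⟨he.symm, Subtype.ext (mul_right_cancel₀ hb.ne' ?_)⟩
    linear_combination k2 - (u' : ℝ) * k1
  · have k1 : (u : ℝ) * (1 - u) = 0 := congrArg Prod.fst k
    exact absurd k1 hb.ne'

open Classical in
/-- A bump function of a vertex. -/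
def vertexBump (v : V) : C(Gr s t, ℝ) :=
  lift (fun w => if w = v then 1 else 0) fun e =>
    { toFun := fun u => (if s e = v then max 0 (1 - 2 * (u : ℝ)) else 0) +
        if t e = v then max 0 (2 * (u : ℝ) - 1) else 0
      continuous_toFun := by split_ifs <;> fun_prop
      source' := by norm_num
      target' := by norm_num }

open Classical in
theorem vertexBump_pt (v : V) (e : E) (u : I) : vertexBump v (pt s t e u) =
    (if s e = v then max 0 (1 - 2 * (u : ℝ)) else 0) +
      if t e = v then max 0 (2 * (u : ℝ) - 1) else 0 := rfl

theorem vertexBump_pos {v : V} {e : E} {u : I} (h : 0 < vertexBump v (pt s t e u)) :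
    ((u : ℝ) < 1 / 2 ∧ s e = v) ∨ (1 / 2 < (u : ℝ) ∧ t e = v) := by
  rw [vertexBump_pt] at h
  rcases lt_trichotomy (u : ℝ) (1 / 2) with k | k | k
  · left
    refine ⟨k, ?_⟩
    by_contra hs
    rw [if_neg hs, max_eq_left (by linarith)] at h
    simp at h
  · rw [k] at h
    norm_num at h
  · right
    refine ⟨k, ?_⟩
    by_contra hs
    rw [if_neg hs, max_eq_left (by linarith)] at h
    simp at h

theorem vertexBump_unique {v v' : V} {x : Gr s t} (h : 0 < vertexBump v x)
    (h' : 0 < vertexBump v' x) : v = v' := by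
  obtain ⟨e, u⟩ := x
  rcases vertexBump_pos h with ⟨k, rfl⟩ | ⟨k, rfl⟩ <;>
    rcases vertexBump_pos h' with ⟨k', rfl⟩ | ⟨k', rfl⟩ <;> first | rfl | linarith

end Gr

theorem quotient_map_trans {Y Z : Type*} [TopologicalSpace Y] [TopologicalSpace Z] {x y z : Y}
    (f : C(Y, Z)) (a : Path.Homotopic.Quotient x y) (b : Path.Homotopic.Quotient y z) :
    (a.trans b).map f = (a.map f).trans (b.map f) := by
  induction a using Path.Homotopic.Quotient.ind
  induction b using Path.Homotopic.Quotient.ind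
  exact congrArg Path.Homotopic.Quotient.mk (Path.map_trans _ _ _)

theorem quotient_map_symm {Y Z : Type*} [TopologicalSpace Y] [TopologicalSpace Z] {x y : Y}
    (f : C(Y, Z)) (a : Path.Homotopic.Quotient x y) : a.symm.map f = (a.map f).symm := by
  induction a using Path.Homotopic.Quotient.ind
  exact congrArg Path.Homotopic.Quotient.mk (Path.map_symm _ f.continuous)

/-- The circles of the wedge. -/
def roseEdge (k : Fin 7) : Path rosePt rosePt where
  toFun u := edgePt _ 0 k u
  continuous_toFun := continuous_quot_mk.comp continuous_sigmaMk
  source' := Quot.sound ⟨0, Or.inl ⟨rfl, rfl⟩, Or.inl ⟨rfl, rfl⟩⟩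
  target' := Quot.sound ⟨0, Or.inr ⟨rfl, rfl⟩, Or.inl ⟨rfl, rfl⟩⟩

/-- The class in the fundamental group of the wedge of circles of a word. -/
def roseVal : FreeGroup (Fin 7) →* LoopGrp rosePt := FreeGroup.lift fun k => .mk (roseEdge k)

variable {G : Type} [Group G] (c : Fin 7 → G)

/-- The Cayley graph. -/
abbrev Cay : Type := Gr (V := G) (E := G × Fin 7) Prod.fst (fun e => e.1 * c e.2)

namespace Cay

/-- The point at time `u` of the edge `(g, k)`. -/
abbrev pt (g : G) (k : Fin 7) (u : I) : Cay c := Gr.pt _ _ (g, k) u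

/-- A vertex. -/
def vx (g : G) : Cay c := pt c g 0 0

theorem pt_zero (g : G) (k : Fin 7) : pt c g k 0 = vx c g :=
  Gr.pt_eq (v := g) (Or.inl ⟨rfl, rfl⟩) (Or.inl ⟨rfl, rfl⟩)

theorem pt_one (g : G) (k : Fin 7) : pt c g k 1 = vx c (g * c k) :=
  Gr.pt_eq (v := g * c k) (Or.inr ⟨rfl, rfl⟩) (Or.inl ⟨rfl, rfl⟩)

/-- An edge. -/
def edge (g : G) (k : Fin 7) : Path (vx c g) (vx c (g * c k)) where
  toFun := pt c g k
  continuous_toFun := Gr.continuous_pt _ _ _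
  source' := pt_zero c g k
  target' := pt_one c g k

/-- The projection to the wedge of circles. -/
def down : C(Cay c, Rose) where
  toFun := Quot.map (fun x => ⟨(0, x.1.2), x.2⟩) (by
    rintro x y ⟨v, hx, hy⟩
    exact ⟨0, hx.imp (fun h => ⟨h.1, rfl⟩) (fun h => ⟨h.1, rfl⟩),
      hy.imp (fun h => ⟨h.1, rfl⟩) (fun h => ⟨h.1, rfl⟩)⟩)
  continuous_toFun := continuous_coinduced_dom.2 (continuous_sigma fun e =>
    (roseEdge e.2).continuous)

theorem down_vx (g : G) : down c (vx c g) = rosePt := rfl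

instance : MulAction G (Cay c) where
  smul g := Quot.map (fun x => ⟨(g * x.1.1, x.1.2), x.2⟩) (by
    rintro x y ⟨v, hx, hy⟩
    have key : ∀ z : (Σ _ : G × Fin 7, I), Gr.IsEnd Prod.fst (fun e : G × Fin 7 => e.1 * c e.2) z v →
        Gr.IsEnd Prod.fst (fun e : G × Fin 7 => e.1 * c e.2) ⟨(g * z.1.1, z.1.2), z.2⟩ (g * v) := by
      rintro z (⟨h1, rfl⟩ | ⟨h1, rfl⟩)
      · exact Or.inl ⟨h1, rfl⟩
      · exact Or.inr ⟨h1, (mul_assoc _ _ _).symm⟩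
    exact ⟨g * v, key x hx, key y hy⟩)
  one_smul := by
    rintro ⟨⟨g, k⟩, u⟩
    exact congrArg (fun h => pt c h k u) (one_mul g)
  mul_smul g h := by
    rintro ⟨⟨g', k⟩, u⟩
    exact congrArg (fun h => pt c h k u) (mul_assoc g h g')

theorem smul_pt (h g : G) (k : Fin 7) (u : I) : h • pt c g k u = pt c (h * g) k u := rfl

theorem smul_vx (h g : G) : h • vx c g = vx c (h * g) := rfl

variable {c}

theorem cases_pt (x : Cay c) : (∃ g, x = vx c g) ∨
    ∃ g k u, u ≠ 0 ∧ u ≠ 1 ∧ x = pt c g k u := by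
  obtain ⟨⟨g, k⟩, u⟩ := x
  by_cases h0 : u = 0
  · subst h0
    exact Or.inl ⟨g, pt_zero c g k⟩
  · by_cases h1 : u = 1
    · subst h1
      exact Or.inl ⟨g * c k, pt_one c g k⟩
    · exact Or.inr ⟨g, k, u, h0, h1, rfl⟩

theorem edgePt_inj {k k' : Fin 7} {u u' : I}
    (h : edgePt (fun _ => 0 : Fin 7 → PUnit) 0 k u = edgePt _ 0 k' u') (h0 : u ≠ 0) (h1 : u ≠ 1) :
    k = k' ∧ u = u' := by
  obtain ⟨h2, h3⟩ := Gr.pt_inj (V := PUnit) (E := PUnit × Fin 7) (s := Prod.fst)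
    (t := fun e => e.1 + 0) (e := (0, k)) (e' := (0, k')) h h0 h1
  exact ⟨congrArg Prod.snd h2, h3⟩

theorem vertexBump_vx (g : G) : 0 < Gr.vertexBump g (vx c g) := by
  rw [vx, Gr.vertexBump_pt]
  norm_num

theorem vx_injective : Function.Injective (vx c) := fun g h e =>
  Gr.vertexBump_unique (vertexBump_vx g) (e ▸ vertexBump_vx h)

variable (c) in
theorem isQuotientCoveringMap : IsQuotientCoveringMap (down c) G where
  toIsQuotientMap := by
    let f : (Σ _ : PUnit × Fin 7, I) → Cay c := fun x => pt c 1 x.1.2 x.2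
    have hf : Continuous f := continuous_sigma fun e => (edge c 1 e.2).continuous
    exact IsQuotientMap.of_comp hf (down c).continuous isQuotientMap_quot_mk
  continuous_const_smul g := continuous_coinduced_dom.2 (continuous_sigma fun e =>
    (edge c (g * e.1) e.2).continuous)
  apply_eq_iff_mem_orbit := by
    intro x y
    constructor
    · intro h
      rcases cases_pt x with ⟨g, rfl⟩ | ⟨g, k, u, h0, h1, rfl⟩ <;>
        rcases cases_pt y with ⟨g', rfl⟩ | ⟨g', k', u', h0', h1', rfl⟩
      · exact ⟨g * g'⁻¹, by simp only [smul_vx, inv_mul_cancel_right]⟩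
      · exact absurd (edgePt_inj h.symm h0' h1').2 h0'
      · exact absurd (edgePt_inj h h0 h1).2 h0
      · obtain ⟨rfl, rfl⟩ := edgePt_inj h h0 h1
        exact ⟨g * g'⁻¹, by simp only [smul_pt, inv_mul_cancel_right]⟩
    · rintro ⟨g, rfl⟩
      obtain ⟨⟨h, k⟩, u⟩ := y
      rfl
  disjoint := by
    intro x
    rcases cases_pt x with ⟨g, rfl⟩ | ⟨g, k, u, h0, h1, rfl⟩
    · refine ⟨{y | 0 < Gr.vertexBump g y}, (isOpen_lt continuous_const
        (Gr.vertexBump g).continuous).mem_nhds (vertexBump_vx g), ?_⟩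
      rintro h ⟨_, ⟨y, hy, rfl⟩, hy'⟩
      have : 0 < Gr.vertexBump (h * g) (h • y) := by
        obtain ⟨⟨g', k⟩, u⟩ := y
        have e : Gr.vertexBump (h * g) (h • pt c g' k u) = Gr.vertexBump g (pt c g' k u) := by
          rw [smul_pt, Gr.vertexBump_pt, Gr.vertexBump_pt]
          have e1 : h * g' = h * g ↔ g' = g := mul_right_inj h
          have e2 : h * g' * c k = h * g ↔ g' * c k = g := by rw [mul_assoc, mul_right_inj]
          classical
          exact congrArg₂ (· + ·) (if_congr e1 rfl rfl) (if_congr e2 rfl rfl)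
        exact e.symm ▸ hy
      exact mul_eq_right.1 (Gr.vertexBump_unique this hy')
    · refine ⟨{y | 0 < (Gr.edgeBump (g, k) y).1}, (isOpen_lt continuous_const
        (Gr.edgeBump (g, k)).continuous.fst).mem_nhds ?_, ?_⟩
      · rw [Set.mem_ofPred_eq, Gr.edgeBump_pt, if_pos rfl]
        exact Gr.bump_pos h0 h1
      · have key : ∀ g' k' u', 0 < (Gr.edgeBump (g, k) (pt c g' k' u')).1 → g' = g := by
          intro g' k' u' h
          rw [Gr.edgeBump_pt] at h
          split_ifs at h with e
          · exact congrArg Prod.fst e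
          · exact absurd h (lt_irrefl _)
        rintro h ⟨_, ⟨⟨⟨g', k'⟩, u'⟩, hy, rfl⟩, hy'⟩
        have e1 := key g' k' u' hy
        have e2 := key (h * g') k' u' hy'
        subst e1
        exact mul_eq_right.1 e2

theorem isCoveringMap : IsCoveringMap (down c) := (isQuotientCoveringMap c).isCoveringMap

theorem eq_vx {x : Cay c} (h : down c x = rosePt) : ∃ g, x = vx c g := by
  obtain ⟨g, rfl⟩ := (isQuotientCoveringMap c).apply_eq_iff_mem_orbit.1
    (h.trans (down_vx c 1).symm)
  exact ⟨g * 1, smul_vx c g 1⟩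

/-- The projection of a class of paths between vertices. -/
def cdown {g h : G} (w : Path.Homotopic.Quotient (vx c g) (vx c h)) : LoopGrp rosePt :=
  w.map (down c)

theorem cdown_injective {g h : G} : Function.Injective (cdown (c := c) (g := g) (h := h)) :=
  isCoveringMap.injective_path_homotopic_map _ _

theorem cdown_trans {g h i : G} (w : Path.Homotopic.Quotient (vx c g) (vx c h))
    (w' : Path.Homotopic.Quotient (vx c h) (vx c i)) : cdown (w.trans w') = cdown w * cdown w' :=
  quotient_map_trans _ _ _

theorem end_unique {g h h' : G} {w : Path.Homotopic.Quotient (vx c g) (vx c h)}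
    {w' : Path.Homotopic.Quotient (vx c g) (vx c h')} (e : cdown w = cdown w') : h = h' := by
  have k := isCoveringMap.monodromy_map w
  have k' := isCoveringMap.monodromy_map w'
  have e' : w.map (down c) = w'.map (down c) := e
  have := congrArg Subtype.val (k.symm.trans ((congrArg (fun γ : Path.Homotopic.Quotient
    (down c (vx c g)) rosePt => isCoveringMap.monodromy γ ⟨vx c g, rfl⟩) e').trans k'))
  exact vx_injective this

theorem cdown_edge (g : G) (k : Fin 7) :
    cdown (Path.Homotopic.Quotient.mk (edge c g k)) = .mk (roseEdge k) := rfl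

theorem exists_lift (w : FreeGroup (Fin 7)) : ∀ g h : G, h = g * FreeGroup.lift c w →
    ∃ γ : Path.Homotopic.Quotient (vx c g) (vx c h), cdown γ = roseVal w := by
  induction w using FreeGroup.induction_on with
  | C1 =>
    rintro g h rfl
    rw [map_one, mul_one, map_one]
    exact ⟨Path.Homotopic.Quotient.refl _, rfl⟩
  | of k =>
    rintro g h rfl
    rw [FreeGroup.lift_apply_of]
    refine ⟨Path.Homotopic.Quotient.mk (edge c g k), ?_⟩
    rw [cdown_edge, roseVal, FreeGroup.lift_apply_of]
  | inv_of k ih =>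
    rintro g h rfl
    obtain ⟨γ, hγ⟩ := ih (g * FreeGroup.lift c (FreeGroup.of k)⁻¹) g
      (by rw [map_inv, inv_mul_cancel_right])
    refine ⟨γ.symm, ?_⟩
    exact (quotient_map_symm _ _).trans ((congrArg (·⁻¹) hγ).trans (map_inv _ _).symm)
  | mul v w ihv ihw =>
    rintro g h rfl
    obtain ⟨γ, hγ⟩ := ihv g _ rfl
    obtain ⟨γ', hγ'⟩ := ihw (g * FreeGroup.lift c v) (g * FreeGroup.lift c (v * w))
      (by rw [map_mul, mul_assoc])
    exact ⟨γ.trans γ', by rw [cdown_trans, hγ, hγ', map_mul]⟩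

theorem exists_lift_path (γ : Path rosePt rosePt) (g : G) :
    ∃ (h : G) (Γ : Path (vx c g) (vx c h)), ∀ t, down c (Γ t) = γ t := by
  obtain ⟨Γ, h1, h2⟩ := (isCoveringMap (c := c)).exists_path_lifts γ (vx c g) γ.source
  obtain ⟨h, hh⟩ := eq_vx (x := Γ 1) ((congrFun h1 1).trans γ.target)
  exact ⟨h, ⟨Γ, h2, hh⟩, congrFun h1⟩

end Cay

section Free

theorem lift_of (w : FreeGroup (Fin 7)) : FreeGroup.lift FreeGroup.of w = w :=
  FreeGroup.lift_of_apply w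

theorem contractible_tree : ContractibleSpace (Cay (FreeGroup.of : Fin 7 → FreeGroup (Fin 7))) := by
  have key : ∀ g : FreeGroup (Fin 7), ∃ p : Path (Cay.vx FreeGroup.of g) (Cay.vx FreeGroup.of 1),
      Cay.cdown (Path.Homotopic.Quotient.mk p) = roseVal g⁻¹ := by
    intro g
    obtain ⟨γ, hγ⟩ := Cay.exists_lift (c := FreeGroup.of) g⁻¹ g 1
      (by rw [lift_of, mul_inv_cancel])
    induction γ using Path.Homotopic.Quotient.ind with
    | mk p => exact ⟨p, hγ⟩
  choose p hp using key
  obtain ⟨H, -⟩ := Gr.exists_homotopy (ContinuousMap.id (Cay (FreeGroup.of (α := Fin 7))))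
    (ContinuousMap.const _ (Cay.vx FreeGroup.of 1)) (fun e => Cay.edge FreeGroup.of e.1 e.2)
    (fun _ => Path.refl _) (fun _ _ => rfl) (fun _ _ => rfl) p (by
      rintro ⟨g, k⟩
      rw [← Path.Homotopic.Quotient.eq]
      apply Cay.cdown_injective
      simp only [Path.Homotopic.Quotient.mk_trans, Path.Homotopic.Quotient.mk_refl,
        Path.Homotopic.Quotient.trans_refl]
      rw [Cay.cdown_trans, hp, hp, Cay.cdown_edge, mul_inv_rev, map_mul, ← mul_assoc]
      have : LoopGrp.mk (roseEdge k) = roseVal (FreeGroup.of k) := (FreeGroup.lift_apply_of).symm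
      rw [this, ← map_mul, mul_inv_cancel, map_one, one_mul])
  exact (contractible_iff_id_nullhomotopic _).2 ⟨_, ⟨H⟩⟩

/-- The fundamental group of the wedge of circles is free. -/
theorem roseVal_bijective : Function.Bijective roseVal := by
  constructor
  · rw [injective_iff_map_eq_one]
    intro w hw
    obtain ⟨γ, hγ⟩ := Cay.exists_lift (c := FreeGroup.of) w 1 w (by rw [lift_of, one_mul])
    exact Cay.end_unique (w := γ) (w' := Path.Homotopic.Quotient.refl _) (hγ.trans hw)
  · intro γ
    induction γ using Path.Homotopic.Quotient.ind with
    | mk p =>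
      obtain ⟨g, Γ, hΓ⟩ := Cay.exists_lift_path (c := FreeGroup.of) p 1
      obtain ⟨γ, hγ⟩ := Cay.exists_lift (c := FreeGroup.of) g 1 g (by rw [lift_of, one_mul])
      have := contractible_tree
      refine ⟨g, ?_⟩
      rw [← hγ, Subsingleton.elim γ (Path.Homotopic.Quotient.mk Γ)]
      exact congrArg Path.Homotopic.Quotient.mk (Path.ext (funext hΓ))

end Free

end AY

namespace AY

/-! ### The octagonal surface deformed to a graph -/

/-- The point of the octagonal surface represented by a point of the octagon `j`. -/
def OctSurf.mk (j : Fin 6) (o : Oct) : OctSurf := Quot.mk _ ⟨j, o⟩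

theorem OctSurf.continuous_mk (j : Fin 6) : Continuous (OctSurf.mk j) :=
  continuous_quot_mk.comp continuous_sigmaMk

/-- The centre of the octagon. -/
def octMid : Oct := ⟨(0, 0), by norm_num [Oct]⟩

/-- The midpoint of the right or the upper side. -/
def octOut (up : Bool) : Oct := cond up midU midR

/-- The midpoint of the left or the lower side. -/
def octIn (up : Bool) : Oct := cond up midD midL

theorem OctSurf.mk_out (j : Fin 6) (up : Bool) :
    OctSurf.mk j (octOut up) = OctSurf.mk (across up j) (octIn up) := by
  cases up
  · exact Quot.sound (Or.inl ⟨rfl, rfl, rfl⟩)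
  · exact Quot.sound (Or.inr ⟨rfl, rfl, rfl⟩)

theorem across_across (up : Bool) (j : Fin 6) : across up (across up j) = j := by
  revert up j
  decide

/-- The graph dual to the octagons: an edge across every side. -/
abbrev Dual : Type := Gr (V := Fin 6) (E := Fin 6 × Bool) Prod.fst (fun e => across e.2 e.1)

namespace Dual

/-- The vertex in an octagon. -/
def vx (j : Fin 6) : Dual := Gr.pt _ _ (j, false) 0

/-- The edge across a side. -/
def edge (j : Fin 6) (up : Bool) : Path (vx j) (vx (across up j)) where
  toFun := Gr.pt _ _ (j, up)
  continuous_toFun := Gr.continuous_pt _ _ _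
  source' := Gr.pt_eq (v := j) (Or.inl ⟨rfl, rfl⟩) (Or.inl ⟨rfl, rfl⟩)
  target' := Gr.pt_eq (v := across up j) (Or.inr ⟨rfl, rfl⟩) (Or.inl ⟨rfl, rfl⟩)

/-- The edges in an octagon, parametrized by the horizontal and the vertical axis. -/
def arm (up : Bool) (j : Fin 6) (a : ℝ) : Dual :=
  if 0 ≤ a then (edge j up).extend (a / 2) else (edge (across up j) up).extend (1 + a / 2)

theorem arm_zero (up : Bool) (j : Fin 6) : arm up j 0 = vx j := by
  rw [arm, if_pos le_rfl, zero_div, Path.extend_zero]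

theorem arm_one (up : Bool) (j : Fin 6) : arm up j 1 = arm up (across up j) (-1) := by
  rw [arm, arm, if_pos zero_le_one, if_neg (by norm_num), across_across]
  norm_num

theorem continuous_arm (up : Bool) (j : Fin 6) : Continuous (arm up j) := by
  refine Continuous.if_le (by fun_prop) (by fun_prop) continuous_const continuous_id ?_
  rintro a rfl
  rw [zero_div, add_zero, Path.extend_zero, Path.extend_one, across_across]

end Dual

/-- The number `x` moved towards zero by `|y|`. -/
def soft (x y : ℝ) : ℝ := max (x - |y|) 0 + min (x + |y|) 0

theorem soft_eq_zero {x y : ℝ} (h : |x| ≤ |y|) : soft x y = 0 := by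
  obtain ⟨h1, h2⟩ := abs_le.1 h
  rw [soft, max_eq_right (by linarith), min_eq_right (by linarith), add_zero]

theorem soft_of_nonneg {x y : ℝ} (h : |y| ≤ x) : soft x y = x - |y| := by
  rw [soft, max_eq_left (by linarith), min_eq_right (by linarith [abs_nonneg y]), add_zero]

theorem soft_neg (x y : ℝ) : soft (-x) y = -soft x y := by
  have h1 : max (-x - |y|) 0 = -min (x + |y|) 0 := by
    rw [← max_neg_neg, neg_zero]; ring_nf
  have h2 : min (-x + |y|) 0 = -max (x - |y|) 0 := by
    rw [← min_neg_neg, neg_zero]; ring_nf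
  rw [soft, soft, h1, h2]
  ring

/-- Truncation to the interval from `-1` to `1`. -/
def trunc (r : ℝ) : ℝ := max (-1) (min 1 r)

theorem abs_trunc_le (r : ℝ) : |trunc r| ≤ 1 :=
  abs_le.2 ⟨le_max_left _ _, max_le (by norm_num) (min_le_left _ _)⟩

theorem trunc_neg (r : ℝ) : trunc (-r) = -trunc r := by
  simp only [trunc, max_def, min_def]
  split_ifs <;> linarith

theorem trunc_zero : trunc 0 = 0 := by norm_num [trunc]

theorem trunc_of_one_le {r : ℝ} (h : 1 ≤ r) : trunc r = 1 := by
  rw [trunc, min_eq_left h]; norm_num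

/-- The coordinate along an axis of the point of the cross to which a point is moved. -/
def armCoord (x y : ℝ) : ℝ := trunc (2 * soft x y)

theorem armCoord_eq_zero {x y : ℝ} (h : |x| ≤ |y|) : armCoord x y = 0 := by
  rw [armCoord, soft_eq_zero h, mul_zero, trunc_zero]

theorem armCoord_neg (x y : ℝ) : armCoord (-x) y = -armCoord x y := by
  rw [armCoord, armCoord, soft_neg, mul_neg, trunc_neg]

theorem armCoord_one {y : ℝ} (h : |y| ≤ 1 / 2) : armCoord 1 y = 1 := by
  rw [armCoord, soft_of_nonneg (by linarith), trunc_of_one_le (by linarith)]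

@[fun_prop]
theorem continuous_armCoord {T : Type*} [TopologicalSpace T] {f g : T → ℝ} (hf : Continuous f)
    (hg : Continuous g) : Continuous fun p => armCoord (f p) (g p) := by
  unfold armCoord trunc soft
  fun_prop

/-- The retraction of the octagon to the cross of its axes. -/
def retract (o : Oct) : Oct := ⟨(armCoord o.1.1 o.1.2, armCoord o.1.2 o.1.1), by
  have h1 := abs_trunc_le (2 * soft o.1.1 o.1.2)
  have h2 := abs_trunc_le (2 * soft o.1.2 o.1.1)
  refine ⟨h1, h2, ?_⟩
  change |armCoord _ _| + |armCoord _ _| ≤ _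
  rcases le_total |o.1.1| |o.1.2| with h | h
  · rw [armCoord_eq_zero h, abs_zero]
    exact (add_le_add_right h2 0).trans (by norm_num)
  · rw [armCoord_eq_zero h, abs_zero]
    exact (add_le_add_left h1 0).trans (by norm_num)⟩

theorem retract_val (o : Oct) :
    (retract o : ℝ × ℝ) = (armCoord o.1.1 o.1.2, armCoord o.1.2 o.1.1) := rfl

theorem continuous_retract : Continuous fun o => (retract o : ℝ × ℝ) := by
  simp only [retract_val]
  fun_prop

theorem Oct.abs_snd_le {o : Oct} (h : |o.1.1| = 1) : |o.1.2| ≤ 1 / 2 := by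
  have := o.2.2.2
  rw [h] at this
  linarith

theorem Oct.abs_fst_le {o : Oct} (h : |o.1.2| = 1) : |o.1.1| ≤ 1 / 2 := by
  have := o.2.2.2
  rw [h] at this
  linarith

/-- The retraction of the octagon `j` to the graph. -/
def toDual (j : Fin 6) (o : Oct) : Dual :=
  if |o.1.2| ≤ |o.1.1| then Dual.arm false j (armCoord o.1.1 o.1.2)
  else Dual.arm true j (armCoord o.1.2 o.1.1)

theorem continuous_toDual (j : Fin 6) : Continuous (toDual j) := by
  refine Continuous.if_le ((Dual.continuous_arm _ _).comp (by fun_prop))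
    ((Dual.continuous_arm _ _).comp (by fun_prop))
    (by fun_prop) (by fun_prop) ?_
  intro o h
  rw [armCoord_eq_zero h.le, armCoord_eq_zero h.ge, Dual.arm_zero, Dual.arm_zero]

/-- The map from the octagonal surface to the graph. -/
def dualRetract : C(OctSurf, Dual) where
  toFun := Quot.lift (fun x => toDual x.1 x.2) (by
    rintro ⟨j, x⟩ ⟨j', y⟩ (⟨h1, rfl, h2⟩ | ⟨h1, rfl, h2⟩) <;> dsimp only at h1 h2 ⊢
    · have hx := Oct.abs_snd_le (o := x) (by rw [h1, abs_one])
      rw [toDual, toDual, h2, h1, abs_neg, abs_one, if_pos (by linarith), if_pos (by linarith),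
        armCoord_neg, armCoord_one hx]
      exact Dual.arm_one false j
    · have hx := Oct.abs_fst_le (o := x) (by rw [h1, abs_one])
      rw [toDual, toDual, h2, h1, abs_neg, abs_one, if_neg (by linarith), if_neg (by linarith),
        armCoord_neg, armCoord_one hx]
      exact Dual.arm_one true j)
  continuous_toFun := continuous_coinduced_dom.2 (continuous_sigma continuous_toDual)

theorem dualRetract_mk (j : Fin 6) (o : Oct) : dualRetract (OctSurf.mk j o) = toDual j o := rfl

/-- The edges of the graph on the surface. -/
def dualArc (j : Fin 6) (up : Bool) :
    Path (OctSurf.mk j octMid) (OctSurf.mk (across up j) octMid) :=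
  ((octLine octMid (octOut up)).map (OctSurf.continuous_mk j)).trans
    (((octLine (octIn up) octMid).map (OctSurf.continuous_mk (across up j))).cast
      (OctSurf.mk_out j up) rfl)

/-- The inclusion of the graph into the surface. -/
def dualIncl : C(Dual, OctSurf) := Gr.lift (fun j => OctSurf.mk j octMid) fun e => dualArc e.1 e.2

/-- A point of an axis. -/
def axisPt (up : Bool) (a : ℝ) : ℝ × ℝ := cond up (0, a) (a, 0)

theorem dualArc_of_le {j : Fin 6} {up : Bool} {u : I} (h : (u : ℝ) ≤ 1 / 2) {o : Oct}
    (ho : (o : ℝ × ℝ) = axisPt up (2 * u)) : dualArc j up u = OctSurf.mk j o := by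
  rw [dualArc, Path.trans_apply, dif_pos h]
  refine congrArg (OctSurf.mk j) (Subtype.ext ?_)
  rw [ho, octLine_apply]
  cases up <;> simp [octOut, octMid, midR, midU, axisPt, AffineMap.lineMap_apply]

theorem dualArc_of_ge {j : Fin 6} {up : Bool} {u : I} (h : 1 / 2 ≤ (u : ℝ)) {o : Oct}
    (ho : (o : ℝ × ℝ) = axisPt up (2 * u - 2)) :
    dualArc j up u = OctSurf.mk (across up j) o := by
  rw [dualArc, ← Path.extend_apply _ u.2, trans_extend_of_half_le _ _ h,
    Path.extend_apply _ ⟨by linarith, by linarith [u.2.2]⟩]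
  refine congrArg (OctSurf.mk _) (Subtype.ext ?_)
  rw [ho, octLine_apply]
  cases up <;> simp [octIn, octMid, midL, midD, axisPt, AffineMap.lineMap_apply] <;> ring

theorem dualIncl_arm {up : Bool} {j : Fin 6} {a : ℝ} (ha : |a| ≤ 1) {o : Oct}
    (ho : (o : ℝ × ℝ) = axisPt up a) : dualIncl (Dual.arm up j a) = OctSurf.mk j o := by
  obtain ⟨h1, h2⟩ := abs_le.1 ha
  rw [Dual.arm]
  split_ifs with h
  · rw [Path.extend_apply _ ⟨by linarith, by linarith⟩]
    exact dualArc_of_le (j := j) (up := up) (u := ⟨a / 2, by constructor <;> linarith⟩)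
      (by dsimp only; linarith) (by rw [ho]; congr 1; ring)
  · rw [Path.extend_apply _ ⟨by linarith, by linarith⟩]
    have := dualArc_of_ge (j := across up j) (up := up)
      (u := ⟨1 + a / 2, by constructor <;> linarith⟩) (by dsimp only; linarith)
      (o := o) (by rw [ho]; congr 1; ring)
    exact this.trans (congrArg (OctSurf.mk · o) (across_across up j))

theorem dualIncl_toDual (j : Fin 6) (o : Oct) :
    dualIncl (toDual j o) = OctSurf.mk j (retract o) := by
  rw [toDual]
  split_ifs with h
  · refine dualIncl_arm (abs_trunc_le _) ?_
    rw [retract_val, armCoord_eq_zero h]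
    rfl
  · refine dualIncl_arm (abs_trunc_le _) ?_
    rw [retract_val, armCoord_eq_zero (not_le.1 h).le]
    rfl

/-- The octagonal surface can be deformed to the graph. -/
theorem dual_homotopic : (ContinuousMap.id OctSurf).Homotopic (dualIncl.comp dualRetract) := by
  have hc : ∀ j, Continuous fun w : Oct × I => OctSurf.mk j (octLine w.1 (retract w.1) w.2) := by
    intro j
    refine (OctSurf.continuous_mk j).comp (Continuous.subtype_mk ?_ _)
    have := continuous_retract.comp (continuous_fst (X := Oct) (Y := I))
    simp only [AffineMap.lineMap_apply]
    exact ((continuous_subtype_val.comp continuous_snd).smul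
      (this.sub (continuous_subtype_val.comp continuous_fst))).add
      (continuous_subtype_val.comp continuous_fst)
  let Φ : C(OctSurf, C(I, OctSurf)) :=
    { toFun := Quot.lift (fun x => ContinuousMap.curry ⟨_, hc x.1⟩ x.2) (by
        rintro ⟨j, x⟩ ⟨j', y⟩ (⟨h1, rfl, h2⟩ | ⟨h1, rfl, h2⟩) <;> dsimp only at h1 h2 ⊢
        · ext s
          have hx := Oct.abs_snd_le (o := x) (by rw [h1, abs_one])
          refine Quot.sound (Or.inl ⟨?_, rfl, ?_⟩)
          · change (AffineMap.lineMap x.1 (retract x).1 (s : ℝ)).1 = (1 : ℝ)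
            rw [retract_val, h1, armCoord_one hx]
            simp [AffineMap.lineMap_apply, h1]
          · change AffineMap.lineMap y.1 (retract y).1 (s : ℝ) =
              (-1, (AffineMap.lineMap x.1 (retract x).1 (s : ℝ)).2)
            rw [retract_val, retract_val, h2, h1, armCoord_neg, armCoord_one hx,
              armCoord_eq_zero (by rw [abs_neg, abs_one]; linarith),
              armCoord_eq_zero (by rw [abs_one]; linarith)]
            simp [AffineMap.lineMap_apply]
        · ext s
          have hx := Oct.abs_fst_le (o := x) (by rw [h1, abs_one])
          refine Quot.sound (Or.inr ⟨?_, rfl, ?_⟩)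
          · change (AffineMap.lineMap x.1 (retract x).1 (s : ℝ)).2 = (1 : ℝ)
            rw [retract_val, h1, armCoord_one hx]
            simp [AffineMap.lineMap_apply, h1]
          · change AffineMap.lineMap y.1 (retract y).1 (s : ℝ) =
              ((AffineMap.lineMap x.1 (retract x).1 (s : ℝ)).1, -1)
            rw [retract_val, retract_val, h2, h1, armCoord_neg, armCoord_one hx,
              armCoord_eq_zero (by rw [abs_neg, abs_one]; linarith),
              armCoord_eq_zero (by rw [abs_one]; linarith)]
            simp [AffineMap.lineMap_apply])
      continuous_toFun := continuous_coinduced_dom.2 (continuous_sigma fun j =>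
        (ContinuousMap.curry ⟨_, hc j⟩).continuous) }
  refine ⟨{ toFun := fun w => Φ.uncurry (w.2, w.1)
            continuous_toFun := by fun_prop
            map_zero_left := ?_
            map_one_left := ?_ }⟩
  · rintro ⟨j, o⟩
    exact congrArg (OctSurf.mk j) (octLine o (retract o)).source
  · rintro ⟨j, o⟩
    exact (congrArg (OctSurf.mk j) (octLine o (retract o)).target).trans (dualIncl_toDual j o).symm

theorem extend_coe {Y : Type*} [TopologicalSpace Y] {x y : Y} (p : Path x y) (u : I) :
    p.extend u = p u := by simp

/-- An edge of the graph, included into the surface and retracted again, is homotopic to itself. -/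
theorem dualArc_retract (j : Fin 6) (up : Bool) :
    ∃ f : I → I, Continuous f ∧ f 0 = 0 ∧ f 1 = 1 ∧
      ∀ u, dualRetract (dualArc j up u) = Dual.edge j up (f u) := by
  have key : ∀ a : ℝ, |a| ≤ 1 → ∀ o : Oct, (o : ℝ × ℝ) = axisPt up a → ∀ i,
      toDual i o = Dual.arm up i (trunc (2 * a)) := by
    intro a ha o ho i
    have e : armCoord a 0 = trunc (2 * a) := by
      rw [armCoord, soft, abs_zero, sub_zero, add_zero, max_add_min, add_zero]
    rw [toDual, ho]
    cases up
    · rw [if_pos (by simp [axisPt])]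
      exact congrArg _ e
    · rcases eq_or_ne a 0 with rfl | h0
      · rw [if_pos (by simp [axisPt])]
        simp only [axisPt, mul_zero, trunc_zero, cond_true, armCoord_eq_zero le_rfl, Dual.arm_zero]
      · rw [if_neg (by simpa [axisPt] using h0)]
        exact congrArg _ e
  have mem : ∀ a : ℝ, |a| ≤ 1 → axisPt up a ∈ Oct := by
    intro a ha
    cases up <;> simp only [axisPt, Oct, cond_true, cond_false, Set.mem_ofPred_eq, abs_zero] <;>
      refine ⟨?_, ?_, ?_⟩ <;> linarith
  refine ⟨fun u => ⟨(min 1 (4 * (u : ℝ)) + max 0 (4 * (u : ℝ) - 3)) / 2, ?_, ?_⟩, by fun_prop,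
    Subtype.ext (by norm_num), Subtype.ext (by norm_num), fun u => ?_⟩
  · exact div_nonneg (add_nonneg (le_min zero_le_one (by linarith [u.2.1])) (le_max_left _ _))
      zero_le_two
  · have := min_le_left 1 (4 * (u : ℝ))
    have : max 0 (4 * (u : ℝ) - 3) ≤ 1 := max_le zero_le_one (by linarith [u.2.2])
    linarith
  · have hu0 := u.2.1
    have hu1 := u.2.2
    rcases le_total (u : ℝ) (1 / 2) with h | h
    · have ha : |2 * (u : ℝ)| ≤ 1 := abs_le.2 ⟨by linarith, by linarith⟩
      rw [dualArc_of_le h (o := ⟨_, mem _ ha⟩) rfl, dualRetract_mk, key _ ha _ rfl, trunc,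
        max_eq_right (le_min (by norm_num) (by linarith)), Dual.arm,
        if_pos (le_min zero_le_one (by linarith))]
      refine Eq.trans (congrArg _ ?_) (extend_coe _ _)
      dsimp only
      rw [max_eq_left (by linarith : 4 * (u : ℝ) - 3 ≤ 0)]
      ring_nf
    · have ha : |2 * (u : ℝ) - 2| ≤ 1 := abs_le.2 ⟨by linarith, by linarith⟩
      rw [dualArc_of_ge h (o := ⟨_, mem _ ha⟩) rfl, dualRetract_mk, key _ ha _ rfl, trunc,
        min_eq_right (by linarith)]
      rcases eq_or_lt_of_le hu1 with h1 | h1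
      · refine Eq.trans ?_ (extend_coe _ _)
        dsimp only
        rw [h1]
        norm_num
        exact Dual.arm_zero _ _
      · rw [Dual.arm, if_neg (not_le.2 (max_lt (by norm_num) (by linarith))), across_across]
        refine Eq.trans (congrArg _ ?_) (extend_coe _ _)
        dsimp only
        rw [min_eq_left (by linarith)]
        rcases le_total (4 * (u : ℝ)) 3 with h3 | h3
        · rw [max_eq_left (by linarith), max_eq_left (by linarith)]
          ring
        · rw [max_eq_right (by linarith), max_eq_right (by linarith)]
          ring

end AY

namespace AY

/-! ### Fundamental groups under maps -/

section Loops

variable {Y Z : Type*} [TopologicalSpace Y] [TopologicalSpace Z]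

/-- The homomorphism of fundamental groups induced by a map that preserves base points. -/
def LoopGrp.map (f : C(Y, Z)) {y : Y} {z : Z} (h : z = f y) : LoopGrp y →* LoopGrp z where
  toFun a := (Path.Homotopic.Quotient.map a f).cast h h
  map_one' := by subst h; rfl
  map_mul' a b := by
    subst h
    simp only [Path.Homotopic.Quotient.cast_rfl_rfl]
    exact quotient_map_trans f a b

theorem LoopGrp.map_mk (f : C(Y, Z)) {y : Y} {z : Z} (h : z = f y) (p : Path y y) :
    LoopGrp.map f h (.mk p) = .mk ((p.map f.continuous).cast h h) := rfl

/-- The change of the base point. -/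
def LoopGrp.shift {x y : Y} (θ : Path.Homotopic.Quotient x y) : LoopGrp x →* LoopGrp y where
  toFun a := θ.symm.trans (Path.Homotopic.Quotient.trans a θ)
  map_one' := by
    rw [LoopGrp.one_def, LoopGrp.one_def, Path.Homotopic.Quotient.refl_trans,
      Path.Homotopic.Quotient.symm_trans]
  map_mul' a b := by
    have (a b : Path.Homotopic.Quotient x x) : θ.symm.trans ((a.trans b).trans θ) =
        (θ.symm.trans (a.trans θ)).trans (θ.symm.trans (b.trans θ)) := by
      simp only [Path.Homotopic.Quotient.trans_assoc]
      rw [← Path.Homotopic.Quotient.trans_assoc θ θ.symm, Path.Homotopic.Quotient.trans_symm,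
        Path.Homotopic.Quotient.refl_trans]
    exact this a b

theorem LoopGrp.trans_shift {x y : Y} (θ : Path.Homotopic.Quotient x y) (a : LoopGrp x) :
    θ.trans (LoopGrp.shift θ a) = Path.Homotopic.Quotient.trans a θ := by
  change θ.trans (θ.symm.trans _) = _
  rw [← Path.Homotopic.Quotient.trans_assoc, Path.Homotopic.Quotient.trans_symm,
    Path.Homotopic.Quotient.refl_trans]

theorem LoopGrp.shift_eq {x y : Y} {θ : Path.Homotopic.Quotient x y} {a : LoopGrp x}
    {b : LoopGrp y} (h : θ.trans b = Path.Homotopic.Quotient.trans a θ) : LoopGrp.shift θ a = b := by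
  change θ.symm.trans (Path.Homotopic.Quotient.trans a θ) = b
  rw [← h]
  exact (Path.Homotopic.Quotient.trans_assoc _ _ _).symm.trans
    ((congrArg (Path.Homotopic.Quotient.trans · b) (Path.Homotopic.Quotient.symm_trans θ)).trans
      (Path.Homotopic.Quotient.refl_trans _))

theorem quotient_map_cast {x y y' : Y} {z : Z} (f : C(Y, Z)) (h : z = f y) (h' : z = f y')
    {a : Path.Homotopic.Quotient x y} {b : Path.Homotopic.Quotient x y'}
    {p : Path.Homotopic.Quotient y y'} {w : LoopGrp x}
    (e : a.trans p = Path.Homotopic.Quotient.trans w b) :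
    ((a.map f).cast rfl h).trans ((p.map f).cast h h') =
      Path.Homotopic.Quotient.trans (LoopGrp.map f rfl w) ((b.map f).cast rfl h') := by
  have key : ∀ {u v v' t : Z} (A : Path.Homotopic.Quotient u v) (P : Path.Homotopic.Quotient v v')
      (k : t = v) (k' : t = v'), (A.cast rfl k).trans (P.cast k k') = (A.trans P).cast rfl k' := by
    intro u v v' t A P k k'
    subst k
    subst k'
    simp only [Path.Homotopic.Quotient.cast_rfl_rfl]
  have key' : ∀ {u v t : Z} (W : Path.Homotopic.Quotient u u) (B : Path.Homotopic.Quotient u v)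
      (k : t = v), W.trans (B.cast rfl k) = (W.trans B).cast rfl k := by
    intro u v t W B k
    subst k
    simp only [Path.Homotopic.Quotient.cast_rfl_rfl]
  rw [key, ← quotient_map_trans, e]
  exact (congrArg (Path.Homotopic.Quotient.cast · rfl h') (quotient_map_trans f _ b)).trans
    ((key' _ _ _).symm.trans (congrArg (Path.Homotopic.Quotient.trans · _)
      (Path.Homotopic.Quotient.cast_rfl_rfl (Path.Homotopic.Quotient.map w f)).symm))

end Loops

/-! ### The wedge of circles and the blown-up surface -/

/-- The letters of the octagons as words in the loops. -/
def octWord : Fin 7 → List (Fin 7 × Bool) :=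
  ![[(3, true), (0, false)], [(5, true)], [(6, true), (0, false), (1, true)],
    [(6, true), (4, false)], [(2, false)], [(6, true), (0, false)], [(6, false)]]

theorem octWord_loop (i : Fin 7) :
    FreeGroup.lift (fun k => FreeGroup.mk (loopWord k)) (FreeGroup.mk (octWord i)) =
      FreeGroup.of i := by
  revert i
  decide +kernel

theorem loop_octWord (k : Fin 7) :
    FreeGroup.lift (fun i => FreeGroup.mk (octWord i)) (FreeGroup.mk (loopWord k)) =
      FreeGroup.of k := by
  revert k
  decide +kernel

/-- The word of an edge of the dual graph. -/
def dualVal (up : Bool) (j : Fin 6) : FreeGroup (Fin 7) :=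
  letterVal (fun i => FreeGroup.mk (octWord i)) (letterSide up j)

variable {α : ℝ} (A : IsRoot3 α) (D : Data α)

namespace Data

theorem roseMap_pt : D.x₀ = D.roseMap rosePt := (D.loop 0).source.symm

theorem roseMap_roseVal (w : FreeGroup (Fin 7)) :
    LoopGrp.map D.roseMap D.roseMap_pt (roseVal w) = FreeGroup.lift (fun k => .mk (D.loop k)) w := by
  have : (LoopGrp.map D.roseMap D.roseMap_pt).comp roseVal =
      FreeGroup.lift fun k => LoopGrp.mk (D.loop k) := by
    refine FreeGroup.ext_hom _ _ fun k => ?_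
    rw [MonoidHom.comp_apply, roseVal, FreeGroup.lift_apply_of, FreeGroup.lift_apply_of]
    rfl
  exact DFunLike.congr_fun this w

end Data

variable {A D} (S : Sheets (octMap A) (D.o₀ A) (D.octMap_o₀ A))

theorem loops_octWord (i : Fin 7) :
    FreeGroup.lift (fun k => LoopGrp.mk (D.loop k)) (FreeGroup.mk (octWord i)) = S.W i := by
  have : (FreeGroup.lift fun k => LoopGrp.mk (D.loop k)) =
      (FreeGroup.lift S.W).comp (FreeGroup.lift fun k => FreeGroup.mk (loopWord k)) := by
    refine FreeGroup.ext_hom _ _ fun k => ?_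
    rw [MonoidHom.comp_apply, FreeGroup.lift_apply_of, FreeGroup.lift_apply_of]
    exact Data.loop_class S k
  rw [this, MonoidHom.comp_apply, octWord_loop, FreeGroup.lift_apply_of]

theorem loops_dualVal (up : Bool) (j : Fin 6) :
    FreeGroup.lift (fun k => LoopGrp.mk (D.loop k)) (dualVal up j) =
      letterVal S.W (letterSide up j) := by
  rw [dualVal]
  cases letterSide up j with
  | none => exact map_one _
  | some i => exact loops_octWord S i

theorem Sheets.exists_mid (j : Fin 6) : ∃ η : Path D.x₀ (octMap A j octMid),
    S.T j octMid = ⟨_, Path.Homotopic.Quotient.mk η⟩ := by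
  have h := S.pt j octMid
  revert h
  generalize S.T j octMid = τ
  obtain ⟨y, c⟩ := τ
  intro h
  dsimp only at h
  subst h
  induction c using Path.Homotopic.Quotient.ind with
  | mk p => exact ⟨p, rfl⟩

theorem Sheets.cross (up : Bool) (j : Fin 6) : S.T j (octOut up) =
    letterVal S.W (letterSide up j) • S.T (across up j) (octIn up) := by
  cases up
  · exact S.right j _ _ rfl rfl
  · exact S.upper j _ _ rfl rfl

variable (A) in
/-- The edges of the dual graph on the blown-up surface. -/
def hatArc (j : Fin 6) (up : Bool) : Path (octMap A j octMid) (octMap A (across up j) octMid) :=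
  (dualArc j up).map (octSurfHomeo A).symm.continuous

theorem Sheets.arc (up : Bool) (j : Fin 6)
    {c : Path.Homotopic.Quotient D.x₀ (octMap A j octMid)}
    {c' : Path.Homotopic.Quotient D.x₀ (octMap A (across up j) octMid)}
    (h : S.T j octMid = ⟨_, c⟩) (h' : S.T (across up j) octMid = ⟨_, c'⟩) :
    c.trans (Path.Homotopic.Quotient.mk (hatArc A j up)) =
      Path.Homotopic.Quotient.trans (letterVal (G := LoopGrp D.x₀) S.W (letterSide up j)) c' := by
  have hp := (hatArc A j up).continuous_extend
  have e1 : Carries (hatArc A j up).extend 0 (1 / 2) (S.T j octMid) (S.T j (octOut up)) := by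
    refine S.carries j _ _ _ _ _ (octLine octMid (octOut up)) fun t => ?_
    have ht : ((t : ℝ) / 2) ∈ I := ⟨by linarith [t.2.1], by linarith [t.2.2]⟩
    rw [show (0 + (t : ℝ) * (1 / 2 - 0) : ℝ) = ((⟨_, ht⟩ : I) : ℝ) by dsimp only; ring, extend_coe]
    refine congrArg (octSurfHomeo A).symm (dualArc_of_le (by dsimp only; linarith [t.2.2]) ?_)
    rw [octLine_apply]
    cases up <;> simp [octOut, octMid, midR, midU, axisPt, AffineMap.lineMap_apply] <;> ring
  have e2 : Carries (hatArc A j up).extend (1 / 2) 1 (S.T (across up j) (octIn up))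
      (S.T (across up j) octMid) := by
    refine S.carries _ _ _ _ _ _ (octLine (octIn up) octMid) fun t => ?_
    have ht : (1 / 2 + (t : ℝ) / 2) ∈ I := ⟨by linarith [t.2.1], by linarith [t.2.2]⟩
    rw [show (1 / 2 + (t : ℝ) * (1 - 1 / 2) : ℝ) = ((⟨_, ht⟩ : I) : ℝ) by dsimp only; ring,
      extend_coe]
    refine congrArg (octSurfHomeo A).symm (dualArc_of_ge (by dsimp only; linarith [t.2.1]) ?_)
    rw [octLine_apply]
    cases up <;> simp [octIn, octMid, midL, midD, axisPt, AffineMap.lineMap_apply] <;> ring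
  have e3 := Carries.trans hp e1 ((S.cross up j) ▸ (e2.smul _))
  rw [h, h'] at e3
  exact e3.path

/-- Every class of loops in the wedge of circles is represented by a path. -/
theorem exists_rosePath (w : FreeGroup (Fin 7)) : ∃ p : Path rosePt rosePt,
    LoopGrp.mk p = roseVal w := Path.Homotopic.Quotient.mk_surjective _

/-- The path in the wedge of circles of an edge of the dual graph. -/
def rosePath (up : Bool) (j : Fin 6) : Path rosePt rosePt := (exists_rosePath (dualVal up j)).choose

theorem mk_rosePath (up : Bool) (j : Fin 6) : LoopGrp.mk (rosePath up j) = roseVal (dualVal up j) :=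
  (exists_rosePath (dualVal up j)).choose_spec

/-- The map from the dual graph to the wedge of circles. -/
def dualRose : C(Dual, Rose) := Gr.lift (fun _ => rosePt) fun e => rosePath e.2 e.1

variable (A) in
/-- The homotopy inverse of the map from the wedge of circles. -/
def toRose : C(Xhat α, Rose) :=
  (dualRose.comp dualRetract).comp (octSurfHomeo A : C(Xhat α, OctSurf))

include S in
theorem roseMap_toRose : (D.roseMap.comp (toRose A)).Homotopic (ContinuousMap.id (Xhat α)) := by
  choose η hη using S.exists_mid
  let i : C(OctSurf, Xhat α) := ((octSurfHomeo A).symm : C(OctSurf, Xhat α))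
  have h1 : (D.roseMap.comp dualRose).Homotopic (i.comp dualIncl) := by
    obtain ⟨H, -⟩ := Gr.exists_homotopy (D.roseMap.comp dualRose) (i.comp dualIncl)
      (a := fun _ => D.x₀) (b := fun j => octMap A j octMid)
      (fun e => ((rosePath e.2 e.1).map D.roseMap.continuous).cast D.roseMap_pt D.roseMap_pt)
      (fun e => hatArc A e.1 e.2) (fun _ _ => rfl) (fun _ _ => rfl) η (by
        rintro ⟨j, up⟩
        rw [← Path.Homotopic.Quotient.eq, Path.Homotopic.Quotient.mk_trans,
          Path.Homotopic.Quotient.mk_trans, S.arc up j (hη j) (hη (across up j)),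
          ← loops_dualVal S, ← D.roseMap_roseVal, ← mk_rosePath]
        rfl)
    exact ⟨H⟩
  have h2 : (i.comp (dualIncl.comp dualRetract)).Homotopic i :=
    (ContinuousMap.Homotopic.refl i).comp dual_homotopic.symm
  have h3 : ((D.roseMap.comp dualRose).comp dualRetract).Homotopic i :=
    (h1.comp (ContinuousMap.Homotopic.refl dualRetract)).trans h2
  have h4 := h3.comp (ContinuousMap.Homotopic.refl (octSurfHomeo A : C(Xhat α, OctSurf)))
  have h5 : i.comp (octSurfHomeo A : C(Xhat α, OctSurf)) = ContinuousMap.id _ := by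
    ext x
    exact (octSurfHomeo A).symm_apply_apply x
  rw [h5] at h4
  exact h4

include S in
theorem toRose_loop : ∃ θ : Path (toRose A D.x₀) rosePt, ∀ k,
    Path.Homotopic ((((D.loop k).map (toRose A).continuous)).trans θ) (θ.trans (roseEdge k)) := by
  choose η hη using S.exists_mid
  have hm : ∀ j, rosePt = toRose A (octMap A j octMid) := by
    intro j
    have e : octSurfHomeo A (octMap A j octMid) = OctSurf.mk j octMid :=
      (octSurfHomeo A).apply_symm_apply _
    have e' : toDual j octMid = Dual.vx j := by
      rw [toDual, if_pos (by simp [octMid]), octMid, armCoord_eq_zero le_rfl, Dual.arm_zero]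
    change _ = dualRose (dualRetract (octSurfHomeo A (octMap A j octMid)))
    rw [e, dualRetract_mk, e']
    exact (rosePath false j).source.symm
  let θ : Fin 6 → Path.Homotopic.Quotient (toRose A D.x₀) rosePt := fun j =>
    ((Path.Homotopic.Quotient.mk (η j)).map (toRose A)).cast rfl (hm j)
  have hθ : ∀ up j, (θ j).trans (roseVal (dualVal up j)) =
      Path.Homotopic.Quotient.trans (LoopGrp.map (toRose A) rfl (letterVal S.W (letterSide up j)))
        (θ (across up j)) := by
    intro up j
    rw [← quotient_map_cast (toRose A) (hm j) (hm (across up j))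
      (S.arc up j (hη j) (hη (across up j))), ← mk_rosePath]
    refine congrArg (θ j).trans (Path.Homotopic.Quotient.eq.2 ?_)
    obtain ⟨f, hf, h0, h1, hu⟩ := dualArc_retract j up
    have : (((hatArc A j up).map (toRose A).continuous).cast (hm j) (hm (across up j))) =
        (rosePath up j).reparam f hf h0 h1 := by
      ext u
      change dualRose (dualRetract (octSurfHomeo A ((octSurfHomeo A).symm (dualArc j up u)))) = _
      rw [(octSurfHomeo A).apply_symm_apply, hu]
      rfl
    have e : (rosePath up j).Homotopic
        (((hatArc A j up).map (toRose A).continuous).cast (hm j) (hm (across up j))) := by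
      rw [this]
      exact ⟨Path.Homotopy.reparam _ f hf h0 h1⟩
    exact e
  have tree : ∀ up j, letterSide up j = none → θ (across up j) = θ j := by
    intro up j h
    have := hθ up j
    rw [dualVal, h] at this
    have e : (θ j).trans (roseVal 1) = θ j := by
      rw [map_one]; exact Path.Homotopic.Quotient.trans_refl _
    refine Eq.trans ?_ (this.symm.trans e)
    change _ = Path.Homotopic.Quotient.trans (LoopGrp.map (toRose A) rfl 1) _
    rw [map_one]
    exact (Path.Homotopic.Quotient.refl_trans _).symm
  have all : ∀ j, θ j = θ 5 := by
    have t1 : θ 0 = θ 5 := tree false 5 rfl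
    have t2 : θ 3 = θ 0 := tree true 0 rfl
    have t3 : θ 1 = θ 3 := tree false 3 rfl
    have t4 : θ 2 = θ 1 := tree true 1 rfl
    have t5 : θ 4 = θ 2 := tree false 2 rfl
    intro j
    fin_cases j <;> simp only [Fin.reduceFinMk, Fin.zero_eta, Fin.mk_one, t1, t2, t3, t4, t5]
  have letters : ∀ i, LoopGrp.shift (θ 5) (LoopGrp.map (toRose A) rfl (S.W i)) =
      roseVal (FreeGroup.mk (octWord i)) := by
    intro i
    obtain ⟨up, j, h⟩ : ∃ up j, letterSide up j = some i := by revert i; decide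
    have := hθ up j
    rw [dualVal, h, all, all (across up j)] at this
    exact LoopGrp.shift_eq this
  have words : ((LoopGrp.shift (θ 5)).comp (LoopGrp.map (toRose A) rfl)).comp (FreeGroup.lift S.W) =
      roseVal.comp (FreeGroup.lift fun i => FreeGroup.mk (octWord i)) := by
    refine FreeGroup.ext_hom _ _ fun i => ?_
    simp only [MonoidHom.comp_apply, FreeGroup.lift_apply_of]
    exact letters i
  obtain ⟨p, hp⟩ := Path.Homotopic.Quotient.mk_surjective (θ 5)
  refine ⟨p, fun k => ?_⟩
  rw [← Path.Homotopic.Quotient.eq, Path.Homotopic.Quotient.mk_trans,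
    Path.Homotopic.Quotient.mk_trans, hp]
  have e := DFunLike.congr_fun words (FreeGroup.mk (loopWord k))
  simp only [MonoidHom.comp_apply, loop_octWord] at e
  have e' : FreeGroup.lift S.W (FreeGroup.mk (loopWord k)) = LoopGrp.mk (D.loop k) :=
    (Data.loop_class S k).symm
  rw [e', roseVal, FreeGroup.lift_apply_of] at e
  exact (LoopGrp.trans_shift _ _).symm.trans (congrArg (θ 5).trans e)

include S in
theorem toRose_roseMap : ((toRose A).comp D.roseMap).Homotopic (ContinuousMap.id Rose) := by
  obtain ⟨θ, hθ⟩ := toRose_loop S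
  obtain ⟨H, -⟩ := Gr.exists_homotopy (V := PUnit) (E := PUnit × Fin 7) (s := Prod.fst)
    (t := fun e => e.1 + 0) ((toRose A).comp D.roseMap) (ContinuousMap.id Rose)
    (a := fun _ => toRose A D.x₀) (b := fun _ => rosePt)
    (fun e => (D.loop e.2).map (toRose A).continuous) (fun e => roseEdge e.2)
    (fun _ _ => rfl) (fun _ _ => rfl) (fun _ => θ) (fun e => hθ e.2)
  exact ⟨H⟩

include S in
/-- The map from the wedge of circles is a homotopy equivalence. -/
theorem exists_homotopyEquiv :
    ∃ E : ContinuousMap.HomotopyEquiv Rose (Xhat α), E.toFun = D.roseMap :=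
  ⟨⟨D.roseMap, toRose A, toRose_roseMap S, roseMap_toRose S⟩, rfl⟩

include S in
theorem bijective_roseMap :
    Function.Bijective (LoopGrp.map D.roseMap D.roseMap_pt) := by
  obtain ⟨E, hE⟩ := exists_homotopyEquiv S
  have h : ∀ q : Path.Homotopic.Quotient (D.roseMap rosePt) (D.roseMap rosePt),
      ∃! a : LoopGrp rosePt, Path.Homotopic.Quotient.map a D.roseMap = q := by
    rw [← hE]
    intro q
    let F := (FundamentalGroupoidFunctor.equivOfHomotopyEquiv E).functor
    obtain ⟨a, ha⟩ := F.map_surjective (X := ⟨rosePt⟩) (Y := ⟨rosePt⟩)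
      (show F.obj ⟨rosePt⟩ ⟶ F.obj ⟨rosePt⟩ from q)
    exact ⟨a, ha, fun b hb => F.map_injective (hb.trans ha.symm)⟩
  have key : ∀ (y : Xhat α) (hy : D.x₀ = y) (q : LoopGrp D.x₀),
      ∃ q' : Path.Homotopic.Quotient y y, q'.cast hy hy = q := by
    rintro _ rfl q
    exact ⟨q, Path.Homotopic.Quotient.cast_rfl_rfl q⟩
  have key' : ∀ (y : Xhat α) (hy : D.x₀ = y) (q q' : Path.Homotopic.Quotient y y),
      q.cast hy hy = q'.cast hy hy → q = q' := by
    rintro _ rfl q q' e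
    simpa only [Path.Homotopic.Quotient.cast_rfl_rfl] using e
  constructor
  · intro a b e
    exact (h _).unique (key' _ D.roseMap_pt _ _ e) rfl
  · intro q
    obtain ⟨q', rfl⟩ := key _ D.roseMap_pt q
    obtain ⟨a, rfl, -⟩ := h q'
    exact ⟨a, rfl⟩

include S in
/-- The loops freely generate the group of homotopy classes. -/
theorem bijective_loops :
    Function.Bijective (FreeGroup.lift fun k => LoopGrp.mk (D.loop k)) := by
  have := (bijective_roseMap S).comp roseVal_bijective
  rwa [show (LoopGrp.map D.roseMap D.roseMap_pt) ∘ roseVal =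
    FreeGroup.lift fun k => LoopGrp.mk (D.loop k) from funext D.roseMap_roseVal] at this

end AY

namespace AY

/-! ### Degrees of closed curves in the circle -/

section Degree

theorem isCoveringMap_circle : IsCoveringMap ((↑) : ℝ → UnitAddCircle) :=
  AddCircle.isCoveringMap_coe 1

variable {p p' : Path (0 : UnitAddCircle) 0} {d d' : ℤ}

theorem path_zero (p : Path (0 : UnitAddCircle) 0) : (p : C(I, UnitAddCircle)) 0 = ((0 : ℝ) : _) :=
  p.source

theorem HasDegree.lift_one (h : HasDegree p d) :
    isCoveringMap_circle.liftPath p (0 : ℝ) (path_zero p) 1 = d := by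
  obtain ⟨θ, h1, h2⟩ := h
  have h0 : ((θ 0 : ℝ) : UnitAddCircle) = 0 := (h1 0).trans p.source
  have e := (isCoveringMap_circle.eq_liftPath_iff' (γ := p) (γ_0 := path_zero p)
    (Γ := ⟨fun t => θ t - θ 0, by fun_prop⟩)).2 ⟨by
      ext t
      change ((θ t - θ 0 : ℝ) : UnitAddCircle) = p t
      rw [AddCircle.coe_sub, h1, h0, sub_zero], sub_self _⟩
  rw [← e]
  exact h2

theorem HasDegree.of_homotopic (h : HasDegree p d) (e : p.Homotopic p') : HasDegree p' d := by
  refine ⟨isCoveringMap_circle.liftPath p' (0 : ℝ) (path_zero p'),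
    congrFun (isCoveringMap_circle.liftPath_lifts p' (0 : ℝ) (path_zero p')), ?_⟩
  rw [isCoveringMap_circle.liftPath_zero, sub_zero, ← h.lift_one]
  exact (isCoveringMap_circle.liftPath_apply_one_eq_of_homotopicRel e (0 : ℝ) _ _).symm

theorem HasDegree.unique (h : HasDegree p d) (h' : HasDegree p d') : d = d' := by
  exact_mod_cast h.lift_one.symm.trans h'.lift_one

theorem hasDegree_refl : HasDegree (Path.refl (0 : UnitAddCircle)) 0 :=
  ⟨ContinuousMap.const _ 0, fun _ => rfl, by simp⟩

theorem HasDegree.symm (h : HasDegree p d) : HasDegree p.symm (-d) := by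
  obtain ⟨θ, h1, h2⟩ := h
  refine ⟨⟨fun t => θ (unitInterval.symm t), by fun_prop⟩, fun t => h1 _, ?_⟩
  push_cast
  rw [← h2]
  simp

theorem HasDegree.trans (h : HasDegree p d) (h' : HasDegree p' d') :
    HasDegree (p.trans p') (d + d') := by
  obtain ⟨θ, h1, h2⟩ := h
  obtain ⟨θ', h1', h2'⟩ := h'
  let q : Path (θ 0) (θ 1) := ⟨θ, rfl, rfl⟩
  let q' : Path (θ 1) (θ 1 + d') :=
    ⟨⟨fun t => θ' t + (θ 1 - θ' 0), by fun_prop⟩, by simp, by simp [← h2']; ring⟩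
  have e0 : ((θ 1 - θ' 0 : ℝ) : UnitAddCircle) = 0 := by
    rw [AddCircle.coe_sub, h1, h1', p.target, p'.source, sub_zero]
  refine ⟨q.trans q', fun t => ?_, ?_⟩
  · change (((q.trans q') t : ℝ) : UnitAddCircle) = _
    rw [Path.trans_apply, Path.trans_apply]
    split_ifs with ht
    · exact h1 _
    · change ((θ' _ + (θ 1 - θ' 0) : ℝ) : UnitAddCircle) = _
      rw [AddCircle.coe_add, e0, add_zero]
      exact h1' _
  · change (q.trans q') 1 - (q.trans q') 0 = _
    rw [Path.target, Path.source]
    push_cast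
    rw [← h2]
    ring

end Degree

/-! ### Degrees of paths in Cayley graphs -/

section Fox

variable {Q : Type} [AddCommGroup Q] (ψ : Fin 7 → Q)

/-- The Fox derivatives of a word, in the group ring. -/
def fox (j : Fin 7) : List (Fin 7 × Bool) → AddMonoidAlgebra ℤ Q
  | [] => 0
  | (k, true) :: L => (if k = j then 1 else 0) + .single (ψ k) 1 * fox j L
  | (k, false) :: L => .single (-ψ k) 1 * ((if k = j then -1 else 0) + fox j L)

/-- The cover of the wedge of circles as a Cayley graph. -/
abbrev gens (k : Fin 7) : Multiplicative Q := Multiplicative.ofAdd (ψ k)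

open Classical in
theorem wrap_edge (q q' : Q) (j k : Fin 7) (t : I) : wrap ψ q j (edgePt ψ q' k t) =
    if q' = q ∧ k = j then (((t : I) : ℝ) : UnitAddCircle) else 0 := by
  change (if (q', k) = (q, j) then _ else _) = _
  exact if_congr Prod.mk_inj rfl rfl

theorem wrap_vertex (q q' : Q) (j : Fin 7) : wrap ψ q j (vertex ψ q') = 0 := by
  refine (wrap_edge ψ q q' j 0 0).trans ?_
  simp

theorem continuous_wrap (q : Q) (j : Fin 7) : Continuous (wrap ψ q j) := by
  refine continuous_coinduced_dom.2 (continuous_sigma fun e => ?_)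
  have : ∀ t : I, (wrap ψ q j ∘ Quot.mk _) ⟨e, t⟩ = _ := fun t => wrap_edge ψ q e.1 j e.2 t
  simp only [this]
  split_ifs
  · exact (AddCircle.continuous_mk' 1).comp continuous_subtype_val
  · exact continuous_const

/-- The closed curve in the circle that records how a path runs through an edge. -/
def wrapPath {q₁ q₂ : Q} (p : Path (vertex ψ q₁) (vertex ψ q₂)) (q : Q) (j : Fin 7) :
    Path (0 : UnitAddCircle) 0 :=
  (p.map (continuous_wrap ψ q j)).cast (wrap_vertex ψ q q₁ j).symm (wrap_vertex ψ q q₂ j).symm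

theorem wrapPath_homotopic {q₁ q₂ : Q} {p p' : Path (vertex ψ q₁) (vertex ψ q₂)}
    (h : p.Homotopic p') (q : Q) (j : Fin 7) :
    (wrapPath ψ p q j).Homotopic (wrapPath ψ p' q j) := by
  have := h.map ⟨_, continuous_wrap ψ q j⟩
  exact this.pathCast _ _

theorem wrapPath_trans {q₁ q₂ q₃ : Q} (p : Path (vertex ψ q₁) (vertex ψ q₂))
    (p' : Path (vertex ψ q₂) (vertex ψ q₃)) (q : Q) (j : Fin 7) :
    wrapPath ψ (p.trans p') q j = (wrapPath ψ p q j).trans (wrapPath ψ p' q j) := by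
  ext t
  change wrap ψ q j (p.trans p' t) = _
  rw [Path.trans_apply, Path.trans_apply]
  split_ifs <;> rfl

/-- An edge of the cover. -/
def coverEdge (q : Q) (k : Fin 7) : Path (vertex ψ q) (vertex ψ (q + ψ k)) :=
  Cay.edge (gens ψ) q k

open Classical in
theorem hasDegree_edge (q₁ q : Q) (k j : Fin 7) :
    HasDegree (wrapPath ψ (coverEdge ψ q₁ k) q j)
      ((if k = j then 1 else 0 : AddMonoidAlgebra ℤ Q).coeff (q - q₁)) := by
  have e : ∀ t : I, wrapPath ψ (coverEdge ψ q₁ k) q j t =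
      if q₁ = q ∧ k = j then (((t : I) : ℝ) : UnitAddCircle) else 0 :=
    fun t => wrap_edge ψ q q₁ j k t
  by_cases h : q₁ = q ∧ k = j
  · refine ⟨⟨fun t => t, continuous_subtype_val⟩, fun t => ?_, ?_⟩
    · rw [e, if_pos h]; rfl
    · rw [if_pos h.2, h.1, sub_self, AddMonoidAlgebra.one_def]
      simp
  · refine ⟨ContinuousMap.const _ 0, fun t => ?_, ?_⟩
    · rw [e, if_neg h]; rfl
    · split_ifs with hk
      · have : q - q₁ ≠ 0 := fun h0 => h ⟨(sub_eq_zero.1 h0).symm, hk⟩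
        rw [AddMonoidAlgebra.one_def]
        simp [this.symm]
      · simp

theorem coeff_single_mul (q q' : Q) (x : AddMonoidAlgebra ℤ Q) :
    (AddMonoidAlgebra.single q 1 * x).coeff q' = x.coeff (q' - q) := by
  rw [AddMonoidAlgebra.coeff_single_mul_apply, one_mul, neg_add_eq_sub]

/-- The degrees of a path that lifts a word are given by the Fox derivatives. -/
theorem exists_lift_degrees (L : List (Fin 7 × Bool)) : ∀ q₁ : Q, ∃ (q₂ : Q)
    (p : Path (vertex ψ q₁) (vertex ψ q₂)),
    Cay.cdown (c := gens ψ) (g := q₁) (h := q₂) (Path.Homotopic.Quotient.mk p) =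
      roseVal (FreeGroup.mk L) ∧
    ∀ q j, HasDegree (wrapPath ψ p q j) ((fox ψ j L).coeff (q - q₁)) := by
  induction L with
  | nil =>
    intro q₁
    refine ⟨q₁, Path.refl _, (map_one roseVal).symm, fun q j => ?_⟩
    have : wrapPath ψ (Path.refl (vertex ψ q₁)) q j = Path.refl 0 := by
      ext t
      exact wrap_vertex ψ q q₁ j
    rw [this]
    exact hasDegree_refl
  | cons x L ih =>
    intro q₁
    obtain ⟨k, b⟩ := x
    have hw : ∀ b, roseVal (FreeGroup.mk ((k, b) :: L)) =
        roseVal (FreeGroup.mk [(k, b)]) * roseVal (FreeGroup.mk L) := by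
      intro b
      rw [← map_mul, FreeGroup.mul_mk]; rfl
    have hk : LoopGrp.mk (roseEdge k) = roseVal (FreeGroup.mk [(k, true)]) :=
      (FreeGroup.lift_apply_of).symm
    cases b
    · obtain ⟨q₂, p, hp, hd⟩ := ih (q₁ - ψ k)
      have e : (q₁ - ψ k) + ψ k = q₁ := sub_add_cancel _ _
      let γ : Path (vertex ψ (q₁ - ψ k)) (vertex ψ q₁) :=
        (coverEdge ψ (q₁ - ψ k) k).cast rfl (congrArg (vertex ψ) e.symm)
      have hγ : Cay.cdown (c := gens ψ) (g := q₁ - ψ k) (h := q₁)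
          (Path.Homotopic.Quotient.mk γ) = LoopGrp.mk (roseEdge k) := rfl
      refine ⟨q₂, γ.symm.trans p, ?_, fun q j => ?_⟩
      · rw [hw, ← hp]
        have h2 : FreeGroup.mk [(k, false)] = (FreeGroup.mk [(k, true)])⁻¹ := by
          rw [FreeGroup.inv_mk]; rfl
        rw [h2, map_inv, ← hk, ← hγ]
        refine (Cay.cdown_trans (c := gens ψ) (g := q₁) (h := q₁ - ψ k) (i := q₂)
          (Path.Homotopic.Quotient.mk γ.symm) (Path.Homotopic.Quotient.mk p)).trans ?_
        exact congrArg (· * Cay.cdown (c := gens ψ) (g := q₁ - ψ k) (h := q₂)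
          (Path.Homotopic.Quotient.mk p)) (quotient_map_symm (Cay.down (gens ψ))
            (Path.Homotopic.Quotient.mk γ))
      · have h3 : HasDegree (wrapPath ψ γ q j)
            ((if k = j then 1 else 0 : AddMonoidAlgebra ℤ Q).coeff (q - (q₁ - ψ k))) :=
          hasDegree_edge ψ (q₁ - ψ k) q k j
        have h4 : HasDegree (wrapPath ψ γ.symm q j) _ := h3.symm
        rw [wrapPath_trans]
        convert h4.trans (hd q j) using 1
        have e1 : q - q₁ - -ψ k = q - (q₁ - ψ k) := by abel
        rw [fox.eq_3, coeff_single_mul, e1, AddMonoidAlgebra.coeff_add, Finsupp.add_apply]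
        split_ifs <;> simp
    · obtain ⟨q₂, p, hp, hd⟩ := ih (q₁ + ψ k)
      refine ⟨q₂, (coverEdge ψ q₁ k).trans p, ?_, fun q j => ?_⟩
      · rw [hw, ← hp, ← hk]
        exact Cay.cdown_trans (c := gens ψ) (g := q₁) (h := q₁ + ψ k) (i := q₂)
          (Path.Homotopic.Quotient.mk (coverEdge ψ q₁ k)) (Path.Homotopic.Quotient.mk p)
      · rw [wrapPath_trans]
        convert (hasDegree_edge ψ q₁ q k j).trans (hd q j) using 1
        rw [fox.eq_2, AddMonoidAlgebra.coeff_add, Finsupp.add_apply, coeff_single_mul, sub_sub]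

end Fox

end AY

namespace AY

/-- The words of the images of the loops. -/
def formWord : Fin 7 → List (Fin 7 × Bool) :=
  ![[(5, true), (2, true)], [(5, true), (3, true), (6, false)], [(5, true), (4, true), (6, false)],
    [(5, true), (5, true), (2, true)], [(6, true), (0, true), (2, true)], [(6, true), (1, true)],
    [(6, true), (2, true)]]

theorem formWord_loop (k : Fin 7) :
    FreeGroup.lift (fun k => FreeGroup.mk (loopWord k)) (FreeGroup.mk (formWord k)) =
      FreeGroup.mk (imageWord k) := by
  revert k
  decide +kernel

/-- The sum of the letters of a word. -/
def wordSum {M : Type*} [AddCommGroup M] (v : Fin 7 → M) (L : List (Fin 7 × Bool)) : M :=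
  (L.map fun x => cond x.2 (v x.1) (-v x.1)).sum

theorem wordSum_map {M N : Type*} [AddCommGroup M] [AddCommGroup N] (f : M →+ N) (v : Fin 7 → M)
    (L : List (Fin 7 × Bool)) : f (wordSum v L) = wordSum (fun k => f (v k)) L := by
  rw [wordSum, wordSum, map_list_sum, List.map_map]
  congr 2
  funext ⟨k, b⟩
  cases b
  · exact map_neg f _
  · rfl

theorem eq_of_wordSum {M : Type*} [AddCommGroup M] {v : Fin 7 → M}
    (h : ∀ k, wordSum v (formWord k) = v k) : v 2 = 0 ∧ v 0 = v 5 ∧ 2 • v 5 = 0 ∧ v 3 = 0 ∧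
      v 4 = v 6 + v 5 ∧ v 1 = v 5 - v 6 := by
  have h0 : v 5 + v 2 = v 0 := by simpa [wordSum, formWord] using h 0
  have h1 : v 5 + (v 3 + -v 6) = v 1 := by simpa [wordSum, formWord] using h 1
  have h3 : v 5 + (v 5 + v 2) = v 3 := by simpa [wordSum, formWord] using h 3
  have h4 : v 6 + (v 0 + v 2) = v 4 := by simpa [wordSum, formWord] using h 4
  have h5 : v 6 + v 1 = v 5 := by simpa [wordSum, formWord] using h 5
  have h6 : v 2 = 0 := by simpa [wordSum, formWord] using h 6
  rw [h6, add_zero] at h0 h3 h4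
  have e3 : v 3 = 0 := by
    rw [← h1] at h5
    linear_combination (norm := module) h5
  exact ⟨h6, h0.symm, by rw [two_smul, h3, e3], e3, by rw [← h4, h0],
    by rw [← h1, e3, zero_add, sub_eq_add_neg]⟩

theorem toAdd_lift {M : Type*} [AddCommGroup M] (v : Fin 7 → M) (L : List (Fin 7 × Bool)) :
    (FreeGroup.lift (fun k => Multiplicative.ofAdd (v k)) (FreeGroup.mk L)).toAdd =
      wordSum v L := by
  rw [FreeGroup.lift_mk, wordSum]
  induction L with
  | nil => rfl
  | cons x L ih =>
    rw [List.map_cons, List.prod_cons, toAdd_mul, ih, List.map_cons, List.sum_cons]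
    rcases x with ⟨k, _ | _⟩ <;> rfl

variable {α : ℝ} {A : IsRoot3 α} {D : Data α} (S : Sheets (octMap A) (D.o₀ A) (D.octMap_o₀ A))

namespace Data

variable (D) in
/-- The homology class of a loop. -/
def homClass : LoopGrp D.x₀ →* Multiplicative D.H1 where
  toFun γ := Multiplicative.ofAdd (Additive.ofMul (Abelianization.of (FundamentalGroup.fromPath γ)))
  map_one' := rfl
  map_mul' a b := by
    refine Eq.trans ?_ (mul_comm _ _)
    rfl

theorem homClass_word (L : List (Fin 7 × Bool)) :
    (D.homClass (FreeGroup.lift (fun k => LoopGrp.mk (D.loop k)) (FreeGroup.mk L))).toAdd =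
      wordSum D.cls L := by
  have : D.homClass.comp (FreeGroup.lift fun k => LoopGrp.mk (D.loop k)) =
      FreeGroup.lift fun k => Multiplicative.ofAdd (D.cls k) := by
    refine FreeGroup.ext_hom _ _ fun k => ?_
    rw [MonoidHom.comp_apply, FreeGroup.lift_apply_of, FreeGroup.lift_apply_of]
    rfl
  rw [← toAdd_lift, ← this]
  rfl

include S in
theorem wordVal_image (k : Fin 7) : wordVal S.W (imageWord k) =
    FreeGroup.lift (fun k => LoopGrp.mk (D.loop k)) (FreeGroup.mk (formWord k)) := by
  have : (FreeGroup.lift fun k => LoopGrp.mk (D.loop k)) =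
      (FreeGroup.lift S.W).comp (FreeGroup.lift fun k => FreeGroup.mk (loopWord k)) := by
    refine FreeGroup.ext_hom _ _ fun k => ?_
    rw [MonoidHom.comp_apply, FreeGroup.lift_apply_of, FreeGroup.lift_apply_of]
    exact loop_class S k
  rw [this, MonoidHom.comp_apply, formWord_loop]
  rfl

include S in
/-- The classes of the images of the loops. -/
theorem imageLoop_conj {k : Fin 7} {F : Path D.x₀ D.x₀} (hF : LoopGrp.mk F =
    FreeGroup.lift (fun k => LoopGrp.mk (D.loop k)) (FreeGroup.mk (formWord k))) :
    (D.imageLoop k).Homotopic (D.conj F) :=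
  imageLoop_homotopic S k F (hF.trans (wordVal_image S k).symm)

include S in
theorem eps_imageLoop {k : Fin 7} {F : Path D.x₀ D.x₀} (hF : LoopGrp.mk F =
    FreeGroup.lift (fun k => LoopGrp.mk (D.loop k)) (FreeGroup.mk (formWord k))) :
    (F.trans D.eps).Homotopic (D.eps.trans (D.imageLoop k)) := by
  have h := Path.Homotopic.Quotient.eq.2 (imageLoop_conj S hF)
  rw [← Path.Homotopic.Quotient.eq, Path.Homotopic.Quotient.mk_trans,
    Path.Homotopic.Quotient.mk_trans, h, conj, Path.Homotopic.Quotient.mk_trans,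
    Path.Homotopic.Quotient.mk_trans, Path.Homotopic.Quotient.mk_symm,
    Path.Homotopic.Quotient.trans_assoc, ← Path.Homotopic.Quotient.trans_assoc (.mk D.eps),
    Path.Homotopic.Quotient.trans_symm, Path.Homotopic.Quotient.refl_trans]

include S in
theorem hStar_cls (k : Fin 7) : D.hStar (D.cls k) = wordSum D.cls (formWord k) := by
  obtain ⟨F, hF⟩ := Path.Homotopic.Quotient.mk_surjective
    (FreeGroup.lift (fun k => LoopGrp.mk (D.loop k)) (FreeGroup.mk (formWord k)))
  have h := Path.Homotopic.Quotient.eq.2 (eps_imageLoop S hF)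
  have e : D.hStar (D.cls k) = (D.homClass (((Path.Homotopic.Quotient.mk D.eps).trans
      (.mk (D.imageLoop k))).trans (Path.Homotopic.Quotient.mk D.eps).symm)).toAdd := by
    rw [Path.Homotopic.Quotient.trans_assoc]
    have : D.hStar (D.cls k) = (D.homClass ((Path.Homotopic.Quotient.mk D.eps.symm.symm).trans
        ((Path.Homotopic.Quotient.mk (D.imageLoop k)).trans (.mk D.eps.symm)))).toAdd := rfl
    rw [this, Path.symm_symm, Path.Homotopic.Quotient.mk_symm]
  rw [e, ← homClass_word, ← hF, ← Path.Homotopic.Quotient.mk_trans, ← h,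
    Path.Homotopic.Quotient.mk_trans, Path.Homotopic.Quotient.trans_assoc,
    Path.Homotopic.Quotient.trans_symm, Path.Homotopic.Quotient.trans_refl]

include S in
theorem toCoker_word (k : Fin 7) :
    wordSum (fun k => D.toCoker (D.cls k)) (formWord k) = D.toCoker (D.cls k) := by
  rw [← wordSum_map, ← hStar_cls S, ← sub_eq_zero, ← map_sub]
  exact (QuotientAddGroup.eq_zero_iff _).2 ⟨D.cls k, rfl⟩

include S in
theorem toCoker_cls : D.toCoker (D.cls 2) = 0 ∧ D.toCoker (D.cls 0) = D.toCoker (D.cls 5) ∧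
    2 • D.toCoker (D.cls 5) = 0 ∧ D.toCoker (D.cls 3) = 0 ∧
    D.toCoker (D.cls 4) = D.toCoker (D.cls 6) + D.toCoker (D.cls 5) ∧
    D.toCoker (D.cls 1) = D.toCoker (D.cls 5) - D.toCoker (D.cls 6) :=
  eq_of_wordSum (toCoker_word S)

include S in
theorem psiQ_cls : D.psiQ (D.cls 0) = 0 ∧ D.psiQ (D.cls 1) = -D.psiQ (D.cls 6) ∧
    D.psiQ (D.cls 2) = 0 ∧ D.psiQ (D.cls 3) = 0 ∧ D.psiQ (D.cls 4) = D.psiQ (D.cls 6) ∧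
    D.psiQ (D.cls 5) = 0 := by
  obtain ⟨h2, h0, h5, h3, h4, h1⟩ := toCoker_cls S
  have e : ∀ x, D.psiQ x = QuotientAddGroup.mk' (AddCommGroup.torsion D.Coker) (D.toCoker x) :=
    fun _ => rfl
  have e5 : D.psiQ (D.cls 5) = 0 :=
    (QuotientAddGroup.eq_zero_iff _).2 (isOfFinAddOrder_iff_nsmul_eq_zero.2 ⟨2, by norm_num, h5⟩)
  have e0 : D.psiQ (D.cls 0) = 0 := by rw [e, h0, ← e, e5]
  refine ⟨e0, ?_, ?_, ?_, ?_, e5⟩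
  · rw [e, h1, map_sub, ← e, ← e, e5, zero_sub]
  · rw [e, h2, map_zero]
  · rw [e, h3, map_zero]
  · rw [e, h4, map_add, ← e, ← e, e5, add_zero]

variable (D) in
/-- A cellular version of the blown-up map, with its elevation. -/
structure CellularMap where
  /-- The cellular map. -/
  f : C(Rose, Rose)
  f_pt : f rosePt = rosePt
  /-- The homotopy to the blown-up map. -/
  H : ContinuousMap.Homotopy (D.roseMap.comp f)
    ((D.hhat : C(Xhat α, Xhat α)).comp D.roseMap)
  H_pt : ∃ (h₀ : D.x₀ = D.roseMap.comp f rosePt)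
    (h₁ : D.hhat D.x₀ = ((D.hhat : C(Xhat α, Xhat α)).comp D.roseMap) rosePt),
    ((H.evalAt rosePt).cast h₀ h₁).Homotopic D.eps
  /-- The elevation. -/
  fQ : C(D.RoseQ, D.RoseQ)
  proj_fQ : ∀ x, proj _ (fQ x) = f (proj _ x)
  fQ_zero : fQ (vertex _ 0) = vertex _ 0

/-- The values of the loops in the deck group. -/
abbrev deck (D : Data α) (k : Fin 7) : D.Q := D.psiQ (D.cls k)

include S in
theorem lift_deck (q : D.Q) (k : Fin 7) : (q + deck D k : D.Q) =
    (show Multiplicative D.Q from q) * FreeGroup.lift (gens (deck D)) (FreeGroup.mk (formWord k)) := by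
  have e : wordSum (deck D) (formWord k) = deck D k := by
    have := congrArg (QuotientAddGroup.mk' (AddCommGroup.torsion D.Coker)) (toCoker_word S k)
    rwa [wordSum_map] at this
  rw [← e, ← toAdd_lift]
  rfl

include S in
theorem nonempty_cellularMap : Nonempty D.CellularMap := by
  choose p hp using fun k => exists_rosePath (FreeGroup.mk (formWord k))
  let f : C(Rose, Rose) := Gr.lift (V := PUnit) (E := PUnit × Fin 7) (s := Prod.fst)
    (t := fun e => e.1 + 0) (fun _ => rosePt) fun e => p e.2
  obtain ⟨H, hH⟩ := Gr.exists_homotopy (V := PUnit) (E := PUnit × Fin 7) (s := Prod.fst)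
    (t := fun e => e.1 + 0) (D.roseMap.comp f) ((D.hhat : C(Xhat α, Xhat α)).comp D.roseMap)
    (a := fun _ => D.x₀) (b := fun _ => D.hhat D.x₀)
    (fun e => ((p e.2).map D.roseMap.continuous).cast D.roseMap_pt D.roseMap_pt)
    (fun e => D.imageLoop e.2) (fun _ _ => rfl) (fun _ _ => rfl) (fun _ => D.eps) (fun e => by
      refine eps_imageLoop S ?_
      rw [← roseMap_roseVal, ← hp, LoopGrp.map_mk])
  have hlift : ∀ (q : D.Q) (k : Fin 7), ∃ Γ : Path (vertex (deck D) q) (vertex (deck D) (q + deck D k)),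
      ∀ t, proj _ (Γ t) = p k t := by
    intro q k
    obtain ⟨h, Γ, hΓ⟩ := Cay.exists_lift_path (c := gens (deck D)) (p k) q
    obtain ⟨γ, hγ⟩ := Cay.exists_lift (c := gens (deck D)) (FreeGroup.mk (formWord k)) q
      (q + deck D k) (lift_deck S q k)
    have e : h = q + deck D k := by
      refine Cay.end_unique (w := Path.Homotopic.Quotient.mk Γ) (w' := γ) ?_
      rw [hγ, ← hp]
      exact congrArg Path.Homotopic.Quotient.mk (Path.ext (funext hΓ))
    subst e
    exact ⟨Γ, hΓ⟩
  choose Γ hΓ using hlift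
  have hpt : f rosePt = rosePt := (p 0).source
  refine ⟨⟨f, hpt, H, ⟨D.roseMap_pt.trans (congrArg D.roseMap hpt).symm,
    congrArg D.hhat D.roseMap_pt, ?_⟩,
    Gr.lift (s := Prod.fst) (t := fun e : D.Q × Fin 7 => e.1 + deck D e.2)
      (fun q => vertex (deck D) q) (fun e => Γ e.1 e.2), ?_, (Γ 0 0).source⟩⟩
  · refine Path.Homotopic.trans ?_ ⟨Path.Homotopy.reflTrans D.eps⟩
    exact Path.Homotopic.Quotient.eq.1 (congrArg Path.Homotopic.Quotient.mk
      (Path.ext (funext fun u => hH ((0 : PUnit), 0) u)))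
  · rintro ⟨⟨q, k⟩, u⟩
    exact hΓ q k u

namespace CellularMap

variable (M : D.CellularMap)

include S in
/-- The classes of the images of the circles under a cellular version. -/
theorem edge_class (k : Fin 7) :
    LoopGrp.mk (((roseEdge k).map M.f.continuous).cast M.f_pt.symm M.f_pt.symm) =
      roseVal (FreeGroup.mk (formWord k)) := by
  apply (bijective_roseMap S).1
  rw [roseMap_roseVal, LoopGrp.map_mk]
  obtain ⟨F, hF⟩ := Path.Homotopic.Quotient.mk_surjective
    (FreeGroup.lift (fun k => LoopGrp.mk (D.loop k)) (FreeGroup.mk (formWord k)))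
  obtain ⟨h₀, h₁, hev⟩ := M.H_pt
  have nat := (Path.Homotopic.map_trans_evalAt M.H (roseEdge k)).pathCast h₀ h₁
  let u : Path D.x₀ D.x₀ := ((roseEdge k).map (D.roseMap.comp M.f).continuous).cast h₀ h₀
  have nat' : (u.trans ((M.H.evalAt rosePt).cast h₀ h₁)).Homotopic
      (((M.H.evalAt rosePt).cast h₀ h₁).trans (D.imageLoop k)) := nat
  rw [← Path.Homotopic.Quotient.eq, Path.Homotopic.Quotient.mk_trans,
    Path.Homotopic.Quotient.mk_trans, Path.Homotopic.Quotient.eq.2 hev,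
    ← Path.Homotopic.Quotient.mk_trans, ← Path.Homotopic.Quotient.mk_trans,
    ← Path.Homotopic.Quotient.eq.2 (eps_imageLoop S hF), Path.Homotopic.Quotient.mk_trans,
    Path.Homotopic.Quotient.mk_trans] at nat'
  have h := congrArg (Path.Homotopic.Quotient.trans · (.mk D.eps.symm)) nat'
  simp only [Path.Homotopic.Quotient.trans_assoc, Path.Homotopic.Quotient.mk_symm,
    Path.Homotopic.Quotient.trans_symm, Path.Homotopic.Quotient.trans_refl] at h
  exact h.trans hF

theorem exists_vertex (q : D.Q) : ∃ q' : D.Q, M.fQ (vertex _ q) = vertex _ q' :=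
  Cay.eq_vx (c := gens (deck D)) ((M.proj_fQ _).trans M.f_pt)

/-- The image of an edge. -/
def edgeImage {q q₁ q₂ : D.Q} {k : Fin 7} (h₁ : M.fQ (vertex _ q) = vertex _ q₁)
    (h₂ : M.fQ (vertex _ (q + deck D k)) = vertex _ q₂) :
    Path (vertex (deck D) q₁) (vertex (deck D) q₂) :=
  ((coverEdge (deck D) q k).map M.fQ.continuous).cast h₁.symm h₂.symm

include S in
theorem cdown_edgeImage {q q₁ q₂ : D.Q} {k : Fin 7} (h₁ : M.fQ (vertex _ q) = vertex _ q₁)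
    (h₂ : M.fQ (vertex _ (q + deck D k)) = vertex _ q₂) :
    Cay.cdown (c := gens (deck D)) (g := q₁) (h := q₂)
      (Path.Homotopic.Quotient.mk (M.edgeImage h₁ h₂)) = roseVal (FreeGroup.mk (formWord k)) := by
  rw [← edge_class S M k]
  exact congrArg Path.Homotopic.Quotient.mk (Path.ext (funext fun u => M.proj_fQ _))

include S in
theorem vertex_step {q q₁ q₂ : D.Q} {k : Fin 7} (h₁ : M.fQ (vertex _ q) = vertex _ q₁)
    (h₂ : M.fQ (vertex _ (q + deck D k)) = vertex _ q₂) : q₂ = q₁ + deck D k := by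
  obtain ⟨γ, hγ⟩ := Cay.exists_lift (c := gens (deck D)) (FreeGroup.mk (formWord k)) q₁
    (q₁ + deck D k) (lift_deck S q₁ k)
  exact Cay.end_unique (c := gens (deck D)) (g := q₁) (h := q₂) (h' := q₁ + deck D k)
    ((M.cdown_edgeImage S h₁ h₂).trans hγ.symm)

include S in
theorem fQ_vertex (hQ : ∀ q : D.Q, ∃ n : ℤ, q = n • deck D 6) (q : D.Q) :
    M.fQ (vertex _ q) = vertex _ q := by
  obtain ⟨n, rfl⟩ := hQ q
  induction n using Int.induction_on with
  | zero => rw [zero_smul]; exact M.fQ_zero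
  | succ n ih =>
    rw [add_smul, one_smul]
    obtain ⟨q', h⟩ := M.exists_vertex ((n : ℤ) • deck D 6 + deck D 6)
    rw [h, M.vertex_step S ih h]
  | pred n ih =>
    obtain ⟨q', h⟩ := M.exists_vertex ((-(n : ℤ) - 1) • deck D 6)
    have e : -(n : ℤ) • deck D 6 = (-(n : ℤ) - 1) • deck D 6 + deck D 6 := by
      rw [sub_smul, one_smul, sub_add_cancel]
    rw [e] at ih
    rw [h, add_right_cancel (M.vertex_step S h ih)]

include S in
theorem hasDegree (hf : ∀ q, M.fQ (vertex _ q) = vertex _ q) (q' : D.Q) (k : Fin 7) (q : D.Q)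
    (j : Fin 7) : HasDegree (wrapPath (deck D) (M.edgeImage (hf q') (hf (q' + deck D k))) q j)
      ((fox (deck D) j (formWord k)).coeff (q - q')) := by
  obtain ⟨q₂, p, hp, hd⟩ := exists_lift_degrees (deck D) (formWord k) q'
  have e := (M.cdown_edgeImage S (hf q') (hf (q' + deck D k)))
  obtain rfl : q' + deck D k = q₂ := Cay.end_unique (c := gens (deck D)) (g := q')
    (h := q' + deck D k) (h' := q₂) (e.trans hp.symm)
  refine (hd q j).of_homotopic (wrapPath_homotopic _ ?_ q j)
  exact Path.Homotopic.Quotient.eq.1 (Cay.cdown_injective (hp.trans e.symm))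

end CellularMap

end Data

end AY

namespace AY

variable {α : ℝ} {A : IsRoot3 α} {D : Data α} (S : Sheets (octMap A) (D.o₀ A) (D.octMap_o₀ A))

/-- The automorphism of the free group inverting the generators. -/
def invGens : FreeGroup (Fin 7) →* FreeGroup (Fin 7) := FreeGroup.lift fun k => (FreeGroup.of k)⁻¹

theorem invGens_invGens (w : FreeGroup (Fin 7)) : invGens (invGens w) = w := by
  have : invGens.comp invGens = MonoidHom.id _ := by
    refine FreeGroup.ext_hom _ _ fun k => ?_
    simp [invGens]
  exact DFunLike.congr_fun this w

namespace Data

variable (D) in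
/-- The isomorphism between the group of loops and the fundamental group, whose multiplication is
reversed. -/
def piInv : LoopGrp D.x₀ →* FundamentalGroup (Xhat α) D.x₀ where
  toFun γ := (FundamentalGroup.fromPath γ)⁻¹
  map_one' := inv_one
  map_mul' a b := by
    refine Eq.trans ?_ (mul_inv_rev (FundamentalGroup.fromPath b) (FundamentalGroup.fromPath a))
    rfl

include S in
theorem bijective_piClass :
    Function.Bijective (FreeGroup.lift fun k : Fin 7 => D.piClass (D.loop k)) := by
  have e : (FreeGroup.lift fun k : Fin 7 => D.piClass (D.loop k)) =
      (D.piInv.comp (FreeGroup.lift fun k => LoopGrp.mk (D.loop k))).comp invGens := by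
    refine FreeGroup.ext_hom _ _ fun k => ?_
    rw [MonoidHom.comp_apply, FreeGroup.lift_apply_of, invGens, FreeGroup.lift_apply_of, map_inv,
      MonoidHom.comp_apply, FreeGroup.lift_apply_of]
    exact (inv_inv _).symm
  rw [e, MonoidHom.coe_comp, MonoidHom.coe_comp]
  refine (Function.Bijective.comp ⟨fun a b h => ?_, fun x => ?_⟩ (bijective_loops S)).comp
    (Function.Involutive.bijective invGens_invGens)
  · exact inv_injective (G := FundamentalGroup (Xhat α) D.x₀) h
  · obtain ⟨y, hy⟩ := (inv_surjective (G := FundamentalGroup (Xhat α) D.x₀)) x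
    exact ⟨y, hy⟩

include S in
theorem exists_wordSum (x : D.H1) : ∃ L, x = wordSum D.cls L := by
  obtain ⟨y, hy⟩ := QuotientGroup.mk_surjective x.toMul
  obtain ⟨w, hw⟩ := (bijective_loops S).2 y
  refine ⟨w.toWord, ?_⟩
  rw [← homClass_word, FreeGroup.mk_toWord, hw]
  exact hy.symm

include S in
theorem hom_ext {M : Type*} [AddCommGroup M] {f g : D.H1 →+ M}
    (h : ∀ k, f (D.cls k) = g (D.cls k)) : f = g := by
  refine AddMonoidHom.ext fun x => ?_
  obtain ⟨L, rfl⟩ := exists_wordSum S x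
  rw [wordSum_map, wordSum_map]
  exact congrArg (wordSum · L) (funext h)

include S in
theorem exists_hom {M : Type*} [AddCommGroup M] (m : Fin 7 → M) :
    ∃ f : D.H1 →+ M, ∀ k, f (D.cls k) = m k := by
  let e := MulEquiv.ofBijective _ (bijective_piClass S)
  refine ⟨MonoidHom.toAdditiveLeft (Abelianization.lift
    ((FreeGroup.lift fun k => Multiplicative.ofAdd (m k)).comp e.symm.toMonoidHom)), fun k => ?_⟩
  have h : e.symm (D.piClass (D.loop k)) = FreeGroup.of k := by
    rw [MulEquiv.symm_apply_eq]
    exact FreeGroup.lift_apply_of.symm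
  change (FreeGroup.lift (fun k => Multiplicative.ofAdd (m k))
    (e.symm (D.piClass (D.loop k)))).toAdd = m k
  rw [h, FreeGroup.lift_apply_of]
  rfl

include S in
theorem exists_basis : ∃ B : Module.Basis (Fin 7) ℤ D.H1, ⇑B = D.cls := by
  obtain ⟨f, hf⟩ := exists_hom S fun k => Finsupp.single (M := ℤ) k 1
  let g : (Fin 7 →₀ ℤ) →ₗ[ℤ] D.H1 := Finsupp.linearCombination ℤ D.cls
  have hg : ∀ k, g (Finsupp.single k 1) = D.cls k := fun k => by
    rw [Finsupp.linearCombination_single, one_smul]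
  have h1 : g.comp f.toIntLinearMap = LinearMap.id := by
    refine LinearMap.toAddMonoidHom_injective (hom_ext S fun k => ?_)
    change g (f (D.cls k)) = D.cls k
    rw [hf, hg]
  have h2 : f.toIntLinearMap.comp g = LinearMap.id := by
    refine Finsupp.lhom_ext' fun k => LinearMap.ext_ring ?_
    change f (g (Finsupp.single k 1)) = Finsupp.single k 1
    rw [hg, hf]
  refine ⟨Module.Basis.ofRepr (LinearEquiv.ofLinearMap f.toIntLinearMap g h2 h1), funext fun k => ?_⟩
  exact hg k

include S in
theorem exists_basis' : ∃ B : Module.Basis (Fin 7) ℤ D.H1, ⇑B = D.cls' := by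
  obtain ⟨B, hB⟩ := exists_basis S
  obtain ⟨T, hT⟩ := exists_hom S D.cls'
  obtain ⟨U, hU⟩ := exists_hom S ![D.cls 2 + D.cls 4 - D.cls 5,
    D.cls 0 - D.cls 1 + D.cls 2 - D.cls 3 + D.cls 4 + D.cls 5 - D.cls 6,
    D.cls 0 + D.cls 2 + D.cls 4 - 2 • D.cls 5, D.cls 0 + D.cls 2 - D.cls 3 + D.cls 4,
    D.cls 0 + 2 • D.cls 2 + D.cls 4 - 3 • D.cls 5 + D.cls 6, D.cls 5, D.cls 6]
  simp only [Fin.forall_fin_succ, cls'] at hT hU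
  simp at hT hU
  have h1 : T.comp U = AddMonoidHom.id D.H1 := by
    refine hom_ext S fun k => ?_
    fin_cases k <;> simp [hU, hT] <;> abel
  have h2 : U.comp T = AddMonoidHom.id D.H1 := by
    refine hom_ext S fun k => ?_
    fin_cases k <;> simp [hU, hT] <;> abel
  refine ⟨B.map (AddMonoidHom.toAddEquiv T U h2 h1).toIntLinearEquiv, funext fun k => ?_⟩
  rw [Module.Basis.map_apply, hB]
  change T (D.cls k) = _
  fin_cases k <;> simp [cls', hT]

theorem wordSum_sub_eq {M : Type*} [AddCommGroup M] (v : Fin 7 → M) (k : Fin 7) :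
    wordSum v (formWord k) - v k = ∑ j, homologyMatrix j k • v j := by
  fin_cases k <;> simp [wordSum, formWord, homologyMatrix, Fin.sum_univ_succ] <;> abel

include S in
theorem hStar_sub (k : Fin 7) :
    D.hStar (D.cls k) - D.cls k = ∑ j, homologyMatrix j k • D.cls j := by
  rw [hStar_cls S, wordSum_sub_eq]

include S in
theorem toCoker_cls' (k : Fin 7) (hk : k < 5) : D.toCoker (D.cls' k) = 0 := by
  obtain ⟨h2, h0, h5, h3, h4, h1⟩ := toCoker_cls S
  have h5' := h5
  rw [two_smul] at h5'
  fin_cases k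
  · simp [cls', h2, h0]
  · simp [cls', h1, h3]
  · simp [cls', h2, h4]
    linear_combination (norm := module) h5
  · simp [cls', h2, h3, h5]
  · simp [cls', h2, h0, h4]
  · exact absurd hk (by decide)
  · exact absurd hk (by decide)

include S in
theorem exists_coker_lift {M : Type*} [AddCommGroup M] (m : Fin 7 → M)
    (hm : ∀ k, wordSum m (formWord k) = m k) :
    ∃ f : D.Coker →+ M, ∀ k, f (D.toCoker (D.cls k)) = m k := by
  obtain ⟨f, hf⟩ := exists_hom S m
  have h : f.comp (D.hStar - AddMonoidHom.id D.H1) = 0 := by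
    refine hom_ext S fun k => ?_
    change f (D.hStar (D.cls k) - D.cls k) = 0
    rw [hStar_cls S, map_sub, wordSum_map, funext hf, hm, hf, sub_self]
  refine ⟨QuotientAddGroup.lift _ f ?_, fun k => hf k⟩
  rintro _ ⟨x, rfl⟩
  exact DFunLike.congr_fun h x

include S in
theorem exists_cokerEquiv : ∃ E : D.Coker ≃+ ZMod 2 × ℤ,
    E (D.toCoker (D.cls' 6)) = (0, 1) ∧ E (D.toCoker (D.cls' 5)) = (1, 0) := by
  obtain ⟨f, hf⟩ := exists_coker_lift S (M := ZMod 2 × ℤ)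
    ![(1, 0), (1, -1), (0, 0), (0, 0), (1, 1), (1, 0), (0, 1)] (by decide)
  obtain ⟨h2, h0, h5, h3, h4, h1⟩ := toCoker_cls S
  let g : ZMod 2 × ℤ →+ D.Coker := (ZMod.lift 2 ⟨zmultiplesHom _ (D.toCoker (D.cls 5)), 
    (natCast_zsmul (D.toCoker (D.cls 5)) 2).trans h5⟩).coprod (zmultiplesHom _ (D.toCoker (D.cls 6)))
  have g1 : ∀ n : ℤ, g ((n : ZMod 2), 0) = n • D.toCoker (D.cls 5) := fun n => by
    simp [g]
  have g2 : ∀ n : ℤ, g (0, n) = n • D.toCoker (D.cls 6) := fun n => by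
    simp [g]
  have g1' : g (1, 0) = D.toCoker (D.cls 5) := by simpa using g1 1
  have g2' : g (0, 1) = D.toCoker (D.cls 6) := by simpa using g2 1
  have ep : ∀ (a : ZMod 2) (n : ℤ), g (a, n) = g (a, 0) + g (0, n) := fun a n => by
    rw [← map_add, Prod.mk_add_mk, add_zero, zero_add]
  have hgf : g.comp f = AddMonoidHom.id _ := by
    refine QuotientAddGroup.addMonoidHom_ext _ (hom_ext S fun k => ?_)
    change g (f (D.toCoker (D.cls k))) = D.toCoker (D.cls k)
    have ea : g (1, 1) = D.toCoker (D.cls 4) := by rw [ep, g1', g2', h4, add_comm]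
    have eb : g (1, -1) = D.toCoker (D.cls 1) := by
      rw [ep, g1', g2, h1, neg_smul, one_smul]
      exact (sub_eq_add_neg _ _).symm
    rw [hf]
    fin_cases k
    · exact g1'.trans h0.symm
    · exact eb
    · exact (map_zero g).trans h2.symm
    · exact (map_zero g).trans h3.symm
    · exact ea
    · exact g1'
    · exact g2'
  have hfg : f.comp g = AddMonoidHom.id _ := by
    refine AddMonoidHom.ext fun x => ?_
    obtain ⟨a, n⟩ := x
    obtain ⟨m, rfl⟩ := ZMod.intCast_surjective a
    change f (g _) = _
    rw [ep, g1, g2, map_add, map_zsmul, map_zsmul, hf, hf]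
    refine Prod.ext ?_ ?_ <;> simp
  exact ⟨AddMonoidHom.toAddEquiv f g hgf hfg, hf 6, hf 5⟩

include S in
theorem exists_QEquiv : ∃ E : D.Q ≃+ ℤ, E (D.psiQ (D.cls 6)) = 1 := by
  obtain ⟨f, hf⟩ := exists_coker_lift S (M := ℤ) ![0, -1, 0, 0, 1, 0, 1] (by decide)
  obtain ⟨h0, h1, h2, h3, h4, h5⟩ := psiQ_cls S
  let F : D.Q →+ ℤ := QuotientAddGroup.lift _ f fun x hx => by
    obtain ⟨n, hn, h⟩ := isOfFinAddOrder_iff_nsmul_eq_zero.1 hx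
    have := congrArg f h
    rw [map_nsmul, map_zero] at this
    exact (smul_eq_zero.1 this).resolve_left hn.ne'
  have hF : ∀ k, F (D.psiQ (D.cls k)) = _ := hf
  let g : ℤ →+ D.Q := zmultiplesHom _ (D.psiQ (D.cls 6))
  have hg : ∀ n, g n = n • D.psiQ (D.cls 6) := fun n => rfl
  have hgF : g.comp F = AddMonoidHom.id _ := by
    refine QuotientAddGroup.addMonoidHom_ext _ (QuotientAddGroup.addMonoidHom_ext _
      (hom_ext S fun k => ?_))
    change g (F (D.psiQ (D.cls k))) = D.psiQ (D.cls k)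
    rw [hF, hg]
    fin_cases k <;> simp [h0, h1, h2, h3, h4, h5]
  have hFg : F.comp g = AddMonoidHom.id _ := by
    refine AddMonoidHom.ext_int ?_
    change F (g 1) = 1
    rw [hg, one_smul]
    exact hF 6
  exact ⟨AddMonoidHom.toAddEquiv F g hgF hFg, hF 6⟩

include S in
theorem eq_smul (q : D.Q) : ∃ n : ℤ, q = n • deck D 6 := by
  obtain ⟨E, hE⟩ := exists_QEquiv S
  refine ⟨E q, E.injective ?_⟩
  rw [map_zsmul, hE, smul_eq_mul, mul_one]

end Data

end AY

namespace AY

variable {α : ℝ} {A : IsRoot3 α} {D : Data α} (S : Sheets (octMap A) (D.o₀ A) (D.octMap_o₀ A))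

namespace Data

variable (D) in
theorem nu_mul_nuInv : D.nu * D.nuInv = 1 := by
  rw [nu, nuInv, AddMonoidAlgebra.single_mul_single, add_neg_cancel, one_mul,
    AddMonoidAlgebra.one_def]

include S in
theorem fox_formWord (j k : Fin 7) : fox (deck D) j (formWord k) = D.actionMatrix j k := by
  obtain ⟨h0, h1, h2, h3, h4, h5⟩ := psiQ_cls S
  have hz : (AddMonoidAlgebra.single (0 : D.Q) (1 : ℤ)) = 1 := AddMonoidAlgebra.one_def.symm
  have hn : AddMonoidAlgebra.single (D.psiQ (D.cls 6)) (1 : ℤ) = D.nu := rfl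
  have hn' : AddMonoidAlgebra.single (-D.psiQ (D.cls 6)) (1 : ℤ) = D.nuInv := rfl
  have hm := D.nu_mul_nuInv
  have f0 : fox (deck D) j (formWord 0) = (if 5 = j then 1 else 0) + if 2 = j then 1 else 0 := by
    simp [formWord, fox, h5, h2, hz]
  have f1 : fox (deck D) j (formWord 1) = (if 5 = j then 1 else 0) + ((if 3 = j then 1 else 0) +
      D.nuInv * if 6 = j then -1 else 0) := by
    simp [formWord, fox, h5, h3, hz, hn']
  have f2 : fox (deck D) j (formWord 2) = (if 5 = j then 1 else 0) + ((if 4 = j then 1 else 0) +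
      if 6 = j then -1 else 0) := by
    simp [formWord, fox, h5, h4, hz, hn, hn', hm]
  have f3 : fox (deck D) j (formWord 3) = (if 5 = j then 1 else 0) + ((if 5 = j then 1 else 0) +
      if 2 = j then 1 else 0) := by
    simp [formWord, fox, h5, hz]
  have f4 : fox (deck D) j (formWord 4) = (if 6 = j then 1 else 0) + D.nu *
      ((if 0 = j then 1 else 0) + if 2 = j then 1 else 0) := by
    simp [formWord, fox, h0, hz, hn]
  have f5 : fox (deck D) j (formWord 5) = (if 6 = j then 1 else 0) + D.nu *
      if 1 = j then 1 else 0 := by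
    simp [formWord, fox, hn]
  have f6 : fox (deck D) j (formWord 6) = (if 6 = j then 1 else 0) + D.nu *
      if 2 = j then 1 else 0 := by
    simp [formWord, fox, hn]
  fin_cases k
  · refine f0.trans ?_
    fin_cases j <;> simp [actionMatrix]
  · refine f1.trans ?_
    fin_cases j <;> simp [actionMatrix]
  · refine f2.trans ?_
    fin_cases j <;> simp [actionMatrix]
  · refine f3.trans ?_
    fin_cases j <;> simp [actionMatrix, one_add_one_eq_two]
  · refine f4.trans ?_
    fin_cases j <;> simp [actionMatrix]
  · refine f5.trans ?_
    fin_cases j <;> simp [actionMatrix]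
  · refine f6.trans ?_
    fin_cases j <;> simp [actionMatrix]

/-- The underlying cellular map. -/
def CellularModel.toCellularMap (M : D.CellularModel) : D.CellularMap where
  __ := M

include S in
theorem isAction₀_one (M : D.CellularMap) : IsAction₀ _ M.fQ 1 := by
  classical
  intro q' q
  rw [M.fQ_vertex S (eq_smul S), Matrix.one_apply_eq, AddMonoidAlgebra.one_def]
  have h : vertex (deck D) q' = vertex (deck D) q ↔ q = q' :=
    ⟨fun h => (Cay.vx_injective (c := gens (deck D)) h).symm, fun h => h ▸ rfl⟩
  rw [AddMonoidAlgebra.coeff_single, Finsupp.single_apply]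
  exact if_congr (eq_comm.trans (sub_eq_zero.trans h.symm)) rfl rfl

include S in
theorem isAction₁_actionMatrix (M : D.CellularMap) : IsAction₁ _ M.fQ D.actionMatrix := by
  intro q' k q j
  rw [← fox_formWord S]
  exact M.hasDegree S (M.fQ_vertex S (eq_smul S)) q' k q j

include S in
theorem nonempty_cellularModel : Nonempty D.CellularModel := by
  obtain ⟨M⟩ := nonempty_cellularMap S
  exact ⟨{ M with
    F₀ := 1
    isAction₀ := isAction₀_one S M
    F₁ := D.actionMatrix
    isAction₁ := isAction₁_actionMatrix S M }⟩

namespace CellularModel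

variable (M : D.CellularModel)

include S in
theorem fQ_vertex (q : D.Q) : M.fQ (vertex _ q) = vertex _ q :=
  M.toCellularMap.fQ_vertex S (eq_smul S) q

include S in
theorem F₀_eq : M.F₀ = 1 := by
  refine Matrix.ext fun i j => ?_
  obtain rfl := Subsingleton.elim i 0
  obtain rfl := Subsingleton.elim j 0
  refine AddMonoidAlgebra.ext (Finsupp.ext fun q : D.Q => ?_)
  have h := (M.isAction₀ 0 q).trans (isAction₀_one S M.toCellularMap 0 q).symm
  rwa [sub_zero] at h

include S in
theorem F₁_eq : M.F₁ = D.actionMatrix := by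
  refine Matrix.ext fun j k => ?_
  refine AddMonoidAlgebra.ext (Finsupp.ext fun q : D.Q => ?_)
  have hf := fQ_vertex S M
  have h := HasDegree.unique (p := wrapPath (deck D)
    (M.toCellularMap.edgeImage (hf 0) (hf (0 + deck D k))) q j) (M.isAction₁ 0 k q j)
    (isAction₁_actionMatrix S M.toCellularMap 0 k q j)
  rwa [sub_zero] at h

end CellularModel

end Data

/-! ### The zeta function -/

theorem det_eq {R : Type*} [CommRing R] (t n m : R) (h : n * m = 1) :
    (!![1, 0, 0, 0, -(t * n), 0, 0;
      0, 1, 0, 0, 0, -(t * n), 0;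
      -t, 0, 1, -t, -(t * n), 0, -(t * n);
      0, -t, 0, 1, 0, 0, 0;
      0, 0, -t, 0, 1, 0, 0;
      -t, -t, -t, -(t * 2), 0, 1, 0;
      0, t * m, t, 0, -t, -t, 1 - t] : Matrix (Fin 7) (Fin 7) R).det =
      1 - t - n * t ^ 2 - 3 * n * t ^ 3 + 3 * n * t ^ 4 + n * t ^ 5 + n ^ 2 * t ^ 6 -
        n ^ 2 * t ^ 7 := by
  simp [Matrix.det_succ_row_zero, Fin.sum_univ_succ, Fin.succAbove]
  grind

theorem charpolyRev_actionMatrix (D : Data α) : D.actionMatrix.charpolyRev =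
    1 - .X - .C D.nu * .X ^ 2 - 3 * .C D.nu * .X ^ 3 + 3 * .C D.nu * .X ^ 4 + .C D.nu * .X ^ 5 +
      .C D.nu ^ 2 * .X ^ 6 - .C D.nu ^ 2 * .X ^ 7 := by
  rw [← det_eq _ _ (.C D.nuInv) (by rw [← map_mul, D.nu_mul_nuInv, map_one]), Matrix.charpolyRev]
  congr 1
  ext1 i j
  fin_cases i <;> fin_cases j <;> simp [Data.actionMatrix]
  rw [mul_comm, map_ofNat]

section Zeta

variable {R : Type} [CommRing R] {n : ℕ} (F : Matrix (Fin n) (Fin n) R)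

theorem charpolyRev_one : (1 : Matrix (Fin 1) (Fin 1) R).charpolyRev = 1 - .X := by
  simp [Matrix.charpolyRev]

theorem zeta_mul : friedZeta (1 : Matrix (Fin 1) (Fin 1) R) F *
    algebraMap R[X] (FractionRing R[X]) (1 - .X) =
    algebraMap R[X] (FractionRing R[X]) F.charpolyRev := by
  rw [← charpolyRev_one]
  exact IsLocalization.mk'_spec _ _ _

theorem zeta_mul_neg (hn : Odd n) : friedZeta (1 : Matrix (Fin 1) (Fin 1) R) F *
    algebraMap R[X] (FractionRing R[X]) (.X - 1) =
    algebraMap R[X] (FractionRing R[X]) ((Polynomial.X : R[X]) • F.map Polynomial.C - 1).det := by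
  rw [← neg_sub 1 (Polynomial.X : R[X]), map_neg, mul_neg, zeta_mul, ← map_neg, ← neg_sub 1,
    Matrix.det_neg, Fintype.card_fin, hn.neg_one_pow, neg_one_mul, Matrix.charpolyRev]

theorem zeta_eq {p : R[X]} (h : F.charpolyRev = p * (1 - .X)) :
    friedZeta (1 : Matrix (Fin 1) (Fin 1) R) F = algebraMap R[X] (FractionRing R[X]) p := by
  refine IsLocalization.mk'_eq_iff_eq_mul.2 ?_
  rw [← map_mul, h]
  exact congrArg (fun x => algebraMap R[X] (FractionRing R[X]) (p * x)) charpolyRev_one.symm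

end Zeta

theorem factor_eq {R : Type*} [CommRing R] (t n : R) :
    1 - t - n * t ^ 2 - 3 * n * t ^ 3 + 3 * n * t ^ 4 + n * t ^ 5 + n ^ 2 * t ^ 6 -
      n ^ 2 * t ^ 7 = (1 - n * t ^ 2 - 4 * n * t ^ 3 - n * t ^ 4 + n ^ 2 * t ^ 6) * (1 - t) := by
  ring

theorem zeta_formulas (D : Data α) :
    (let ι := algebraMap (Polynomial D.GroupRing)
        (FractionRing (Polynomial D.GroupRing))
      let τ : Polynomial D.GroupRing := Polynomial.X
      let ν : Polynomial D.GroupRing := Polynomial.C D.nu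
      let ζ := friedZeta (m := 1) 1 D.actionMatrix
      ζ * ι (τ - 1) = ι (τ • D.actionMatrix.map Polynomial.C - 1).det ∧
      ζ * ι (1 - τ) = ι (1 - τ - ν * τ ^ 2 - 3 * ν * τ ^ 3 + 3 * ν * τ ^ 4 + ν * τ ^ 5
        + ν ^ 2 * τ ^ 6 - ν ^ 2 * τ ^ 7) ∧
      ζ = ι (1 - ν * τ ^ 2 - 4 * ν * τ ^ 3 - ν * τ ^ 4 + ν ^ 2 * τ ^ 6)) := by
  refine ⟨zeta_mul_neg _ (by decide), ?_, zeta_eq _ ?_⟩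
  · rw [zeta_mul, charpolyRev_actionMatrix]
  · rw [charpolyRev_actionMatrix]
    exact factor_eq _ _

end AY

end

theorem lemmal (α : ℝ) (hα_pos : 0 < α) (hα : α ^ 3 + α ^ 2 + α - 1 = 0) :
    Nonempty (AY.Data α) ∧ ∀ D : AY.Data α,
      -- the seven loops freely generate the fundamental group
      Function.Bijective (FreeGroup.lift fun k : Fin 7 => D.piClass (D.loop k)) ∧
      -- the images of the seven loops, and of the path joining the base point to its image
      (let a := D.loop 0; let b := D.loop 1; let c := D.loop 2; let d := D.loop 3
       let e := D.loop 4; let f := D.loop 5; let g := D.loop 6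
       (D.imageLoop 0).Homotopic (D.conj (f.trans c)) ∧
       (D.imageLoop 1).Homotopic (D.conj ((f.trans d).trans g.symm)) ∧
       (D.imageLoop 2).Homotopic (D.conj ((f.trans e).trans g.symm)) ∧
       (D.imageLoop 3).Homotopic (D.conj ((f.trans f).trans c)) ∧
       (D.imageLoop 4).Homotopic (D.conj ((g.trans a).trans c)) ∧
       (D.imageLoop 5).Homotopic (D.conj (g.trans b)) ∧
       (D.imageLoop 6).Homotopic (D.conj (g.trans c)) ∧
       ∃ hx : D.x₀ = D.hhat (D.hhat D.x₀),
         ((D.eps.trans (D.eps.map D.hhat.continuous)).cast rfl hx).Homotopic g) ∧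
      -- the map on the first homology
      (∃ B : Module.Basis (Fin 7) ℤ D.H1, ⇑B = D.cls) ∧
      (∀ k, D.hStar (D.cls k) - D.cls k = ∑ j, AY.homologyMatrix j k • D.cls j) ∧
      -- the cokernel
      (∃ B' : Module.Basis (Fin 7) ℤ D.H1, ⇑B' = D.cls') ∧
      (∃ E : D.Coker ≃+ ZMod 2 × ℤ,
        E (D.toCoker (D.cls' 6)) = (0, 1) ∧ E (D.toCoker (D.cls' 5)) = (1, 0)) ∧
      (∀ k : Fin 7, k < 5 → D.toCoker (D.cls' k) = 0) ∧
      (∃ E : D.Q ≃+ ℤ, E (D.psiQ (D.cls 6)) = 1) ∧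
      -- the cellular versions, their actions on cells and the zeta function
      (∃ E : ContinuousMap.HomotopyEquiv AY.Rose (AY.Xhat α), E.toFun = D.roseMap) ∧
      Nonempty D.CellularModel ∧
      ∀ M : D.CellularModel,
        M.F₁ = D.actionMatrix ∧
        (∀ q, M.fQ (AY.vertex _ q) = AY.vertex _ q) ∧
        M.F₀ = 1 ∧
        (let ι := algebraMap (Polynomial D.GroupRing)
            (FractionRing (Polynomial D.GroupRing))
         let τ : Polynomial D.GroupRing := Polynomial.X
         let ν : Polynomial D.GroupRing := Polynomial.C D.nu
         let ζ := AY.friedZeta M.F₀ M.F₁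
         ζ * ι (τ - 1) = ι (τ • M.F₁.map Polynomial.C - 1).det ∧
         ζ * ι (1 - τ) = ι (1 - τ - ν * τ ^ 2 - 3 * ν * τ ^ 3 + 3 * ν * τ ^ 4 + ν * τ ^ 5
           + ν ^ 2 * τ ^ 6 - ν ^ 2 * τ ^ 7) ∧
         ζ = ι (1 - ν * τ ^ 2 - 4 * ν * τ ^ 3 - ν * τ ^ 4 + ν ^ 2 * τ ^ 6)) := by
  have A : AY.IsRoot3 α := ⟨hα_pos, hα⟩
  refine ⟨AY.nonempty_data A, fun D => ?_⟩
  obtain ⟨S⟩ := AY.Data.nonempty_sheets A D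
  let m : Fin 7 → AY.LoopGrp D.x₀ := fun k => AY.LoopGrp.mk (D.loop k)
  refine ⟨AY.Data.bijective_piClass S, ⟨?_, ?_, ?_, ?_, ?_, ?_, ?_, AY.Data.hhat_hhat A D, ?_⟩,
    AY.Data.exists_basis S, AY.Data.hStar_sub S, AY.Data.exists_basis' S,
    AY.Data.exists_cokerEquiv S, AY.Data.toCoker_cls' S, AY.Data.exists_QEquiv S,
    AY.exists_homotopyEquiv S, AY.Data.nonempty_cellularModel S, fun M => ?_⟩
  · exact AY.Data.imageLoop_conj S ((show _ = m 5 * m 2 from rfl).trans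
      (by simp [m, AY.formWord]))
  · exact AY.Data.imageLoop_conj S ((show _ = m 5 * m 3 * (m 6)⁻¹ from rfl).trans
      (by simp [m, AY.formWord, mul_assoc]))
  · exact AY.Data.imageLoop_conj S ((show _ = m 5 * m 4 * (m 6)⁻¹ from rfl).trans
      (by simp [m, AY.formWord, mul_assoc]))
  · exact AY.Data.imageLoop_conj S ((show _ = m 5 * m 5 * m 2 from rfl).trans
      (by simp [m, AY.formWord, mul_assoc]))
  · exact AY.Data.imageLoop_conj S ((show _ = m 6 * m 0 * m 2 from rfl).trans
      (by simp [m, AY.formWord, mul_assoc]))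
  · exact AY.Data.imageLoop_conj S ((show _ = m 6 * m 1 from rfl).trans
      (by simp [m, AY.formWord]))
  · exact AY.Data.imageLoop_conj S ((show _ = m 6 * m 2 from rfl).trans
      (by simp [m, AY.formWord]))
  · exact AY.Data.eps_eps_homotopic S _ _ ((AY.Data.loop_class S 6).trans
      (congrArg _ (show AY.loopWord 6 = [(6, false)] by decide +kernel)))
  · have h0 := AY.Data.CellularModel.F₀_eq S M
    have h1 := AY.Data.CellularModel.F₁_eq S M
    refine ⟨h1, AY.Data.CellularModel.fQ_vertex S M, h0, ?_⟩
    rw [h0, h1]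
    exact AY.zeta_formulas D
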